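/- Let $d\ge 0$ and let $S_d$ be the star with $d$ rays. A finite simple graph $G$ is a \emph{proper $S_d$-graph} if there are a subdivision $S'$ of $S_d$ and connected subgraphs $R_v\subseteq S'$ ($v\in V(G)$), pairwise incomparable by inclusion, such that distinct vertices $u,v$ are adjacent in $G$ if and only if $R_u$ and $R_v$ share a node; $(R_v)_{v\in V(G)}$ is then a proper $S_d$-representation of $G$, and its \emph{central clique} $C$ is the set of vertices $v$ such that $R_v$ contains the central node of $S'$. (1) For every proper $S_d$-representation of $G$ with central clique $C$, at most $d$ connected components of $G-C$ contain a vertex with a neighbour in $C$. (2) Isomorphism of proper $S_d$-graphs can be tested in \textbf{FPT} time with parameter $d$. More precisely, there is a single deterministic algorithm (a program for a random access machine whose words have $O(\log(n+d))$ bits, with unit-cost instructions) which, given $d$ and the adjacency matrices of two proper $S_d$-graphs $G$ and $H$ on $n$ vertices, without any representation of them, decides whether $G\simeq H$ in time $O(d!\,n^3)$ (for $n\ge1$; $O(1)$ for $n=0$), where the implied constants are absolute. -/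

import Mathlib

/-! ### Proper `S_d`-graphs -/

/-- Nodes of a subdivision of the star with `d` rays: the centre `none`, and on the ray `i` the
`ℓ i + 1` nodes `some ⟨i, 0⟩, …, some ⟨i, ℓ i⟩`, numbered outwards from the centre. -/
abbrev StarNode (d : ℕ) (ℓ : Fin d → ℕ) : Type := Option (Σ i : Fin d, Fin (ℓ i + 1))

/-- The subdivision of the star `S_d` in which the `i`-th edge is subdivided `ℓ i` times, that is,
replaced by a path with `ℓ i + 1` edges. Every subdivision of `S_d` has this form, and
`ℓ = 0` gives `S_d` itself. -/
def subdividedStar (d : ℕ) (ℓ : Fin d → ℕ) : SimpleGraph (StarNode d ℓ) :=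
  SimpleGraph.fromRel fun a b =>
    match a, b with
    | none, some ⟨_, j⟩ => (j : ℕ) = 0
    | some ⟨i, j⟩, some ⟨i', j'⟩ => i = i' ∧ (j' : ℕ) = j + 1
    | _, _ => False

/-- `R` represents `G` as the intersection graph of connected subgraphs of `T` which are pairwise
incomparable by inclusion. -/
structure IsProperRepresentation {V N : Type*} (G : SimpleGraph V) (T : SimpleGraph N)
    (R : V → T.Subgraph) : Prop where
  connected : ∀ v, (R v).Connected
  adj_iff : ∀ u v, u ≠ v → (G.Adj u v ↔ ((R u).verts ∩ (R v).verts).Nonempty)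
  incomparable : ∀ u v, u ≠ v → ¬ R u ≤ R v

/-- `G` is a proper `S_d`-graph. -/
def IsProperStarGraph {V : Type*} (d : ℕ) (G : SimpleGraph V) : Prop :=
  ∃ (ℓ : Fin d → ℕ) (R : V → (subdividedStar d ℓ).Subgraph),
    IsProperRepresentation G (subdividedStar d ℓ) R

/-- The central clique: the vertices whose subgraphs contain the centre. -/
def centralClique {V : Type*} {d : ℕ} {ℓ : Fin d → ℕ}
    (R : V → (subdividedStar d ℓ).Subgraph) : Set V :=
  {v | none ∈ (R v).verts}

/-- The connected components of `G - C` with nonempty attachment in `C`, i.e. containing a vertex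
that has a neighbour in `C`. -/
def attachedComponents {V : Type*} (G : SimpleGraph V) (C : Set V) :
    Set (G.induce Cᶜ).ConnectedComponent :=
  {X | ∃ x ∈ X.supp, ∃ v ∈ C, G.Adj x v}

/-! ### Random access machine with bounded words -/

namespace WordRAM

/-- A memory configuration: registers, and an indirectly addressable random access memory. -/
structure State where
  reg : ℕ → ℕ
  mem : ℕ → ℕ

/-- Write `x` to the register `r`. -/
def State.setReg (s : State) (r x : ℕ) : State := { s with reg := Function.update s.reg r x }

/-- Write `x` to the memory cell with address `a`. -/
def State.setMem (s : State) (a x : ℕ) : State := { s with mem := Function.update s.mem a x }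

/-- Programs. The arguments of an instruction are names of registers, except for the
literal `k` in `const r k`. A program is a finite object and uses finitely many registers. -/
inductive Program where
  | skip
  /-- `r := k` -/
  | const (r k : ℕ)
  /-- `r := a` -/
  | copy (r a : ℕ)
  /-- `r := a + b` -/
  | add (r a b : ℕ)
  /-- `r := a - b`, truncated at zero -/
  | sub (r a b : ℕ)
  /-- `r := a * b` -/
  | mul (r a b : ℕ)
  /-- `r := mem[a]` -/
  | load (r a : ℕ)
  /-- `mem[a] := b` -/
  | store (a b : ℕ)
  | seq (p q : Program)
  /-- if `a < b` then `p` else `q` -/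
  | ifLt (a b : ℕ) (p q : Program)
  /-- while `a < b` do `p` -/
  | whileLt (a b : ℕ) (p : Program)

/-- `Exec W p s t s'`: started in `s`, the program `p` halts after exactly `t` steps in `s'`, where
every number computed on the way is smaller than `W` (there is no execution with an overflow).
Each instruction and each evaluation of a test is one step. -/
inductive Exec (W : ℕ) : Program → State → ℕ → State → Prop where
  | skip {s} : Exec W .skip s 1 s
  | const {s} {r k : ℕ} : k < W → Exec W (.const r k) s 1 (s.setReg r k)
  | copy {s} {r a : ℕ} : Exec W (.copy r a) s 1 (s.setReg r (s.reg a))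
  | add {s} {r a b : ℕ} : s.reg a + s.reg b < W →
      Exec W (.add r a b) s 1 (s.setReg r (s.reg a + s.reg b))
  | sub {s} {r a b : ℕ} : Exec W (.sub r a b) s 1 (s.setReg r (s.reg a - s.reg b))
  | mul {s} {r a b : ℕ} : s.reg a * s.reg b < W →
      Exec W (.mul r a b) s 1 (s.setReg r (s.reg a * s.reg b))
  | load {s} {r a : ℕ} : Exec W (.load r a) s 1 (s.setReg r (s.mem (s.reg a)))
  | store {s} {a b : ℕ} : Exec W (.store a b) s 1 (s.setMem (s.reg a) (s.reg b))
  | seq {p q s t₁ s₁ t₂ s₂} : Exec W p s t₁ s₁ → Exec W q s₁ t₂ s₂ →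
      Exec W (.seq p q) s (t₁ + t₂) s₂
  | ifLt_pos {a b : ℕ} {p q s t s'} : s.reg a < s.reg b → Exec W p s t s' →
      Exec W (.ifLt a b p q) s (t + 1) s'
  | ifLt_neg {a b : ℕ} {p q s t s'} : ¬ s.reg a < s.reg b → Exec W q s t s' →
      Exec W (.ifLt a b p q) s (t + 1) s'
  | while_done {a b : ℕ} {p s} : ¬ s.reg a < s.reg b → Exec W (.whileLt a b p) s 1 s
  | while_step {a b : ℕ} {p s t₁ s₁ t₂ s₂} : s.reg a < s.reg b → Exec W p s t₁ s₁ →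
      Exec W (.whileLt a b p) s₁ t₂ s₂ → Exec W (.whileLt a b p) s (t₁ + t₂ + 1) s₂

open Classical in
/-- The input `(d, G, H)`: register `0` holds `d`, register `1` holds `n`, and all other registers
are zero; the memory holds the adjacency matrix of `G`, row by row, at the addresses
`0, …, n² - 1`, and that of `H` at `n², …, 2n² - 1`, and is zero elsewhere. -/
noncomputable def input (d : ℕ) {n : ℕ} (G H : SimpleGraph (Fin n)) : State where
  reg r := if r = 0 then d else if r = 1 then n else 0
  mem a :=
    if ∃ i j : Fin n, G.Adj i j ∧ a = i * n + j then 1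
    else if ∃ i j : Fin n, H.Adj i j ∧ a = n * n + (i * n + j) then 1
    else 0

/-- On the input `(d, G, H)`, with words below `W`, the program `p` halts within `T` steps and
leaves in register `0` the answer to whether `G` and `H` are isomorphic (`1` if so, `0` if not). -/
def DecidesIso (p : Program) (W T d : ℕ) {n : ℕ} (G H : SimpleGraph (Fin n)) : Prop :=
  ∃ (t : ℕ) (s : State), Exec W p (input d G H) t s ∧ t ≤ T ∧
    (Nonempty (G ≃g H) → s.reg 0 = 1) ∧ (¬ Nonempty (G ≃g H) → s.reg 0 = 0)

end WordRAM

/-! Part (1). Seen from the centre, a representation is purely combinatorial data (`StarModel`): a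
vertex outside the central clique is an interval [lo, hi] on one ray, and a central vertex has a
reach on every ray. Incomparability says that intervals on a ray are not nested and that every
interval ends beyond the reach of every central vertex. Two vertices on one ray that both have
central neighbours therefore overlap, since each starts within some reach and ends beyond all of
them (`adj_of_attached`). Hence sending an attached component to the ray of one of its attached
vertices is injective.

Part (2). The algorithm sees no representation, so everything it uses is recovered from adjacency in
the disjoint union of the two graphs, which has N = 2n vertices. In a model, an interval with the
largest left end is simplicial in every induced subgraph (`exists_simplicial`), so a simplicial
elimination produces N cliques that include all maximal ones. Moreover the centre of a represented
component can be moved until the central clique is a maximal clique (`exists_maximal`), which is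
then on the list.

Take such a clique as an anchor. Distances reveal the rays: along a ray the distance from the anchor
grows with the left end, the layers of a ray are cliques, and two vertices share a ray when one of
them is next to the anchor and no farther from the other than the anchor is (`ModelAt.mono`,
`ModelAt.layer`, `ModelAt.nearZ_iff`). Inside a layer, the neighbours one step closer decrease and
those one step farther increase with the left end. Sorting a ray by distance, and then by the
difference of the two numbers, thus recovers its order up to twins (`ModelAt.twins`). The predicate
`Good` collects these facts without mentioning a representation, so the algorithm can test it; the
model only guarantees that every component has a good anchor (`ModelAt.good`).

An isomorphism carries a good anchor to a clique on the list, permutes the rays, and preserves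
distances and keys. For the induced permutation, matching vertices by their position on the ray
agrees with the isomorphism up to twins, and the anchors then need only contain equally many
vertices of each neighbourhood type (`AnchorIso.leaf`). Conversely any matching that passes these
tests is an isomorphism of components, whichever anchors produced it (`Leaf.exists_isoOn`).
Isomorphic components may be cancelled (`exists_isoOn_diff_iff`), so matching components greedily is
correct.

Testing one permutation of rays takes time O(sN), where s is the size of the component up to a
constant factor. There are at most d! permutations and N candidate anchors in the second graph. The
components of the chosen anchors are disjoint, so the values of s add up to at most 2N
(`sum_leafSize_le`), for a total of O(d! N³). The tables cost O(N³).

The machine model is handled by a small language of expressions and commands with a verified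
compiler (`Expr.go`, `Tri`). Each lemma `exists_...` about a command fixes its constant before the
instance, which makes the final constant absolute. Word sizes are controlled by a static exponent
(`Expr.pw`): all values stay below a fixed power of B, where B is polynomial in n + d. -/

/-! ### A small language compiled to the random access machine -/

namespace WordRAM

/-- `p`, started in `s`, halts within `T` steps in a state satisfying `Q`. -/
def Go (W : ℕ) (p : Program) (s : State) (T : ℕ) (Q : State → Prop) : Prop :=
  ∃ t s', Exec W p s t s' ∧ t ≤ T ∧ Q s'

section Go

variable {W : ℕ} {p q : Program} {s : State} {T T' T₁ T₂ : ℕ} {Q Q' : State → Prop}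

theorem Go.mono (h : Go W p s T Q) (hT : T ≤ T') (hQ : ∀ s, Q s → Q' s) : Go W p s T' Q' := by
  obtain ⟨t, s', h₁, h₂, h₃⟩ := h
  exact ⟨t, s', h₁, h₂.trans hT, hQ _ h₃⟩

theorem Go.bind {R : State → Prop} (h : Go W p s T₁ R) (h' : ∀ s', R s' → Go W q s' T₂ Q)
    (hT : T₁ + T₂ ≤ T) : Go W (.seq p q) s T Q := by
  obtain ⟨t, s', h₁, h₂, h₆⟩ := h
  obtain ⟨t', s'', h₃, h₄, h₅⟩ := h' s' h₆
  exact ⟨t + t', s'', .seq h₁ h₃, by omega, h₅⟩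

theorem Go.skip (h : Q s) : Go W .skip s 1 Q := ⟨1, _, .skip, le_rfl, h⟩

theorem Go.const {r k : ℕ} (hk : k < W) (h : Q (s.setReg r k)) : Go W (.const r k) s 1 Q :=
  ⟨1, _, .const hk, le_rfl, h⟩

theorem Go.copy {r a : ℕ} (h : Q (s.setReg r (s.reg a))) : Go W (.copy r a) s 1 Q :=
  ⟨1, _, .copy, le_rfl, h⟩

theorem Go.add {r a b : ℕ} (hk : s.reg a + s.reg b < W)
    (h : Q (s.setReg r (s.reg a + s.reg b))) : Go W (.add r a b) s 1 Q :=
  ⟨1, _, .add hk, le_rfl, h⟩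

theorem Go.sub {r a b : ℕ} (h : Q (s.setReg r (s.reg a - s.reg b))) : Go W (.sub r a b) s 1 Q :=
  ⟨1, _, .sub, le_rfl, h⟩

theorem Go.mul {r a b : ℕ} (hk : s.reg a * s.reg b < W)
    (h : Q (s.setReg r (s.reg a * s.reg b))) : Go W (.mul r a b) s 1 Q :=
  ⟨1, _, .mul hk, le_rfl, h⟩

theorem Go.load {r a : ℕ} (h : Q (s.setReg r (s.mem (s.reg a)))) : Go W (.load r a) s 1 Q :=
  ⟨1, _, .load, le_rfl, h⟩

theorem Go.store {a b : ℕ} (h : Q (s.setMem (s.reg a) (s.reg b))) : Go W (.store a b) s 1 Q :=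
  ⟨1, _, .store, le_rfl, h⟩

theorem Go.ifLt {a b : ℕ} (h₁ : s.reg a < s.reg b → Go W p s T Q)
    (h₂ : ¬ s.reg a < s.reg b → Go W q s T Q) : Go W (.ifLt a b p q) s (T + 1) Q := by
  by_cases h : s.reg a < s.reg b
  · obtain ⟨t, s', h₃, h₄, h₅⟩ := h₁ h
    exact ⟨t + 1, s', .ifLt_pos h h₃, by omega, h₅⟩
  · obtain ⟨t, s', h₃, h₄, h₅⟩ := h₂ h
    exact ⟨t + 1, s', .ifLt_neg h h₃, by omega, h₅⟩

theorem Go.seq_const {r k : ℕ} (hk : k < W) (h : Go W q (s.setReg r k) T Q) :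
    Go W (.seq (.const r k) q) s (T + 1) Q :=
  (Go.const (Q := fun s' => Go W q s' T Q) hk h).bind (fun _ h => h) (by omega)

theorem Go.seq_copy {r a : ℕ} (h : Go W q (s.setReg r (s.reg a)) T Q) :
    Go W (.seq (.copy r a) q) s (T + 1) Q :=
  (Go.copy (Q := fun s' => Go W q s' T Q) h).bind (fun _ h => h) (by omega)

theorem Go.seq_add {r a b : ℕ} (hk : s.reg a + s.reg b < W)
    (h : Go W q (s.setReg r (s.reg a + s.reg b)) T Q) :
    Go W (.seq (.add r a b) q) s (T + 1) Q :=
  (Go.add (Q := fun s' => Go W q s' T Q) hk h).bind (fun _ h => h) (by omega)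

theorem Go.seq_mul {r a b : ℕ} (hk : s.reg a * s.reg b < W)
    (h : Go W q (s.setReg r (s.reg a * s.reg b)) T Q) :
    Go W (.seq (.mul r a b) q) s (T + 1) Q :=
  (Go.mul (Q := fun s' => Go W q s' T Q) hk h).bind (fun _ h => h) (by omega)

/-- A loop with the invariant `I k` before the `k`-th iteration, which ends after at most `R`
iterations. -/
theorem Go.whileLt {a b : ℕ} (I : ℕ → State → Prop) (τ : ℕ → ℕ) (R : ℕ)
    (hstep : ∀ k < R, ∀ s, I k s → s.reg a < s.reg b → Go W p s (τ k) (I (k + 1)))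
    (hend : ∀ s, I R s → ¬ s.reg a < s.reg b) (h0 : I 0 s) :
    Go W (.whileLt a b p) s (∑ k ∈ Finset.range R, (τ k + 1) + 1)
      (fun s' => ∃ k ≤ R, I k s' ∧ ¬ s'.reg a < s'.reg b) := by
  -- Induction on the number m of iterations still allowed; the sum over the interval from k to R is
  -- the time left.
  have key : ∀ m k s, m + k = R → I k s →
      Go W (.whileLt a b p) s (∑ j ∈ Finset.Ico k R, (τ j + 1) + 1)
        (fun s' => ∃ k ≤ R, I k s' ∧ ¬ s'.reg a < s'.reg b) := by
    intro m
    induction m with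
    | zero =>
      intro k s hk hI
      obtain rfl : k = R := by omega
      exact ⟨1, s, .while_done (hend s hI), by simp, k, le_rfl, hI, hend s hI⟩
    | succ m ih =>
      intro k s hk hI
      by_cases h : s.reg a < s.reg b
      · obtain ⟨t, s₁, h₁, h₂, h₃⟩ := hstep k (by omega) s hI h
        obtain ⟨t', s₂, h₄, h₅, h₆⟩ := ih (k + 1) s₁ (by omega) h₃
        refine ⟨t + t' + 1, s₂, .while_step h h₁ h₄, ?_, h₆⟩
        rw [Finset.sum_eq_sum_Ico_succ_bot (by omega)]
        omega
      · exact ⟨1, s, .while_done h, by omega, k, by omega, hI, h⟩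
  rw [Finset.range_eq_Ico]
  exact key R 0 s (by omega) h0

end Go

/-- Values of the variables. -/
abbrev Env := ℕ → ℕ

/-- Contents of the two-dimensional arrays. -/
abbrev Arr := ℕ → ℕ → ℕ → ℕ

/-- Parameters of a run: the loop bound `N`, the side length `Q` of the arrays, the bound `B` for
stored values, and the read-only input. -/
structure Ctx where
  N : ℕ
  Q : ℕ
  B : ℕ
  inp : ℕ → ℕ

/-- The minimum of `M` and `f 0, …, f (k - 1)`. -/
def minTo (M : ℕ) (f : ℕ → ℕ) : ℕ → ℕ
  | 0 => M
  | k + 1 => if f k < minTo M f k then f k else minTo M f k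

/-- Expressions: `sum x e` and `mn x e` range over `x < N`; `rd k i j` reads the cell `(i, j)` of
the array `k`, and `inp e` reads the input. -/
inductive Expr where
  | var (x : ℕ)
  | lit (k : ℕ)
  | size
  | add (a b : Expr)
  | sub (a b : Expr)
  | mul (a b : Expr)
  | lt (a b : Expr)
  | ite (c a b : Expr)
  | rd (k : ℕ) (i j : Expr)
  | inp (e : Expr)
  | sum (x : ℕ) (e : Expr)
  | mn (x : ℕ) (e : Expr)

namespace Expr

/-- The value of an expression. -/
def eval (C : Ctx) (α : Arr) : Expr → Env → ℕ
  | var x, v => v x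
  | lit k, _ => k
  | size, _ => C.N
  | add a b, v => a.eval C α v + b.eval C α v
  | sub a b, v => a.eval C α v - b.eval C α v
  | mul a b, v => a.eval C α v * b.eval C α v
  | lt a b, v => if a.eval C α v < b.eval C α v then 1 else 0
  | ite c a b, v => if 0 < c.eval C α v then a.eval C α v else b.eval C α v
  | rd k i j, v => α k (i.eval C α v) (j.eval C α v)
  | inp e, v => C.inp (e.eval C α v)
  | sum x e, v => ∑ i ∈ Finset.range C.N, e.eval C α (Function.update v x i)
  | mn x e, v => minTo C.N (fun i => e.eval C α (Function.update v x i)) C.N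

/-- A bound for the evaluation time. -/
def cost (N : ℕ) : Expr → ℕ
  | var _ => 1
  | lit _ => 1
  | size => 1
  | add a b => a.cost N + b.cost N + 1
  | sub a b => a.cost N + b.cost N + 1
  | mul a b => a.cost N + b.cost N + 1
  | lt a b => a.cost N + b.cost N + 2
  | ite c a b => c.cost N + a.cost N + b.cost N + 2
  | rd _ i j => i.cost N + j.cost N + 9
  | inp e => e.cost N + 4
  | sum _ e => N * (e.cost N + 5) + 6
  | mn _ e => N * (e.cost N + 6) + 6

/-- Values computed during the evaluation are at most `B ^ pw`. -/
def pw : Expr → ℕ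
  | var _ => 1
  | lit k => k + 1
  | size => 1
  | add a b => a.pw + b.pw
  | sub a b => a.pw + b.pw
  | mul a b => a.pw + b.pw
  | lt a b => a.pw + b.pw
  | ite c a b => c.pw + a.pw + b.pw
  | rd k i j => i.pw + j.pw + k + 6
  | inp e => e.pw + 3
  | sum _ e => e.pw + 1
  | mn _ e => e.pw + 1

/-- The array `k` is read. -/
def reads (k : ℕ) : Expr → Bool
  | var _ => false
  | lit _ => false
  | size => false
  | add a b => a.reads k || b.reads k
  | sub a b => a.reads k || b.reads k
  | mul a b => a.reads k || b.reads k
  | lt a b => a.reads k || b.reads k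
  | ite c a b => c.reads k || a.reads k || b.reads k
  | rd k' i j => k' == k || i.reads k || j.reads k
  | inp e => e.reads k
  | sum _ e => e.reads k
  | mn _ e => e.reads k

end Expr

/-- The register of a variable. -/
abbrev vreg (x : ℕ) : ℕ := 3 * x

/-- The register of a temporary. -/
abbrev treg (t : ℕ) : ℕ := 3 * t + 1

open Program in
/-- With `i` and `j` in the temporaries `t` and `t + 1`, put the address of the cell `(i, j)` of the
array `k` into `t`. -/
def addrOf (k t : ℕ) : Program :=
  .seq (mul (treg t) (treg t) 5) <| .seq (add (treg t) (treg t) (treg (t + 1))) <|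
  .seq (const (treg (t + 1)) (k + 1)) <| .seq (mul (treg (t + 1)) (treg (t + 1)) 5) <|
  .seq (mul (treg (t + 1)) (treg (t + 1)) 5) (add (treg t) (treg t) (treg (t + 1)))

open Program in
/-- The program that puts the value of an expression into the temporary `t`. -/
def Expr.comp : Expr → ℕ → Program
  | var x, t => copy (treg t) (vreg x)
  | lit k, t => const (treg t) k
  | size, t => copy (treg t) 2
  | add a b, t => .seq (a.comp t) (.seq (b.comp (t + 1)) (.add (treg t) (treg t) (treg (t + 1))))
  | sub a b, t => .seq (a.comp t) (.seq (b.comp (t + 1)) (.sub (treg t) (treg t) (treg (t + 1))))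
  | mul a b, t => .seq (a.comp t) (.seq (b.comp (t + 1)) (.mul (treg t) (treg t) (treg (t + 1))))
  | lt a b, t => .seq (a.comp t) (.seq (b.comp (t + 1))
      (ifLt (treg t) (treg (t + 1)) (const (treg t) 1) (const (treg t) 0)))
  | ite c a b, t => .seq (c.comp t) (.seq (const (treg (t + 1)) 0)
      (ifLt (treg (t + 1)) (treg t) (a.comp t) (b.comp t)))
  | rd k i j, t => .seq (i.comp t) (.seq (j.comp (t + 1))
      (ifLt (treg t) 5 (ifLt (treg (t + 1)) 5 (.seq (addrOf k t) (load (treg t) (treg t)))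
        (const (treg t) 0)) (const (treg t) 0)))
  | inp e, t => .seq (e.comp t) (.seq (.mul (treg (t + 1)) 5 5)
      (ifLt (treg t) (treg (t + 1)) (load (treg t) (treg t)) (const (treg t) 0)))
  | sum x e, t => .seq (copy (treg t) (vreg x)) <| .seq (const (treg (t + 1)) 0) <|
      .seq (const (treg (t + 2)) 0) <|
      .seq (whileLt (treg (t + 2)) 2
        (.seq (copy (vreg x) (treg (t + 2))) <| .seq (e.comp (t + 3)) <|
         .seq (.add (treg (t + 1)) (treg (t + 1)) (treg (t + 3))) <|
         .seq (const (treg (t + 3)) 1) (.add (treg (t + 2)) (treg (t + 2)) (treg (t + 3))))) <|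
      .seq (copy (vreg x) (treg t)) (copy (treg t) (treg (t + 1)))
  | mn x e, t => .seq (copy (treg t) (vreg x)) <| .seq (copy (treg (t + 1)) 2) <|
      .seq (const (treg (t + 2)) 0) <|
      .seq (whileLt (treg (t + 2)) 2
        (.seq (copy (vreg x) (treg (t + 2))) <| .seq (e.comp (t + 3)) <|
         .seq (ifLt (treg (t + 3)) (treg (t + 1)) (copy (treg (t + 1)) (treg (t + 3))) .skip) <|
         .seq (const (treg (t + 3)) 1) (.add (treg (t + 2)) (treg (t + 2)) (treg (t + 3))))) <|
      .seq (copy (vreg x) (treg t)) (copy (treg t) (treg (t + 1)))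

/-- The parameters are consistent with each other and with words below `W`. -/
structure Ctx.Valid (C : Ctx) (W P : ℕ) : Prop where
  NQ : C.N < C.Q
  QB : C.Q ≤ C.B
  two : 2 ≤ C.B
  inpB : ∀ e, C.inp e ≤ C.B
  inp0 : ∀ e, C.Q * C.Q ≤ e → C.inp e = 0
  word : C.B ^ P < W

/-- The machine state `s` represents the variables `v` and the arrays `α`. -/
structure Rel (C : Ctx) (v : Env) (α : Arr) (s : State) : Prop where
  var : ∀ k, s.reg (3 * k) = v k
  rN : s.reg 2 = C.N
  rQ : s.reg 5 = C.Q
  rB : s.reg 8 = C.B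
  arr : ∀ k i j, i < C.Q → j < C.Q →
    s.mem (i * C.Q + j + (k + 1) * C.Q * C.Q) = α k i j
  inp : ∀ e < C.Q * C.Q, s.mem e = C.inp e
  varB : ∀ k, v k ≤ C.B
  arrB : ∀ k i j, α k i j ≤ C.B
  arr0 : ∀ k i j, (C.Q ≤ i ∨ C.Q ≤ j) → α k i j = 0

section

variable {C : Ctx} {v : Env} {α : Arr} {s : State} {W P : ℕ}

@[simp] theorem State.reg_setReg (s : State) (r x r' : ℕ) :
    (s.setReg r x).reg r' = if r' = r then x else s.reg r' := by
  simp [State.setReg, Function.update_apply]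

@[simp] theorem State.mem_setReg (s : State) (r x : ℕ) : (s.setReg r x).mem = s.mem := rfl

@[simp] theorem State.reg_setMem (s : State) (r x : ℕ) : (s.setMem r x).reg = s.reg := rfl

/-- Registers are split by residue modulo 3: variables have residue 0, temporaries 1, and the
parameters in the registers 2, 5 and 8 have residue 2. A write of one kind cannot disturb the
others. -/
theorem Rel.setT (h : Rel C v α s) (t x : ℕ) : Rel C v α (s.setReg (treg t) x) where
  var k := by
    have := h.var k
    simp only [State.reg_setReg, treg]; rw [if_neg (by omega), this]
  rN := by simp only [State.reg_setReg, treg]; rw [if_neg (by omega), h.rN]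
  rQ := by simp only [State.reg_setReg, treg]; rw [if_neg (by omega), h.rQ]
  rB := by simp only [State.reg_setReg, treg]; rw [if_neg (by omega), h.rB]
  arr := h.arr
  inp := h.inp
  varB := h.varB
  arrB := h.arrB
  arr0 := h.arr0

theorem Rel.setV (h : Rel C v α s) (x i : ℕ) (hi : i ≤ C.B) :
    Rel C (Function.update v x i) α (s.setReg (vreg x) i) where
  var k := by
    have := h.var k
    by_cases hk : k = x
    · subst hk; simp
    · simp only [State.reg_setReg, vreg]; rw [if_neg (by omega), this, Function.update_of_ne hk]
  rN := by simp only [State.reg_setReg, vreg]; rw [if_neg (by omega), h.rN]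
  rQ := by simp only [State.reg_setReg, vreg]; rw [if_neg (by omega), h.rQ]
  rB := by simp only [State.reg_setReg, vreg]; rw [if_neg (by omega), h.rB]
  arr := h.arr
  inp := h.inp
  varB k := by
    by_cases hk : k = x
    · subst hk; simpa
    · rw [Function.update_of_ne hk]; exact h.varB k
  arrB := h.arrB
  arr0 := h.arr0

theorem Rel.unsetV {x i : ℕ} (h : Rel C (Function.update v x i) α s) (hv : ∀ k, v k ≤ C.B) :
    Rel C v α (s.setReg (vreg x) (v x)) := by
  simpa using h.setV x (v x) (hv x)

theorem minTo_le_top (M : ℕ) (f : ℕ → ℕ) (k : ℕ) : minTo M f k ≤ M := by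
  induction k with
  | zero => simp [minTo]
  | succ k ih => rw [minTo]; split_ifs <;> omega

theorem minTo_le {M : ℕ} {f : ℕ → ℕ} {k i : ℕ} (hi : i < k) : minTo M f k ≤ f i := by
  induction k with
  | zero => omega
  | succ k ih =>
    rw [minTo]
    rcases Nat.lt_succ_iff_lt_or_eq.mp hi with h | rfl
    · have := ih h; split_ifs <;> omega
    · split_ifs <;> omega

theorem minTo_eq_top_or (M : ℕ) (f : ℕ → ℕ) (k : ℕ) :
    minTo M f k = M ∨ ∃ i < k, minTo M f k = f i := by
  induction k with
  | zero => simp [minTo]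
  | succ k ih =>
    rw [minTo]
    split_ifs
    · exact Or.inr ⟨k, by omega, rfl⟩
    · rcases ih with h | ⟨i, hi, h⟩
      · exact Or.inl h
      · exact Or.inr ⟨i, by omega, h⟩

theorem minTo_congr {M : ℕ} {f g : ℕ → ℕ} {k : ℕ} (h : ∀ i < k, f i = g i) :
    minTo M f k = minTo M g k := by
  induction k with
  | zero => rfl
  | succ k ih =>
    rw [minTo, minTo, ih fun i hi => h i (by omega), h k (by omega)]

/-- Two numbers that are at least 2 have a sum bounded by their product. Hence exponents simply add
up for sums as well as for products, and one exponent per expression suffices to exclude overflow.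
-/
theorem pow_add_pow_le {B p q : ℕ} (hB : 2 ≤ B) (hp : 1 ≤ p) (hq : 1 ≤ q) :
    B ^ p + B ^ q ≤ B ^ (p + q) := by
  have h1 : 2 ≤ B ^ p := hB.trans (Nat.le_self_pow (by omega) B)
  have h2 : 2 ≤ B ^ q := hB.trans (Nat.le_self_pow (by omega) B)
  rw [pow_add]; nlinarith

theorem Expr.one_le_pw (e : Expr) : 1 ≤ e.pw := by
  induction e <;> simp only [Expr.pw] <;> omega

theorem le_pow_succ_self {B : ℕ} (hB : 2 ≤ B) (k : ℕ) : k + 1 ≤ B ^ (k + 1) :=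
  (Nat.lt_two_pow_self (n := k + 1)).le.trans (Nat.pow_le_pow_left hB _)

/-- Stored cells, inputs and minima are bounded by B outright, so only arithmetic raises the
exponent. A sum has at most N ≤ B terms and costs one further power. -/
theorem Expr.eval_le (hC : C.Valid W P) (hα : ∀ k i j, α k i j ≤ C.B) (e : Expr) :
    ∀ v : Env, (∀ k, v k ≤ C.B) → e.eval C α v ≤ C.B ^ e.pw := by
  have hB := hC.two
  have hpos : ∀ k, 1 ≤ C.B ^ k := fun k => Nat.one_le_pow _ _ (by omega)
  have hself : ∀ k, k ≠ 0 → C.B ≤ C.B ^ k := fun k hk => Nat.le_self_pow hk _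
  have hN : C.N ≤ C.B := hC.NQ.le.trans hC.QB
  induction e with
  | var x => intro v hv; simpa [eval, pw] using hv x
  | lit k => intro v hv; exact (Nat.le_succ k).trans (le_pow_succ_self hB k)
  | size => intro v hv; simpa [eval, pw] using hN
  | add a b iha ihb =>
    intro v hv
    exact (add_le_add (iha v hv) (ihb v hv)).trans (pow_add_pow_le hB a.one_le_pw b.one_le_pw)
  | sub a b iha ihb =>
    intro v hv
    exact (Nat.sub_le _ _).trans ((iha v hv).trans
      (Nat.pow_le_pow_right (by omega) (Nat.le_add_right _ _)))
  | mul a b iha ihb =>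
    intro v hv
    simp only [eval, pw, pow_add]
    exact Nat.mul_le_mul (iha v hv) (ihb v hv)
  | lt a b iha ihb =>
    intro v hv
    simp only [eval]
    have := hpos (lt a b).pw
    split_ifs <;> omega
  | ite c a b _ iha ihb =>
    intro v hv
    simp only [eval]
    split_ifs
    · exact (iha v hv).trans (Nat.pow_le_pow_right (by omega) (by simp [pw]; omega))
    · exact (ihb v hv).trans (Nat.pow_le_pow_right (by omega) (by simp [pw]))
  | rd k i j _ _ =>
    intro v hv
    exact (hα _ _ _).trans (hself _ (by simp [pw]))
  | inp e _ =>
    intro v hv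
    exact (hC.inpB _).trans (hself _ (by simp [pw]))
  | sum x e ih =>
    intro v hv
    simp only [eval, pw, pow_succ']
    calc _ ≤ ∑ i ∈ Finset.range C.N, C.B ^ e.pw := by
          refine Finset.sum_le_sum fun i hi => ih _ fun k => ?_
          have := Finset.mem_range.mp hi
          by_cases hk : k = x
          · subst hk; simp; omega
          · rw [Function.update_of_ne hk]; exact hv k
      _ ≤ _ := by simpa using Nat.mul_le_mul_right _ hN
  | mn x e _ =>
    intro v hv
    exact ((minTo_le_top _ _ _).trans hN).trans (hself _ (by simp [pw]))

/-- This is what allows a table to be filled in place: while array k is being overwritten, an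
expression that does not read k keeps the values it had at the start. -/
theorem Expr.eval_congr {k : ℕ} {α' : Arr} (h : ∀ k', k' ≠ k → α' k' = α k') (e : Expr) :
    e.reads k = false → ∀ v, e.eval C α' v = e.eval C α v := by
  induction e with
  | var x => intro _ _; rfl
  | lit k => intro _ _; rfl
  | size => intro _ _; rfl
  | add a b iha ihb | sub a b iha ihb | mul a b iha ihb | lt a b iha ihb =>
    intro hr v
    simp only [reads, Bool.or_eq_false_iff] at hr
    simp only [eval, iha hr.1, ihb hr.2]
  | ite c a b ihc iha ihb =>
    intro hr v
    simp only [reads, Bool.or_eq_false_iff] at hr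
    simp only [eval, ihc hr.1.1, iha hr.1.2, ihb hr.2]
  | rd k' i j ihi ihj =>
    intro hr v
    simp only [reads, Bool.or_eq_false_iff, beq_eq_false_iff_ne] at hr
    simp only [eval, ihi hr.1.2, ihj hr.2, h k' hr.1.1]
  | inp e ih =>
    intro hr v
    simp only [reads] at hr
    simp only [eval, ih hr]
  | sum x e ih | mn x e ih =>
    intro hr v
    simp only [reads] at hr
    simp only [eval, ih hr]

/-- Agreement of the temporaries below `t`. -/
def Keep (t : ℕ) (s s' : State) : Prop := ∀ u < t, s'.reg (treg u) = s.reg (treg u)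

theorem Keep.trans {t t' : ℕ} {s₁ s₂ s₃ : State} (h : Keep t s₁ s₂) (h' : Keep t' s₂ s₃)
    (ht : t ≤ t') : Keep t s₁ s₃ := fun u hu => (h' u (by omega)).trans (h u hu)

theorem Keep.refl (t : ℕ) (s : State) : Keep t s s := fun _ _ => rfl

theorem Keep.setT {t t' : ℕ} {s s' : State} (h : Keep t s s') (ht : t ≤ t') (x : ℕ) :
    Keep t s (s'.setReg (treg t') x) := fun u hu => by
  simp only [State.reg_setReg, treg]; rw [if_neg (by omega)]; exact h u hu

theorem Keep.setV {t : ℕ} {s s' : State} (h : Keep t s s') (x i : ℕ) :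
    Keep t s (s'.setReg (vreg x) i) := fun u hu => by
  simp only [State.reg_setReg, treg, vreg]; rw [if_neg (by omega)]; exact h u hu

theorem Keep.setMem {t : ℕ} {s s' : State} (h : Keep t s s') (x i : ℕ) :
    Keep t s (s'.setMem x i) := fun u hu => h u hu

/-- With k + 1 ≤ B^(k+1) and Q ≤ B, the address is at most B² + B^(k+3) ≤ B^(k+5). This is the
reason for the summand k + 6 in the exponent of a read. -/
theorem go_addrOf (hC : C.Valid W P) (h : Rel C v α s) {k t i j : ℕ} (hk : k + 6 ≤ P)
    (hi : s.reg (treg t) = i) (hj : s.reg (treg (t + 1)) = j) (hiQ : i < C.Q) (hjQ : j < C.Q) :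
    Go W (addrOf k t) s 6 (fun s' => Rel C v α s' ∧
      s'.reg (treg t) = i * C.Q + j + (k + 1) * C.Q * C.Q ∧ s'.mem = s.mem ∧
      ∀ u, u ≠ t → u ≠ t + 1 → s'.reg (treg u) = s.reg (treg u)) := by
  have hB := hC.two
  have hQB := hC.QB
  have hQB2 : C.Q * C.Q ≤ C.B ^ 2 := by rw [pow_two]; exact Nat.mul_le_mul hQB hQB
  have hk1 := le_pow_succ_self hB k
  have hk2 : (k + 1) * C.Q ≤ C.B ^ (k + 2) := by
    rw [pow_succ C.B (k + 1)]; exact Nat.mul_le_mul hk1 hQB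
  have hk3 : (k + 1) * C.Q * C.Q ≤ C.B ^ (k + 3) := by
    rw [pow_succ C.B (k + 2)]; exact Nat.mul_le_mul hk2 hQB
  have hij : i * C.Q + j ≤ C.Q * C.Q := by nlinarith
  have hP : C.B ^ (k + 6) ≤ C.B ^ P := Nat.pow_le_pow_right (by omega) hk
  have hm : ∀ m, m ≤ k + 6 → C.B ^ m < W := fun m hm =>
    (Nat.pow_le_pow_right (by omega) (hm.trans hk)).trans_lt hC.word
  have hs : C.B ^ 2 + C.B ^ (k + 3) ≤ C.B ^ (k + 5) := by
    rw [show k + 5 = 2 + (k + 3) by omega]; exact pow_add_pow_le hB (by omega) (by omega)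
  have w5 := hm (k + 5) (by omega)
  have w3 := hm (k + 3) (by omega)
  have w2 := hm (k + 2) (by omega)
  have w1 := hm (k + 1) (by omega)
  have w0 := hm 2 (by omega)
  unfold addrOf
  have hQ5 := h.rQ
  refine Go.seq_mul ?_ (Go.seq_add ?_ (Go.seq_const ?_ (Go.seq_mul ?_ (Go.seq_mul ?_
    (Go.add ?_ ?_)))))
  · rw [hi, hQ5]; nlinarith
  · have h5 : ∀ u, 5 ≠ 3 * u + 1 := by omega
    simp [hi, hj, hQ5]; omega
  · omega
  · have h5 : ∀ u, 5 ≠ 3 * u + 1 := by omega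
    simp [hQ5, h5]; omega
  · have h5 : ∀ u, 5 ≠ 3 * u + 1 := by omega
    simp [hQ5, h5]; omega
  · have h5 : ∀ u, 5 ≠ 3 * u + 1 := by omega
    simp [hi, hj, hQ5, h5]; omega
  · refine ⟨((((((h.setT _ _).setT _ _).setT _ _).setT _ _).setT _ _).setT _ _), ?_, rfl, ?_⟩
    · have h5 : ∀ u, 5 ≠ 3 * u + 1 := by omega
      simp [hi, hj, hQ5, h5]
    · intro u hu hu'
      simp [hu, hu']

/-- Correctness of the compiler. A subexpression compiled at t + 1 leaves the temporaries up to t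
alone, so a partial result kept in t survives its evaluation; `Keep` carries this through the
induction. -/
theorem Expr.go (hC : C.Valid W P) (e : Expr) : ∀ (t : ℕ) (v : Env) (s : State), Rel C v α s →
    e.pw ≤ P → Go W (e.comp t) s (e.cost C.N) (fun s' => Rel C v α s' ∧
      s'.reg (treg t) = e.eval C α v ∧ Keep t s s') := by
  have hB := hC.two
  have hN : C.N ≤ C.B := hC.NQ.le.trans hC.QB
  have hm : ∀ m, m ≤ P → C.B ^ m < W := fun m hm =>
    (Nat.pow_le_pow_right (by omega) hm).trans_lt hC.word
  have hBW : 1 ≤ P → C.B < W := fun h => by simpa using hm 1 h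
  induction e with
  | var x =>
    intro t v s h hp
    exact Go.copy ⟨h.setT _ _, by simp [eval, h.var], (Keep.refl t s).setT le_rfl _⟩
  | lit k =>
    intro t v s h hp
    refine Go.const ?_ ⟨h.setT _ _, by simp [eval], (Keep.refl t s).setT le_rfl _⟩
    exact lt_of_le_of_lt ((Nat.le_succ k).trans (le_pow_succ_self hB k)) (hm _ hp)
  | size =>
    intro t v s h hp
    exact Go.copy ⟨h.setT _ _, by simp [eval, h.rN], (Keep.refl t s).setT le_rfl _⟩
  | add a b iha ihb | sub a b iha ihb | mul a b iha ihb =>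
    intro t v s h hp
    have hp' := hp
    simp only [pw] at hp
    refine (iha t v s h (by omega)).bind (T₂ := b.cost C.N + 1) ?_ (by simp [cost]; omega)
    rintro s₁ ⟨r₁, e₁, k₁⟩
    refine (ihb (t + 1) v s₁ r₁ (by omega)).bind (T₂ := 1) ?_ (by omega)
    rintro s₂ ⟨r₂, e₂, k₂⟩
    have e₁' := (k₂ t (by omega)).trans e₁
    have hle := Expr.eval_le hC r₂.arrB _ v r₂.varB |>.trans_lt (hm _ hp')
    have kk := (k₁.trans k₂ (show t ≤ t + 1 by omega))
    first
      | exact Go.add (by rw [e₁', e₂]; exact hle)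
          ⟨r₂.setT t _, by simp [e₁', e₂, eval], kk.setT le_rfl _⟩
      | exact Go.sub ⟨r₂.setT t _, by simp [e₁', e₂, eval], kk.setT le_rfl _⟩
      | exact Go.mul (by rw [e₁', e₂]; exact hle)
          ⟨r₂.setT t _, by simp [e₁', e₂, eval], kk.setT le_rfl _⟩
  | lt a b iha ihb =>
    intro t v s h hp
    simp only [pw] at hp
    have hbw := hBW ((a.one_le_pw).trans (by omega))
    refine (iha t v s h (by omega)).bind (T₂ := b.cost C.N + 2) ?_ (by simp [cost]; omega)
    rintro s₁ ⟨r₁, e₁, k₁⟩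
    refine (ihb (t + 1) v s₁ r₁ (by omega)).bind (T₂ := 2) ?_ (by omega)
    rintro s₂ ⟨r₂, e₂, k₂⟩
    have e₁' := (k₂ t (by omega)).trans e₁
    refine Go.ifLt (fun hlt => Go.const (by omega) ⟨r₂.setT t _, ?_, ?_⟩)
      (fun hlt => Go.const (by omega) ⟨r₂.setT t _, ?_, ?_⟩)
    · rw [e₁', e₂] at hlt; simp [eval, hlt]
    · exact (k₁.trans k₂ (by omega)).setT le_rfl _
    · rw [e₁', e₂] at hlt; simp [eval, hlt]
    · exact (k₁.trans k₂ (by omega)).setT le_rfl _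
  | ite c a b ihc iha ihb =>
    intro t v s h hp
    simp only [pw] at hp
    have hbw := hBW ((a.one_le_pw).trans (by omega))
    refine (ihc t v s h (by omega)).bind (T₂ := a.cost C.N + b.cost C.N + 1 + 1) ?_
      (by simp [cost]; omega)
    rintro s₁ ⟨r₁, e₁, k₁⟩
    refine Go.seq_const (by omega) (Go.ifLt (fun hlt => ?_) (fun hlt => ?_))
    · refine (iha t v _ (r₁.setT _ _) (by omega)).mono (by omega) ?_
      rintro s₂ ⟨r₂, e₂, k₂⟩
      refine ⟨r₂, ?_, (k₁.setT (by omega) _).trans k₂ le_rfl⟩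
      simp [e₁] at hlt
      simp [eval, hlt, e₂]
    · refine (ihb t v _ (r₁.setT _ _) (by omega)).mono (by omega) ?_
      rintro s₂ ⟨r₂, e₂, k₂⟩
      refine ⟨r₂, ?_, (k₁.setT (by omega) _).trans k₂ le_rfl⟩
      simp [e₁] at hlt
      simp [eval, hlt, e₂]
  | rd k i j ihi ihj =>
    intro t v s h hp
    simp only [pw] at hp
    have hbw := hBW ((i.one_le_pw).trans (by omega))
    refine (ihi t v s h (by omega)).bind (T₂ := j.cost C.N + 9) ?_ (by simp [cost]; omega)
    rintro s₁ ⟨r₁, e₁, k₁⟩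
    refine (ihj (t + 1) v s₁ r₁ (by omega)).bind (T₂ := 9) ?_ (by omega)
    rintro s₂ ⟨r₂, e₂, k₂⟩
    have e₁' := (k₂ t (by omega)).trans e₁
    have kk := k₁.trans k₂ (by omega)
    refine Go.ifLt (fun h₁ => Go.ifLt (fun h₂ => ?_) (fun h₂ => ?_)) (fun h₁ => ?_)
    · rw [e₁', r₂.rQ] at h₁
      rw [e₂, r₂.rQ] at h₂
      refine (go_addrOf hC r₂ (by omega) e₁' e₂ h₁ h₂).bind (T₂ := 1) ?_ (by omega)
      rintro s₃ ⟨r₃, e₃, m₃, k₃⟩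
      refine Go.load ⟨r₃.setT _ _, ?_, ?_⟩
      · simp [e₃, r₃.arr k _ _ h₁ h₂, eval]
      · exact fun u hu => by
          have := kk.setT (t' := t) le_rfl 0 u hu
          simp [hu.ne] at this
          simp [hu.ne, k₃ u (by omega) (by omega), this]
    · refine (Go.const (by omega) ⟨r₂.setT _ _, ?_, kk.setT le_rfl _⟩).mono (by omega) fun _ h => h
      rw [e₂, r₂.rQ] at h₂
      simp [eval, r₂.arr0 _ _ _ (Or.inr (not_lt.mp h₂))]
    · refine (Go.const (by omega) ⟨r₂.setT _ _, ?_, kk.setT le_rfl _⟩).mono (by omega) fun _ h => h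
      rw [e₁', r₂.rQ] at h₁
      simp [eval, r₂.arr0 _ _ _ (Or.inl (not_lt.mp h₁))]
  | inp e ih =>
    intro t v s h hp
    simp only [pw] at hp
    have hbw := hBW ((e.one_le_pw).trans (by omega))
    have h2 : C.Q * C.Q < W := by
      refine lt_of_le_of_lt ?_ (hm 2 (by omega))
      rw [pow_two]; exact Nat.mul_le_mul hC.QB hC.QB
    refine (ih t v s h (by omega)).bind (T₂ := 4) ?_ (by simp [cost])
    rintro s₁ ⟨r₁, e₁, k₁⟩
    refine Go.seq_mul (by rw [r₁.rQ]; exact h2) ?_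
    refine (Go.ifLt (T := 1) (fun hlt => Go.load ⟨(r₁.setT _ _).setT _ _, ?_, ?_⟩)
      (fun hlt => Go.const (by omega) ⟨(r₁.setT _ _).setT _ _, ?_, ?_⟩)).mono (by omega)
      fun _ h => h
    · simp [e₁, r₁.rQ] at hlt
      simp [e₁, r₁.inp _ hlt, eval]
    · exact (k₁.setT (by omega) _).setT le_rfl _
    · simp [e₁, r₁.rQ] at hlt
      simp [eval, hC.inp0 _ hlt]
    · exact (k₁.setT (by omega) _).setT le_rfl _
  | sum x e ih =>
    intro t v s h hp
    have hp' := hp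
    simp only [pw] at hp
    have hbw := hBW (by omega)
    have hval := Expr.eval_le hC h.arrB (.sum x e) v h.varB |>.trans_lt (hm _ hp')
    simp only [eval] at hval
    have hvx := h.varB x
    -- Partial sums are bounded by the complete sum, so the word bound for the value of the whole
    -- expression also covers the accumulator.
    have hpart : ∀ k < C.N, (∑ i ∈ Finset.range k, e.eval C α (Function.update v x i)) +
        e.eval C α (Function.update v x k) < W := by
      intro k hk
      rw [← Finset.sum_range_succ]
      exact (Finset.sum_le_sum_of_subset (Finset.range_subset_range.mpr hk)).trans_lt hval
    have hT : (Expr.sum x e).cost C.N =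
        ((∑ k ∈ Finset.range C.N, (e.cost C.N + 4 + 1) + 1) + 2) + 3 := by simp [cost]
    rw [hT]
    refine Go.seq_copy (Go.seq_const (by omega) (Go.seq_const (by omega) ?_))
    -- The register of the bound variable holds whatever the previous round left there, hence the
    -- existential `u`. The old value waits in temporary t and is restored after the loop.
    refine Go.bind (Go.whileLt (fun k s' => (∃ u, Rel C (Function.update v x u) α s') ∧ k ≤ C.N ∧
      s'.reg (treg t) = v x ∧
      s'.reg (treg (t + 1)) = ∑ i ∈ Finset.range k, e.eval C α (Function.update v x i) ∧
      s'.reg (treg (t + 2)) = k ∧ Keep t s s') (fun _ => e.cost C.N + 4) C.N ?_ ?_ ?_)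
      (T₂ := 2) ?_ le_rfl
    · rintro k hk s₁ ⟨⟨u, r₁⟩, -, ex, ea, ei, k₁⟩ -
      refine (Go.seq_copy ?_ : Go W _ s₁ (e.cost C.N + 3 + 1) _)
      rw [ei]
      have r₁' := r₁.setV x k (by omega)
      rw [Function.update_idem] at r₁'
      refine (ih (t + 3) _ _ r₁' (by omega)).bind (T₂ := 3) ?_ le_rfl
      rintro s₂ ⟨r₂, e₂, k₂⟩
      have q0 := k₂ t (by omega)
      have q1 := k₂ (t + 1) (by omega)
      have q2 := k₂ (t + 2) (by omega)
      have hx : ∀ u, 3 * u + 1 ≠ 3 * x := by omega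
      simp only [State.reg_setReg, treg, vreg, hx, if_false] at q0 q1 q2
      simp only [treg] at ex ea ei e₂
      refine Go.seq_add ?_ (Go.seq_const (by omega) (Go.add ?_
        ⟨⟨k, ((r₂.setT _ _).setT _ _).setT _ _⟩, hk, ?_, ?_, ?_, ?_⟩))
      · simp [q1, ea, e₂]; exact hpart k hk
      · simp [q2, ei]; omega
      · simp [q0, ex]
      · simp [q1, ea, e₂, Finset.sum_range_succ]
      · simp [q2, ei]
      · exact (((((k₁.setV x k).trans k₂ (by omega)).setT (by omega) _).setT (by omega) _).setT
          (by omega) _)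
    · rintro s₁ ⟨⟨u, r₁⟩, -, ex, ea, ei, k₁⟩
      rw [ei, r₁.rN]; omega
    · refine ⟨⟨v x, by simpa using ((h.setT _ _).setT _ _).setT _ _⟩, by omega, ?_, ?_, ?_, ?_⟩
      · simp [h.var]
      · simp
      · simp
      · exact ((((Keep.refl t s).setT le_rfl _).setT (by omega) _).setT (by omega) _)
    · rintro s₁ ⟨k, hk, ⟨⟨u, r₁⟩, -, ex, ea, ei, k₁⟩, hlt⟩
      rw [ei, r₁.rN] at hlt
      obtain rfl : k = C.N := by omega
      refine Go.seq_copy (Go.copy ?_)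
      rw [ex]
      refine ⟨(r₁.unsetV h.varB).setT _ _, ?_, (k₁.setV _ _).setT le_rfl _⟩
      have hx : ∀ u, 3 * u + 1 ≠ 3 * x := by omega
      simp only [treg] at ea
      simp [ea, eval, hx]
  | mn x e ih =>
    intro t v s h hp
    simp only [pw] at hp
    have hbw := hBW (by omega)
    have hvx := h.varB x
    have hT : (Expr.mn x e).cost C.N =
        ((∑ k ∈ Finset.range C.N, (e.cost C.N + 5 + 1) + 1) + 2) + 3 := by simp [cost]
    rw [hT]
    refine Go.seq_copy (Go.seq_copy (Go.seq_const (by omega) ?_))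
    refine Go.bind (Go.whileLt (fun k s' => (∃ u, Rel C (Function.update v x u) α s') ∧ k ≤ C.N ∧
      s'.reg (treg t) = v x ∧
      s'.reg (treg (t + 1)) = minTo C.N (fun i => e.eval C α (Function.update v x i)) k ∧
      s'.reg (treg (t + 2)) = k ∧ Keep t s s') (fun _ => e.cost C.N + 5) C.N ?_ ?_ ?_)
      (T₂ := 2) ?_ le_rfl
    · rintro k hk s₁ ⟨⟨u, r₁⟩, -, ex, ea, ei, k₁⟩ -
      refine (Go.seq_copy ?_ : Go W _ s₁ (e.cost C.N + 4 + 1) _)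
      rw [ei]
      have r₁' := r₁.setV x k (by omega)
      rw [Function.update_idem] at r₁'
      refine (ih (t + 3) _ _ r₁' (by omega)).bind (T₂ := 4) ?_ le_rfl
      rintro s₂ ⟨r₂, e₂, k₂⟩
      have q0 := k₂ t (by omega)
      have q1 := k₂ (t + 1) (by omega)
      have q2 := k₂ (t + 2) (by omega)
      have hx : ∀ u, 3 * u + 1 ≠ 3 * x := by omega
      simp only [State.reg_setReg, treg, vreg, hx, if_false] at q0 q1 q2
      simp only [treg] at ex ea ei e₂
      refine Go.bind (T₁ := 2) (T₂ := 2) (R := fun s' => Rel C (Function.update v x k) α s' ∧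
        s'.reg (treg t) = v x ∧
        s'.reg (treg (t + 1)) = minTo C.N (fun i => e.eval C α (Function.update v x i)) (k + 1) ∧
        s'.reg (treg (t + 2)) = k ∧ Keep t s s') (Go.ifLt (fun hlt => Go.copy ?_)
          (fun hlt => Go.skip ?_)) ?_ le_rfl
      · simp only [treg, e₂, q1, ea] at hlt
        refine ⟨r₂.setT _ _, ?_, ?_, ?_, ?_⟩
        · simp [q0, ex]
        · simp [e₂, minTo, hlt]
        · simp [q2, ei]
        · exact ((k₁.setV x k).trans k₂ (by omega)).setT (by omega) _
      · simp only [treg, e₂, q1, ea] at hlt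
        refine ⟨r₂, ?_, ?_, ?_, ?_⟩
        · simp [q0, ex]
        · simp [q1, ea, minTo, hlt]
        · simp [q2, ei]
        · exact ((k₁.setV x k).trans k₂ (by omega))
      · rintro s₃ ⟨r₃, ex₃, ea₃, ei₃, k₃⟩
        simp only [treg] at ex₃ ea₃ ei₃
        refine Go.seq_const (by omega) (Go.add ?_
          ⟨⟨k, (r₃.setT _ _).setT _ _⟩, hk, ?_, ?_, ?_, ?_⟩)
        · simp [ei₃]; omega
        · simp [ex₃]
        · simp [ea₃]
        · simp [ei₃]
        · exact (k₃.setT (by omega) _).setT (by omega) _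
    · rintro s₁ ⟨⟨u, r₁⟩, -, ex, ea, ei, k₁⟩
      rw [ei, r₁.rN]; omega
    · refine ⟨⟨v x, by simpa using ((h.setT _ _).setT _ _).setT _ _⟩, by omega, ?_, ?_, ?_, ?_⟩
      · simp [h.var]
      · have h2 : ∀ u, 2 ≠ 3 * u + 1 := by omega
        simp [h.rN, h2, minTo]
      · simp
      · exact ((((Keep.refl t s).setT le_rfl _).setT (by omega) _).setT (by omega) _)
    · rintro s₁ ⟨k, hk, ⟨⟨u, r₁⟩, -, ex, ea, ei, k₁⟩, hlt⟩
      rw [ei, r₁.rN] at hlt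
      obtain rfl : k = C.N := by omega
      refine Go.seq_copy (Go.copy ?_)
      rw [ex]
      refine ⟨(r₁.unsetV h.varB).setT _ _, ?_, (k₁.setV _ _).setT le_rfl _⟩
      have hx : ∀ u, 3 * u + 1 ≠ 3 * x := by omega
      simp only [treg] at ea
      simp [ea, eval, hx]

end

end WordRAM

/-! ### Commands on two-dimensional arrays and their total correctness -/

namespace WordRAM

/-- A command, compiled so as to use only the temporaries from a given number on. -/
abbrev Cmd := ℕ → Program

/-- Total correctness of a command, with time bound `T`. Commands do not change variables. -/
def Tri (C : Ctx) (W : ℕ) (c : Cmd) (v : Env) (α : Arr) (T : ℕ) (Q : Arr → Prop) : Prop :=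
  ∀ t s, Rel C v α s →
    Go W (c t) s T (fun r => ∃ β, Rel C v β r ∧ Q β ∧ Keep t s r)

/-- Write `x` to the cell `(i, j)` of the array `k`. -/
def Arr.set (α : Arr) (k i j x : ℕ) : Arr :=
  fun k' i' j' => if k' = k ∧ i' = i ∧ j' = j then x else α k' i' j'

namespace Cmd

open Program

/-- Sequential composition. -/
def seq (c₁ c₂ : Cmd) : Cmd := fun t => .seq (c₁ t) (c₂ t)

/-- No operation. -/
def skip : Cmd := fun _ => .skip

/-- Conditional. -/
def ite (e : Expr) (c₁ c₂ : Cmd) : Cmd := fun t =>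
  .seq (e.comp t) (.seq (const (treg (t + 1)) 0) (ifLt (treg (t + 1)) (treg t) (c₁ t) (c₂ t)))

/-- Assignment to an array cell, truncating the value at the bound for stored values. -/
def st (k : ℕ) (a b e : Expr) : Cmd := fun t =>
  .seq (a.comp t) <| .seq (b.comp (t + 1)) <| .seq (e.comp (t + 2)) <|
  .seq (ifLt 8 (treg (t + 2)) (copy (treg (t + 2)) 8) .skip) <|
  ifLt (treg t) 5 (ifLt (treg (t + 1)) 5
    (.seq (addrOf k t) (store (treg t) (treg (t + 2)))) .skip) .skip

/-- Loop over `x < N`. -/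
def loop (x : ℕ) (c : Cmd) : Cmd := fun t =>
  .seq (copy (treg t) (vreg x)) <| .seq (const (treg (t + 1)) 0) <|
  .seq (whileLt (treg (t + 1)) 2
    (.seq (copy (vreg x) (treg (t + 1))) <| .seq (c (t + 2)) <|
     .seq (const (treg (t + 2)) 1) (add (treg (t + 1)) (treg (t + 1)) (treg (t + 2)))))
  (copy (vreg x) (treg t))

/-- While the value of `e` is positive. -/
def whl (e : Expr) (c : Cmd) : Cmd := fun t =>
  .seq (e.comp t) <| .seq (const (treg (t + 1)) 0) <|
  whileLt (treg (t + 1)) (treg t)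
    (.seq (c (t + 2)) (.seq (e.comp t) (const (treg (t + 1)) 0)))

/-- Fill the array `k` with the values of `e` for `x, y < N`. -/
def tab (k x y : ℕ) (e : Expr) : Cmd := loop x (loop y (st k (.var x) (.var y) e))

/-- Fill the first row of the array `k` with the values of `e` for those `x < N` which satisfy
`g`. -/
def gtab (k x : ℕ) (g e : Expr) : Cmd := loop x (ite g (st k (.lit 0) (.var x) e) skip)

end Cmd

section

variable {C : Ctx} {v : Env} {α : Arr} {s : State} {W P : ℕ} {c c₁ c₂ : Cmd} {T T₁ T₂ : ℕ}
  {Q Q' R : Arr → Prop}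

theorem Tri.mono (h : Tri C W c v α T₁ Q) (hT : T₁ ≤ T) (hQ : ∀ β, Q β → Q' β) :
    Tri C W c v α T Q' := fun t s hs =>
  (h t s hs).mono hT fun _ ⟨α', h₁, h₂, h₃⟩ => ⟨α', h₁, hQ _ h₂, h₃⟩

theorem Tri.seq (h₁ : Tri C W c₁ v α T₁ R) (h₂ : ∀ β, R β → Tri C W c₂ v β T₂ Q)
    (hT : T₁ + T₂ ≤ T) : Tri C W (c₁.seq c₂) v α T Q := fun t s hs => by
  refine (h₁ t s hs).bind ?_ hT
  rintro s' ⟨α', r, hr, k⟩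
  exact (h₂ α' hr t s' r).mono le_rfl fun _ ⟨β, q₁, q₂, q₃⟩ => ⟨β, q₁, q₂, k.trans q₃ le_rfl⟩

theorem Tri.skip (h : Q α) : Tri C W Cmd.skip v α 1 Q := fun t s hs =>
  Go.skip ⟨α, hs, h, Keep.refl t s⟩

theorem Ctx.Valid.pos_word (hC : C.Valid W P) (k : ℕ) (hk : k ≤ 1) : k < W := by
  have := hC.word
  have h2 : 1 ≤ C.B ^ P := Nat.one_le_pow _ _ (by have := hC.two; omega)
  omega

theorem Tri.ite (hC : C.Valid W P) {e : Expr} (he : e.pw ≤ P)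
    (h₁ : 0 < e.eval C α v → Tri C W c₁ v α T Q)
    (h₂ : ¬ 0 < e.eval C α v → Tri C W c₂ v α T Q) :
    Tri C W (Cmd.ite e c₁ c₂) v α (e.cost C.N + T + 2) Q := fun t s hs => by
  refine (e.go hC t v s hs he).bind (T₂ := T + 1 + 1) ?_ (by omega)
  rintro s₁ ⟨r₁, e₁, k₁⟩
  refine Go.seq_const (hC.pos_word _ (by omega)) (Go.ifLt (fun hlt => ?_) (fun hlt => ?_))
  · simp [e₁] at hlt
    exact (h₁ hlt t _ (r₁.setT _ _)).mono le_rfl fun _ ⟨β, q₁, q₂, q₃⟩ =>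
      ⟨β, q₁, q₂, (k₁.setT (by omega) _).trans q₃ le_rfl⟩
  · simp [e₁] at hlt
    exact (h₂ (by omega) t _ (r₁.setT _ _)).mono le_rfl fun _ ⟨β, q₁, q₂, q₃⟩ =>
      ⟨β, q₁, q₂, (k₁.setT (by omega) _).trans q₃ le_rfl⟩

/-- The address equals j + q (i + q (k + 1)), an expansion in base q, and its digits are recovered
by reduction modulo q. -/
theorem addr_inj {q k i j k' i' j' : ℕ} (hi : i < q) (hj : j < q) (hi' : i' < q) (hj' : j' < q)
    (h : i * q + j + (k + 1) * q * q = i' * q + j' + (k' + 1) * q * q) :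
    k = k' ∧ i = i' ∧ j = j' := by
  have e : ∀ k i j, i * q + j + (k + 1) * q * q = j + q * (i + q * (k + 1)) := by intros; ring
  rw [e, e] at h
  have hq : 0 < q := by omega
  have h1 : j = j' := by
    have := congrArg (· % q) h
    simpa [Nat.mod_eq_of_lt hj, Nat.mod_eq_of_lt hj'] using this
  subst h1
  have h2 : i + q * (k + 1) = i' + q * (k' + 1) := Nat.eq_of_mul_eq_mul_left hq (by omega)
  have h3 : i = i' := by
    have := congrArg (· % q) h2
    simpa [Nat.mod_eq_of_lt hi, Nat.mod_eq_of_lt hi'] using this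
  subst h3
  have h4 : k + 1 = k' + 1 := Nat.eq_of_mul_eq_mul_left hq (by omega)
  exact ⟨by omega, rfl, rfl⟩

/-- Injectivity of addresses protects the other cells. The arrays begin at address Q², so the input
below Q² is never overwritten. -/
theorem Rel.setArr (h : Rel C v α s) {k i j x : ℕ} (hi : i < C.Q)
    (hj : j < C.Q) (hx : x ≤ C.B) :
    Rel C v (α.set k i j x) (s.setMem (i * C.Q + j + (k + 1) * C.Q * C.Q) x) where
  var := h.var
  rN := h.rN
  rQ := h.rQ
  rB := h.rB
  arr k' i' j' hi' hj' := by
    have := h.arr k' i' j' hi' hj'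
    simp only [State.setMem, Function.update_apply, Arr.set, this]
    congr 1
    refine propext ⟨fun h => addr_inj hi' hj' hi hj h, ?_⟩
    rintro ⟨rfl, rfl, rfl⟩; rfl
  inp e he := by
    have := h.inp e he
    have h2 : C.Q * C.Q ≤ (k + 1) * C.Q * C.Q := by
      rw [mul_assoc]; exact Nat.le_mul_of_pos_left _ (by omega)
    simp only [State.setMem, Function.update_apply]
    rw [if_neg (by omega), this]
  varB := h.varB
  arrB k' i' j' := by
    simp only [Arr.set]; split_ifs
    · exact hx
    · exact h.arrB ..
  arr0 k' i' j' h0 := by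
    simp only [Arr.set]; rw [if_neg (by omega)]; exact h.arr0 _ _ _ h0

/-- Truncation at B preserves the bound on stored values with no assumption on `e`. Applications
that know their value to be small remove the minimum afterwards. -/
theorem Tri.st (hC : C.Valid W P) {k : ℕ} {a b e : Expr} (ha : a.pw ≤ P) (hb : b.pw ≤ P)
    (he : e.pw ≤ P) (hk : k + 6 ≤ P) (hi : a.eval C α v < C.Q) (hj : b.eval C α v < C.Q)
    (hQ : Q (α.set k (a.eval C α v) (b.eval C α v) (min (e.eval C α v) C.B))) :
    Tri C W (Cmd.st k a b e) v α (a.cost C.N + b.cost C.N + e.cost C.N + 11) Q := fun t s hs => by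
  refine (a.go hC t v s hs ha).bind (T₂ := b.cost C.N + e.cost C.N + 11) ?_ (by omega)
  rintro s₁ ⟨r₁, e₁, k₁⟩
  refine (b.go hC (t + 1) v s₁ r₁ hb).bind (T₂ := e.cost C.N + 11) ?_ (by omega)
  rintro s₂ ⟨r₂, e₂, k₂⟩
  refine (e.go hC (t + 2) v s₂ r₂ he).bind (T₂ := 11) ?_ (by omega)
  rintro s₃ ⟨r₃, e₃, k₃⟩
  have q1 := (k₃ t (by omega)).trans ((k₂ t (by omega)).trans e₁)
  have q2 := (k₃ (t + 1) (by omega)).trans e₂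
  have kk := (k₁.trans k₂ (show t ≤ t + 1 by omega)).trans k₃ (show t ≤ t + 2 by omega)
  refine Go.bind (T₁ := 2) (T₂ := 9) (R := fun s' => Rel C v α s' ∧
    s'.reg (treg t) = a.eval C α v ∧ s'.reg (treg (t + 1)) = b.eval C α v ∧
    s'.reg (treg (t + 2)) = min (e.eval C α v) C.B ∧ Keep t s s')
    (Go.ifLt (fun hlt => Go.copy ?_) (fun hlt => Go.skip ?_)) ?_ le_rfl
  · rw [e₃, r₃.rB] at hlt
    refine ⟨r₃.setT _ _, ?_, ?_, ?_, kk.setT (by omega) _⟩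
    · simpa using q1
    · simpa using q2
    · simp [r₃.rB, hlt.le]
  · rw [e₃, r₃.rB] at hlt
    refine ⟨r₃, q1, q2, ?_, kk⟩
    rw [e₃, min_eq_left (by omega)]
  · rintro s₄ ⟨r₄, f1, f2, f3, k₄⟩
    refine Go.ifLt (fun hlt => Go.ifLt (fun hlt => ?_) (fun hlt => ?_)) (fun hlt => ?_)
    · refine (go_addrOf hC r₄ hk f1 f2 hi hj).bind (T₂ := 1) ?_ (by omega)
      rintro s₅ ⟨r₅, g1, g2, g3⟩
      refine Go.store ⟨_, ?_, hQ, ?_⟩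
      · rw [g1, g3 (t + 2) (by omega) (by omega), f3]
        exact r₅.setArr hi hj (min_le_right _ _)
      · refine Keep.setMem (fun u hu => ?_) _ _
        rw [g3 u (by omega) (by omega), k₄ u hu]
    · rw [f2, r₄.rQ] at hlt; omega
    · rw [f1, r₄.rQ] at hlt; omega

theorem Tri.loop (hC : C.Valid W P) (hP : 1 ≤ P) {x : ℕ} (I : ℕ → Arr → Prop) (τ : ℕ → ℕ)
    (hstep : ∀ i < C.N, ∀ β, I i β → Tri C W c (Function.update v x i) β (τ i) (I (i + 1)))
    (h0 : I 0 α) :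
    Tri C W (Cmd.loop x c) v α (∑ i ∈ Finset.range C.N, (τ i + 4) + 4) (I C.N) := fun t s hs => by
  have hBW : C.B < W := lt_of_le_of_lt (Nat.le_self_pow (by omega) _) hC.word
  have hNB : C.N ≤ C.B := hC.NQ.le.trans hC.QB
  refine Go.seq_copy (Go.seq_const (hC.pos_word _ (by omega)) ?_)
  refine Go.bind (Go.whileLt (fun k s' => (∃ u β, Rel C (Function.update v x u) β s' ∧ I k β) ∧
    s'.reg (treg t) = v x ∧ s'.reg (treg (t + 1)) = k ∧ Keep t s s') (fun k => τ k + 3) C.N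
    ?_ ?_ ?_) (T₂ := 1) ?_ le_rfl
  · rintro k hk s₁ ⟨⟨u, β, r₁, hI⟩, ex, ei, k₁⟩ -
    refine (Go.seq_copy ?_ : Go W _ s₁ (τ k + 2 + 1) _)
    rw [ei]
    have r₁' := r₁.setV x k (by omega)
    rw [Function.update_idem] at r₁'
    refine (hstep k hk β hI (t + 2) _ r₁').bind (T₂ := 2) ?_ le_rfl
    rintro s₂ ⟨β', r₂, hI', k₂⟩
    have q0 := k₂ t (by omega)
    have q1 := k₂ (t + 1) (by omega)
    have hx : ∀ u, 3 * u + 1 ≠ 3 * x := by omega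
    simp only [State.reg_setReg, treg, vreg, hx, if_false] at q0 q1
    simp only [treg] at ex ei
    refine Go.seq_const (hC.pos_word _ (by omega)) (Go.add ?_
      ⟨⟨k, β', (r₂.setT _ _).setT _ _, hI'⟩, ?_, ?_, ?_⟩)
    · simp [q1, ei]; omega
    · simp [q0, ex]
    · simp [q1, ei]
    · exact ((((k₁.setV x k).trans k₂ (by omega)).setT (by omega) _).setT (by omega) _)
  · rintro s₁ ⟨⟨u, β, r₁, hI⟩, ex, ei, k₁⟩
    rw [ei, r₁.rN]; omega
  · refine ⟨⟨v x, α, by simpa using (hs.setT _ _).setT _ _, h0⟩, ?_, ?_, ?_⟩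
    · simp [hs.var]
    · simp
    · exact (((Keep.refl t s).setT le_rfl _).setT (by omega) _)
  · rintro s₁ ⟨k, hk, ⟨⟨u, β, r₁, hI⟩, ex, ei, k₁⟩, hlt⟩
    rw [ei, r₁.rN] at hlt
    obtain rfl : k = C.N := by omega
    refine Go.copy ?_
    rw [ex]
    exact ⟨β, r₁.unsetV hs.varB, hI, k₁.setV _ _⟩

/-- The test is evaluated once before the loop and once at the end of each round; the factor R + 1
pays for the extra evaluation. -/
theorem Tri.whl (hC : C.Valid W P) {e : Expr} (he : e.pw ≤ P) (I : ℕ → Arr → Prop) (τ R : ℕ)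
    (hstep : ∀ i < R, ∀ β, I i β → 0 < e.eval C β v → Tri C W c v β τ (I (i + 1)))
    (hend : ∀ β, I R β → ¬ 0 < e.eval C β v) (h0 : I 0 α) :
    Tri C W (Cmd.whl e c) v α ((R + 1) * (τ + e.cost C.N + 2))
      (fun β => ∃ k ≤ R, I k β ∧ ¬ 0 < e.eval C β v) := fun t s hs => by
  have hT : (R + 1) * (τ + e.cost C.N + 2) = e.cost C.N +
      ((∑ k ∈ Finset.range R, (τ + e.cost C.N + 1 + 1) + 1) + τ + 1) := by
    simp only [Finset.sum_const, Finset.card_range, smul_eq_mul]; ring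
  rw [hT]
  refine (e.go hC t v s hs he).bind ?_ le_rfl
  rintro s₁ ⟨r₁, e₁, k₁⟩
  refine Go.seq_const (hC.pos_word _ (by omega)) ?_
  refine (Go.whileLt (fun k s' => (∃ β, Rel C v β s' ∧ I k β ∧
    s'.reg (treg t) = e.eval C β v) ∧ s'.reg (treg (t + 1)) = 0 ∧ Keep t s s')
    (fun k => τ + e.cost C.N + 1) R ?_ ?_ ?_).mono (by omega) ?_
  · rintro k hk s₂ ⟨⟨β, r₂, hI, e₂⟩, ez, k₂⟩ hlt
    rw [e₂, ez] at hlt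
    refine (hstep k hk β hI hlt (t + 2) s₂ r₂).bind (T₂ := e.cost C.N + 1) ?_ (by omega)
    rintro s₃ ⟨β', r₃, hI', k₃⟩
    refine (e.go hC t v s₃ r₃ he).bind (T₂ := 1) ?_ le_rfl
    rintro s₄ ⟨r₄, e₄, k₄⟩
    refine Go.const (hC.pos_word _ (by omega)) ⟨⟨β', r₄.setT _ _, hI', ?_⟩, ?_, ?_⟩
    · simpa using e₄
    · simp
    · exact ((k₂.trans k₃ (by omega)).trans k₄ le_rfl).setT (by omega) _
  · rintro s₂ ⟨⟨β, r₂, hI, e₂⟩, ez, k₂⟩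
    rw [e₂, ez]; exact hend β hI
  · exact ⟨⟨α, r₁.setT _ _, h0, by simpa using e₁⟩, by simp, k₁.setT (by omega) _⟩
  · rintro s₂ ⟨k, hk, ⟨⟨β, r₂, hI, e₂⟩, ez, k₂⟩, hlt⟩
    rw [e₂, ez] at hlt
    exact ⟨β, r₂, ⟨k, hk, hI, hlt⟩, k₂⟩

/-- The new contents are expressed through the initial array state α, although the table changes
under the loops; this is sound because `e` does not read it. -/
theorem Tri.tab (hC : C.Valid W P) {k x y : ℕ} {e : Expr} (hxy : x ≠ y) (he : e.pw ≤ P)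
    (hk : k + 6 ≤ P) (hr : e.reads k = false)
    (hQ : Q (Function.update α k fun i j => if i < C.N ∧ j < C.N then
      min (e.eval C α (Function.update (Function.update v x i) y j)) C.B else α k i j)) :
    Tri C W (Cmd.tab k x y e) v α (C.N * (C.N * (e.cost C.N + 17) + 8) + 4) Q := by
  set f := fun i j => min (e.eval C α (Function.update (Function.update v x i) y j)) C.B with hf
  have hNQ := hC.NQ
  have hT : ∑ i ∈ Finset.range C.N,
      ((∑ j ∈ Finset.range C.N, ((1 + 1 + e.cost C.N + 11) + 4) + 4) + 4) + 4 =
      C.N * (C.N * (e.cost C.N + 17) + 8) + 4 := by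
    simp only [Finset.sum_const, Finset.card_range, smul_eq_mul]; ring
  have hv1 : (Expr.var x).pw ≤ P := by simp [Expr.pw]; omega
  have hv2 : (Expr.var y).pw ≤ P := by simp [Expr.pw]; omega
  rw [← hT]
  refine (Tri.loop hC (by omega) (fun i β => β = Function.update α k fun i' j =>
    if i' < i ∧ j < C.N then f i' j else α k i' j) _ ?_ ?_).mono le_rfl ?_
  · rintro i hi β rfl
    refine (Tri.loop hC (by omega) (fun j β => β = Function.update α k fun i' j' =>
      if (i' < i ∧ j' < C.N) ∨ (i' = i ∧ j' < j) then f i' j' else α k i' j') _ ?_ ?_).mono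
      le_rfl ?_
    · rintro j hj β rfl
      refine Tri.st hC hv1 hv2 he hk ?_ ?_ ?_
      · simp [Expr.eval, hxy]; omega
      · simp [Expr.eval]; omega
      · rw [Expr.eval_congr (k := k) (α := α) (fun k' hk' => by simp [hk']) e hr]
        funext k' i' j'
        simp only [Expr.eval, Arr.set, Function.update_apply, hxy, if_true, if_false]
        by_cases h1 : k' = k
        · subst h1
          simp only [true_and, if_true]
          by_cases h2 : i' = i ∧ j' = j
          · obtain ⟨rfl, rfl⟩ := h2
            simp [hf]
          · rw [if_neg h2]
            congr 1
            apply propext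
            omega
        · simp [h1]
    · funext k' i' j'
      simp only [Function.update_apply]
      by_cases h1 : k' = k <;> simp [h1]
    · rintro β rfl
      congr 1
      funext i' j'
      congr 1
      apply propext
      omega
  · funext k' i' j'
    simp only [Function.update_apply]
    by_cases h1 : k' = k <;> simp [h1]
  · rintro β rfl; exact hQ

/-- Only the cheap guard `g` is paid for at every index, while `e` is paid for where the guard
holds. With an `e` of linear cost guarded by membership in a component, the time is proportional to
the size of the component times N, which is essential for the final cubic bound. -/
theorem Tri.gtab (hC : C.Valid W P) {k x : ℕ} {g e : Expr} (he : e.pw ≤ P) (hg : g.pw ≤ P)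
    (hk : k + 6 ≤ P) (hr : e.reads k = false) (hr' : g.reads k = false)
    (hQ : Q (Function.update α k fun i j =>
      if i = 0 ∧ j < C.N ∧ 0 < g.eval C α (Function.update v x j) then
      min (e.eval C α (Function.update v x j)) C.B else α k i j)) :
    Tri C W (Cmd.gtab k x g e) v α (C.N * (g.cost C.N + 7) +
      ((Finset.range C.N).filter fun j => 0 < g.eval C α (Function.update v x j)).card *
        (e.cost C.N + 13) + 4) Q := by
  set f := fun j => min (e.eval C α (Function.update v x j)) C.B with hf
  have hNQ := hC.NQ
  have hT : ∑ i ∈ Finset.range C.N, ((g.cost C.N +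
      ((if 0 < g.eval C α (Function.update v x i) then e.cost C.N + 13 else 0) + 1) + 2) + 4) + 4
      = C.N * (g.cost C.N + 7) +
      ((Finset.range C.N).filter fun j => 0 < g.eval C α (Function.update v x j)).card *
        (e.cost C.N + 13) + 4 := by
    rw [Finset.card_eq_sum_ones, Finset.sum_mul, Finset.sum_filter]
    simp only [Finset.sum_add_distrib, Finset.sum_const, Finset.card_range, smul_eq_mul, one_mul]
    ring
  have hv1 : (Expr.var x).pw ≤ P := by simp [Expr.pw]; omega
  have hv2 : (Expr.lit 0).pw ≤ P := by simp [Expr.pw]; omega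
  rw [← hT]
  refine (Tri.loop hC (by omega) (fun i β => β = Function.update α k fun i' j =>
    if i' = 0 ∧ j < i ∧ 0 < g.eval C α (Function.update v x j) then f j else α k i' j) _
    ?_ ?_).mono le_rfl ?_
  · rintro i hi β rfl
    have hgc := Expr.eval_congr (C := C) (k := k) (α := α)
      (α' := Function.update α k fun i' j =>
        if i' = 0 ∧ j < i ∧ 0 < g.eval C α (Function.update v x j) then f j else α k i' j)
      (fun k' hk' => by simp [hk']) g hr' (Function.update v x i)
    refine Tri.ite hC hg (fun h => ?_) (fun h => ?_)
    · rw [hgc] at h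
      refine Tri.mono (T₁ := 1 + 1 + e.cost C.N + 11) (Tri.st hC hv2 hv1 he hk ?_ ?_
        (Q := fun β => β = _) rfl) (by rw [if_pos h]; omega) ?_
      · simp [Expr.eval]; omega
      · simp [Expr.eval]; omega
      · rintro β rfl
        rw [Expr.eval_congr (k := k) (α := α) (fun k' hk' => by simp [hk']) e hr]
        funext k' i' j'
        simp only [Expr.eval, Arr.set, Function.update_apply, if_true]
        by_cases h1 : k' = k
        · subst h1
          simp only [true_and, if_true]
          by_cases h2 : i' = 0 ∧ j' = i
          · obtain ⟨rfl, rfl⟩ := h2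
            simp [hf, h]
          · rw [if_neg h2]
            congr 1
            apply propext
            constructor
            · rintro ⟨h3, h4, h5⟩; exact ⟨h3, by omega, h5⟩
            · rintro ⟨h3, h4, h5⟩; exact ⟨h3, by omega, h5⟩
        · simp [h1]
    · rw [hgc] at h
      refine (Tri.skip ?_).mono (by omega) fun _ h => h
      congr 1
      funext i' j'
      congr 1
      apply propext
      constructor
      · rintro ⟨h3, h4, h5⟩; exact ⟨h3, by omega, h5⟩
      · rintro ⟨h3, h4, h5⟩
        refine ⟨h3, ?_, h5⟩
        rcases Nat.lt_succ_iff_lt_or_eq.mp h4 with h6 | rfl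
        · exact h6
        · exact absurd h5 h
  · funext k' i' j'
    simp only [Function.update_apply]
    by_cases h1 : k' = k <;> simp [h1]
  · rintro β rfl; exact hQ

end

end WordRAM

/-! ### Representations by intervals on rays -/

/-- The vertices in `A` are represented on a star with `d` rays, those in `C` by subtrees which
contain the centre and reach up to `reach v i` on the ray `i`, the others by intervals `[lo, hi]` on
rays. Incomparability is required only where an interval is involved. -/
structure StarModel {V : Type*} (G : SimpleGraph V) (A C : Set V) (d : ℕ) (ray lo hi : V → ℕ)
    (reach : V → ℕ → ℕ) : Prop where
  ray_lt : ∀ x ∈ A, x ∉ C → ray x < d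
  lo_pos : ∀ x ∈ A, x ∉ C → 0 < lo x
  lo_le_hi : ∀ x ∈ A, x ∉ C → lo x ≤ hi x
  adj_central : ∀ u ∈ A, ∀ v ∈ A, u ∈ C → v ∈ C → u ≠ v → G.Adj u v
  adj_mixed : ∀ v ∈ A, ∀ x ∈ A, v ∈ C → x ∉ C → (G.Adj v x ↔ lo x ≤ reach v (ray x))
  adj_ray : ∀ x ∈ A, ∀ y ∈ A, x ∉ C → y ∉ C → x ≠ y →
    (G.Adj x y ↔ ray x = ray y ∧ lo x ≤ hi y ∧ lo y ≤ hi x)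
  proper : ∀ x ∈ A, ∀ y ∈ A, x ∉ C → y ∉ C → x ≠ y → ray x = ray y → lo y ≤ lo x → hi y < hi x
  reach_lt : ∀ v ∈ A, ∀ x ∈ A, v ∈ C → x ∉ C → reach v (ray x) < hi x

section Representation

theorem SimpleGraph.Subgraph.Connected.closed {N : Type*} {T : SimpleGraph N} {R : T.Subgraph}
    (h : R.Connected) (Q : N → Prop) (hQ : ∀ a b, R.Adj a b → Q a → Q b) {a b : N}
    (ha : a ∈ R.verts) (hb : b ∈ R.verts) (hqa : Q a) : Q b := by
  have hr := h.coe.preconnected ⟨a, ha⟩ ⟨b, hb⟩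
  rw [SimpleGraph.reachable_iff_reflTransGen] at hr
  have key : ∀ c : R.verts, Relation.ReflTransGen R.coe.Adj ⟨a, ha⟩ c → Q c := by
    intro c hc
    induction hc with
    | refl => exact hqa
    | tail _ h ih => exact hQ _ _ h ih
  exact key _ hr

variable {d : ℕ} {ℓ : Fin d → ℕ}

theorem subdividedStar_adj_some_some {i i' : Fin d} {j : Fin (ℓ i + 1)} {j' : Fin (ℓ i' + 1)} :
    (subdividedStar d ℓ).Adj (some ⟨i, j⟩) (some ⟨i', j'⟩) ↔
      i = i' ∧ ((j' : ℕ) = j + 1 ∨ (j : ℕ) = j' + 1) := by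
  simp only [subdividedStar, SimpleGraph.fromRel_adj]
  constructor
  · rintro ⟨-, ⟨h, h'⟩ | ⟨h, h'⟩⟩
    · exact ⟨h, Or.inl h'⟩
    · exact ⟨h.symm, Or.inr h'⟩
  · rintro ⟨rfl, h⟩
    refine ⟨?_, by simpa using h⟩
    intro h'
    have : j = j' := by simpa using h'
    subst this
    omega

theorem subdividedStar_adj_none_some {i : Fin d} {j : Fin (ℓ i + 1)} :
    (subdividedStar d ℓ).Adj none (some ⟨i, j⟩) ↔ (j : ℕ) = 0 := by
  simp [subdividedStar, SimpleGraph.fromRel_adj]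

/-- The outer part of the ray `i`, from position `m` on. -/
def outer (i : Fin d) (m : ℕ) : StarNode d ℓ → Prop
  | none => False
  | some ⟨i', j⟩ => i' = i ∧ m ≤ (j : ℕ)

/-- The only edge leaving an outer part. -/
theorem outer_closed {R : (subdividedStar d ℓ).Subgraph} {i : Fin d} {m : ℕ}
    (h0 : m = 0 → ∀ j : Fin (ℓ i + 1), (j : ℕ) = 0 → ¬ R.Adj none (some ⟨i, j⟩))
    (h1 : ∀ j j' : Fin (ℓ i + 1), (j : ℕ) + 1 = m → (j' : ℕ) = m →
      ¬ R.Adj (some ⟨i, j⟩) (some ⟨i, j'⟩)) {a b : StarNode d ℓ} (hab : R.Adj a b)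
    (ha : outer i m a) : outer i m b := by
  rcases a with _ | ⟨i₁, j₁⟩
  · exact ha.elim
  · obtain ⟨rfl, hj⟩ := ha
    rcases b with _ | ⟨i₂, j₂⟩
    · have h := subdividedStar_adj_none_some.mp (hab.adj_sub).symm
      exact h0 (by omega) j₁ h hab.symm
    · obtain ⟨rfl, h⟩ := subdividedStar_adj_some_some.mp hab.adj_sub
      refine ⟨rfl, ?_⟩
      by_contra hlt
      exact h1 j₂ j₁ (by omega) (by omega) hab.symm

variable {R R' : (subdividedStar d ℓ).Subgraph}

/-- Without this edge no edge of R would leave the part of the ray from j' on, yet R has nodes on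
both sides of it. -/
theorem adj_some_of_connected (h : R.Connected) {i : Fin d} {j j' : Fin (ℓ i + 1)}
    (hj : (j : ℕ) + 1 = j') (h1 : some ⟨i, j⟩ ∈ R.verts) (h2 : some ⟨i, j'⟩ ∈ R.verts) :
    R.Adj (some ⟨i, j⟩) (some ⟨i, j'⟩) := by
  by_contra hn
  have := h.closed (outer i j') (fun a b => outer_closed (m := j') (fun h => by omega) (by
    intro k k' hk hk'
    obtain rfl : k = j := Fin.ext (by omega)
    obtain rfl : k' = j' := Fin.ext hk'
    exact hn)) h2 h1 ⟨rfl, le_rfl⟩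
  have := this.2
  omega

theorem adj_none_of_connected (h : R.Connected) {i : Fin d} {j : Fin (ℓ i + 1)}
    (hj : (j : ℕ) = 0) (h1 : none ∈ R.verts) (h2 : some ⟨i, j⟩ ∈ R.verts) :
    R.Adj none (some ⟨i, j⟩) := by
  by_contra hn
  exact h.closed (outer i 0) (fun a b => outer_closed (m := 0) (by
    intro _ k hk
    obtain rfl : k = j := Fin.ext (by omega)
    exact hn) (fun k k' hk => by omega)) h2 h1 ⟨rfl, Nat.zero_le _⟩

/-- Connected subgraphs of a subdivided star are compared by their nodes. -/
theorem subgraph_le_of_verts (h' : R'.Connected) (hv : R.verts ⊆ R'.verts) : R ≤ R' := by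
  refine ⟨hv, fun a b hab => ?_⟩
  have ha := hv hab.fst_mem
  have hb := hv hab.snd_mem
  have hadj := hab.adj_sub
  rcases a with _ | ⟨i, j⟩ <;> rcases b with _ | ⟨i', j'⟩
  · exact absurd rfl hadj.ne
  · exact adj_none_of_connected h' (subdividedStar_adj_none_some.mp hadj) ha hb
  · exact (adj_none_of_connected h' (subdividedStar_adj_none_some.mp hadj.symm) hb ha).symm
  · obtain ⟨rfl, h | h⟩ := subdividedStar_adj_some_some.mp hadj
    · exact adj_some_of_connected h' h.symm ha hb
    · exact (adj_some_of_connected h' h.symm hb ha).symm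

/-- Every edge entering the outer part that starts at j is incident with the node j itself. If that
node is missing, R cannot connect a node of the outer part to b. -/
theorem mem_of_between (h : R.Connected) {i : Fin d} {j j' : Fin (ℓ i + 1)} (hj : j ≤ j')
    (h2 : some ⟨i, j'⟩ ∈ R.verts) {b : StarNode d ℓ} (hb : b ∈ R.verts) (hbo : ¬ outer i j b) :
    some ⟨i, j⟩ ∈ R.verts := by
  by_contra hn
  refine hbo (h.closed (outer i j) (fun a b => outer_closed (m := j) ?_ ?_) h2 hb ⟨rfl, hj⟩)
  · intro h0 k hk hk'
    obtain rfl : k = j := Fin.ext (by omega)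
    exact hn hk'.snd_mem
  · intro k k' _ hk' hkk
    obtain rfl : k' = j := Fin.ext hk'
    exact hn hkk.snd_mem

/-- A connected subgraph containing the centre is described by its extent on each ray. -/
theorem exists_reach (h : R.Connected) (hc : none ∈ R.verts) :
    ∃ p : ℕ → ℕ, ∀ (i : Fin d), p i ≤ ℓ i + 1 ∧
      ∀ j : Fin (ℓ i + 1), some ⟨i, j⟩ ∈ R.verts ↔ (j : ℕ) + 1 ≤ p i := by
  classical
  -- Positions are shifted by one: the node j of a ray has position j + 1, position 0 is the centre,
  -- and extent 0 means that the ray is not entered.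
  refine ⟨fun i => if hi : i < d then
    ((Finset.univ : Finset (Fin (ℓ ⟨i, hi⟩ + 1))).filter
      fun j => some ⟨⟨i, hi⟩, j⟩ ∈ R.verts).sup (fun j => (j : ℕ) + 1) else 0, fun i => ?_⟩
  simp only [i.isLt, dif_pos, Fin.eta]
  refine ⟨Finset.sup_le fun j _ => j.isLt, fun j => ⟨fun hj => ?_, fun hj => ?_⟩⟩
  · exact Finset.le_sup (f := fun j : Fin (ℓ i + 1) => (j : ℕ) + 1)
      (Finset.mem_filter.mpr ⟨Finset.mem_univ _, hj⟩)
  · obtain ⟨j', hj', hle⟩ := (Finset.le_sup_iff (by simp)).mp hj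
    rw [Finset.mem_filter] at hj'
    exact mem_of_between h (j := j) (j' := j') (by rw [Fin.le_def]; omega) hj'.2 hc (fun h => h)

/-- A connected subgraph avoiding the centre is an interval on a ray. -/
theorem exists_interval (h : R.Connected) (hc : none ∉ R.verts) :
    ∃ (i : Fin d) (l r : ℕ), 0 < l ∧ l ≤ r ∧ r ≤ ℓ i + 1 ∧
      ∀ (i' : Fin d) (j : Fin (ℓ i' + 1)), some ⟨i', j⟩ ∈ R.verts ↔
        i' = i ∧ l ≤ (j : ℕ) + 1 ∧ (j : ℕ) + 1 ≤ r := by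
  classical
  obtain ⟨⟨a, ha⟩⟩ := h.coe.nonempty
  rcases a with _ | ⟨i, j₀⟩
  · exact absurd ha hc
  set S := (Finset.univ : Finset (Fin (ℓ i + 1))).filter fun j => some ⟨i, j⟩ ∈ R.verts with hS
  have hne : S.Nonempty := ⟨j₀, by simp [hS, ha]⟩
  have hmem : ∀ j, j ∈ S ↔ some ⟨i, j⟩ ∈ R.verts := fun j => by simp [hS]
  have hmin := (hmem _).mp (S.min'_mem hne)
  have hmax := (hmem _).mp (S.max'_mem hne)
  refine ⟨i, (S.min' hne : ℕ) + 1, (S.max' hne : ℕ) + 1, by omega, ?_, (S.max' hne).isLt, ?_⟩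
  · have := S.min'_le_max' hne
    rw [Fin.le_def] at this; omega
  · intro i' j
    constructor
    · intro hj
      have hi : outer i 0 (some ⟨i', j⟩) := h.closed (outer i 0)
        (fun a b => outer_closed (m := 0) (fun _ _ _ h => hc h.fst_mem) (fun k k' hk => by omega))
        ha hj ⟨rfl, Nat.zero_le _⟩
      obtain ⟨rfl, -⟩ := hi
      refine ⟨rfl, ?_, ?_⟩
      · have := S.min'_le j ((hmem j).mpr hj)
        rw [Fin.le_def] at this; omega
      · have := S.le_max' j ((hmem j).mpr hj)
        rw [Fin.le_def] at this; omega
    · rintro ⟨rfl, h1, h2⟩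
      by_cases he : S.min' hne = j
      · rw [← he]; exact hmin
      · have hlt : ((S.min' hne : Fin (ℓ i' + 1)) : ℕ) < j := by
          have : ((S.min' hne : Fin (ℓ i' + 1)) : ℕ) ≠ j := fun h => he (Fin.ext h)
          omega
        refine mem_of_between h (j := j) (by rw [Fin.le_def]; omega) hmax hmin ?_
        rintro ⟨-, h3⟩
        omega

/-- A proper representation yields a model by intervals on rays. -/
theorem IsProperRepresentation.exists_model {V : Type*} {G : SimpleGraph V}
    {R : V → (subdividedStar d ℓ).Subgraph}
    (h : IsProperRepresentation G (subdividedStar d ℓ) R) :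
    ∃ ray lo hi reach, StarModel G Set.univ (centralClique R) d ray lo hi reach := by
  classical
  have hi0 : ∀ x, ∃ (i l r : ℕ), x ∉ centralClique R → ∃ hi : i < d, 0 < l ∧ l ≤ r ∧
      r ≤ ℓ ⟨i, hi⟩ + 1 ∧ ∀ (i' : Fin d) (j : Fin (ℓ i' + 1)), some ⟨i', j⟩ ∈ (R x).verts ↔
        i' = ⟨i, hi⟩ ∧ l ≤ (j : ℕ) + 1 ∧ (j : ℕ) + 1 ≤ r := by
    intro x
    by_cases hx : x ∈ centralClique R
    · exact ⟨0, 0, 0, fun h => absurd hx h⟩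
    · obtain ⟨i, l, r, h1⟩ := exists_interval (h.connected x) hx
      exact ⟨i, l, r, fun _ => ⟨i.isLt, h1⟩⟩
  choose ray lo hi hray using hi0
  have hp0 : ∀ v, ∃ p : ℕ → ℕ, v ∈ centralClique R → ∀ (i : Fin d), p i ≤ ℓ i + 1 ∧
      ∀ j : Fin (ℓ i + 1), some ⟨i, j⟩ ∈ (R v).verts ↔ (j : ℕ) + 1 ≤ p i := by
    intro v
    by_cases hv : v ∈ centralClique R
    · obtain ⟨p, hp⟩ := exists_reach (h.connected v) hv
      exact ⟨p, fun _ => hp⟩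
    · exact ⟨0, fun h => absurd h hv⟩
  choose reach hreach using hp0
  -- Incomparability is turned into a statement about node sets. It is used twice: between two
  -- intervals of a ray for `proper`, and between an interval and a central vertex for `reach_lt`.
  have hsub : ∀ u v, u ≠ v → ¬ (R u).verts ⊆ (R v).verts := fun u v huv hs =>
    h.incomparable u v huv (subgraph_le_of_verts (h.connected v) hs)
  refine ⟨ray, lo, hi, reach, ?_, ?_, ?_, ?_, ?_, ?_, ?_, ?_⟩
  · rintro x - hx
    exact (hray x hx).1
  · rintro x - hx
    exact (hray x hx).2.1
  · rintro x - hx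
    exact (hray x hx).2.2.1
  · rintro u - v - hu hv huv
    exact (h.adj_iff u v huv).mpr ⟨none, hu, hv⟩
  · rintro v - x - hv hx
    have hvx : v ≠ x := fun e => hx (e ▸ hv)
    obtain ⟨hid, h0, h1, h2, h3⟩ := hray x hx
    obtain ⟨h4, h5⟩ := hreach v hv ⟨ray x, hid⟩
    rw [h.adj_iff v x hvx]
    constructor
    · rintro ⟨a, ha, ha'⟩
      rcases a with _ | ⟨i, j⟩
      · exact absurd ha' hx
      · obtain ⟨rfl, h6, h7⟩ := (h3 i j).mp ha'
        have := (h5 j).mp ha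
        dsimp only at this
        omega
    · intro hle
      -- The innermost node of the interval of x is the first one that a central subtree would meet.
      have hlt : lo x - 1 < ℓ ⟨ray x, hid⟩ + 1 := by omega
      refine ⟨some ⟨⟨ray x, hid⟩, ⟨lo x - 1, hlt⟩⟩, ?_, ?_⟩
      · rw [h5]; dsimp only; omega
      · rw [h3]; refine ⟨rfl, ?_, ?_⟩ <;> dsimp only <;> omega
  · rintro x - y - hx hy hxy
    obtain ⟨hid, h0, h1, h2, h3⟩ := hray x hx
    obtain ⟨hid', h0', h1', h2', h3'⟩ := hray y hy
    rw [h.adj_iff x y hxy]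
    constructor
    · rintro ⟨a, ha, ha'⟩
      rcases a with _ | ⟨i, j⟩
      · exact absurd ha' hy
      · obtain ⟨e, h6, h7⟩ := (h3 i j).mp ha
        obtain ⟨e', h6', h7'⟩ := (h3' i j).mp ha'
        have : ray x = ray y := congrArg Fin.val (e.symm.trans e')
        omega
    · rintro ⟨e, h4, h5⟩
      -- Two overlapping intervals share the position of the larger left end.
      have hlt : max (lo x) (lo y) - 1 < ℓ ⟨ray x, hid⟩ + 1 := by
        have : ℓ ⟨ray x, hid⟩ = ℓ ⟨ray y, hid'⟩ := by congr 1; exact Fin.ext e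
        omega
      refine ⟨some ⟨⟨ray x, hid⟩, ⟨max (lo x) (lo y) - 1, hlt⟩⟩, ?_, ?_⟩
      · rw [h3]; refine ⟨rfl, ?_, ?_⟩ <;> dsimp only <;> omega
      · rw [h3']; refine ⟨Fin.ext e, ?_, ?_⟩ <;> dsimp only <;> omega
  · rintro x - y - hx hy hxy e hlo
    obtain ⟨hid, h0, h1, h2, h3⟩ := hray x hx
    obtain ⟨hid', h0', h1', h2', h3'⟩ := hray y hy
    by_contra hlt
    refine hsub x y hxy ?_
    rintro (_ | ⟨i, j⟩) ha
    · exact absurd ha hx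
    · obtain ⟨rfl, h6, h7⟩ := (h3 i j).mp ha
      rw [h3']
      exact ⟨Fin.ext e, by omega, by omega⟩
  · rintro v - x - hv hx
    have hvx : x ≠ v := fun e => hx (e ▸ hv)
    obtain ⟨hid, h0, h1, h2, h3⟩ := hray x hx
    obtain ⟨h4, h5⟩ := hreach v hv ⟨ray x, hid⟩
    by_contra hlt
    refine hsub x v hvx ?_
    rintro (_ | ⟨i, j⟩) ha
    · exact absurd ha hx
    · obtain ⟨rfl, h6, h7⟩ := (h3 i j).mp ha
      rw [h5]
      dsimp only
      omega

end Representation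

/-! ### Attached vertices, simplicial vertices and maximal central cliques in a model -/

namespace StarModel

variable {V : Type*} {G : SimpleGraph V} {A C : Set V} {d : ℕ} {ray lo hi : V → ℕ}
  {reach : V → ℕ → ℕ}

/-- Vertices on the same ray with neighbours in the central clique are adjacent. -/
theorem adj_of_attached (M : StarModel G A C d ray lo hi reach) {x y u v : V} (hx : x ∈ A)
    (hy : y ∈ A) (hu : u ∈ A) (hv : v ∈ A) (hxC : x ∉ C) (hyC : y ∉ C) (huC : u ∈ C) (hvC : v ∈ C)
    (hxu : G.Adj u x) (hyv : G.Adj v y) (hxy : x ≠ y) (hr : ray x = ray y) : G.Adj x y := by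
  -- The left end of x lies within the reach of u, which is smaller than the right end of y;
  -- likewise with the roles exchanged. Hence the two intervals overlap.
  have h1 := (M.adj_mixed u hu x hx huC hxC).mp hxu
  have h2 := (M.adj_mixed v hv y hy hvC hyC).mp hyv
  have h3 := M.reach_lt u hu x hx huC hxC
  have h4 := M.reach_lt v hv y hy hvC hyC
  have h5 := M.reach_lt u hu y hy huC hyC
  have h6 := M.reach_lt v hv x hx hvC hxC
  rw [hr] at h1 h3 h6
  exact (M.adj_ray x hx y hy hxC hyC hxy).mpr ⟨hr, by omega, by omega⟩

/-- At most one component per ray is attached to the central clique. -/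
theorem encard_attachedComponents_le (M : StarModel G Set.univ C d ray lo hi reach) :
    (attachedComponents G C).encard ≤ d := by
  classical
  have hch : ∀ X : attachedComponents G C, ∃ x : (Cᶜ : Set V), x ∈ X.1.supp ∧
      ∃ v ∈ C, G.Adj x v := by
    rintro ⟨X, x, hx, v, hv, hxv⟩
    exact ⟨x, hx, v, hv, hxv⟩
  choose f hf v hv hadj using hch
  let g : attachedComponents G C → Fin d := fun X =>
    ⟨ray (f X), M.ray_lt _ (Set.mem_univ _) (f X).2⟩
  have hinj : Function.Injective g := by
    intro X Y hXY
    have hr : ray (f X) = ray (f Y) := congrArg Fin.val hXY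
    have hX := (SimpleGraph.ConnectedComponent.mem_supp_iff _ _).mp (hf X)
    have hY := (SimpleGraph.ConnectedComponent.mem_supp_iff _ _).mp (hf Y)
    apply Subtype.ext
    rw [← hX, ← hY]
    by_cases he : f X = f Y
    · rw [he]
    · apply SimpleGraph.ConnectedComponent.sound
      refine SimpleGraph.Adj.reachable ?_
      exact M.adj_of_attached (Set.mem_univ _) (Set.mem_univ _) (Set.mem_univ _) (Set.mem_univ _)
        (f X).2 (f Y).2 (hv X) (hv Y) (hadj X).symm (hadj Y).symm
        (fun h => he (Subtype.ext h)) hr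
  have := (Function.Embedding.encard_le (s := attachedComponents G C)
    (t := (Set.univ : Set (Fin d)))
    ⟨fun X => ⟨g X, Set.mem_univ _⟩, fun X Y h => hinj (congrArg Subtype.val h)⟩)
  simpa using this

theorem mono (M : StarModel G A C d ray lo hi reach) {A' : Set V} (h : A' ⊆ A) :
    StarModel G A' C d ray lo hi reach where
  ray_lt x hx := M.ray_lt x (h hx)
  lo_pos x hx := M.lo_pos x (h hx)
  lo_le_hi x hx := M.lo_le_hi x (h hx)
  adj_central u hu v hv := M.adj_central u (h hu) v (h hv)
  adj_mixed v hv x hx := M.adj_mixed v (h hv) x (h hx)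
  adj_ray x hx y hy := M.adj_ray x (h hx) y (h hy)
  proper x hx y hy := M.proper x (h hx) y (h hy)
  reach_lt v hv x hx := M.reach_lt v (h hv) x (h hx)

/-- Transport of a model along a map which is injective on the represented vertices. -/
theorem comap {V' : Type*} (M : StarModel G A C d ray lo hi reach) {G' : SimpleGraph V'}
    {A' : Set V'} {g : V' → V} (hg : Set.InjOn g A') (hA : Set.MapsTo g A' A)
    (hadj : ∀ u ∈ A', ∀ w ∈ A', G'.Adj u w ↔ G.Adj (g u) (g w)) :
    StarModel G' A' (g ⁻¹' C) d (ray ∘ g) (lo ∘ g) (hi ∘ g) (reach ∘ g) where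
  ray_lt _ hx := M.ray_lt _ (hA hx)
  lo_pos _ hx := M.lo_pos _ (hA hx)
  lo_le_hi _ hx := M.lo_le_hi _ (hA hx)
  adj_central u hu v hv h₁ h₂ h₃ := (hadj u hu v hv).mpr
    (M.adj_central _ (hA hu) _ (hA hv) h₁ h₂ fun h => h₃ (hg hu hv h))
  adj_mixed v hv x hx h₁ h₂ := (hadj v hv x hx).trans (M.adj_mixed _ (hA hv) _ (hA hx) h₁ h₂)
  adj_ray x hx y hy h₁ h₂ h₃ := (hadj x hx y hy).trans
    (M.adj_ray _ (hA hx) _ (hA hy) h₁ h₂ fun h => h₃ (hg hx hy h))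
  proper _ hx _ hy h₁ h₂ h₃ := M.proper _ (hA hx) _ (hA hy) h₁ h₂ fun h => h₃ (hg hx hy h)
  reach_lt _ hv _ hx := M.reach_lt _ (hA hv) _ (hA hx)

/-- Every finite nonempty set of represented vertices contains one whose neighbours in the set form
a clique. -/
theorem exists_simplicial (M : StarModel G A C d ray lo hi reach) {S : Set V} (hS : S ⊆ A)
    (hfin : S.Finite) (hne : S.Nonempty) :
    ∃ v ∈ S, ∀ x ∈ S, ∀ y ∈ S, G.Adj v x → G.Adj v y → x ≠ y → G.Adj x y := by
  by_cases hc : ∃ x ∈ S, x ∉ C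
  -- Take the interval with the largest left end in S. All neighbours of v in S outside C contain
  -- the point `lo v`, and the central neighbours reach it, so together they form a clique.
  · obtain ⟨v, ⟨hv, hvC⟩, hmax⟩ := (hfin.subset (Set.sep_subset S fun x => x ∉ C)).exists_maximalFor
      lo {x ∈ S | x ∉ C} hc
    replace hmax : ∀ x ∈ S, x ∉ C → lo x ≤ lo v := fun x hx hxC => by
      by_contra h
      exact h (hmax ⟨hx, hxC⟩ (by omega))
    have hvle := M.lo_le_hi v (hS hv) hvC
    refine ⟨v, hv, ?_⟩
    have hCx : ∀ x ∈ S, ∀ y ∈ S, G.Adj v x → G.Adj v y → x ∈ C → y ∉ C → G.Adj x y := by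
      intro x hx y hy hvx hvy hxC hyC
      have h1 := (M.adj_mixed x (hS hx) v (hS hv) hxC hvC).mp hvx.symm
      obtain ⟨h2, h3, h4⟩ := (M.adj_ray v (hS hv) y (hS hy) hvC hyC hvy.ne).mp hvy
      have := hmax y hy hyC
      exact (M.adj_mixed x (hS hx) y (hS hy) hxC hyC).mpr (by rw [← h2]; omega)
    intro x hx y hy hvx hvy hxy
    by_cases hxC : x ∈ C <;> by_cases hyC : y ∈ C
    · exact M.adj_central x (hS hx) y (hS hy) hxC hyC hxy
    · exact hCx x hx y hy hvx hvy hxC hyC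
    · exact (hCx y hy x hx hvy hvx hyC hxC).symm
    · obtain ⟨h2, h3, h4⟩ := (M.adj_ray v (hS hv) y (hS hy) hvC hyC hvy.ne).mp hvy
      obtain ⟨h2', h3', h4'⟩ := (M.adj_ray v (hS hv) x (hS hx) hvC hxC hvx.ne).mp hvx
      have := hmax y hy hyC
      have := hmax x hx hxC
      exact (M.adj_ray x (hS hx) y (hS hy) hxC hyC hxy).mpr ⟨by omega, by omega, by omega⟩
  · push Not at hc
    obtain ⟨v, hv⟩ := hne
    exact ⟨v, hv, fun x hx y hy _ _ hxy =>
      M.adj_central x (hS hx) y (hS hy) (hc x hx) (hc y hy) hxy⟩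

/-- The central clique can be enlarged to a maximal clique. -/
theorem exists_maximal (M : StarModel G A C d ray lo hi reach) (hfin : A.Finite)
    (hne : A.Nonempty) :
    ∃ C' ⊆ A, C'.Nonempty ∧ (∀ u ∈ A, (∀ c ∈ C', c ≠ u → G.Adj c u) → u ∈ C') ∧
      ∃ reach', StarModel G A C' d ray lo hi reach' := by
  classical
  by_cases hmax : (∀ u ∈ A, (∀ c ∈ A ∩ C, c ≠ u → G.Adj c u) → u ∈ A ∩ C)
  · refine ⟨A ∩ C, Set.inter_subset_left, ?_, hmax, reach, ?_⟩
    · by_contra h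
      rw [Set.not_nonempty_iff_eq_empty] at h
      obtain ⟨u, hu⟩ := hne
      have := hmax u hu
      simp [h] at this
    · exact ⟨fun x hx hxC => M.ray_lt x hx (fun h => hxC ⟨hx, h⟩),
        fun x hx hxC => M.lo_pos x hx (fun h => hxC ⟨hx, h⟩),
        fun x hx hxC => M.lo_le_hi x hx (fun h => hxC ⟨hx, h⟩),
        fun u hu v hv huC hvC => M.adj_central u hu v hv huC.2 hvC.2,
        fun v hv x hx hvC hxC => M.adj_mixed v hv x hx hvC.2 (fun h => hxC ⟨hx, h⟩),
        fun x hx y hy hxC hyC => M.adj_ray x hx y hy (fun h => hxC ⟨hx, h⟩)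
          (fun h => hyC ⟨hy, h⟩),
        fun x hx y hy hxC hyC => M.proper x hx y hy (fun h => hxC ⟨hx, h⟩)
          (fun h => hyC ⟨hy, h⟩),
        fun v hv x hx hvC hxC => M.reach_lt v hv x hx hvC.2 (fun h => hxC ⟨hx, h⟩)⟩
  -- Some w outside the clique is adjacent to all of it. The centre is moved along the ray of w to
  -- the smallest right end p found there, counting both intervals of that ray and reaches of
  -- central vertices; the new clique C' consists of everything that contains p.
  · push Not at hmax
    obtain ⟨w, hw, hwadj, hwC⟩ := hmax
    replace hwC : w ∉ C := fun h => hwC ⟨hw, h⟩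
    -- the right end on the ray of `w`
    set i := ray w with hi_def
    let rend : V → ℕ := fun u => if u ∈ C then reach u i else hi u
    obtain ⟨m, ⟨hm, hm'⟩, hmin⟩ := (hfin.subset (Set.sep_subset A
      fun u => u ∈ C ∨ ray u = i)).exists_minimalFor rend {u ∈ A | u ∈ C ∨ ray u = i}
      ⟨w, hw, Or.inr rfl⟩
    set p := rend m with hp
    replace hmin : ∀ u ∈ A, (u ∈ C ∨ ray u = i) → p ≤ rend u := fun u hu hu' => by
      by_contra h
      exact h (hmin ⟨hu, hu'⟩ (by omega))
    have hrC : ∀ u, u ∈ C → rend u = reach u i := fun u hu => by simp [rend, hu]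
    have hrN : ∀ u, u ∉ C → rend u = hi u := fun u hu => by simp [rend, hu]
    let C' : Set V := {u ∈ A | u ∈ C ∨ (ray u = i ∧ lo u ≤ p)}
    have hC'adj : ∀ u ∈ C', ∀ v ∈ C', u ∉ C → u ≠ v → G.Adj u v := by
      rintro u ⟨hu, huu⟩ v ⟨hv, hvv⟩ huC huv
      have huu' := huu.resolve_left huC
      by_cases hvC : v ∈ C
      · refine ((M.adj_mixed v hv u hu hvC huC).mpr ?_).symm
        have := hmin v hv (Or.inl hvC)
        rw [hrC v hvC] at this
        rw [huu'.1]; omega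
      · have hvv' := hvv.resolve_left hvC
        have h1 := hmin v hv (Or.inr hvv'.1)
        have h2 := hmin u hu (Or.inr huu'.1)
        rw [hrN v hvC] at h1
        rw [hrN u huC] at h2
        exact (M.adj_ray u hu v hv huC hvC huv).mpr ⟨by omega, by omega, by omega⟩
    have hlow : ∀ u, u ∈ A → u ∉ C' → u ∉ C := fun u hu huC h => huC ⟨hu, Or.inl h⟩
    have hlow' : ∀ u, u ∈ A → u ∉ C' → ray u = i → p < lo u := fun u hu huC h => by
      by_contra hlt
      exact huC ⟨hu, Or.inr ⟨h, by omega⟩⟩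
    refine ⟨C', fun u hu => hu.1, ?_, ?_, ?_⟩
    · by_cases hmC : m ∈ C
      · exact ⟨m, hm, Or.inl hmC⟩
      · refine ⟨m, hm, Or.inr ⟨hm'.resolve_left hmC, ?_⟩⟩
        rw [hp, hrN m hmC]; exact M.lo_le_hi m hm hmC
    · intro u hu hadj
      by_contra huC'
      have huC := hlow u hu huC'
      -- A vertex adjacent to all of C' is adjacent to an interval of the ray i that belongs to C'.
      -- If the minimum p is attained by an interval, that one will do. If it is attained by a
      -- central m, then w will do: it is adjacent to m and so starts at or before p.
      have hray : ray u = i := by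
        by_cases hmC : m ∈ C
        · have hwC' : w ∈ C' := by
            refine ⟨hw, Or.inr ⟨rfl, ?_⟩⟩
            have h1 := (M.adj_mixed m hm w hw hmC hwC).mp
              (hwadj m ⟨hm, hmC⟩ fun h => hwC (h ▸ hmC))
            rw [hp, hrC m hmC]; exact h1
          have hwu : w ≠ u := fun h => huC' (h ▸ hwC')
          exact ((M.adj_ray w hw u hu hwC huC hwu).mp (hadj w hwC' hwu)).1.symm
        · have hmr := hm'.resolve_left hmC
          have hmC' : m ∈ C' := by
            refine ⟨hm, Or.inr ⟨hmr, ?_⟩⟩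
            rw [hp, hrN m hmC]; exact M.lo_le_hi m hm hmC
          have hmu : m ≠ u := fun h => huC' (h ▸ hmC')
          exact ((M.adj_ray m hm u hu hmC huC hmu).mp (hadj m hmC' hmu)).1.symm.trans hmr
      have hlt := hlow' u hu huC' hray
      by_cases hmC : m ∈ C
      · have hmu : m ≠ u := fun h => huC (h ▸ hmC)
        have := (M.adj_mixed m hm u hu hmC huC).mp (hadj m ⟨hm, Or.inl hmC⟩ hmu)
        rw [hray, ← hrC m hmC] at this
        omega
      · have hmr := hm'.resolve_left hmC
        have hmC' : m ∈ C' := by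
          refine ⟨hm, Or.inr ⟨hmr, ?_⟩⟩
          rw [hp, hrN m hmC]; exact M.lo_le_hi m hm hmC
        have hmu : m ≠ u := fun h => huC' (h ▸ hmC')
        have := ((M.adj_ray m hm u hu hmC huC hmu).mp (hadj m hmC' hmu)).2.2
        rw [hp, hrN m hmC] at hlt
        omega
    -- An interval that becomes central reaches to its right end on the ray i, and nowhere else. The
    -- remaining intervals on this ray start after p, so the requirement on reaches follows from the
    -- old `proper`.
    · refine ⟨fun u j => if u ∈ C then reach u j else if j = i then hi u else 0, ?_⟩
      refine ⟨fun x hx hxC => M.ray_lt x hx (hlow x hx hxC),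
        fun x hx hxC => M.lo_pos x hx (hlow x hx hxC),
        fun x hx hxC => M.lo_le_hi x hx (hlow x hx hxC), ?_, ?_,
        fun x hx y hy hxC hyC => M.adj_ray x hx y hy (hlow x hx hxC) (hlow y hy hyC),
        fun x hx y hy hxC hyC => M.proper x hx y hy (hlow x hx hxC) (hlow y hy hyC), ?_⟩
      · intro u hu v hv huC hvC huv
        by_cases h1 : u ∈ C
        · by_cases h2 : v ∈ C
          · exact M.adj_central u hu v hv h1 h2 huv
          · exact (hC'adj v hvC u huC h2 huv.symm).symm
        · exact hC'adj u huC v hvC h1 huv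
      · intro v hv x hx hvC hxC
        have hxC₀ := hlow x hx hxC
        by_cases h1 : v ∈ C
        · simp only [h1, if_true]
          exact M.adj_mixed v hv x hx h1 hxC₀
        · simp only [h1, if_false]
          have hvv := hvC.2.resolve_left h1
          have hvx : v ≠ x := fun h => hxC (h ▸ hvC)
          rw [M.adj_ray v hv x hx h1 hxC₀ hvx]
          have hlh := M.lo_le_hi x hx hxC₀
          have hlp := M.lo_pos x hx hxC₀
          by_cases h2 : ray x = i
          · have := hlow' x hx hxC h2
            simp only [h2, if_true]
            omega
          · simp only [h2, if_false]
            omega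
      · intro v hv x hx hvC hxC
        have hxC₀ := hlow x hx hxC
        by_cases h1 : v ∈ C
        · simp only [h1, if_true]
          exact M.reach_lt v hv x hx h1 hxC₀
        · simp only [h1, if_false]
          have hvv := hvC.2.resolve_left h1
          have hvx : x ≠ v := fun h => hxC (h ▸ hvC)
          have hlh := M.lo_le_hi x hx hxC₀
          have hlp := M.lo_pos x hx hxC₀
          by_cases h2 : ray x = i
          · have := hlow' x hx hxC h2
            simp only [h2, if_true]
            exact M.proper x hx v hv hxC₀ h1 hvx (by omega) (by omega)
          · simp only [h2, if_false]
            omega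

end StarModel

/-! ### Distances and the structure around an anchor clique -/

namespace StarIso

open WordRAM Classical

noncomputable section

/-- Edges join only vertices below `N`. -/
def Below (U : SimpleGraph ℕ) (N : ℕ) : Prop := ∀ u w, U.Adj u w → u < N

/-- The distance in `U`, with value `N` between different components. -/
def capDist (U : SimpleGraph ℕ) (N u w : ℕ) : ℕ := if U.Reachable u w then U.dist u w else N

section capDist

variable {U : SimpleGraph ℕ} {N : ℕ}

theorem Below.lt_of_reachable (hU : Below U N) {u w : ℕ} (h : U.Reachable u w) (hw : w < N) :
    u < N := by
  rw [SimpleGraph.reachable_iff_reflTransGen] at h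
  induction h using Relation.ReflTransGen.head_induction_on with
  | refl => exact hw
  | head h _ _ => exact hU _ _ h

/-- A shortest path has distinct vertices, all below N. So true distances are smaller than N, and
the value N is free to signal different components. -/
theorem Below.dist_lt (hU : Below U N) {u w : ℕ} (h : U.Reachable u w) (hw : w < N) :
    U.dist u w < N := by
  obtain ⟨p, hp, hl⟩ := h.exists_path_of_dist
  have hsub : p.support.toFinset ⊆ Finset.range N := by
    intro x hx
    rw [List.mem_toFinset] at hx
    exact Finset.mem_range.mpr (hU.lt_of_reachable (p.dropUntil x hx).reachable hw)
  have := Finset.card_le_card hsub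
  rw [List.toFinset_card_of_nodup hp.support_nodup, SimpleGraph.Walk.length_support,
    Finset.card_range] at this
  omega

theorem capDist_self (u : ℕ) : capDist U N u u = 0 := by simp [capDist]

theorem capDist_comm (u w : ℕ) : capDist U N u w = capDist U N w u := by
  simp [capDist, SimpleGraph.reachable_comm, SimpleGraph.dist_comm]

theorem Below.capDist_lt (hU : Below U N) {u w : ℕ} (hw : w < N) :
    capDist U N u w < N ↔ U.Reachable u w := by
  unfold capDist
  split_ifs with h
  · simp [h, hU.dist_lt h hw]
  · simp [h]

theorem Below.capDist_le (hU : Below U N) {u w : ℕ} (hw : w < N) : capDist U N u w ≤ N := by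
  unfold capDist
  split_ifs with h
  · exact (hU.dist_lt h hw).le
  · exact le_rfl

theorem capDist_le_length {u w : ℕ} (p : U.Walk u w) : capDist U N u w ≤ p.length := by
  rw [capDist, if_pos p.reachable]; exact SimpleGraph.dist_le p

theorem capDist_eq_zero (hN : 0 < N) {u w : ℕ} : capDist U N u w = 0 ↔ u = w := by
  constructor
  · intro h
    unfold capDist at h
    split_ifs at h with hr
    · exact hr.dist_eq_zero_iff.mp h
    · omega
  · rintro rfl; exact capDist_self u

theorem capDist_le_one (hN : 2 ≤ N) {u w : ℕ} : capDist U N u w ≤ 1 ↔ u = w ∨ U.Adj u w := by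
  constructor
  · intro h
    unfold capDist at h
    split_ifs at h with hr
    · rcases Nat.le_one_iff_eq_zero_or_eq_one.mp h with h | h
      · exact Or.inl (hr.dist_eq_zero_iff.mp h)
      · exact Or.inr (SimpleGraph.dist_eq_one_iff_adj.mp h)
    · omega
  · rintro (rfl | h)
    · simp [capDist_self]
    · simpa using capDist_le_length (N := N) h.toWalk

theorem Below.capDist_triangle (hU : Below U N) {u w x : ℕ} (hw : w < N) :
    capDist U N u w ≤ capDist U N u x + capDist U N x w := by
  by_cases h1 : U.Reachable u x
  · by_cases h2 : U.Reachable x w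
    · obtain ⟨p, hp⟩ := h1.exists_walk_length_eq_dist
      obtain ⟨q, hq⟩ := h2.exists_walk_length_eq_dist
      have := capDist_le_length (N := N) (p.append q)
      simp only [capDist, h1, h2, if_true]
      simp only [SimpleGraph.Walk.length_append, hp, hq] at this
      simpa [capDist, h1.trans h2] using this
    · have := hU.capDist_le (u := u) hw
      simp only [capDist, h2, if_false] at *
      omega
  · have := hU.capDist_le (u := u) hw
    simp only [capDist, h1, if_false] at *
    omega

/-- The last step of a shortest path. -/
theorem Below.capDist_step (hU : Below U N) {u w : ℕ} (hw : w < N) (h0 : 0 < capDist U N u w)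
    (h1 : capDist U N u w < N) : ∃ x, U.Adj x w ∧ capDist U N u x + 1 = capDist U N u w := by
  have hr := (hU.capDist_lt hw).mp h1
  obtain ⟨p, hp⟩ := hr.exists_walk_length_eq_dist
  have hd : capDist U N u w = U.dist u w := by simp [capDist, hr]
  have hnil : ¬ p.Nil := by
    rw [← SimpleGraph.Walk.length_eq_zero_iff]; omega
  refine ⟨p.penultimate, p.adj_penultimate hnil, ?_⟩
  have hx := capDist_le_length (N := N) p.dropLast
  have hl : p.dropLast.length + 1 = p.length := by
    simp; omega
  have := hU.capDist_triangle (u := u) (x := p.penultimate) hw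
  have h2 := capDist_le_length (N := N) (p.adj_penultimate hnil).toWalk
  simp at h2
  omega

end capDist

/-! ### Tables relative to an anchor -/

variable (U : SimpleGraph ℕ) (N : ℕ) (C : Set ℕ)

/-- The distance from the anchor. -/
def aDist (u : ℕ) : ℕ := minTo N (fun c => if c ∈ C then capDist U N c u else N) N

/-- The vertices outside the anchor, in its component. -/
def inX (u : ℕ) : Prop := 0 < aDist U N C u ∧ aDist U N C u < N

/-- `z` is next to the anchor, and on the same ray as `u`. -/
def nearZ (z u : ℕ) : Prop := aDist U N C z = 1 ∧ capDist U N z u ≤ aDist U N C u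

/-- The representative of the ray of `u`. -/
def aLab (u : ℕ) : ℕ :=
  if inX U N C u then minTo N (fun z => if nearZ U N C z u then z else N) N else N

/-- The number of neighbours one step further away from the anchor. -/
def aUp (u : ℕ) : ℕ :=
  ((Finset.range N).filter fun w => U.Adj w u ∧ aDist U N C w = aDist U N C u + 1).card

/-- The number of neighbours one step closer to the anchor. -/
def aDown (u : ℕ) : ℕ :=
  ((Finset.range N).filter fun w => U.Adj w u ∧ aDist U N C w + 1 = aDist U N C u).card

/-- The key by which the vertices on a ray are ordered. -/
def aKey (u : ℕ) : ℕ :=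
  aDist U N C u * (2 * (N + 1)) + (N + 1 + aUp U N C u - aDown U N C u)

/-- The set of representatives of rays. -/
def aRoots : Finset ℕ := (Finset.range N).filter fun z => ∃ u < N, aLab U N C u = z

/-- The number of rays. -/
def aR : ℕ := (aRoots U N C).card

/-- The number of the ray of `u`. -/
def aIdx (u : ℕ) : ℕ := ((aRoots U N C).filter fun z => z < aLab U N C u).card

/-- The position of `u` on its ray. -/
def aPos (u : ℕ) : ℕ := ((Finset.range N).filter fun w => aLab U N C w = aLab U N C u ∧
  (aKey U N C w < aKey U N C u ∨ aKey U N C w = aKey U N C u ∧ w < u)).card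

/-- The vertices in the component of the anchor outside of it. -/
def aX : Finset ℕ := (Finset.range N).filter fun u => aLab U N C u < N

/-- The anchor as a finite set. -/
def aC : Finset ℕ := (Finset.range N).filter fun u => u ∈ C

/-- The properties of an anchor that make the matching procedure succeed. -/
structure Good (d : ℕ) : Prop where
  maximal : ∀ u < N, (∀ c < N, c ∈ C → capDist U N c u ≤ 1) → u ∈ C
  near : ∀ u < N, aLab U N C u < N → ∀ z < N,
    (nearZ U N C z u ↔ nearZ U N C z (aLab U N C u))
  ties : ∀ u < N, ∀ w < N, aLab U N C u < N → aLab U N C u = aLab U N C w →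
    aKey U N C u = aKey U N C w → ∀ y < N, (capDist U N u y ≤ 1 ↔ capDist U N w y ≤ 1)
  rays : aR U N C ≤ d

variable {U N C}

/-- Standing assumptions on an anchor. -/
structure Anchor (U : SimpleGraph ℕ) (N : ℕ) (C : Set ℕ) : Prop where
  below : Below U N
  two : 2 ≤ N
  lt : ∀ c ∈ C, c < N
  clique : ∀ c ∈ C, ∀ c' ∈ C, c ≠ c' → U.Adj c c'
  nonempty : C.Nonempty

section

theorem Anchor.aDist_le (h : Anchor U N C) {c u : ℕ} (hc : c ∈ C) : aDist U N C u ≤ capDist U N c u := by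
  have := minTo_le (M := N) (f := fun c => if c ∈ C then capDist U N c u else N) (h.lt c hc)
  simpa [hc, aDist] using this

theorem aDist_spec {u : ℕ} (hu : aDist U N C u < N) :
    ∃ c ∈ C, capDist U N c u = aDist U N C u := by
  rcases minTo_eq_top_or N (fun c => if c ∈ C then capDist U N c u else N) N with h1 | ⟨c, _, h1⟩
  · unfold aDist at hu; omega
  · by_cases hcC : c ∈ C
    · exact ⟨c, hcC, by simpa [hcC, aDist] using h1.symm⟩
    · simp only [hcC, if_false] at h1
      unfold aDist at hu; omega

theorem Anchor.aDist_eq_zero (h : Anchor U N C) {u : ℕ} : aDist U N C u = 0 ↔ u ∈ C := by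
  have hN := h.two
  constructor
  · intro h0
    obtain ⟨c, hc, h1⟩ := aDist_spec (U := U) (N := N) (C := C) (u := u) (by omega)
    rw [h0, capDist_eq_zero (by omega)] at h1
    exact h1 ▸ hc
  · intro hu
    have := h.aDist_le (u := u) hu
    rw [capDist_self] at this
    omega

theorem Anchor.aDist_lip (h : Anchor U N C) {x w : ℕ} (hxw : U.Adj x w) : aDist U N C w ≤ aDist U N C x + 1 := by
  have hw : w < N := h.below _ _ hxw.symm
  by_cases hx : aDist U N C x < N
  · obtain ⟨c, hc, h1⟩ := aDist_spec hx
    have h2 := h.aDist_le (u := w) hc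
    have h3 := h.below.capDist_triangle (u := c) (x := x) hw
    have h4 := (capDist_le_one (N := N) h.two).mpr (Or.inr hxw)
    omega
  · have : aDist U N C w ≤ N := minTo_le_top _ _ _
    omega

theorem Anchor.aDist_lt_iff (h : Anchor U N C) {c u : ℕ} (hc : c ∈ C) (hu : u < N) :
    aDist U N C u < N ↔ U.Reachable c u := by
  constructor
  · intro h1
    obtain ⟨c', hc', h2⟩ := aDist_spec h1
    have hr := (h.below.capDist_lt hu).mp (h2 ▸ h1)
    by_cases hcc : c = c'
    · exact hcc ▸ hr
    · exact (h.clique c hc c' hc' hcc).reachable.trans hr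
  · intro hr
    exact (h.aDist_le hc).trans_lt ((h.below.capDist_lt hu).mpr hr)

theorem Anchor.aDist_step (h : Anchor U N C) {w : ℕ} (hw : w < N) (h0 : 0 < aDist U N C w)
    (h1 : aDist U N C w < N) : ∃ x, U.Adj x w ∧ aDist U N C x + 1 = aDist U N C w := by
  obtain ⟨c, hc, h2⟩ := aDist_spec h1
  obtain ⟨x, hx, h3⟩ := h.below.capDist_step hw (h2 ▸ h0) (h2 ▸ h1)
  refine ⟨x, hx, ?_⟩
  have h4 := h.aDist_lip hx
  have h5 := h.aDist_le (u := x) hc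
  omega

/-- Follow a shortest path back to the anchor; its last vertex before entering the anchor serves as
z. -/
theorem Anchor.exists_nearZ (h : Anchor U N C) {u : ℕ} (hu : u < N) (hx : inX U N C u) :
    ∃ z < N, nearZ U N C z u := by
  obtain ⟨k, hk⟩ : ∃ k, aDist U N C u = k + 1 := ⟨aDist U N C u - 1, by have := hx.1; omega⟩
  induction k generalizing u with
  | zero => exact ⟨u, hu, hk, by simp [capDist_self]⟩
  | succ k ih =>
    obtain ⟨x, hxu, h1⟩ := h.aDist_step hu hx.1 hx.2
    have hxN := h.below _ _ hxu
    obtain ⟨z, hz, h2, h3⟩ := ih hxN ⟨by omega, by have := hx.2; omega⟩ (by omega)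
    refine ⟨z, hz, h2, ?_⟩
    have h4 := h.below.capDist_triangle (u := z) (x := x) hu
    have h5 := (capDist_le_one (N := N) h.two).mpr (Or.inr hxu)
    omega

theorem Anchor.aLab_lt (h : Anchor U N C) {u : ℕ} (hu : u < N) : aLab U N C u < N ↔ inX U N C u := by
  unfold aLab
  split_ifs with hx
  · obtain ⟨z, hz, h1⟩ := h.exists_nearZ hu hx
    have := minTo_le (M := N) (f := fun z => if nearZ U N C z u then z else N) hz
    simp only [h1, if_true] at this
    exact ⟨fun _ => hx, fun _ => by omega⟩
  · simp [hx]

theorem aLab_near {u : ℕ} (hu : aLab U N C u < N) : nearZ U N C (aLab U N C u) u := by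
  unfold aLab at hu ⊢
  split_ifs at hu ⊢ with hx
  · rcases minTo_eq_top_or N (fun z => if nearZ U N C z u then z else N) N with h1 | ⟨z, hz, h1⟩
    · omega
    · by_cases hn : nearZ U N C z u
      · simp only [hn, if_true] at h1
        rw [h1]; exact hn
      · simp only [hn, if_false] at h1; omega
  · omega

theorem aLab_le {u z : ℕ} (hx : inX U N C u) (hz : z < N) (hn : nearZ U N C z u) :
    aLab U N C u ≤ z := by
  have := minTo_le (M := N) (f := fun z => if nearZ U N C z u then z else N) hz
  simp only [hn, if_true] at this
  simpa [aLab, hx] using this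

theorem aUp_le (u : ℕ) : aUp U N C u ≤ N := by
  simpa [aUp] using Finset.card_filter_le (Finset.range N) _

theorem aDown_le (u : ℕ) : aDown U N C u ≤ N := by
  simpa [aDown] using Finset.card_filter_le (Finset.range N) _

/-- The second summand of the key lies between 1 and 2N + 1, below the modulus 2(N + 1). The key is
thus a lexicographic encoding of the distance and the difference of `aUp` and `aDown`, and N + 1
makes the truncated subtraction exact. -/
theorem aKey_eq {u w : ℕ} (hk : aKey U N C u = aKey U N C w) :
    aDist U N C u = aDist U N C w ∧
      aUp U N C u + aDown U N C w = aUp U N C w + aDown U N C u := by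
  have h1 := aUp_le (U := U) (N := N) (C := C) u
  have h2 := aUp_le (U := U) (N := N) (C := C) w
  have h3 := aDown_le (U := U) (N := N) (C := C) u
  have h4 := aDown_le (U := U) (N := N) (C := C) w
  unfold aKey at hk
  have h5 : aDist U N C u = aDist U N C w := by
    have e : ∀ q r, r < 2 * (N + 1) → (q * (2 * (N + 1)) + r) / (2 * (N + 1)) = q := by
      intro q r hr
      rw [mul_comm, Nat.mul_add_div (by omega), Nat.div_eq_of_lt hr, add_zero]
    have := congrArg (· / (2 * (N + 1))) hk
    rwa [e _ _ (by omega), e _ _ (by omega)] at this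
  refine ⟨h5, ?_⟩
  rw [h5] at hk
  omega

end

/-! ### Anchors of represented graphs -/

section Model

variable {A : Set ℕ} {d : ℕ} {ray lo hi : ℕ → ℕ} {reach : ℕ → ℕ → ℕ}

/-- A component represented with central clique `C`. -/
structure ModelAt (U : SimpleGraph ℕ) (N : ℕ) (A C : Set ℕ) (d : ℕ) (ray lo hi : ℕ → ℕ)
    (reach : ℕ → ℕ → ℕ) : Prop where
  anchor : Anchor U N C
  model : StarModel U A C d ray lo hi reach
  sub : C ⊆ A
  mem : ∀ u < N, aDist U N C u < N → u ∈ A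
  closed : ∀ u ∈ A, ∀ w, U.Adj u w → w ∈ A

theorem ModelAt.inX_iff (m : ModelAt U N A C d ray lo hi reach) {u : ℕ} (hu : u < N) : inX U N C u → u ∈ A ∧ u ∉ C := fun hx =>
  ⟨m.mem u hu hx.2, fun hc => by
    have := m.anchor.aDist_eq_zero.mpr hc
    have := hx.1
    omega⟩

theorem ModelAt.notMem (m : ModelAt U N A C d ray lo hi reach) {u : ℕ} (hx : 0 < aDist U N C u) : u ∉ C := fun hc => by
  have := m.anchor.aDist_eq_zero.mpr hc; omega

theorem ModelAt.ray_eq (m : ModelAt U N A C d ray lo hi reach) {x y : ℕ} (hx : x ∈ A) (hxC : x ∉ C) (hyC : y ∉ C) (hxy : U.Adj x y) :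
    ray x = ray y :=
  ((m.model.adj_ray x hx y (m.closed x hx y hxy) hxC hyC hxy.ne).mp hxy).1

/-- Let w be the predecessor of y on a shortest path from the anchor. If x starts no later than w,
induction applies to x and w. Otherwise w starts before x and extends to y, hence covers the left
end of x and is adjacent to x. In the base case a central neighbour of y reaches x as well. -/
theorem ModelAt.mono (m : ModelAt U N A C d ray lo hi reach) {x y : ℕ} (hxN : x < N) (hyN : y < N) (hx : inX U N C x)
    (hy : inX U N C y) (hr : ray x = ray y) (hlo : lo x ≤ lo y) :
    aDist U N C x ≤ aDist U N C y := by
  obtain ⟨k, hk⟩ : ∃ k, aDist U N C y = k + 1 := ⟨aDist U N C y - 1, by have := hy.1; omega⟩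
  obtain ⟨hxA, hxC⟩ := m.inX_iff hxN hx
  induction k generalizing y with
  | zero =>
    obtain ⟨hyA, hyC⟩ := m.inX_iff hyN hy
    obtain ⟨c, hcy, h1⟩ := m.anchor.aDist_step hyN hy.1 hy.2
    have hc : c ∈ C := m.anchor.aDist_eq_zero.mp (by omega)
    have h2 := (m.model.adj_mixed c (m.sub hc) y hyA hc hyC).mp hcy
    have h3 := (m.model.adj_mixed c (m.sub hc) x hxA hc hxC).mpr (by rw [hr]; omega)
    have := m.anchor.aDist_lip h3
    omega
  | succ k ih =>
    obtain ⟨hyA, hyC⟩ := m.inX_iff hyN hy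
    obtain ⟨w, hwy, h1⟩ := m.anchor.aDist_step hyN hy.1 hy.2
    have hwN := m.anchor.below _ _ hwy
    have hwX : inX U N C w := ⟨by omega, by have := hy.2; omega⟩
    obtain ⟨hwA, hwC⟩ := m.inX_iff hwN hwX
    have hrw := m.ray_eq hwA hwC hyC hwy
    by_cases hle : lo x ≤ lo w
    · have := ih hwN hwX (by omega) hle (by omega)
      omega
    · obtain ⟨-, h2, h3⟩ := (m.model.adj_ray w hwA y hyA hwC hyC hwy.ne).mp hwy
      have hwx : w ≠ x := fun e => by subst e; omega
      have h4 := m.model.lo_le_hi x hxA hxC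
      have h5 := (m.model.adj_ray w hwA x hxA hwC hxC hwx).mpr ⟨by omega, by omega, by omega⟩
      have := m.anchor.aDist_lip h5
      omega

/-- Layers of a ray are cliques. -/
theorem ModelAt.layer (m : ModelAt U N A C d ray lo hi reach) {x y : ℕ} (hxN : x < N) (hyN : y < N) (hx : inX U N C x)
    (hy : inX U N C y) (hr : ray x = ray y) (hd : aDist U N C x = aDist U N C y) (hxy : x ≠ y) :
    U.Adj x y := by
  wlog hlo : lo x ≤ lo y generalizing x y
  · exact (this hyN hxN hy hx hr.symm hd.symm hxy.symm (by omega)).symm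
  obtain ⟨hxA, hxC⟩ := m.inX_iff hxN hx
  obtain ⟨hyA, hyC⟩ := m.inX_iff hyN hy
  obtain ⟨w, hwy, h1⟩ := m.anchor.aDist_step hyN hy.1 hy.2
  have hwN := m.anchor.below _ _ hwy
  by_cases hk : aDist U N C w = 0
  · have hw : w ∈ C := m.anchor.aDist_eq_zero.mp hk
    obtain ⟨w', hwx, h2⟩ := m.anchor.aDist_step hxN hx.1 hx.2
    have hw' : w' ∈ C := m.anchor.aDist_eq_zero.mp (by omega)
    exact m.model.adj_of_attached hxA hyA (m.sub hw') (m.sub hw) hxC hyC hw' hw hwx hwy hxy hr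
  · have hwX : inX U N C w := ⟨by omega, by have := hy.2; omega⟩
    obtain ⟨hwA, hwC⟩ := m.inX_iff hwN hwX
    have hrw := m.ray_eq hwA hwC hyC hwy
    -- The predecessor w of y lies in an earlier layer, so by monotonicity it starts before x.
    -- Properness then makes x end after w, and w meets y; so x extends far enough to meet y too.
    have hlt : lo w < lo x := by
      by_contra hle
      have := m.mono hxN hwN hx hwX (by omega) (by omega)
      omega
    have hwx : x ≠ w := fun e => by subst e; omega
    have h2 := m.model.proper x hxA w hwA hxC hwC hwx (by omega) hlt.le
    obtain ⟨-, h3, h4⟩ := (m.model.adj_ray w hwA y hyA hwC hyC hwy.ne).mp hwy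
    have h5 := m.model.lo_le_hi y hyA hyC
    exact (m.model.adj_ray x hxA y hyA hxC hyC hxy).mpr ⟨hr, by omega, by omega⟩

/-- A walk can leave a ray only through the anchor, and a walk from z through the anchor to u has
length at least 1 + `aDist u`. Conversely the first layer of a ray is a clique, so z is within
distance one of the vertex where the path from the anchor to u enters the ray. This makes the rays
visible from distances alone. -/
theorem ModelAt.nearZ_iff (m : ModelAt U N A C d ray lo hi reach) {z u : ℕ} (hz : z < N) (hu : u < N) (hu' : inX U N C u)
    (hz1 : aDist U N C z = 1) : nearZ U N C z u ↔ ray z = ray u := by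
  have hN := m.anchor.two
  have hzX : inX U N C z := ⟨by omega, by omega⟩
  obtain ⟨hzA, hzC⟩ := m.inX_iff hz hzX
  constructor
  · rintro ⟨-, hle⟩
    -- a shortest walk from `z` to `u` avoids the anchor
    have key : ∀ k w, w < N → capDist U N z w = k → k ≤ aDist U N C w → inX U N C w →
        ray z = ray w := by
      intro k
      induction k with
      | zero =>
        intro w hw h0 _ _
        rw [capDist_eq_zero (by omega)] at h0
        rw [h0]
      | succ k ih =>
        intro w hw hk hkw hwX
        obtain ⟨x, hxw, h1⟩ := m.anchor.below.capDist_step (u := z) hw (by omega)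
          (by have := hwX.2; omega)
        have hxN := m.anchor.below _ _ hxw
        have h2 := m.anchor.aDist_lip hxw
        by_cases hxC : x ∈ C
        · have h3 := m.anchor.aDist_eq_zero.mpr hxC
          have h4 := m.anchor.aDist_le (u := z) hxC
          rw [capDist_comm] at h4
          have h5 := m.anchor.aDist_lip hxw
          omega
        · have hx0 : 0 < aDist U N C x := Nat.pos_of_ne_zero fun h => hxC
            (m.anchor.aDist_eq_zero.mp h)
          have hxX : inX U N C x := by
            refine ⟨hx0, ?_⟩
            obtain ⟨c, hc⟩ := m.anchor.nonempty
            have := (m.anchor.aDist_lt_iff hc hw).mp hwX.2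
            exact (m.anchor.aDist_lt_iff hc hxN).mpr (this.trans hxw.symm.reachable)
          obtain ⟨hxA, -⟩ := m.inX_iff hxN hxX
          obtain ⟨-, hwC⟩ := m.inX_iff hw hwX
          rw [ih x hxN (by omega) (by omega) hxX]
          exact m.ray_eq hxA hxC hwC hxw
    exact key _ u hu rfl hle hu'
  · intro hr
    refine ⟨hz1, ?_⟩
    obtain ⟨k, hk⟩ : ∃ k, aDist U N C u = k + 1 := ⟨aDist U N C u - 1, by have := hu'.1; omega⟩
    induction k generalizing u with
    | zero =>
      by_cases hzu : z = u
      · subst hzu; simp [capDist_self]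
      · have := m.layer hz hu hzX hu' hr (by omega) hzu
        have := (capDist_le_one (N := N) hN).mpr (Or.inr this)
        omega
    | succ k ih =>
      obtain ⟨x, hxu, h1⟩ := m.anchor.aDist_step hu hu'.1 hu'.2
      have hxN := m.anchor.below _ _ hxu
      have hxX : inX U N C x := ⟨by omega, by have := hu'.2; omega⟩
      obtain ⟨hxA, hxC⟩ := m.inX_iff hxN hxX
      obtain ⟨-, huC⟩ := m.inX_iff hu hu'
      have h2 := ih hxN hxX (hr.trans (m.ray_eq hxA hxC huC hxu).symm) (by omega)
      have h3 := m.anchor.below.capDist_triangle (u := z) (x := x) hu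
      have h4 := (capDist_le_one (N := N) hN).mpr (Or.inr hxu)
      omega

/-- Within a layer of a ray the order of left ends is also the order of right ends. Moving outwards
can only lose neighbours in the previous layer and gain neighbours in the next one, so
neighbourhoods are nested and their sizes determine them. -/
theorem ModelAt.subset_of_lo_le (m : ModelAt U N A C d ray lo hi reach) {x y : ℕ} (hxN : x < N) (hyN : y < N) (hx : inX U N C x)
    (hy : inX U N C y) (hr : ray x = ray y) (hd : aDist U N C x = aDist U N C y)
    (hlo : lo x ≤ lo y) (hxy : x ≠ y) (w : ℕ) :
    (U.Adj w y → aDist U N C w + 1 = aDist U N C y → U.Adj w x) ∧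
    (U.Adj w x → aDist U N C w = aDist U N C x + 1 → U.Adj w y) := by
  obtain ⟨hxA, hxC⟩ := m.inX_iff hxN hx
  obtain ⟨hyA, hyC⟩ := m.inX_iff hyN hy
  have hhi := m.model.proper y hyA x hxA hyC hxC hxy.symm hr.symm hlo
  have hlx := m.model.lo_le_hi x hxA hxC
  have hly := m.model.lo_le_hi y hyA hyC
  constructor
  · intro hwy h1
    have hwN := m.anchor.below _ _ hwy
    by_cases hwC : w ∈ C
    · have h2 := (m.model.adj_mixed w (m.sub hwC) y hyA hwC hyC).mp hwy
      exact (m.model.adj_mixed w (m.sub hwC) x hxA hwC hxC).mpr (by rw [hr]; omega)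
    · have hwX : inX U N C w := ⟨Nat.pos_of_ne_zero fun h => hwC
        (m.anchor.aDist_eq_zero.mp h), by have := hy.2; omega⟩
      obtain ⟨hwA, -⟩ := m.inX_iff hwN hwX
      obtain ⟨h2, h3, h4⟩ := (m.model.adj_ray w hwA y hyA hwC hyC hwy.ne).mp hwy
      have hwx : w ≠ x := fun e => by subst e; omega
      refine (m.model.adj_ray w hwA x hxA hwC hxC hwx).mpr ⟨by omega, ?_, by omega⟩
      by_contra hlt
      have := m.mono hxN hwN hx hwX (by omega) (by omega)
      omega
  · intro hwx h1
    have hwN := m.anchor.below _ _ hwx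
    have hwA : w ∈ A := m.closed x hxA w hwx.symm
    have hwC : w ∉ C := m.notMem (by omega)
    have hwX : inX U N C w := by
      refine ⟨by omega, ?_⟩
      obtain ⟨c, hc⟩ := m.anchor.nonempty
      have := (m.anchor.aDist_lt_iff hc hxN).mp hx.2
      exact (m.anchor.aDist_lt_iff hc hwN).mpr (this.trans hwx.symm.reachable)
    obtain ⟨h2, h3, h4⟩ := (m.model.adj_ray w hwA x hxA hwC hxC hwx.ne).mp hwx
    have hwy : w ≠ y := fun e => by subst e; omega
    have hlw := m.model.lo_le_hi w hwA hwC
    refine (m.model.adj_ray w hwA y hyA hwC hyC hwy).mpr ⟨by omega, by omega, ?_⟩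
    by_contra hlt
    have := m.mono hwN hyN hwX hy (by omega) (by omega)
    omega

/-- Vertices of a ray with the same key are twins. -/
theorem ModelAt.twins (m : ModelAt U N A C d ray lo hi reach) {x y : ℕ} (hxN : x < N) (hyN : y < N) (hx : inX U N C x)
    (hy : inX U N C y) (hr : ray x = ray y) (hk : aKey U N C x = aKey U N C y) (w : ℕ) :
    (x = w ∨ U.Adj x w) ↔ (y = w ∨ U.Adj y w) := by
  wlog hlo : lo x ≤ lo y generalizing x y
  · exact (this hyN hxN hy hx hr.symm hk.symm (by omega)).symm
  by_cases hxy : x = y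
  · rw [hxy]
  obtain ⟨hd, hud⟩ := aKey_eq hk
  have hsub := m.subset_of_lo_le hxN hyN hx hy hr hd hlo hxy
  have hdown : ((Finset.range N).filter fun w => U.Adj w y ∧
      aDist U N C w + 1 = aDist U N C y) ⊆ ((Finset.range N).filter fun w => U.Adj w x ∧
      aDist U N C w + 1 = aDist U N C x) := by
    intro w hw
    simp only [Finset.mem_filter] at hw ⊢
    exact ⟨hw.1, (hsub w).1 hw.2.1 hw.2.2, by omega⟩
  have hup : ((Finset.range N).filter fun w => U.Adj w x ∧
      aDist U N C w = aDist U N C x + 1) ⊆ ((Finset.range N).filter fun w => U.Adj w y ∧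
      aDist U N C w = aDist U N C y + 1) := by
    intro w hw
    simp only [Finset.mem_filter] at hw ⊢
    exact ⟨hw.1, (hsub w).2 hw.2.1 hw.2.2, by omega⟩
  -- Equal keys give up(x) + down(y) = up(y) + down(x), while the inclusions give down(y) ≤ down(x)
  -- and up(x) ≤ up(y). Both inclusions must therefore be equalities.
  have c1 := Finset.card_le_card hdown
  have c2 := Finset.card_le_card hup
  unfold aUp aDown at hud
  have e1 := Finset.eq_of_subset_of_card_le hdown (by omega)
  have e2 := Finset.eq_of_subset_of_card_le hup (by omega)
  have hadj := m.layer hxN hyN hx hy hr hd hxy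
  have gen : ∀ {x y : ℕ}, x < N → y < N → inX U N C x → inX U N C y → ray x = ray y →
      aDist U N C x = aDist U N C y → U.Adj x y →
      (∀ w, w ∈ ((Finset.range N).filter fun w => U.Adj w y ∧
        aDist U N C w + 1 = aDist U N C y) ↔ w ∈ ((Finset.range N).filter fun w => U.Adj w x ∧
        aDist U N C w + 1 = aDist U N C x)) →
      (∀ w, w ∈ ((Finset.range N).filter fun w => U.Adj w x ∧
        aDist U N C w = aDist U N C x + 1) ↔ w ∈ ((Finset.range N).filter fun w => U.Adj w y ∧
        aDist U N C w = aDist U N C y + 1)) →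
      (x = w ∨ U.Adj x w) → (y = w ∨ U.Adj y w) := by
    rintro x y hxN hyN hx hy hr hd hadj e1 e2 (rfl | hxw)
    · exact Or.inr hadj.symm
    · have hwN := m.anchor.below _ _ hxw.symm
      have l1 := m.anchor.aDist_lip hxw
      have l2 := m.anchor.aDist_lip hxw.symm
      have hc : aDist U N C w + 1 = aDist U N C x ∨ aDist U N C w = aDist U N C x ∨
        aDist U N C w = aDist U N C x + 1 := by omega
      rcases hc with hc | hc | hc
      · have := (e1 w).mpr (by simp [hwN, hxw.symm, hc])
        simp only [Finset.mem_filter] at this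
        exact Or.inr this.2.1.symm
      · have hwX : inX U N C w := ⟨by have := hx.1; omega, by have := hx.2; omega⟩
        obtain ⟨hxA, hxC⟩ := m.inX_iff hxN hx
        obtain ⟨hwA, hwC⟩ := m.inX_iff hwN hwX
        by_cases hyw : y = w
        · exact Or.inl hyw
        · exact Or.inr (m.layer hyN hwN hy hwX (hr.symm.trans (m.ray_eq hxA hxC hwC hxw))
            (by omega) hyw)
      · have := (e2 w).mp (by simp [hwN, hxw.symm, hc])
        simp only [Finset.mem_filter] at this
        exact Or.inr this.2.1.symm
  constructor
  · exact gen hxN hyN hx hy hr hd hadj (fun w => by rw [e1]) (fun w => by rw [e2])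
  · exact gen hyN hxN hy hx hr.symm hd.symm hadj.symm (fun w => by rw [e1]) (fun w => by rw [e2])

/-- A maximal central clique is a good anchor. -/
theorem ModelAt.good (m : ModelAt U N A C d ray lo hi reach) (hmax : ∀ u ∈ A, (∀ c ∈ C, c ≠ u → U.Adj c u) → u ∈ C) : Good U N C d := by
  have hN := m.anchor.two
  have hlab : ∀ u < N, aLab U N C u < N → ray (aLab U N C u) = ray u := by
    intro u hu hlt
    have hX := (m.anchor.aLab_lt hu).mp hlt
    have hn := aLab_near hlt
    exact (m.nearZ_iff hlt hu hX hn.1).mp hn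
  have hlabX : ∀ u < N, aLab U N C u < N → inX U N C (aLab U N C u) := by
    intro u hu hlt
    have hn := aLab_near hlt
    exact ⟨by have := hn.1; omega, by have := hn.1; omega⟩
  refine ⟨?_, ?_, ?_, ?_⟩
  · intro u hu hall
    obtain ⟨c, hc⟩ := m.anchor.nonempty
    have h1 : aDist U N C u < N := by
      have h1 := m.anchor.aDist_le (u := u) hc
      have h2 := hall c (m.anchor.lt c hc) hc
      omega
    refine hmax u (m.mem u hu h1) fun c hc hcu => ?_
    exact ((capDist_le_one hN).mp (hall c (m.anchor.lt c hc) hc)).resolve_left hcu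
  · intro u hu hlt z hz
    have hX := (m.anchor.aLab_lt hu).mp hlt
    have e := hlab u hu hlt
    constructor
    · intro hn
      rw [m.nearZ_iff hz hlt (hlabX u hu hlt) hn.1, e]
      exact (m.nearZ_iff hz hu hX hn.1).mp hn
    · intro hn
      rw [m.nearZ_iff hz hu hX hn.1, ← e]
      exact (m.nearZ_iff hz hlt (hlabX u hu hlt) hn.1).mp hn
  · intro u hu w hw hlt he hk y hy
    have hX := (m.anchor.aLab_lt hu).mp hlt
    have hX' := (m.anchor.aLab_lt hw).mp (he ▸ hlt)
    have h1 := hlab u hu hlt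
    have h2 := hlab w hw (he ▸ hlt)
    rw [capDist_le_one hN, capDist_le_one hN]
    exact m.twins hu hw hX hX' (by rw [← h1, ← h2, he]) hk y
  · have hroot : ∀ z ∈ aRoots U N C, z < N ∧ inX U N C z ∧ aDist U N C z = 1 ∧
        ∃ u < N, aLab U N C u = z ∧ inX U N C u := by
      intro z hz
      simp only [aRoots, Finset.mem_filter, Finset.mem_range] at hz
      obtain ⟨hz, u, hu, rfl⟩ := hz
      exact ⟨hz, hlabX u hu hz, (aLab_near hz).1, u, hu, rfl,
        (m.anchor.aLab_lt hu).mp hz⟩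
    -- Two representatives on the same ray are candidates for each other's labels. As labels are
    -- least candidates, they coincide, and there are at most d representatives.
    have hinj : Set.InjOn ray (aRoots U N C) := by
      intro z hz z' hz' e
      obtain ⟨hzN, hzX, hz1, u, hu, hul, huX⟩ := hroot z hz
      obtain ⟨hzN', hzX', hz1', u', hu', hul', huX'⟩ := hroot z' hz'
      have r1 := hlab u hu (by omega)
      have r2 := hlab u' hu' (by omega)
      have l1 := aLab_le huX hzN' ((m.nearZ_iff hzN' hu huX hz1').mpr (by
        rw [← r1, hul, e]))
      have l2 := aLab_le huX' hzN ((m.nearZ_iff hzN hu' huX' hz1).mpr (by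
        rw [← r2, hul', e]))
      omega
    have : (aRoots U N C).card ≤ (Finset.range d).card := by
      refine Finset.card_le_card_of_injOn ray ?_ hinj
      intro z hz
      obtain ⟨hzN, hzX, -⟩ := hroot z hz
      obtain ⟨hzA, hzC⟩ := m.inX_iff hzN hzX
      simpa using m.model.ray_lt z hzA hzC
    simpa [aR] using this

end Model

end

end StarIso

namespace StarIso

open WordRAM Classical

noncomputable section

/-! ### Partial isomorphisms -/

/-- A set of vertices without edges to its complement. -/
def ClosedSet (U : SimpleGraph ℕ) (S : Set ℕ) : Prop := ∀ u ∈ S, ∀ w, U.Adj u w → w ∈ S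

/-- `f` restricts to an isomorphism between the subgraphs induced by two sets. -/
structure IsoOn (U : SimpleGraph ℕ) (f : ℕ → ℕ) (S S' : Set ℕ) : Prop where
  bij : Set.BijOn f S S'
  adj : ∀ u ∈ S, ∀ w ∈ S, (U.Adj (f u) (f w) ↔ U.Adj u w)

variable {U : SimpleGraph ℕ} {N : ℕ} {f : ℕ → ℕ} {S S' C C' : Set ℕ}

theorem ClosedSet.mem_of_reachable (hS : ClosedSet U S) {u w : ℕ} (hu : u ∈ S)
    (h : U.Reachable u w) : w ∈ S := by
  rw [SimpleGraph.reachable_iff_reflTransGen] at h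
  induction h with
  | refl => exact hu
  | tail _ h ih => exact hS _ ih _ h

theorem closedSet_reachable (U : SimpleGraph ℕ) (a : ℕ) : ClosedSet U {u | U.Reachable a u} :=
  fun _ hu _ h => hu.trans h.reachable

theorem IsoOn.exists_symm (h : IsoOn U f S S') :
    ∃ g, IsoOn U g S' S ∧ (∀ u ∈ S, g (f u) = u) ∧ ∀ w ∈ S', f (g w) = w := by
  have hinv := h.bij.invOn_invFunOn
  refine ⟨Function.invFunOn f S, ⟨?_, ?_⟩, hinv.1, hinv.2⟩
  · exact hinv.symm.bijOn h.bij.surjOn.mapsTo_invFunOn h.bij.mapsTo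
  · intro u hu w hw
    rw [← h.adj _ (h.bij.surjOn.mapsTo_invFunOn hu) _ (h.bij.surjOn.mapsTo_invFunOn hw),
      hinv.2 hu, hinv.2 hw]

theorem IsoOn.exists_walk (h : IsoOn U f S S') (hS : ClosedSet U S) {u w : ℕ} (p : U.Walk u w)
    (hu : u ∈ S) : ∃ q : U.Walk (f u) (f w), q.length = p.length := by
  induction p with
  | nil => exact ⟨.nil, rfl⟩
  | cons hadj p ih =>
    have hx := hS _ hu _ hadj
    obtain ⟨q, hq⟩ := ih hx
    exact ⟨.cons ((h.adj _ hu _ hx).mpr hadj) q, by simp [hq]⟩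

theorem IsoOn.capDist_le (h : IsoOn U f S S') (hU : Below U N) (hS : ClosedSet U S) {u w : ℕ}
    (hu : u ∈ S) (hw : f w < N) : capDist U N (f u) (f w) ≤ capDist U N u w := by
  by_cases hr : U.Reachable u w
  · obtain ⟨p, hp⟩ := hr.exists_walk_length_eq_dist
    obtain ⟨q, hq⟩ := h.exists_walk hS p hu
    have := capDist_le_length (N := N) q
    rw [hq, hp] at this
    simpa [capDist, hr] using this
  · have := hU.capDist_le (u := f u) hw
    simpa [capDist, hr] using this

/-- An isomorphism between unions of components which maps one anchor to another. -/
structure AnchorIso (U : SimpleGraph ℕ) (N : ℕ) (f : ℕ → ℕ) (S S' C C' : Set ℕ) : Prop where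
  anchor : Anchor U N C
  anchor' : Anchor U N C'
  iso : IsoOn U f S S'
  closed : ClosedSet U S
  closed' : ClosedSet U S'
  lt : ∀ u ∈ S, u < N
  lt' : ∀ u ∈ S', u < N
  sub : C ⊆ S
  image : Set.image f C = C'

section AnchorIso

theorem AnchorIso.exists_symm (h : AnchorIso U N f S S' C C') :
    ∃ g, AnchorIso U N g S' S C' C ∧ (∀ u ∈ S, g (f u) = u) ∧ ∀ w ∈ S', f (g w) = w := by
  obtain ⟨g, hg, h1, h2⟩ := h.iso.exists_symm
  refine ⟨g, ⟨h.anchor', h.anchor, hg, h.closed', h.closed, h.lt', h.lt, ?_, ?_⟩, h1, h2⟩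
  · rw [← h.image]
    exact Set.image_subset_iff.mpr fun u hu => h.iso.bij.mapsTo (h.sub hu)
  · rw [← h.image, Set.image_image]
    ext u
    constructor
    · rintro ⟨c, hc, rfl⟩
      change g (f c) ∈ C
      rw [h1 c (h.sub hc)]; exact hc
    · intro hu
      exact ⟨u, hu, h1 u (h.sub hu)⟩

theorem AnchorIso.maps (h : AnchorIso U N f S S' C C') {u : ℕ} (hu : u ∈ S) : f u ∈ S' :=
  h.iso.bij.mapsTo hu

/-- Walks starting in a closed set stay in it, so f and its inverse both map walks to walks of equal
length. Whatever is computed from distances and adjacency is then preserved; labels, indices and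
positions are not, because they also depend on the numbering of vertices. -/
theorem AnchorIso.capDist_eq (h : AnchorIso U N f S S' C C') {u w : ℕ} (hu : u ∈ S)
    (hw : w ∈ S) : capDist U N (f u) (f w) = capDist U N u w := by
  obtain ⟨g, hg, h1, h2⟩ := h.exists_symm
  refine le_antisymm (h.iso.capDist_le h.anchor.below h.closed hu (h.lt' _ (h.maps hw))) ?_
  have := hg.iso.capDist_le h.anchor.below h.closed' (h.maps hu) (w := f w)
    (by rw [h1 w hw]; exact h.lt w hw)
  rwa [h1 u hu, h1 w hw] at this

theorem AnchorIso.aDist_le (h : AnchorIso U N f S S' C C') {u : ℕ} (hu : u ∈ S) :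
    aDist U N C' (f u) ≤ aDist U N C u := by
  by_cases hlt : aDist U N C u < N
  · obtain ⟨c, hc, h1⟩ := aDist_spec hlt
    rw [← h1, ← h.capDist_eq (h.sub hc) hu]
    exact h.anchor'.aDist_le (by rw [← h.image]; exact ⟨c, hc, rfl⟩)
  · exact (minTo_le_top _ _ _).trans (not_lt.mp hlt)

theorem AnchorIso.aDist_eq (h : AnchorIso U N f S S' C C') {u : ℕ} (hu : u ∈ S) :
    aDist U N C' (f u) = aDist U N C u := by
  obtain ⟨g, hg, h1, h2⟩ := h.exists_symm
  refine le_antisymm (h.aDist_le hu) ?_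
  have := hg.aDist_le (h.maps hu)
  rwa [h1 u hu] at this

theorem AnchorIso.inX_iff (h : AnchorIso U N f S S' C C') {u : ℕ} (hu : u ∈ S) :
    inX U N C' (f u) ↔ inX U N C u := by
  simp only [inX, h.aDist_eq hu]

theorem AnchorIso.nearZ_iff (h : AnchorIso U N f S S' C C') {u z : ℕ} (hu : u ∈ S)
    (hz : z ∈ S) : nearZ U N C' (f z) (f u) ↔ nearZ U N C z u := by
  simp only [nearZ, h.aDist_eq hu, h.aDist_eq hz, h.capDist_eq hz hu]

theorem AnchorIso.mem_of_aDist_lt (h : AnchorIso U N f S S' C C') {u : ℕ} (hu : u < N)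
    (hx : aDist U N C u < N) : u ∈ S := by
  obtain ⟨c, hc⟩ := h.anchor.nonempty
  exact h.closed.mem_of_reachable (h.sub hc) ((h.anchor.aDist_lt_iff hc hu).mp hx)

theorem AnchorIso.mem_of_near (h : AnchorIso U N f S S' C C') {u z : ℕ} (hu : u < N)
    (hx : inX U N C u) (hz : nearZ U N C z u) : z ∈ S := by
  have hr := (h.anchor.below.capDist_lt hu).mp (hz.2.trans_lt hx.2)
  exact h.closed.mem_of_reachable (h.mem_of_aDist_lt hu hx.2) hr.symm

/-- Cardinalities of corresponding sets agree. -/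
theorem AnchorIso.card_eq (h : AnchorIso U N f S S' C C') {p q : ℕ → Prop}
    [DecidablePred p] [DecidablePred q]
    (hp : ∀ w < N, p w → w ∈ S) (hq : ∀ w < N, q w → w ∈ S') (hpq : ∀ w ∈ S, q (f w) ↔ p w) :
    ((Finset.range N).filter q).card = ((Finset.range N).filter p).card := by
  refine (Finset.card_bij (fun w _ => f w) ?_ ?_ ?_).symm
  · intro w hw
    simp only [Finset.mem_filter, Finset.mem_range] at hw ⊢
    have hwS := hp w hw.1 hw.2
    exact ⟨h.lt' _ (h.maps hwS), (hpq w hwS).mpr hw.2⟩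
  · intro w hw w' hw' e
    simp only [Finset.mem_filter, Finset.mem_range] at hw hw'
    exact h.iso.bij.injOn (hp w hw.1 hw.2) (hp w' hw'.1 hw'.2) e
  · intro w hw
    simp only [Finset.mem_filter, Finset.mem_range] at hw
    obtain ⟨x, hx, rfl⟩ := h.iso.bij.surjOn (hq w hw.1 hw.2)
    exact ⟨x, by simp [h.lt x hx, (hpq x hx).mp hw.2], rfl⟩

theorem AnchorIso.aKey_eq (h : AnchorIso U N f S S' C C') {u : ℕ} (hu : u ∈ S) :
    aKey U N C' (f u) = aKey U N C u := by
  have h1 : aUp U N C' (f u) = aUp U N C u := by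
    refine h.card_eq (fun w _ hw => ?_) (fun w _ hw => ?_) fun w hw => ?_
    · exact h.closed _ hu _ hw.1.symm
    · exact h.closed' _ (h.maps hu) _ hw.1.symm
    rw [h.iso.adj w hw u hu, h.aDist_eq hu, h.aDist_eq hw]
  have h2 : aDown U N C' (f u) = aDown U N C u := by
    refine h.card_eq (fun w _ hw => ?_) (fun w _ hw => ?_) fun w hw => ?_
    · exact h.closed _ hu _ hw.1.symm
    · exact h.closed' _ (h.maps hu) _ hw.1.symm
    rw [h.iso.adj w hw u hu, h.aDist_eq hu, h.aDist_eq hw]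
  simp only [aKey, h1, h2, h.aDist_eq hu]

/-- The relation of being on the same ray is transitive. -/
def RayClosed (U : SimpleGraph ℕ) (N : ℕ) (C : Set ℕ) : Prop :=
  ∀ u < N, inX U N C u → ∀ z < N, nearZ U N C z u →
    ∀ y < N, (nearZ U N C y u ↔ nearZ U N C y z)

theorem nearZ_symm {y z : ℕ} (hz : aDist U N C z = 1) (h : nearZ U N C y z) :
    nearZ U N C z y := ⟨hz, by rw [capDist_comm, h.1, ← hz]; exact h.2⟩

/-- A good anchor only compares each vertex with its own label. If z is near u, then the labels of u
and z turn out to be candidates for each other's vertex, so by minimality they are equal, and both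
vertices have the same near vertices as this common label. -/
theorem Good.rayClosed {d : ℕ} (h : Anchor U N C) (hg : Good U N C d) : RayClosed U N C := by
  have hN := h.two
  intro u hu huX z hz hzu y hy
  have hlu := (h.aLab_lt hu).mpr huX
  have hzX : inX U N C z := ⟨by have := hzu.1; omega, by have := hzu.1; omega⟩
  have hlz := (h.aLab_lt hz).mpr hzX
  set c := aLab U N C u with hc
  set c' := aLab U N C z with hc'
  have hcu : nearZ U N C c u := aLab_near hlu
  have hc'z : nearZ U N C c' z := aLab_near hlz
  have h1 := hg.near u hu hlu
  have h2 := hg.near z hz hlz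
  -- `c` and `c'` are near each other
  have hzc : nearZ U N C z c := (h1 z hz).mp hzu
  have hcz : nearZ U N C c z := nearZ_symm hcu.1 hzc
  have hle : c' ≤ c := aLab_le hzX hlu hcz
  have hcc' : nearZ U N C c c' := (h2 c hlu).mp hcz
  have hc'c : nearZ U N C c' c := nearZ_symm hc'z.1 hcc'
  have hle' : c ≤ c' := aLab_le huX hlz ((h1 c' hlz).mpr hc'c)
  have e : c = c' := le_antisymm hle' hle
  rw [h1 y hy, h2 y hy, ← hc, ← hc', e]

theorem AnchorIso.rayClosed (h : AnchorIso U N f S S' C C') (hz : RayClosed U N C) :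
    RayClosed U N C' := by
  obtain ⟨g, hg, h1, h2⟩ := h.exists_symm
  intro u hu huX z hzN hzu y hy
  have huS := hg.mem_of_aDist_lt hu huX.2
  have hzS := hg.mem_of_near hu huX hzu
  have guX := (hg.inX_iff huS).mpr huX
  have gzu := (hg.nearZ_iff huS hzS).mpr hzu
  have glt := fun w hw => h.lt _ (hg.maps (u := w) hw)
  have hzX : inX U N C' z := ⟨by have := hzu.1; omega, by
    have := hzu.1; have := h.anchor.two; omega⟩
  by_cases hyS : y ∈ S'
  · rw [← hg.nearZ_iff huS hyS, ← hg.nearZ_iff hzS hyS]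
    exact hz _ (glt u huS) guX _ (glt z hzS) gzu _ (glt y hyS)
  · exact ⟨fun h => absurd (hg.mem_of_near hu huX h) hyS,
      fun h => absurd (hg.mem_of_near hzN hzX h) hyS⟩

/-- A label is a least vertex number and is not invariant under isomorphism. Equality of labels is,
because it amounts to having a common near vertex. -/
theorem RayClosed.aLab_eq_iff (h : Anchor U N C) (hz : RayClosed U N C) {u w : ℕ} (hu : u < N)
    (hw : w < N) (huX : inX U N C u) (hwX : inX U N C w) :
    aLab U N C u = aLab U N C w ↔ ∃ z < N, nearZ U N C z u ∧ nearZ U N C z w := by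
  constructor
  · intro e
    have h1 := (h.aLab_lt hu).mpr huX
    exact ⟨_, h1, aLab_near h1, e ▸ aLab_near (e ▸ h1)⟩
  · rintro ⟨z, hzN, hzu, hzw⟩
    simp only [aLab, huX, hwX, if_true]
    refine minTo_congr fun y hy => ?_
    rw [hz u hu huX z hzN hzu y hy, hz w hw hwX z hzN hzw y hy]

theorem AnchorIso.aLab_eq_iff (h : AnchorIso U N f S S' C C') (hz : RayClosed U N C) {u w : ℕ}
    (hu : u ∈ S) (hw : w ∈ S) (huX : inX U N C u) (hwX : inX U N C w) :
    aLab U N C' (f u) = aLab U N C' (f w) ↔ aLab U N C u = aLab U N C w := by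
  rw [hz.aLab_eq_iff h.anchor (h.lt u hu) (h.lt w hw) huX hwX,
    (h.rayClosed hz).aLab_eq_iff h.anchor' (h.lt' _ (h.maps hu)) (h.lt' _ (h.maps hw))
      ((h.inX_iff hu).mpr huX) ((h.inX_iff hw).mpr hwX)]
  constructor
  · rintro ⟨z, hzN, h1, h2⟩
    obtain ⟨g, hg, g1, g2⟩ := h.exists_symm
    have hzS := hg.mem_of_near (h.lt' _ (h.maps hu)) ((h.inX_iff hu).mpr huX) h1
    obtain ⟨y, hy, rfl⟩ := h.iso.bij.surjOn hzS
    exact ⟨y, h.lt y hy, (h.nearZ_iff hu hy).mp h1, (h.nearZ_iff hw hy).mp h2⟩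
  · rintro ⟨z, hzN, h1, h2⟩
    have hzS := h.mem_of_near (h.lt u hu) huX h1
    exact ⟨f z, h.lt' _ (h.maps hzS), (h.nearZ_iff hu hzS).mpr h1, (h.nearZ_iff hw hzS).mpr h2⟩

end AnchorIso

/-! ### Ranks -/

section Rank

variable {β : Type*} [LinearOrder β] {K : Finset ℕ} {o : ℕ → β}

theorem rank_lt_rank {x y : ℕ} (hx : x ∈ K) (h : o x < o y) :
    (K.filter fun w => o w < o x).card < (K.filter fun w => o w < o y).card := by
  refine Finset.card_lt_card ⟨fun w hw => ?_, fun hsub => ?_⟩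
  · simp only [Finset.mem_filter] at hw ⊢
    exact ⟨hw.1, hw.2.trans h⟩
  · have := hsub (Finset.mem_filter.mpr ⟨hx, h⟩)
    simp at this

theorem rank_inj (ho : Set.InjOn o K) {x y : ℕ} (hx : x ∈ K) (hy : y ∈ K)
    (h : (K.filter fun w => o w < o x).card = (K.filter fun w => o w < o y).card) : x = y := by
  rcases lt_trichotomy (o x) (o y) with h1 | h1 | h1
  · have := rank_lt_rank hx h1; omega
  · exact ho hx hy h1
  · have := rank_lt_rank hy h1; omega

theorem rank_lt {x : ℕ} (hx : x ∈ K) : (K.filter fun w => o w < o x).card < K.card :=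
  Finset.card_lt_card ⟨Finset.filter_subset _ _, fun hsub => by
    have := hsub hx
    simp at this⟩

theorem exists_rank (ho : Set.InjOn o K) {i : ℕ} (hi : i < K.card) :
    ∃ x ∈ K, (K.filter fun w => o w < o x).card = i := by
  have := Finset.surjOn_of_injOn_of_card_le (s := K) (t := Finset.range K.card)
    (fun x => (K.filter fun w => o w < o x).card)
    (fun x hx => by simpa using rank_lt hx) (fun x hx y hy h => rank_inj ho hx hy h) (by simp)
  exact this (by simpa using hi)

end Rank

theorem mem_aRoots {u : ℕ} (hu : u < N) (h : aLab U N C u < N) :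
    aLab U N C u ∈ aRoots U N C := by
  simp only [aRoots, Finset.mem_filter, Finset.mem_range]
  exact ⟨h, u, hu, rfl⟩

theorem aIdx_lt {u : ℕ} (hu : u < N) (h : aLab U N C u < N) : aIdx U N C u < aR U N C :=
  rank_lt (o := id) (mem_aRoots hu h)

theorem aIdx_eq_iff {u w : ℕ} (hu : u < N) (hw : w < N) (h : aLab U N C u < N)
    (h' : aLab U N C w < N) : aIdx U N C u = aIdx U N C w ↔ aLab U N C u = aLab U N C w :=
  ⟨fun e => rank_inj (o := id) (Set.injOn_id _) (mem_aRoots hu h) (mem_aRoots hw h') e,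
    fun e => by simp only [aIdx, e]⟩

theorem exists_aIdx {i : ℕ} (hi : i < aR U N C) :
    ∃ u < N, aLab U N C u < N ∧ aIdx U N C u = i := by
  obtain ⟨z, hz, h1⟩ := exists_rank (o := id) (Set.injOn_id _) hi
  simp only [aRoots, Finset.mem_filter, Finset.mem_range] at hz
  obtain ⟨hz, u, hu, rfl⟩ := hz
  exact ⟨u, hu, hz, h1⟩

/-- The vertices on the ray of `u`. -/
def aClass (U : SimpleGraph ℕ) (N : ℕ) (C : Set ℕ) (u : ℕ) : Finset ℕ :=
  (Finset.range N).filter fun w => aLab U N C w = aLab U N C u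

/-- Positions are ranks for the lexicographic order of key and vertex number. Breaking ties by
number is arbitrary, which does no harm since on a good anchor tied vertices are twins. -/
theorem aPos_eq (u : ℕ) : aPos U N C u = ((aClass U N C u).filter fun w =>
    toLex (aKey U N C w, w) < toLex (aKey U N C u, u)).card := by
  simp only [aPos, aClass, Finset.filter_filter, Prod.Lex.toLex_lt_toLex]

theorem toLex_injOn (K : Finset ℕ) : Set.InjOn (fun w => toLex (aKey U N C w, w)) K :=
  fun _ _ _ _ e => (Prod.ext_iff.mp (toLex.injective e)).2

theorem aPos_inj {u w : ℕ} (hu : u < N) (hw : w < N) (hl : aLab U N C u = aLab U N C w)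
    (hp : aPos U N C u = aPos U N C w) : u = w := by
  have hc : aClass U N C w = aClass U N C u := by simp only [aClass, hl]
  rw [aPos_eq, aPos_eq, hc] at hp
  refine rank_inj (o := fun w => toLex (aKey U N C w, w)) (toLex_injOn _) ?_ ?_ hp
  · simp [aClass, hu]
  · simp [aClass, hw, hl]

/-- Each ray number is sent to that of the image of a chosen vertex of the ray. Invariance of label
equality shows that the choice does not matter and that distinct rays have distinct images. -/
theorem AnchorIso.aR_le (h : AnchorIso U N f S S' C C') (hz : RayClosed U N C) :
    ∃ τ : Fin (aR U N C) → Fin (aR U N C'), Function.Injective τ ∧ ∀ u < N,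
      ∀ hl : aIdx U N C u < aR U N C, aLab U N C u < N → (τ ⟨_, hl⟩ : ℕ) = aIdx U N C' (f u) := by
  have hch : ∀ i : Fin (aR U N C), ∃ u, u < N ∧ aLab U N C u < N ∧ aIdx U N C u = i := by
    intro i
    obtain ⟨u, h1, h2, h3⟩ := exists_aIdx i.isLt
    exact ⟨u, h1, h2, h3⟩
  choose w hw hwl hwi using hch
  have hX : ∀ u < N, aLab U N C u < N → u ∈ S ∧ inX U N C u ∧ f u < N ∧
      aLab U N C' (f u) < N := by
    intro u hu hl
    have h1 := (h.anchor.aLab_lt hu).mp hl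
    have h2 := h.mem_of_aDist_lt hu h1.2
    have h3 := h.lt' _ (h.maps h2)
    exact ⟨h2, h1, h3, (h.anchor'.aLab_lt h3).mpr ((h.inX_iff h2).mpr h1)⟩
  refine ⟨fun i => ⟨aIdx U N C' (f (w i)), ?_⟩, ?_, ?_⟩
  · obtain ⟨h1, h2, h3, h4⟩ := hX _ (hw i) (hwl i)
    exact aIdx_lt h3 h4
  · intro i j e
    obtain ⟨h1, h2, h3, h4⟩ := hX _ (hw i) (hwl i)
    obtain ⟨g1, g2, g3, g4⟩ := hX _ (hw j) (hwl j)
    have e' := congrArg Fin.val e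
    dsimp only at e'
    rw [aIdx_eq_iff h3 g3 h4 g4, h.aLab_eq_iff hz h1 g1 h2 g2,
      ← aIdx_eq_iff (hw i) (hw j) (hwl i) (hwl j), hwi, hwi] at e'
    exact Fin.ext e'
  · intro u hu hl hlab
    obtain ⟨h1, h2, h3, h4⟩ := hX _ (hw ⟨_, hl⟩) (hwl ⟨_, hl⟩)
    obtain ⟨g1, g2, g3, g4⟩ := hX u hu hlab
    dsimp only
    rw [aIdx_eq_iff h3 g3 h4 g4, h.aLab_eq_iff hz h1 g1 h2 g2,
      ← aIdx_eq_iff (hw _) hu (hwl _) hlab, hwi]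

/-- The permutation of the rays induced by an isomorphism. -/
theorem AnchorIso.exists_perm (h : AnchorIso U N f S S' C C') (hz : RayClosed U N C) :
    aR U N C = aR U N C' ∧ ∃ σ : Equiv.Perm ℕ, (∀ i, aR U N C ≤ i → σ i = i) ∧
      ∀ u < N, aLab U N C u < N → σ (aIdx U N C u) = aIdx U N C' (f u) := by
  obtain ⟨τ, hτ, h1⟩ := h.aR_le hz
  obtain ⟨g, hg, -, -⟩ := h.exists_symm
  obtain ⟨τ', hτ', -⟩ := hg.aR_le (h.rayClosed hz)
  have e1 := Fintype.card_le_of_injective τ hτ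
  have e2 := Fintype.card_le_of_injective τ' hτ'
  simp only [Fintype.card_fin] at e1 e2
  have e : aR U N C = aR U N C' := le_antisymm e1 e2
  refine ⟨e, ?_⟩
  let ρ : Fin (aR U N C) → Fin (aR U N C) := fun i => Fin.cast e.symm (τ i)
  have hρ : Function.Injective ρ := fun i j hij => hτ (Fin.cast_injective _ hij)
  let s : Equiv.Perm (Fin (aR U N C)) := Equiv.ofBijective ρ (Finite.injective_iff_bijective.mp hρ)
  refine ⟨s.extendDomain Fin.equivSubtype, fun i hi => ?_, fun u hu hl => ?_⟩
  · exact Equiv.Perm.extendDomain_apply_not_subtype _ _ (by omega)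
  · have hlt := aIdx_lt hu hl
    have := Equiv.Perm.extendDomain_apply_image s Fin.equivSubtype ⟨aIdx U N C u, hlt⟩
    have h2 := h1 u hu hlt hl
    simp only [Fin.equivSubtype_apply] at this
    rw [this, ← h2]
    rfl

/-- The candidates for the image of `x` under a permutation of the rays. -/
def Matches (U : SimpleGraph ℕ) (N : ℕ) (C C' : Set ℕ) (σ : ℕ → ℕ) (x y : ℕ) : Prop :=
  aLab U N C' y < N ∧ aIdx U N C' y = σ (aIdx U N C x) ∧ aPos U N C' y = aPos U N C x

/-- The keys on a ray and on its image form the same multiset. This is what compares positions on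
the two sides. -/
theorem AnchorIso.card_class (h : AnchorIso U N f S S' C C') (hz : RayClosed U N C) {x : ℕ}
    (hx : x < N) (hl : aLab U N C x < N) (p : ℕ → Prop) [DecidablePred p] :
    ((aClass U N C' (f x)).filter fun w => p (aKey U N C' w)).card =
      ((aClass U N C x).filter fun w => p (aKey U N C w)).card := by
  have hxX := (h.anchor.aLab_lt hx).mp hl
  have hxS := h.mem_of_aDist_lt hx hxX.2
  have hfx := h.lt' _ (h.maps hxS)
  have hl' := (h.anchor'.aLab_lt hfx).mpr ((h.inX_iff hxS).mpr hxX)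
  obtain ⟨g, hg, g1, g2⟩ := h.exists_symm
  simp only [aClass, Finset.filter_filter]
  refine h.card_eq (fun w hw hp => ?_) (fun w hw hp => ?_) fun w hw => ?_
  · exact h.mem_of_aDist_lt hw ((h.anchor.aLab_lt hw).mp (hp.1 ▸ hl)).2
  · exact hg.mem_of_aDist_lt hw ((h.anchor'.aLab_lt hw).mp (hp.1 ▸ hl')).2
  · rw [h.aKey_eq hw]
    refine and_congr_left fun _ => ?_
    by_cases hwX : inX U N C w
    · exact h.aLab_eq_iff hz hw hxS hwX hxX
    · have e1 : aLab U N C w = N := by simp [aLab, hwX]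
      have e2 : aLab U N C' (f w) = N := by simp [aLab, h.inX_iff hw, hwX]
      rw [e1, e2]
      omega

/-- The vertex at the position of x on the image ray need not be f x, but it has the same key: it is
f w for some w that is tied with x on the same ray. -/
theorem AnchorIso.matches_spec (h : AnchorIso U N f S S' C C') (hz : RayClosed U N C)
    {σ : ℕ → ℕ} (hσ : ∀ u < N, aLab U N C u < N → σ (aIdx U N C u) = aIdx U N C' (f u)) {x : ℕ}
    (hx : x < N) (hl : aLab U N C x < N) :
    (∃ y < N, Matches U N C C' σ x y) ∧ ∀ y < N, Matches U N C C' σ x y →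
      ∃ w ∈ S, f w = y ∧ aLab U N C w = aLab U N C x ∧ aKey U N C w = aKey U N C x := by
  have hxX := (h.anchor.aLab_lt hx).mp hl
  have hxS := h.mem_of_aDist_lt hx hxX.2
  have hfx := h.lt' _ (h.maps hxS)
  have hl' := (h.anchor'.aLab_lt hfx).mpr ((h.inX_iff hxS).mpr hxX)
  have hcard := h.card_class hz hx hl
  have hxc : x ∈ aClass U N C x := by simp [aClass, hx]
  constructor
  · have hlt : aPos U N C x < (aClass U N C' (f x)).card := by
      have h1 := hcard fun _ => True
      simp only [Finset.filter_true] at h1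
      rw [h1, aPos_eq]
      exact rank_lt (o := fun w => toLex (aKey U N C w, w)) hxc
    obtain ⟨y, hy, hyp⟩ := exists_rank (o := fun w => toLex (aKey U N C' w, w)) (toLex_injOn _) hlt
    have hyc : aClass U N C' (f x) = aClass U N C' y := by
      simp only [aClass, Finset.mem_filter] at hy ⊢
      rw [hy.2]
    rw [hyc, ← aPos_eq] at hyp
    simp only [aClass, Finset.mem_filter, Finset.mem_range] at hy
    refine ⟨y, hy.1, hy.2 ▸ hl', ?_, hyp⟩
    rw [hσ x hx hl]
    exact (aIdx_eq_iff hy.1 hfx (hy.2 ▸ hl') hl').mpr hy.2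
  · rintro y hyN ⟨hyl, hyi, hyp⟩
    obtain ⟨g, hg, g1, g2⟩ := h.exists_symm
    have hyX := (h.anchor'.aLab_lt hyN).mp hyl
    have hyS := hg.mem_of_aDist_lt hyN hyX.2
    rw [hσ x hx hl, aIdx_eq_iff hyN hfx hyl hl'] at hyi
    obtain ⟨w, hw, rfl⟩ := h.iso.bij.surjOn hyS
    have hwX := (h.inX_iff hw).mp hyX
    refine ⟨w, hw, rfl, (h.aLab_eq_iff hz hw hxS hwX hxX).mp hyi, ?_⟩
    have hyc : aClass U N C' (f w) = aClass U N C' (f x) := by simp only [aClass, hyi]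
    have hym : f w ∈ aClass U N C' (f x) := by simp [aClass, hyN, hyi]
    rw [aPos_eq, aPos_eq, hyc] at hyp
    rw [← h.aKey_eq hw]
    -- If the key of f w were smaller, then all vertices with key at most this one would precede x.
    -- Their number exceeds the position of f w, because f w is among them but does not precede
    -- itself. So the positions would differ; the opposite case is symmetric.
    rcases lt_trichotomy (aKey U N C' (f w)) (aKey U N C x) with hlt | he | hlt
    · have h1 := hcard (fun k => k ≤ aKey U N C' (f w))
      have h2 : ((aClass U N C' (f x)).filter fun v =>
          toLex (aKey U N C' v, v) < toLex (aKey U N C' (f w), f w)).card <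
          ((aClass U N C' (f x)).filter fun v => aKey U N C' v ≤ aKey U N C' (f w)).card := by
        refine Finset.card_lt_card ⟨fun v hv => ?_, fun hsub => ?_⟩
        · simp only [Finset.mem_filter, Prod.Lex.toLex_lt_toLex] at hv ⊢
          exact ⟨hv.1, by omega⟩
        · have := hsub (Finset.mem_filter.mpr ⟨hym, le_rfl⟩)
          simp at this
      have h3 : ((aClass U N C x).filter fun v => aKey U N C v ≤ aKey U N C' (f w)).card ≤
          ((aClass U N C x).filter fun v =>
          toLex (aKey U N C v, v) < toLex (aKey U N C x, x)).card := by
        refine Finset.card_le_card fun v hv => ?_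
        simp only [Finset.mem_filter, Prod.Lex.toLex_lt_toLex] at hv ⊢
        exact ⟨hv.1, by omega⟩
      omega
    · exact he
    · have h1 := hcard (fun k => k ≤ aKey U N C x)
      have h2 : ((aClass U N C x).filter fun v =>
          toLex (aKey U N C v, v) < toLex (aKey U N C x, x)).card <
          ((aClass U N C x).filter fun v => aKey U N C v ≤ aKey U N C x).card := by
        refine Finset.card_lt_card ⟨fun v hv => ?_, fun hsub => ?_⟩
        · simp only [Finset.mem_filter, Prod.Lex.toLex_lt_toLex] at hv ⊢
          exact ⟨hv.1, by omega⟩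
        · have := hsub (Finset.mem_filter.mpr ⟨hxc, le_rfl⟩)
          simp at this
      have h3 : ((aClass U N C' (f x)).filter fun v => aKey U N C' v ≤ aKey U N C x).card ≤
          ((aClass U N C' (f x)).filter fun v =>
          toLex (aKey U N C' v, v) < toLex (aKey U N C' (f w), f w)).card := by
        refine Finset.card_le_card fun v hv => ?_
        simp only [Finset.mem_filter, Prod.Lex.toLex_lt_toLex] at hv ⊢
        exact ⟨hv.1, by omega⟩
      omega

end

end StarIso

namespace StarIso

open WordRAM Classical

noncomputable section

variable {U : SimpleGraph ℕ} {N : ℕ} {f : ℕ → ℕ} {S S' C C' : Set ℕ}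

/-! ### Matching two anchors along a permutation of the rays -/

/-- The vertex to which `x` is matched, or `N`. -/
def mate (U : SimpleGraph ℕ) (N : ℕ) (C C' : Set ℕ) (σ : ℕ → ℕ) (x : ℕ) : ℕ :=
  minTo N (fun y => if Matches U N C C' σ x y then y else N) N

/-- Adjacency as a number. -/
def adjN (U : SimpleGraph ℕ) (u w : ℕ) : ℕ := if U.Adj u w then 1 else 0

/-- Adjacency to `x` or to its mate. -/
def bit (U : SimpleGraph ℕ) (N : ℕ) (C D : Set ℕ) (σ : ℕ → ℕ) (v x : ℕ) : ℕ :=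
  adjN U v x + adjN U v (mate U N C D σ x)

/-- The adjacencies of `v` to all matched pairs. -/
def colour (U : SimpleGraph ℕ) (N : ℕ) (C C' : Set ℕ) (σ : ℕ → ℕ) (v x : ℕ) : ℕ :=
  if x < N ∧ aLab U N C x < N then bit U N C C' σ v x else 0

/-- The matching along `σ` extends to an isomorphism. -/
structure Leaf (U : SimpleGraph ℕ) (N : ℕ) (C C' : Set ℕ) (σ : ℕ → ℕ) : Prop where
  lt : ∀ x < N, aLab U N C x < N → mate U N C C' σ x < N
  adj : ∀ x < N, ∀ w < N, aLab U N C x < N → aLab U N C w < N →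
    adjN U x w = adjN U (mate U N C C' σ x) (mate U N C C' σ w)
  count : ∀ v < N, v ∈ C →
    ((Finset.range N).filter fun w => w ∈ C ∧ colour U N C C' σ w = colour U N C C' σ v).card =
    ((Finset.range N).filter fun w => w ∈ C' ∧ colour U N C C' σ w = colour U N C C' σ v).card

theorem mate_spec {σ : ℕ → ℕ} {x : ℕ} (h : mate U N C C' σ x < N) :
    Matches U N C C' σ x (mate U N C C' σ x) := by
  rcases minTo_eq_top_or N (fun y => if Matches U N C C' σ x y then y else N) N with h1 | ⟨y, _, h1⟩
  · unfold mate at h; omega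
  · by_cases hm : Matches U N C C' σ x y
    · simp only [hm, if_true] at h1
      rw [mate, h1]; exact hm
    · simp only [hm, if_false] at h1
      unfold mate at h; omega

theorem mate_lt {σ : ℕ → ℕ} {x y : ℕ} (hy : y < N) (h : Matches U N C C' σ x y) :
    mate U N C C' σ x < N := by
  have := minTo_le (M := N) (f := fun y => if Matches U N C C' σ x y then y else N) hy
  simp only [h, if_true] at this
  unfold mate; omega

theorem adjN_congr {u w u' w' : ℕ} (h : U.Adj u w ↔ U.Adj u' w') : adjN U u w = adjN U u' w' := by
  simp [adjN, h]

theorem adjN_eq_iff {u w u' w' : ℕ} : adjN U u w = adjN U u' w' ↔ (U.Adj u w ↔ U.Adj u' w') := by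
  unfold adjN
  by_cases h1 : U.Adj u w <;> by_cases h2 : U.Adj u' w' <;> simp [h1, h2]

theorem mate_inj {σ : ℕ → ℕ} (hσ : Function.Injective σ) {x x' : ℕ} (hx : x < N) (hx' : x' < N)
    (hl : aLab U N C x < N) (hl' : aLab U N C x' < N) (hm : mate U N C C' σ x < N)
    (e : mate U N C C' σ x = mate U N C C' σ x') : x = x' := by
  obtain ⟨h1, h2, h3⟩ := mate_spec hm
  obtain ⟨g1, g2, g3⟩ := mate_spec (e ▸ hm)
  rw [← e] at g2 g3
  exact aPos_inj hx hx' ((aIdx_eq_iff hx hx' hl hl').mp (hσ (h2.symm.trans g2)))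
    (h3.symm.trans g3)

/-- An isomorphism is found at the permutation of rays it induces. -/
theorem AnchorIso.leaf {d : ℕ} (h : AnchorIso U N f S S' C C') (hdisj : Disjoint S S')
    (hg : Good U N C d) :
    aR U N C = aR U N C' ∧ (aX U N C).card = (aX U N C').card ∧ (aC N C).card = (aC N C').card ∧
    ∃ σ : Equiv.Perm ℕ, (∀ i, aR U N C ≤ i → σ i = i) ∧ Leaf U N C C' σ := by
  have hN := h.anchor.two
  have hz := hg.rayClosed h.anchor
  obtain ⟨hr, σ, hσ, hσ'⟩ := h.exists_perm hz
  have hms := fun x (hx : x < N) (hl : aLab U N C x < N) => h.matches_spec hz hσ' hx hl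
  obtain ⟨g, hgi, g1, g2⟩ := h.exists_symm
  have hmem : ∀ x < N, aLab U N C x < N → x ∈ S := fun x hx hl =>
    h.mem_of_aDist_lt hx ((h.anchor.aLab_lt hx).mp hl).2
  have hmem' : ∀ x < N, aLab U N C' x < N → x ∈ S' := fun x hx hl =>
    hgi.mem_of_aDist_lt hx ((h.anchor'.aLab_lt hx).mp hl).2
  have hCS' : C' ⊆ S' := hgi.sub
  have hlt : ∀ x < N, aLab U N C x < N → mate U N C C' σ x < N := fun x hx hl => by
    obtain ⟨⟨y, hy, hxy⟩, -⟩ := hms x hx hl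
    exact mate_lt hy hxy
  -- the preimage of the mate is a twin
  have htwin : ∀ x < N, aLab U N C x < N → ∃ w ∈ S, f w = mate U N C C' σ x ∧
      aLab U N C w = aLab U N C x ∧ ∀ y < N, (w = y ∨ U.Adj w y ↔ x = y ∨ U.Adj x y) := by
    intro x hx hl
    obtain ⟨w, hw, h1, h2, h3⟩ := (hms x hx hl).2 _ (hlt x hx hl) (mate_spec (hlt x hx hl))
    refine ⟨w, hw, h1, h2, fun y hy => ?_⟩
    rw [← capDist_le_one hN, ← capDist_le_one hN]
    exact hg.ties w (h.lt w hw) x hx (h2 ▸ hl) h2 h3 y hy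
  have hCiff : ∀ w ∈ S, (f w ∈ C' ↔ w ∈ C) := by
    intro w hw
    rw [← h.image]
    constructor
    · rintro ⟨c, hc, e⟩
      rw [← h.iso.bij.injOn (h.sub hc) hw e]; exact hc
    · intro hc; exact ⟨w, hc, rfl⟩
  refine ⟨hr, ?_, ?_, σ, hσ, hlt, ?_, ?_⟩
  · refine (h.card_eq (p := fun u => aLab U N C u < N) (q := fun u => aLab U N C' u < N)
      hmem hmem' fun w hw => ?_).symm
    rw [h.anchor.aLab_lt (h.lt w hw), h.anchor'.aLab_lt (h.lt' _ (h.maps hw)), h.inX_iff hw]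
  · exact (h.card_eq (p := fun u => u ∈ C) (q := fun u => u ∈ C')
      (fun w _ hw => h.sub hw) (fun w _ hw => hCS' hw) hCiff).symm
  · intro x hx y hy hlx hly
    obtain ⟨x', hx', ex, lx, tx⟩ := htwin x hx hlx
    obtain ⟨y', hy', ey, ly, ty⟩ := htwin y hy hly
    by_cases hxy : x = y
    · subst hxy
      exact adjN_congr (by simp)
    have hne : x' ≠ y' := fun e => hxy (mate_inj σ.injective hx hy hlx hly (hlt x hx hlx)
      (by rw [← ex, ← ey, e]))
    refine adjN_congr ?_
    rw [← ex, ← ey, h.iso.adj x' hx' y' hy']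
    -- Replace x' by its twin x, then y' by its twin y. Closed neighbourhoods of twins agree, and
    -- the vertices are distinct, so adjacency is unchanged at both exchanges.
    have e1 := tx y' (h.lt y' hy')
    have e2 := ty x hx
    constructor
    · intro hadj
      have := e2.mpr (Or.inr hadj.symm)
      have := e1.mpr (by rcases this with rfl | h; exacts [Or.inl rfl, Or.inr h.symm])
      exact this.resolve_left hne
    · intro hadj
      have := e1.mp (Or.inr hadj)
      have := e2.mp (by rcases this with rfl | h; exacts [Or.inl rfl, Or.inr h.symm])
      exact (this.resolve_left (Ne.symm hxy)).symm
  · -- colours are preserved by `f`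
    have hdj : ∀ u, u ∈ S → u ∈ S' → False := fun u h1 h2 => Set.disjoint_left.mp hdisj h1 h2
    have hcol : ∀ w ∈ C, colour U N C C' σ (f w) = colour U N C C' σ w := by
      intro w hw
      funext x
      unfold colour
      split_ifs with hx
      · obtain ⟨hx, hl⟩ := hx
        have hxS := hmem x hx hl
        obtain ⟨x', hx', ex, lx, tx⟩ := htwin x hx hl
        have hmS' : mate U N C C' σ x ∈ S' := ex ▸ h.maps hx'
        have hxC : x ∉ C := fun hc => by
          have h1 := ((h.anchor.aLab_lt hx).mp hl).1
          have h2 := h.anchor.aDist_eq_zero.mpr hc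
          omega
        have hxC' : x' ∉ C := fun hc => by
          have h1 := ((h.anchor.aLab_lt (h.lt x' hx')).mp (lx ▸ hl)).1
          have h2 := h.anchor.aDist_eq_zero.mpr hc
          omega
        -- The two sides are disjoint and closed, so for a vertex of either anchor one of the two
        -- summands of `bit` vanishes. The sum thus gives comparable colours to vertices on both
        -- sides.
        have z1 : ¬ U.Adj (f w) x := fun hadj =>
          hdj x hxS (h.closed' _ (h.maps (h.sub hw)) _ hadj)
        have z2 : ¬ U.Adj w (mate U N C C' σ x) := fun hadj =>
          hdj _ (h.closed _ (h.sub hw) _ hadj) hmS'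
        have z3 : U.Adj (f w) (mate U N C C' σ x) ↔ U.Adj w x := by
          rw [← ex, h.iso.adj w (h.sub hw) x' hx']
          have := tx w (h.lt w (h.sub hw))
          constructor
          · intro hadj
            exact ((this.mp (Or.inr hadj.symm)).resolve_left fun e => hxC (e ▸ hw)).symm
          · intro hadj
            exact ((this.mpr (Or.inr hadj.symm)).resolve_left fun e => hxC' (e ▸ hw)).symm
        simp [bit, adjN, z1, z2, z3]
      · rfl
    intro v hv hvC
    refine (h.card_eq (p := fun w => w ∈ C ∧ colour U N C C' σ w = colour U N C C' σ v)
      (q := fun w => w ∈ C' ∧ colour U N C C' σ w = colour U N C C' σ v)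
      (fun w _ hw => h.sub hw.1) (fun w _ hw => hCS' hw.1) fun w hw => ?_).symm
    rw [hCiff w hw]
    exact and_congr_right fun hwC => by rw [hcol w hwC]

theorem exists_bijOn_of_card_eq {K L : Finset ℕ} (h : K.card = L.card) :
    ∃ e : ℕ → ℕ, Set.BijOn e K L := by
  let E := Finset.equivOfCardEq h
  refine ⟨fun w => if hw : w ∈ K then E ⟨w, hw⟩ else w, fun w hw => ?_, fun w hw w' hw' e => ?_,
    fun w hw => ?_⟩
  · rw [Finset.mem_coe] at hw
    simp only [hw, dif_pos, Finset.mem_coe]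
    exact (E ⟨w, hw⟩).2
  · rw [Finset.mem_coe] at hw hw'
    simp only [hw, hw', dif_pos] at e
    exact congrArg Subtype.val (E.injective (Subtype.ext e))
  · rw [Finset.mem_coe] at hw
    refine ⟨E.symm ⟨w, hw⟩, (E.symm ⟨w, hw⟩).2, ?_⟩
    simp

/-- Equal colour counts yield a colour-preserving bijection. -/
theorem exists_bijOn_colour {γ : Type*} {K L : Finset ℕ} (c : ℕ → γ) (hKL : K.card = L.card)
    (h : ∀ v ∈ K, (K.filter fun w => c w = c v).card = (L.filter fun w => c w = c v).card) :
    ∃ g : ℕ → ℕ, Set.BijOn g K L ∧ ∀ v ∈ K, c (g v) = c v := by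
  have hex : ∀ x : γ, ∃ e : ℕ → ℕ, (K.filter fun w => c w = x).card =
      (L.filter fun w => c w = x).card → Set.BijOn e (K.filter fun w => c w = x)
      (L.filter fun w => c w = x) := fun x => by
    by_cases hc : (K.filter fun w => c w = x).card = (L.filter fun w => c w = x).card
    · obtain ⟨e, he⟩ := exists_bijOn_of_card_eq hc
      exact ⟨e, fun _ => he⟩
    · exact ⟨id, fun h => absurd h hc⟩
  choose e he using hex
  have hb := fun v hv => he (c v) (h v hv)
  have hmaps : ∀ v ∈ K, e (c v) v ∈ L ∧ c (e (c v) v) = c v := fun v hv => by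
    have := (hb v hv).mapsTo (x := v) (by simpa using hv)
    simpa using this
  have hinj : Set.InjOn (fun v => e (c v) v) K := by
    intro v hv w hw heq
    dsimp only at heq
    have hc : c v = c w := by rw [← (hmaps v hv).2, ← (hmaps w hw).2, heq]
    rw [← hc] at heq
    refine (hb v hv).injOn ?_ ?_ heq
    · simpa using hv
    · simpa [hc] using hw
  refine ⟨fun v => e (c v) v, ⟨fun v hv => (hmaps v hv).1, hinj, ?_⟩, fun v hv => (hmaps v hv).2⟩
  exact Finset.surjOn_of_injOn_of_card_le _ (fun v hv => (hmaps v hv).1) hinj hKL.ge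

/-- The component of an anchor consists of the anchor and the rays. -/
theorem Anchor.reachable_iff (h : Anchor U N C) {a u : ℕ} (ha : a ∈ C) :
    U.Reachable a u ↔ u ∈ C ∨ (u < N ∧ aLab U N C u < N) := by
  have haN := h.lt a ha
  constructor
  · intro hr
    have hu := h.below.lt_of_reachable hr.symm haN
    have hd := (h.aDist_lt_iff ha hu).mpr hr
    by_cases h0 : aDist U N C u = 0
    · exact Or.inl (h.aDist_eq_zero.mp h0)
    · exact Or.inr ⟨hu, (h.aLab_lt hu).mpr ⟨by omega, hd⟩⟩
  · rintro (hu | ⟨hu, hl⟩)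
    · by_cases e : a = u
      · rw [e]
      · exact (h.clique a ha u hu e).reachable
    · exact (h.aDist_lt_iff ha hu).mp ((h.aLab_lt hu).mp hl).2

theorem Anchor.notMem_of_aLab_lt (h : Anchor U N C) {u : ℕ} (hu : u < N)
    (hl : aLab U N C u < N) : u ∉ C := fun hc => by
  have h1 := ((h.aLab_lt hu).mp hl).1
  have h2 := h.aDist_eq_zero.mpr hc
  omega

/-- A successful matching yields an isomorphism of components. -/
theorem Leaf.exists_isoOn {a b : ℕ} {σ : ℕ → ℕ} (hσ : Function.Injective σ) (h : Anchor U N C)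
    (h' : Anchor U N C') (ha : a ∈ C) (hb : b ∈ C')
    (hdisj : Disjoint {u | U.Reachable a u} {u | U.Reachable b u})
    (hX : (aX U N C).card = (aX U N C').card) (hCC : (aC N C).card = (aC N C').card)
    (hl : Leaf U N C C' σ) :
    ∃ f, IsoOn U f {u | U.Reachable a u} {u | U.Reachable b u} := by
  have hdj : ∀ u, U.Reachable a u → U.Reachable b u → False := fun u h1 h2 =>
    Set.disjoint_left.mp hdisj h1 h2
  have hmX : ∀ {D : Set ℕ} {u}, u ∈ aX U N D ↔ u < N ∧ aLab U N D u < N := by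
    intro D u; simp [aX]
  have hmC : ∀ {u}, u ∈ aC N C ↔ u ∈ C := by
    intro u; simp only [aC, Finset.mem_filter, Finset.mem_range]
    exact ⟨fun h => h.2, fun hu => ⟨h.lt u hu, hu⟩⟩
  have hmC' : ∀ {u}, u ∈ aC N C' ↔ u ∈ C' := by
    intro u; simp only [aC, Finset.mem_filter, Finset.mem_range]
    exact ⟨fun h => h.2, fun hu => ⟨h'.lt u hu, hu⟩⟩
  have hmap : ∀ x ∈ aX U N C, mate U N C C' σ x ∈ aX U N C' := fun x hx => by
    obtain ⟨hx, hlx⟩ := hmX.mp hx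
    exact hmX.mpr ⟨hl.lt x hx hlx, (mate_spec (hl.lt x hx hlx)).1⟩
  have hinj : Set.InjOn (mate U N C C' σ) (aX U N C) := fun x hx y hy e => by
    obtain ⟨hx, hlx⟩ := hmX.mp hx
    obtain ⟨hy, hly⟩ := hmX.mp hy
    exact mate_inj hσ hx hy hlx hly (hl.lt x hx hlx) e
  have hsurj : Set.SurjOn (mate U N C C' σ) (aX U N C) (aX U N C') :=
    Finset.surjOn_of_injOn_of_card_le _ hmap hinj hX.ge
  -- Both anchors are cliques, so any bijection between them preserves adjacency inside; preserving
  -- colours is all that is needed for the edges to the rays.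
  obtain ⟨g, hg, hgc⟩ := exists_bijOn_colour (colour U N C C' σ) hCC (by
    intro v hv
    have hv' := hmC.mp hv
    have := hl.count v (h.lt v hv') hv'
    simpa only [aC, Finset.filter_filter] using this)
  have hgm : ∀ v ∈ C, g v ∈ C' := fun v hv => hmC'.mp (hg.mapsTo (hmC.mpr hv))
  set F : ℕ → ℕ := fun u => if u ∈ C then g u else mate U N C C' σ u with hF
  have hFC : ∀ u ∈ C, F u = g u := fun u hu => by simp [hF, hu]
  have hFX : ∀ u ∈ aX U N C, F u = mate U N C C' σ u := fun u hu => by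
    obtain ⟨hu, hlu⟩ := hmX.mp hu
    simp [hF, h.notMem_of_aLab_lt hu hlu]
  have hS : ∀ u, U.Reachable a u ↔ u ∈ C ∨ u ∈ aX U N C := fun u => by
    rw [h.reachable_iff ha, hmX]
  have hS' : ∀ u, U.Reachable b u ↔ u ∈ C' ∨ u ∈ aX U N C' := fun u => by
    rw [h'.reachable_iff hb, hmX]
  have hCX' : ∀ u, u ∈ C' → u ∈ aX U N C' → False := fun u hu hx =>
    h'.notMem_of_aLab_lt (hmX.mp hx).1 (hmX.mp hx).2 hu
  have hmixed : ∀ v ∈ C, ∀ x ∈ aX U N C, (U.Adj (g v) (mate U N C C' σ x) ↔ U.Adj v x) := by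
    intro v hv x hx
    have e := congrFun (hgc v (hmC.mpr hv)) x
    have hx' := hmX.mp hx
    simp only [colour, hx', and_self, if_true] at e
    have z1 : ¬ U.Adj (g v) x := fun hadj => hdj x ((hS x).mpr (Or.inr hx))
      (((hS' _).mpr (Or.inl (hgm v hv))).trans hadj.reachable)
    have z2 : ¬ U.Adj v (mate U N C C' σ x) := fun hadj => hdj _
      (((hS v).mpr (Or.inl hv)).trans hadj.reachable) ((hS' _).mpr (Or.inr (hmap x hx)))
    simp only [bit] at e
    have e1 : adjN U (g v) x = 0 := by simp [adjN, z1]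
    have e2 : adjN U v (mate U N C C' σ x) = 0 := by simp [adjN, z2]
    rw [e1, e2, zero_add, add_zero] at e
    exact adjN_eq_iff.mp e
  refine ⟨F, ⟨?_, ?_, ?_⟩, ?_⟩
  · intro u hu
    rcases (hS u).mp hu with hu | hu
    · exact (hS' _).mpr (Or.inl (by rw [hFC u hu]; exact hgm u hu))
    · exact (hS' _).mpr (Or.inr (by rw [hFX u hu]; exact hmap u hu))
  · intro u hu w hw e
    rcases (hS u).mp hu with hu | hu <;> rcases (hS w).mp hw with hw | hw
    · rw [hFC u hu, hFC w hw] at e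
      exact hg.injOn (hmC.mpr hu) (hmC.mpr hw) e
    · rw [hFC u hu, hFX w hw] at e
      exact (hCX' _ (hgm u hu) (e ▸ hmap w hw)).elim
    · rw [hFX u hu, hFC w hw] at e
      exact (hCX' _ (hgm w hw) (e ▸ hmap u hu)).elim
    · rw [hFX u hu, hFX w hw] at e
      exact hinj hu hw e
  · intro w hw
    rcases (hS' w).mp hw with hw | hw
    · obtain ⟨v, hv, rfl⟩ := hg.surjOn (hmC'.mpr hw)
      have hv' := hmC.mp hv
      exact ⟨v, (hS v).mpr (Or.inl hv'), hFC v hv'⟩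
    · obtain ⟨x, hx, rfl⟩ := hsurj hw
      exact ⟨x, (hS x).mpr (Or.inr hx), hFX x hx⟩
  · intro u hu w hw
    rcases (hS u).mp hu with hu | hu <;> rcases (hS w).mp hw with hw | hw
    · rw [hFC u hu, hFC w hw]
      by_cases e : u = w
      · subst e; simp
      · have hne : g u ≠ g w := fun h => e (hg.injOn (hmC.mpr hu) (hmC.mpr hw) h)
        exact ⟨fun _ => h.clique u hu w hw e,
          fun _ => h'.clique _ (hgm u hu) _ (hgm w hw) hne⟩
    · rw [hFC u hu, hFX w hw]; exact hmixed u hu w hw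
    · rw [hFX u hu, hFC w hw, U.adj_comm, hmixed w hw u hu, U.adj_comm]
    · rw [hFX u hu, hFX w hw]
      have hu' := hmX.mp hu
      have hw' := hmX.mp hw
      exact (adjN_eq_iff.mp (hl.adj u hu'.1 w hw'.1 hu'.2 hw'.2)).symm

/-! ### Removing isomorphic components -/

theorem IsoOn.reachable (h : IsoOn U f S S') (hS : ClosedSet U S) {u w : ℕ} (hu : u ∈ S)
    (hr : U.Reachable u w) : U.Reachable (f u) (f w) := by
  obtain ⟨p⟩ := hr
  obtain ⟨q, -⟩ := h.exists_walk hS p hu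
  exact ⟨q⟩

theorem IsoOn.reachable_iff (h : IsoOn U f S S') (hS : ClosedSet U S) (hS' : ClosedSet U S')
    {u w : ℕ} (hu : u ∈ S) (hw : w ∈ S) : U.Reachable (f u) (f w) ↔ U.Reachable u w := by
  refine ⟨fun hr => ?_, h.reachable hS hu⟩
  obtain ⟨g, hg, h1, -⟩ := h.exists_symm
  have := hg.reachable hS' (h.bij.mapsTo hu) hr
  rwa [h1 u hu, h1 w hw] at this

/-- Isomorphic components may be cancelled. -/
theorem exists_isoOn_diff_iff {a b : ℕ} (hS : ClosedSet U S) (hS' : ClosedSet U S')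
    (ha : a ∈ S) (hb : b ∈ S')
    (hAB : ∃ g, IsoOn U g {u | U.Reachable a u} {u | U.Reachable b u}) :
    (∃ f, IsoOn U f S S') ↔
      ∃ f, IsoOn U f (S \ {u | U.Reachable a u}) (S' \ {u | U.Reachable b u}) := by
  have hA : {u | U.Reachable a u} ⊆ S := fun u hu => hS.mem_of_reachable ha hu
  have hB : {u | U.Reachable b u} ⊆ S' := fun u hu => hS'.mem_of_reachable hb hu
  have hAc := closedSet_reachable U a
  have hBc := closedSet_reachable U b
  have hfA : ∀ f, IsoOn U f S S' → ∀ u ∈ S, (U.Reachable (f a) (f u) ↔ u ∈ {u | U.Reachable a u}) :=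
    fun f hf u hu => hf.reachable_iff hS hS' ha hu
  have hBr : ∀ x ∈ {u | U.Reachable b u}, ∀ y, U.Reachable x y → y ∈ {u | U.Reachable b u} :=
    fun x hx y h => hBc.mem_of_reachable hx h
  have hBB : ∀ x ∈ {u | U.Reachable b u}, ∀ y ∈ {u | U.Reachable b u}, U.Reachable x y :=
    fun x hx y hy => hx.symm.trans hy
  generalize {u | U.Reachable a u} = A at *
  generalize {u | U.Reachable b u} = B at *
  obtain ⟨g, hg⟩ := hAB
  obtain ⟨g', hg', hgg', hg'g⟩ := hg.exists_symm
  constructor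
  · rintro ⟨f, hf⟩
    have haA : a ∈ A := (hfA f hf a ha).mp (SimpleGraph.Reachable.refl _)
    -- If f maps the component A onto B, it can simply be restricted. Otherwise A goes to some other
    -- component and B is the image of another one.
    by_cases hab : f a ∈ B
    · have hiff : ∀ u ∈ S, (f u ∈ B ↔ u ∈ A) := fun u hu =>
        ⟨fun h => (hfA f hf u hu).mp (hBB _ hab _ h), fun h => hBr _ hab _ ((hfA f hf u hu).mpr h)⟩
      refine ⟨f, ⟨fun u hu => ⟨hf.bij.mapsTo hu.1, fun h => hu.2 ((hiff u hu.1).mp h)⟩,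
        hf.bij.injOn.mono Set.sdiff_subset, ?_⟩, fun u hu w hw => hf.adj u hu.1 w hw.1⟩
      rintro y ⟨hy, hyB⟩
      obtain ⟨x, hx, rfl⟩ := hf.bij.surjOn hy
      exact ⟨x, ⟨hx, fun h => hyB ((hiff x hx).mpr h)⟩, rfl⟩
    have hfB : ∀ u ∈ A, f u ∉ B := fun u hu h =>
      hab (hBr _ h _ ((hfA f hf u (hA hu)).mpr hu).symm)
    -- Reroute: a vertex that f sends into B is moved back to A by the inverse of g and sent on by f
    -- to the image of A, which has become free.
    refine ⟨fun u => if f u ∈ B then f (g' (f u)) else f u, ⟨?_, ?_, ?_⟩, ?_⟩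
    · intro u hu
      by_cases h : f u ∈ B
      · simp only [h, if_true]
        exact ⟨hf.bij.mapsTo (hA (hg'.bij.mapsTo h)), hfB _ (hg'.bij.mapsTo h)⟩
      · simp only [h, if_false]; exact ⟨hf.bij.mapsTo hu.1, h⟩
    · intro u hu w hw e
      by_cases h1 : f u ∈ B <;> by_cases h2 : f w ∈ B <;>
        simp only [h1, h2, if_true, if_false] at e
      · exact hf.bij.injOn hu.1 hw.1 (hg'.bij.injOn h1 h2
          (hf.bij.injOn (hA (hg'.bij.mapsTo h1)) (hA (hg'.bij.mapsTo h2)) e))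
      · have := hf.bij.injOn (hA (hg'.bij.mapsTo h1)) hw.1 e
        exact (hw.2 (this ▸ hg'.bij.mapsTo h1)).elim
      · have := hf.bij.injOn hu.1 (hA (hg'.bij.mapsTo h2)) e
        exact (hu.2 (this ▸ hg'.bij.mapsTo h2)).elim
      · exact hf.bij.injOn hu.1 hw.1 e
    · rintro y ⟨hy, hyB⟩
      obtain ⟨x, hx, rfl⟩ := hf.bij.surjOn hy
      by_cases hxA : x ∈ A
      · obtain ⟨z, hz, e⟩ := hf.bij.surjOn (hB (hg.bij.mapsTo hxA))
        have hzB : f z ∈ B := e ▸ hg.bij.mapsTo hxA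
        exact ⟨z, ⟨hz, fun h => hfB z h hzB⟩, by simp only [hzB, if_true]; rw [e, hgg' x hxA]⟩
      · exact ⟨x, ⟨hx, hxA⟩, by simp [hyB]⟩
    · intro u hu w hw
      by_cases h1 : f u ∈ B <;> by_cases h2 : f w ∈ B <;> simp only [h1, h2, if_true, if_false]
      · rw [hf.adj _ (hA (hg'.bij.mapsTo h1)) _ (hA (hg'.bij.mapsTo h2)), hg'.adj _ h1 _ h2,
          hf.adj _ hu.1 _ hw.1]
      · rw [hf.adj _ (hA (hg'.bij.mapsTo h1)) _ hw.1, ← hf.adj _ hu.1 _ hw.1]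
        exact ⟨fun h => (hw.2 (hAc _ (hg'.bij.mapsTo h1) _ h)).elim,
          fun h => (h2 (hBc _ h1 _ h)).elim⟩
      · rw [hf.adj _ hu.1 _ (hA (hg'.bij.mapsTo h2)), ← hf.adj _ hu.1 _ hw.1]
        exact ⟨fun h => (hu.2 (hAc _ (hg'.bij.mapsTo h2) _ h.symm)).elim,
          fun h => (h1 (hBc _ h2 _ h.symm)).elim⟩
      · exact hf.adj _ hu.1 _ hw.1
  · rintro ⟨f, hf⟩
    refine ⟨fun u => if u ∈ A then g u else f u, ⟨?_, ?_, ?_⟩, ?_⟩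
    · intro u hu
      by_cases hA' : u ∈ A
      · simp only [hA', if_true]; exact hB (hg.bij.mapsTo hA')
      · simp only [hA', if_false]; exact (hf.bij.mapsTo ⟨hu, hA'⟩).1
    · intro u hu w hw e
      by_cases h1 : u ∈ A <;> by_cases h2 : w ∈ A <;> simp only [h1, h2, if_true, if_false] at e
      · exact hg.bij.injOn h1 h2 e
      · exact ((hf.bij.mapsTo ⟨hw, h2⟩).2 (e ▸ hg.bij.mapsTo h1)).elim
      · exact ((hf.bij.mapsTo ⟨hu, h1⟩).2 (e ▸ hg.bij.mapsTo h2)).elim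
      · exact hf.bij.injOn ⟨hu, h1⟩ ⟨hw, h2⟩ e
    · intro w hw
      by_cases h1 : w ∈ B
      · obtain ⟨u, hu, rfl⟩ := hg.bij.surjOn h1
        exact ⟨u, hA hu, by simp [hu]⟩
      · obtain ⟨u, hu, rfl⟩ := hf.bij.surjOn ⟨hw, h1⟩
        exact ⟨u, hu.1, by simp [hu.2]⟩
    · intro u hu w hw
      by_cases h1 : u ∈ A <;> by_cases h2 : w ∈ A <;> simp only [h1, h2, if_true, if_false]
      · exact hg.adj u h1 w h2
      · exact ⟨fun h => ((hf.bij.mapsTo ⟨hw, h2⟩).2 (hBc _ (hg.bij.mapsTo h1) _ h)).elim,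
          fun h => (h2 (hAc _ h1 _ h)).elim⟩
      · exact ⟨fun h => ((hf.bij.mapsTo ⟨hu, h1⟩).2 (hBc _ (hg.bij.mapsTo h2) _ h.symm)).elim,
          fun h => (h1 (hAc _ h2 _ h.symm)).elim⟩
      · exact hf.adj u ⟨hu, h1⟩ w ⟨hw, h2⟩

end

end StarIso

namespace StarIso

open WordRAM Classical Nat

/-! ### Enumerating permutations by digits -/

/-- The product of the transpositions of `i` and `dig i`, for `i < r`. -/
def permSeq (dig : ℕ → ℕ) : ℕ → Equiv.Perm ℕ
  | 0 => 1
  | i + 1 => permSeq dig i * Equiv.swap i (dig i)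

theorem permSeq_congr {dig dig' : ℕ → ℕ} {r : ℕ} (h : ∀ i < r, dig i = dig' i) :
    permSeq dig r = permSeq dig' r := by
  induction r with
  | zero => rfl
  | succ r ih => rw [permSeq, permSeq, ih fun i hi => h i (by omega), h r (by omega)]

/-- Composing σ with the transposition of r and σ⁻¹ r yields a permutation that fixes r. The digit
σ⁻¹ r is at most r because σ fixes everything above. -/
theorem exists_permSeq (r : ℕ) (σ : Equiv.Perm ℕ) (h : ∀ i, r ≤ i → σ i = i) :
    ∃ dig : ℕ → ℕ, (∀ i, dig i ≤ i) ∧ σ = permSeq dig r := by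
  induction r generalizing σ with
  | zero => exact ⟨fun i => i, fun i => le_rfl, Equiv.ext fun i => h i (by omega)⟩
  | succ r ih =>
    have hle : σ⁻¹ r ≤ r := by
      by_contra hlt
      have := h (σ⁻¹ r) (by omega)
      rw [show σ (σ⁻¹ r) = r from σ.apply_symm_apply r] at this
      omega
    obtain ⟨dig, h1, h2⟩ := ih (σ * Equiv.swap r (σ⁻¹ r)) fun i hi => by
      rcases hi.eq_or_lt with rfl | hi
      · simp
      · rw [Equiv.Perm.mul_apply, Equiv.swap_apply_of_ne_of_ne (by omega) (by omega)]
        exact h i hi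
    refine ⟨Function.update dig r (σ⁻¹ r), fun i => ?_, ?_⟩
    · rcases eq_or_ne i r with rfl | hi
      · simpa using hle
      · simpa [hi] using h1 i
    · rw [permSeq, permSeq_congr (dig' := dig) fun i hi => by simp [hi.ne], ← h2, mul_assoc]
      simp

/-- The `i`-th digit of `k` in the factorial number system. -/
def digit (k i : ℕ) : ℕ := k / i ! % (i + 1)

theorem digit_le (k i : ℕ) : digit k i ≤ i := Nat.lt_succ_iff.mp (Nat.mod_lt _ i.succ_pos)

theorem digit_zero (i : ℕ) : digit 0 i = 0 := by simp [digit]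

/-- The new leading digit contributes a multiple of r!, hence of (i + 1)! for all i < r, so it does
not affect the digits found before. -/
theorem exists_digit (dig : ℕ → ℕ) (h : ∀ i, dig i ≤ i) (r : ℕ) :
    ∃ k < r !, ∀ i < r, digit k i = dig i := by
  induction r with
  | zero => exact ⟨0, by simp, by simp⟩
  | succ r ih =>
    obtain ⟨k, hk, hd⟩ := ih
    refine ⟨k + dig r * r !, ?_, fun i hi => ?_⟩
    · have := Nat.mul_le_mul_right (r !) (h r)
      rw [Nat.factorial_succ]; nlinarith
    · rcases (Nat.lt_succ_iff.mp hi).eq_or_lt with rfl | hi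
      · rw [digit, Nat.add_mul_div_right _ _ (Nat.factorial_pos _), Nat.div_eq_of_lt hk, zero_add,
          Nat.mod_eq_of_lt (Nat.lt_succ_of_le (h i))]
      · obtain ⟨m, hm⟩ := Nat.factorial_dvd_factorial (Nat.succ_le_of_lt hi)
        have e : dig r * r ! = (dig r * m * (i + 1)) * i ! := by
          rw [hm, Nat.succ_eq_add_one, Nat.factorial_succ]; ring
        rw [← hd i hi, digit, e, Nat.add_mul_div_right _ _ (Nat.factorial_pos _),
          Nat.add_mul_mod_self_right, digit]

/-- The carry condition: all lower digits are at their maximum exactly when k is congruent to -1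
modulo r!. The converse direction is `not_dvd_of_digit_lt`. -/
theorem dvd_of_digit_eq {k r : ℕ} (h : ∀ i < r, digit k i = i) : r ! ∣ k + 1 := by
  induction r with
  | zero => simp
  | succ r ih =>
    obtain ⟨m, hm⟩ := ih fun i hi => h i (by omega)
    have h1 := h r (by omega)
    have hm0 : 0 < m := by rcases Nat.eq_zero_or_pos m with rfl | h <;> omega
    have hk : k = (m - 1) * r ! + ((r !) - 1) := by
      obtain ⟨m', rfl⟩ : ∃ m', m = m' + 1 := ⟨m - 1, by omega⟩
      have := Nat.factorial_pos r
      have e : r ! * (m' + 1) = m' * r ! + r ! := by ring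
      simp only [Nat.add_sub_cancel]
      omega
    have hd : k / r ! = m - 1 := by
      rw [hk, add_comm, Nat.add_mul_div_right _ _ (Nat.factorial_pos _),
        Nat.div_eq_of_lt (by have := Nat.factorial_pos r; omega), zero_add]
    rw [digit, hd] at h1
    have h2 := Nat.div_add_mod (m - 1) (r + 1)
    rw [h1] at h2
    refine ⟨(m - 1) / (r + 1) + 1, ?_⟩
    rw [hm, Nat.factorial_succ]
    have : m = (r + 1) * ((m - 1) / (r + 1)) + (r + 1) := by omega
    calc r ! * m = r ! * ((r + 1) * ((m - 1) / (r + 1)) + (r + 1)) := by rw [← this]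
      _ = _ := by ring

theorem not_dvd_of_digit_lt {k r i : ℕ} (hi : i < r) (h : digit k i < i) : ¬ r ! ∣ k + 1 := by
  intro hd
  have h1 : (i + 1)! ∣ k + 1 := (Nat.factorial_dvd_factorial hi).trans hd
  obtain ⟨m, hm⟩ := h1
  have hm0 : 0 < m := by rcases Nat.eq_zero_or_pos m with rfl | h <;> omega
  obtain ⟨m', rfl⟩ : ∃ m', m = m' + 1 := ⟨m - 1, by omega⟩
  have hk : k = ((i !) - 1) + (m' * (i + 1) + i) * i ! := by
    have := Nat.factorial_pos i
    have e : (i + 1)! * (m' + 1) = (m' * (i + 1) + i) * i ! + i ! := by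
      rw [Nat.factorial_succ]; ring
    omega
  have hq : k / i ! = m' * (i + 1) + i := by
    rw [hk, Nat.add_mul_div_right _ _ (Nat.factorial_pos _),
      Nat.div_eq_of_lt (by have := Nat.factorial_pos i; omega), zero_add]
  rw [digit, hq, Nat.mul_add_mod_self_right, Nat.mod_eq_of_lt (by omega)] at h
  omega

theorem digit_succ_of_full {k i : ℕ} (h : ∀ j < i, digit k j = j) :
    digit (k + 1) i = if digit k i < i then digit k i + 1 else 0 := by
  have hd := dvd_of_digit_eq h
  have hle := digit_le k i
  unfold digit at *
  rw [Nat.succ_div, if_pos hd, Nat.add_mod]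
  split_ifs with hlt
  · rcases Nat.eq_zero_or_pos i with rfl | hi
    · omega
    · rw [Nat.mod_eq_of_lt (a := 1) (by omega), Nat.mod_eq_of_lt (by omega)]
  · have : k / i ! % (i + 1) = i := by omega
    rw [this]
    rcases Nat.eq_zero_or_pos i with rfl | hi
    · simp
    · rw [Nat.mod_eq_of_lt (a := 1) (by omega), Nat.mod_self]

theorem digit_succ_of_lt {k i j : ℕ} (hj : j < i) (h : digit k j < j) :
    digit (k + 1) i = digit k i := by
  rw [digit, Nat.succ_div, if_neg (not_dvd_of_digit_lt hj h), add_zero, digit]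

theorem eq_factorial_of_full {k r : ℕ} (hk : k < r !) (h : ∀ i < r, digit k i = i) :
    k + 1 = r ! :=
  le_antisymm hk (Nat.le_of_dvd (by omega) (dvd_of_digit_eq h))

end StarIso

namespace StarIso

open WordRAM Classical

/-! ### The disjoint union of the two graphs -/

/-- The disjoint union of `G` and `H`, on the natural numbers below `n + n`. -/
def glue {n : ℕ} (G H : SimpleGraph (Fin n)) : SimpleGraph ℕ where
  Adj u w := (∃ i j : Fin n, G.Adj i j ∧ u = i ∧ w = j) ∨
    ∃ i j : Fin n, H.Adj i j ∧ u = n + i ∧ w = n + j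
  symm := ⟨by
    rintro u w (⟨i, j, h, rfl, rfl⟩ | ⟨i, j, h, rfl, rfl⟩)
    · exact Or.inl ⟨j, i, h.symm, rfl, rfl⟩
    · exact Or.inr ⟨j, i, h.symm, rfl, rfl⟩⟩
  loopless := ⟨by
    rintro u (⟨i, j, h, rfl, e⟩ | ⟨i, j, h, rfl, e⟩)
    · exact h.ne (Fin.ext e)
    · exact h.ne (Fin.ext (by omega))⟩

/-- What the algorithm uses about the disjoint union `U` of two proper `S_d`-graphs. -/
structure Instance (U : SimpleGraph ℕ) (n d : ℕ) : Prop where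
  below : Below U (n + n)
  side : ∀ u w, U.Adj u w → (u < n ↔ w < n)
  simplicial : ∀ S : Set ℕ, (∀ u ∈ S, u < n + n) → S.Nonempty →
    ∃ v ∈ S, ∀ x ∈ S, ∀ y ∈ S, U.Adj v x → U.Adj v y → x ≠ y → U.Adj x y
  anchor : ∀ a < n + n, ∃ C, Anchor U (n + n) C ∧ Good U (n + n) C d ∧
    (∀ u, (∀ c ∈ C, c ≠ u → U.Adj c u) → u ∈ C) ∧ ∀ c ∈ C, U.Reachable a c

section

variable {n d : ℕ} {G H : SimpleGraph (Fin n)}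

theorem glue_adj_left {u w : ℕ} (hu : u < n) (hw : w < n) :
    (glue G H).Adj u w ↔ G.Adj ⟨u, hu⟩ ⟨w, hw⟩ := by
  constructor
  · rintro (⟨i, j, h, rfl, rfl⟩ | ⟨i, j, h, rfl, rfl⟩)
    · exact h
    · omega
  · exact fun h => Or.inl ⟨_, _, h, rfl, rfl⟩

theorem glue_adj_right {u w : ℕ} (hu : u < n) (hw : w < n) :
    (glue G H).Adj (n + u) (n + w) ↔ H.Adj ⟨u, hu⟩ ⟨w, hw⟩ := by
  constructor
  · rintro (⟨i, j, h, e, e'⟩ | ⟨i, j, h, e, e'⟩)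
    · omega
    · obtain rfl : u = i := by omega
      obtain rfl : w = j := by omega
      exact h
  · exact fun h => Or.inr ⟨_, _, h, rfl, rfl⟩

theorem glue_below : Below (glue G H) (n + n) := by
  rintro u w (⟨i, j, h, rfl, rfl⟩ | ⟨i, j, h, rfl, rfl⟩) <;> omega

theorem glue_side (u w : ℕ) : (glue G H).Adj u w → (u < n ↔ w < n) := by
  rintro (⟨i, j, h, rfl, rfl⟩ | ⟨i, j, h, rfl, rfl⟩) <;> omega

theorem exists_glue_model_left (h : IsProperStarGraph d G) :
    ∃ C ray lo hi reach, StarModel (glue G H) {u | u < n} C d ray lo hi reach := by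
  obtain ⟨ℓ, R, hR⟩ := h
  obtain ⟨ray, lo, hi, reach, m⟩ := hR.exists_model
  rcases Nat.eq_zero_or_pos n with rfl | hn
  · exact ⟨∅, fun _ => 0, fun _ => 0, fun _ => 0, fun _ _ => 0, by constructor <;> simp⟩
  -- The reduction modulo n only makes the map total; below n it is the identity, and no other
  -- values matter.
  let g : ℕ → Fin n := fun u => ⟨u % n, Nat.mod_lt _ hn⟩
  have hg : ∀ u, (hu : u < n) → g u = ⟨u, hu⟩ := fun u hu => Fin.ext (Nat.mod_eq_of_lt hu)
  refine ⟨_, _, _, _, _, m.comap (g := g) ?_ (fun _ _ => Set.mem_univ _) ?_⟩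
  · intro u hu w hw e
    rw [hg u hu, hg w hw] at e
    simpa using e
  · intro u hu w hw
    rw [glue_adj_left hu hw, hg u hu, hg w hw]

theorem exists_glue_model_right (h : IsProperStarGraph d H) :
    ∃ C ray lo hi reach, StarModel (glue G H) {u | n ≤ u ∧ u < n + n} C d ray lo hi reach := by
  obtain ⟨ℓ, R, hR⟩ := h
  obtain ⟨ray, lo, hi, reach, m⟩ := hR.exists_model
  rcases Nat.eq_zero_or_pos n with rfl | hn
  · exact ⟨∅, fun _ => 0, fun _ => 0, fun _ => 0, fun _ _ => 0, by constructor <;> simp⟩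
  let g : ℕ → Fin n := fun u => ⟨(u - n) % n, Nat.mod_lt _ hn⟩
  have hg : ∀ u, (hu : u < n) → g (n + u) = ⟨u, hu⟩ := fun u hu => Fin.ext (by
    simp [g, Nat.mod_eq_of_lt hu])
  refine ⟨_, _, _, _, _, m.comap (g := g) ?_ (fun _ _ => Set.mem_univ _) ?_⟩
  · rintro u ⟨hu, hu'⟩ w ⟨hw, hw'⟩ e
    obtain ⟨u, rfl⟩ := Nat.exists_eq_add_of_le hu
    obtain ⟨w, rfl⟩ := Nat.exists_eq_add_of_le hw
    rw [hg u (by omega), hg w (by omega)] at e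
    simpa using e
  · rintro u ⟨hu, hu'⟩ w ⟨hw, hw'⟩
    obtain ⟨u, rfl⟩ := Nat.exists_eq_add_of_le hu
    obtain ⟨w, rfl⟩ := Nat.exists_eq_add_of_le hw
    rw [hg u (by omega), hg w (by omega), glue_adj_right]

/-- Neighbours stay on one side, so a simplicial vertex is sought on a side that the set meets. For
the anchor, the model is first restricted to the component of a and only then made maximal; this
puts the maximal clique into that component, and every vertex adjacent to all of it lies there too.
-/
theorem glue_instance (hG : IsProperStarGraph d G) (hH : IsProperStarGraph d H) :
    Instance (glue G H) n d := by
  obtain ⟨C₁, ray₁, lo₁, hi₁, re₁, m₁⟩ := exists_glue_model_left (H := H) hG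
  obtain ⟨C₂, ray₂, lo₂, hi₂, re₂, m₂⟩ := exists_glue_model_right (G := G) hH
  have hcl₁ : ClosedSet (glue G H) {u | u < n} := fun u hu w h => (glue_side u w h).mp hu
  have hcl₂ : ClosedSet (glue G H) {u | n ≤ u ∧ u < n + n} := fun u hu w h => by
    have := glue_side u w h
    have := glue_below w u h.symm
    have := hu.1
    constructor <;> omega
  refine ⟨glue_below, glue_side, fun S hS hne => ?_, fun a ha => ?_⟩
  · by_cases h1 : ∃ u ∈ S, u < n
    · obtain ⟨v, ⟨hv, hvn⟩, h⟩ := m₁.exists_simplicial (S := {u ∈ S | u < n}) (fun u hu => hu.2)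
        ((Set.finite_lt_nat n).subset fun u hu => hu.2) h1
      refine ⟨v, hv, fun x hx y hy hvx hvy hxy => h x ⟨hx, ?_⟩ y ⟨hy, ?_⟩ hvx hvy hxy⟩
      · exact (glue_side v x hvx).mp hvn
      · exact (glue_side v y hvy).mp hvn
    · have h2 : S ⊆ {u | n ≤ u ∧ u < n + n} := fun u hu =>
        ⟨not_lt.mp fun h => h1 ⟨u, hu, h⟩, hS u hu⟩
      exact m₂.exists_simplicial h2
        ((Set.finite_lt_nat (n + n)).subset fun u hu => hS u hu) hne
  · have key : ∀ (A C : Set ℕ) (ray lo hi : ℕ → ℕ) (reach : ℕ → ℕ → ℕ),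
        StarModel (glue G H) A C d ray lo hi reach → ClosedSet (glue G H) A → a ∈ A →
        ∃ C, Anchor (glue G H) (n + n) C ∧ Good (glue G H) (n + n) C d ∧
          (∀ u, (∀ c ∈ C, c ≠ u → (glue G H).Adj c u) → u ∈ C) ∧
          ∀ c ∈ C, (glue G H).Reachable a c := by
      intro A C ray lo hi reach m hA haA
      have hr := closedSet_reachable (glue G H) a
      have hlt : ∀ u ∈ {u | (glue G H).Reachable a u}, u < n + n := fun u hu =>
        glue_below.lt_of_reachable hu.symm ha
      obtain ⟨C', h1, h2, h3, reach', m'⟩ := (m.mono (A' := {u | (glue G H).Reachable a u})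
        fun u hu => hA.mem_of_reachable haA hu).exists_maximal
          ((Set.finite_lt_nat (n + n)).subset hlt) ⟨a, SimpleGraph.Reachable.refl _⟩
      have han : Anchor (glue G H) (n + n) C' := ⟨glue_below, by omega,
        fun c hc => hlt c (h1 hc), fun c hc c' hc' hne =>
          m'.adj_central c (h1 hc) c' (h1 hc') hc hc' hne, h2⟩
      obtain ⟨c₀, hc₀⟩ := h2
      refine ⟨C', han, (ModelAt.mk han m' h1 (fun u hu hd => ?_) hr).good h3, fun u hu => ?_, h1⟩
      · exact hr.mem_of_reachable (h1 hc₀) ((han.aDist_lt_iff hc₀ hu).mp hd)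
      · refine h3 u ?_ hu
        by_cases e : c₀ = u
        · exact e ▸ h1 hc₀
        · exact hr _ (h1 hc₀) _ (hu c₀ hc₀ e)
    by_cases han : a < n
    · exact key _ _ _ _ _ _ m₁ hcl₁ han
    · exact key _ _ _ _ _ _ m₂ hcl₂ ⟨not_lt.mp han, ha⟩

theorem nonempty_iso_iff :
    Nonempty (G ≃g H) ↔ ∃ f, IsoOn (glue G H) f {u | u < n} {u | n ≤ u ∧ u < n + n} := by
  constructor
  · rintro ⟨e⟩
    refine ⟨fun u => if hu : u < n then n + e ⟨u, hu⟩ else 0, ⟨?_, ?_, ?_⟩, ?_⟩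
    · intro u (hu : u < n)
      simp [hu]
    · intro u (hu : u < n) w (hw : w < n) h
      simp only [hu, hw, dif_pos] at h
      have := e.injective (Fin.ext (by omega : (e ⟨u, hu⟩ : ℕ) = e ⟨w, hw⟩))
      simpa using this
    · rintro w ⟨hw, hw'⟩
      obtain ⟨w, rfl⟩ := Nat.exists_eq_add_of_le hw
      have hw : w < n := by omega
      refine ⟨e.symm ⟨w, hw⟩, (e.symm ⟨w, hw⟩).2, ?_⟩
      simp
    · intro u (hu : u < n) w (hw : w < n)
      simp only [hu, hw, dif_pos]
      rw [glue_adj_right (e ⟨u, hu⟩).2 (e ⟨w, hw⟩).2, glue_adj_left hu hw]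
      exact e.map_adj_iff
  · rintro ⟨f, hf⟩
    have hm : ∀ i : Fin n, n ≤ f i ∧ f i < n + n := fun i => hf.bij.mapsTo i.2
    let g : Fin n → Fin n := fun i => ⟨f i - n, by have := hm i; omega⟩
    have hgf : ∀ i, n + (g i : ℕ) = f i := fun i => by have := hm i; simp only [g]; omega
    have hg : Function.Injective g := fun i j h =>
      Fin.ext (hf.bij.injOn i.2 j.2 (by rw [← hgf, ← hgf, h]))
    refine ⟨⟨Equiv.ofBijective g (Finite.injective_iff_bijective.mp hg), ?_⟩⟩
    intro i j
    change H.Adj (g i) (g j) ↔ G.Adj i j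
    rw [← glue_adj_left (G := G) (H := H) i.2 j.2, ← hf.adj i i.2 j j.2, ← hgf i, ← hgf j, glue_adj_right (g i).2 (g j).2]

end

end StarIso

namespace WordRAM

/-! ### Derived expressions -/

namespace Expr

/-- Negation. -/
def neg (a : Expr) : Expr := ite a (lit 0) (lit 1)

/-- Conjunction. -/
def conj (a b : Expr) : Expr := ite a (lt (lit 0) b) (lit 0)

/-- Disjunction. -/
def disj (a b : Expr) : Expr := ite a (lit 1) (lt (lit 0) b)

/-- Inequality. -/
def le (a b : Expr) : Expr := neg (lt b a)

/-- Equality. -/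
def eqq (a b : Expr) : Expr := conj (le a b) (le b a)

/-- Exclusive disjunction. -/
def differ (a b : Expr) : Expr := ite a (neg b) (lt (lit 0) b)

/-- The nesting depth of sums and minima. -/
def dep : Expr → ℕ
  | var _ => 0
  | lit _ => 0
  | size => 0
  | add a b => max a.dep b.dep
  | sub a b => max a.dep b.dep
  | mul a b => max a.dep b.dep
  | lt a b => max a.dep b.dep
  | ite c a b => max c.dep (max a.dep b.dep)
  | rd _ i j => max i.dep j.dep
  | inp e => e.dep
  | sum _ e => e.dep + 1
  | mn _ e => e.dep + 1

variable (C : Ctx) (α : Arr) (v : Env) (a b c : Expr)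

theorem eval_neg : (neg a).eval C α v = if 0 < a.eval C α v then 0 else 1 := rfl

theorem eval_conj : (conj a b).eval C α v =
    if 0 < a.eval C α v ∧ 0 < b.eval C α v then 1 else 0 := by
  simp only [conj, eval]
  by_cases h : 0 < a.eval C α v <;> by_cases h' : 0 < b.eval C α v <;> simp [h, h']

theorem eval_disj : (disj a b).eval C α v =
    if 0 < a.eval C α v ∨ 0 < b.eval C α v then 1 else 0 := by
  simp only [disj, eval]
  by_cases h : 0 < a.eval C α v <;> by_cases h' : 0 < b.eval C α v <;> simp [h, h']

theorem eval_leq : (le a b).eval C α v = if a.eval C α v ≤ b.eval C α v then 1 else 0 := by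
  simp only [le, eval_neg, eval]
  by_cases h : b.eval C α v < a.eval C α v <;> simp [h, not_le, not_lt.mp]

theorem eval_eqq : (eqq a b).eval C α v = if a.eval C α v = b.eval C α v then 1 else 0 := by
  simp only [eqq, eval_conj, eval_leq]
  congr 1
  simp only [eq_iff_iff]
  split_ifs <;> simp <;> omega

theorem eval_differ : (differ a b).eval C α v =
    if (0 < a.eval C α v ↔ 0 < b.eval C α v) then 0 else 1 := by
  simp only [differ, eval, eval_neg]
  by_cases h : 0 < a.eval C α v <;> by_cases h' : 0 < b.eval C α v <;> simp [h, h']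

theorem ite_pos_iff (p : Prop) [Decidable p] : 0 < (if p then 1 else 0) ↔ p := by
  by_cases h : p <;> simp [h]

/-- The evaluation time is a polynomial in N whose degree is the nesting depth of sums and minima.
Time bounds thereby reduce to a decidable check of the depth. -/
theorem cost_le {N : ℕ} (hN : 1 ≤ N) (e : Expr) : e.cost N ≤ e.cost 1 * N ^ e.dep := by
  have hpos : ∀ k, 1 ≤ N ^ k := fun k => Nat.one_le_pow _ _ hN
  have hup : ∀ {x c k l : ℕ}, x ≤ c * N ^ k → k ≤ l → x ≤ c * N ^ l := fun h hkl =>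
    h.trans (Nat.mul_le_mul_left _ (Nat.pow_le_pow_right hN hkl))
  induction e with
  | var => simp [cost, dep]
  | lit => simp [cost, dep]
  | size => simp [cost, dep]
  | add a b iha ihb =>
    have h1 := hup iha (le_max_left a.dep b.dep)
    have h2 := hup ihb (le_max_right a.dep b.dep)
    have h3 := hpos (max a.dep b.dep)
    simp only [cost, dep]; nlinarith
  | sub a b iha ihb =>
    have h1 := hup iha (le_max_left a.dep b.dep)
    have h2 := hup ihb (le_max_right a.dep b.dep)
    have h3 := hpos (max a.dep b.dep)
    simp only [cost, dep]; nlinarith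
  | mul a b iha ihb =>
    have h1 := hup iha (le_max_left a.dep b.dep)
    have h2 := hup ihb (le_max_right a.dep b.dep)
    have h3 := hpos (max a.dep b.dep)
    simp only [cost, dep]; nlinarith
  | lt a b iha ihb =>
    have h1 := hup iha (le_max_left a.dep b.dep)
    have h2 := hup ihb (le_max_right a.dep b.dep)
    have h3 := hpos (max a.dep b.dep)
    simp only [cost, dep]; nlinarith
  | ite c a b ihc iha ihb =>
    have h0 := hup ihc (le_max_left c.dep (max a.dep b.dep))
    have h1 := hup iha ((le_max_left a.dep b.dep).trans (le_max_right c.dep _))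
    have h2 := hup ihb ((le_max_right a.dep b.dep).trans (le_max_right c.dep _))
    have h3 := hpos (max c.dep (max a.dep b.dep))
    simp only [cost, dep]; nlinarith
  | rd k a b iha ihb =>
    have h1 := hup iha (le_max_left a.dep b.dep)
    have h2 := hup ihb (le_max_right a.dep b.dep)
    have h3 := hpos (max a.dep b.dep)
    simp only [cost, dep]; nlinarith
  | inp e ih =>
    have h3 := hpos e.dep
    simp only [cost, dep]; nlinarith
  | sum x e ih =>
    have h3 := hpos e.dep
    simp only [cost, dep, pow_succ]
    have h4 := Nat.mul_le_mul_left N ih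
    have h5 : N ≤ N ^ e.dep * N := Nat.le_mul_of_pos_left _ h3
    nlinarith
  | mn x e ih =>
    have h3 := hpos e.dep
    simp only [cost, dep, pow_succ]
    have h4 := Nat.mul_le_mul_left N ih
    have h5 : N ≤ N ^ e.dep * N := Nat.le_mul_of_pos_left _ h3
    nlinarith

theorem cost_le_const {N : ℕ} (hN : 1 ≤ N) {e : Expr} (h : e.dep = 0) : e.cost N ≤ e.cost 1 := by
  simpa [h] using cost_le hN e

theorem cost_le_linear {N : ℕ} (hN : 1 ≤ N) {e : Expr} (h : e.dep ≤ 1) :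
    e.cost N ≤ e.cost 1 * N :=
  (cost_le hN e).trans (Nat.mul_le_mul_left _ (by
    simpa using Nat.pow_le_pow_right hN h))

end Expr

/-! ### Specified tables -/

/-- The arrays below `m` hold the values `F`. -/
def Pre (C : Ctx) (F : Arr) (m : ℕ) (α : Arr) : Prop :=
  ∀ k < m, ∀ i < C.N, ∀ j < C.N, α k i j = F k i j

/-- Only arrays in `l` have changed. -/
def Frame (l : List ℕ) (α β : Arr) : Prop := ∀ k, k ∉ l → β k = α k

section

variable {C : Ctx} {v : Env} {α β γ : Arr} {W P : ℕ} {F : Arr} {m : ℕ} {l l' : List ℕ}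

theorem Frame.refl (l : List ℕ) (α : Arr) : Frame l α α := fun _ _ => rfl

theorem Frame.trans (h : Frame l α β) (h' : Frame l β γ) : Frame l α γ :=
  fun k hk => (h' k hk).trans (h k hk)

theorem Frame.mono (h : Frame l α β) (hl : l ⊆ l') : Frame l' α β :=
  fun k hk => h k fun h => hk (hl h)

theorem Frame.update (l : List ℕ) {k : ℕ} (hk : k ∈ l) (f : ℕ → ℕ → ℕ) :
    Frame l α (Function.update α k f) := fun k' hk' => by
  rw [Function.update_of_ne]; rintro rfl; exact hk' hk

theorem Frame.set (l : List ℕ) {k : ℕ} (hk : k ∈ l) (i j x : ℕ) :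
    Frame l α (α.set k i j x) := fun k' hk' => by
  have : k' ≠ k := by rintro rfl; exact hk' hk
  funext i' j'
  simp [Arr.set, this]

theorem Arr.set_self (α : Arr) (k i j x : ℕ) : α.set k i j x k i j = x := by simp [Arr.set]

theorem Arr.set_of_ne (α : Arr) {k k' : ℕ} (i j x : ℕ) (h : k' ≠ k) : α.set k i j x k' = α k' := by
  funext i' j'
  simp [Arr.set, h]

theorem Pre.frame (h : Pre C F m α) (hf : Frame l α β) (hl : ∀ k ∈ l, m ≤ k) : Pre C F m β :=
  fun k hk i hi j hj => by
    rw [hf k fun hkl => absurd (hl k hkl) (by omega)]; exact h k hk i hi j hj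

/-- The constant 29 collects the overheads 17, 8 and 4 of the two nested loops. -/
theorem tab_time {N c : ℕ} (hN : 1 ≤ N) {e : Expr} (h : e.cost N ≤ c * N) :
    N * (N * (e.cost N + 17) + 8) + 4 ≤ (c + 29) * N ^ 3 := by
  have h2 : N ≤ N ^ 2 := by nlinarith
  have h3 : N ^ 2 ≤ N ^ 3 := Nat.pow_le_pow_right hN (by omega)
  calc N * (N * (e.cost N + 17) + 8) + 4 ≤ N * (N * (c * N + 17) + 8) + 4 := by gcongr
    _ = c * N ^ 3 + 17 * N ^ 2 + 8 * N + 4 := by ring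
    _ ≤ (c + 29) * N ^ 3 := by nlinarith

theorem tab_time_const {N c : ℕ} (hN : 1 ≤ N) {e : Expr} (h : e.cost N ≤ c) :
    N * (N * (e.cost N + 17) + 8) + 4 ≤ (c + 29) * N ^ 2 := by
  have h2 : N ≤ N ^ 2 := by nlinarith
  calc N * (N * (e.cost N + 17) + 8) + 4 ≤ N * (N * (c + 17) + 8) + 4 := by gcongr
    _ = c * N ^ 2 + 17 * N ^ 2 + 8 * N + 4 := by ring
    _ ≤ (c + 29) * N ^ 2 := by nlinarith

/-- Compute one more table. -/
theorem Tri.tab_pre (hC : C.Valid W P) (hN : 1 ≤ C.N) {k x y : ℕ} {e : Expr} (hxy : x ≠ y)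
    (he : e.pw ≤ P) (hk : k + 6 ≤ P) (hr : e.reads k = false) (hd : e.dep ≤ 1)
    (h : Pre C F k α) (hF : ∀ i < C.N, ∀ j < C.N,
      e.eval C α (Function.update (Function.update v x i) y j) = F k i j)
    (hB : ∀ i < C.N, ∀ j < C.N, F k i j ≤ C.B) :
    Tri C W (Cmd.tab k x y e) v α ((e.cost 1 + 29) * C.N ^ 3) (Pre C F (k + 1)) := by
  refine Tri.mono (Tri.tab hC hxy he hk hr ?_) (tab_time hN (Expr.cost_le_linear hN hd))
    fun _ h => h
  intro k' hk' i hi j hj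
  rcases (Nat.lt_succ_iff.mp hk').eq_or_lt with rfl | hlt
  · simp only [Function.update_self, hi, hj, and_self, if_true]
    rw [hF i hi j hj, min_eq_left (hB i hi j hj)]
  · rw [Function.update_of_ne (by omega)]; exact h k' hlt i hi j hj

/-- Compute a table as an auxiliary array. -/
theorem Tri.tab_frame (hC : C.Valid W P) (hN : 1 ≤ C.N) {k x y : ℕ} {e : Expr} (hxy : x ≠ y)
    (he : e.pw ≤ P) (hk : k + 6 ≤ P) (hr : e.reads k = false) (hd : e.dep = 0)
    (f : ℕ → ℕ → ℕ) (hF : ∀ i < C.N, ∀ j < C.N,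
      e.eval C α (Function.update (Function.update v x i) y j) = f i j)
    (hB : ∀ i < C.N, ∀ j < C.N, f i j ≤ C.B) :
    Tri C W (Cmd.tab k x y e) v α ((e.cost 1 + 29) * C.N ^ 2)
      (fun β => Frame [k] α β ∧ ∀ i < C.N, ∀ j < C.N, β k i j = f i j) := by
  refine Tri.mono (Tri.tab hC hxy he hk hr ?_) (tab_time_const hN (Expr.cost_le_const hN hd))
    fun _ h => h
  refine ⟨Frame.update _ (by simp) _, fun i hi j hj => ?_⟩
  simp only [Function.update_self, hi, hj, and_self, if_true]
  rw [hF i hi j hj, min_eq_left (hB i hi j hj)]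

/-- Fill a row, as far as a guard holds. -/
theorem Tri.gtab_frame (hC : C.Valid W P) (hN : 1 ≤ C.N) {k x : ℕ} {g e : Expr} (he : e.pw ≤ P)
    (hg : g.pw ≤ P) (hk : k + 6 ≤ P) (hr : e.reads k = false) (hr' : g.reads k = false)
    (hd : g.dep = 0) (hd' : e.dep ≤ 1) (p : ℕ → Prop) [DecidablePred p]
    (hp : ∀ j < C.N, 0 < g.eval C α (Function.update v x j) ↔ p j) (f : ℕ → ℕ)
    (hF : ∀ j < C.N, p j → e.eval C α (Function.update v x j) = f j)
    (hB : ∀ j < C.N, p j → f j ≤ C.B) :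
    Tri C W (Cmd.gtab k x g e) v α ((g.cost 1 + e.cost 1 + 24) *
      ((((Finset.range C.N).filter p).card + 1) * C.N))
      (fun β => Frame [k] α β ∧ ∀ j < C.N, β k 0 j = if p j then f j else α k 0 j) := by
  have hcard : ((Finset.range C.N).filter fun j => 0 < g.eval C α (Function.update v x j)) =
      (Finset.range C.N).filter p :=
    Finset.filter_congr fun j hj => hp j (Finset.mem_range.mp hj)
  refine Tri.mono (Tri.gtab hC he hg hk hr hr' ?_) ?_ fun _ h => h
  · refine ⟨Frame.update _ (by simp) _, fun j hj => ?_⟩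
    simp only [Function.update_self, hj, true_and, hp j hj]
    by_cases h : p j
    · simp only [h, if_true]
      rw [hF j hj h, min_eq_left (hB j hj h)]
    · simp [h]
  · rw [hcard]
    have h1 := Expr.cost_le_const hN hd
    have h2 := Expr.cost_le_linear hN hd'
    generalize ((Finset.range C.N).filter p).card = q
    calc C.N * (g.cost C.N + 7) + q * (e.cost C.N + 13) + 4
        ≤ C.N * (g.cost 1 + 7) + q * (e.cost 1 * C.N + 13 * C.N) + 4 * C.N := by
          gcongr <;> omega
      _ ≤ _ := by
        have e1 : (g.cost 1 + e.cost 1 + 24) * ((q + 1) * C.N) =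
          C.N * (g.cost 1 + 7) + q * (e.cost 1 * C.N + 13 * C.N) + 4 * C.N +
          (q * C.N * (g.cost 1 + 11) + C.N * (e.cost 1 + 13)) := by ring
        omega

/-- Fill a row with constant work per cell. -/
theorem Tri.row_frame (hC : C.Valid W P) (hN : 1 ≤ C.N) {k x : ℕ} {g e : Expr} (he : e.pw ≤ P)
    (hg : g.pw ≤ P) (hk : k + 6 ≤ P) (hr : e.reads k = false) (hr' : g.reads k = false)
    (hd : g.dep = 0) (hd' : e.dep = 0) (p : ℕ → Prop) [DecidablePred p]
    (hp : ∀ j < C.N, 0 < g.eval C α (Function.update v x j) ↔ p j) (f : ℕ → ℕ)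
    (hF : ∀ j < C.N, p j → e.eval C α (Function.update v x j) = f j)
    (hB : ∀ j < C.N, p j → f j ≤ C.B) :
    Tri C W (Cmd.gtab k x g e) v α ((g.cost 1 + e.cost 1 + 24) * C.N)
      (fun β => Frame [k] α β ∧ ∀ j < C.N, β k 0 j = if p j then f j else α k 0 j) := by
  refine Tri.mono (Tri.gtab hC he hg hk hr hr' ?_) ?_ fun _ h => h
  · refine ⟨Frame.update _ (by simp) _, fun j hj => ?_⟩
    simp only [Function.update_self, hj, true_and, hp j hj]
    by_cases h : p j
    · simp only [h, if_true]
      rw [hF j hj h, min_eq_left (hB j hj h)]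
    · simp [h]
  · have h1 := Expr.cost_le_const hN hd
    have h2 := Expr.cost_le_const hN hd'
    have hcard := (Finset.card_filter_le (Finset.range C.N)
      (fun j => 0 < g.eval C α (Function.update v x j))).trans (Finset.card_range _).le
    generalize ((Finset.range C.N).filter fun j =>
      0 < g.eval C α (Function.update v x j)).card = q at *
    calc C.N * (g.cost C.N + 7) + q * (e.cost C.N + 13) + 4
        ≤ C.N * (g.cost 1 + 7) + C.N * (e.cost 1 + 13) + 4 * C.N := by
          gcongr; omega
      _ = _ := by ring

/-- Set a scalar. -/
theorem Tri.scalar (hC : C.Valid W P) (hN : 1 ≤ C.N) {k : ℕ} {e : Expr}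
    (he : e.pw ≤ P) (hk : k + 6 ≤ P) (hP : 1 ≤ P) (hd : e.dep ≤ 1) (x : ℕ)
    (hF : e.eval C α v = x) (hB : x ≤ C.B) :
    Tri C W (Cmd.st k (.lit 0) (.lit 0) e) v α ((e.cost 1 + 13) * C.N)
      (fun β => Frame [k] α β ∧ β k 0 0 = x) := by
  have hQ : 0 < C.Q := (Nat.zero_le _).trans_lt hC.NQ
  refine Tri.mono (Tri.st hC (by simpa [Expr.pw]) (by simpa [Expr.pw]) he hk
    (by simpa [Expr.eval]) (by simpa [Expr.eval]) ?_) ?_ fun _ h => h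
  · refine ⟨Frame.set _ (by simp) _ _ _, ?_⟩
    simp only [Expr.eval]
    rw [Arr.set_self, hF, min_eq_left hB]
  · have h2 := Expr.cost_le_linear hN hd
    simp only [Expr.cost]
    nlinarith

end

end WordRAM

namespace StarIso

open WordRAM Classical Expr

noncomputable section

/-! ### Computing distances -/

/-- The situation in which the algorithm is run, after setting up the parameters. -/
structure Setup (U : SimpleGraph ℕ) (n d : ℕ) (C : Ctx) (W : ℕ) : Prop where
  valid : C.Valid W 2000
  inst : Instance U n d
  size : C.N = n + n
  pos : 1 ≤ n
  bound : (C.N + 2) ^ 3 ≤ C.B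
  left : ∀ i < n, ∀ j < n, C.inp (i * n + j) = adjN U i j
  right : ∀ i < n, ∀ j < n, C.inp (n * n + (i * n + j)) = adjN U (n + i) (n + j)

/-- The variables that hold the input parameters. -/
structure Params (n d : ℕ) (v : Env) : Prop where
  d : v 0 = d
  n : v 1 = n

variable {U : SimpleGraph ℕ} {n d : ℕ} {C : Ctx} {W : ℕ} {v : Env} {α : Arr}

theorem Params.update (h : Params n d v) {x : ℕ} (hx : 2 ≤ x) (i : ℕ) :
    Params n d (Function.update v x i) :=
  ⟨by rw [Function.update_of_ne (by omega)]; exact h.d,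
    by rw [Function.update_of_ne (by omega)]; exact h.n⟩

theorem Setup.one_le (h : Setup U n d C W) : 1 ≤ C.N := by
  have := h.pos; have := h.size; omega

theorem Setup.two_le (h : Setup U n d C W) : 2 ≤ C.N := by
  have := h.pos; have := h.size; omega

theorem Setup.below (h : Setup U n d C W) : Below U C.N := h.size ▸ h.inst.below

theorem Setup.le_bound (h : Setup U n d C W) : 2 * (C.N + 1) * (C.N + 2) ≤ C.B :=
  le_trans (by
    have : 2 * (C.N + 1) ≤ (C.N + 2) * (C.N + 2) := by nlinarith
    calc 2 * (C.N + 1) * (C.N + 2) ≤ (C.N + 2) * (C.N + 2) * (C.N + 2) := by gcongr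
      _ = (C.N + 2) ^ 3 := by ring) h.bound

theorem Setup.size_le (h : Setup U n d C W) : C.N ≤ C.B :=
  le_trans (by nlinarith) h.le_bound

theorem adjN_le (U : SimpleGraph ℕ) (u w : ℕ) : adjN U u w ≤ 1 := by
  unfold adjN; split_ifs <;> omega

theorem adjN_pos {u w : ℕ} : 0 < adjN U u w ↔ U.Adj u w := by
  unfold adjN; split_ifs with h <;> simp [h]

/-- The entries of the adjacency matrix of the disjoint union. -/
def adjExpr : Expr :=
  .ite (.lt (.var 2) (.var 1))
    (.ite (.lt (.var 3) (.var 1)) (.inp (.add (.mul (.var 2) (.var 1)) (.var 3))) (.lit 0))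
    (.ite (.lt (.var 3) (.var 1)) (.lit 0)
      (.inp (.add (.mul (.var 1) (.var 1))
        (.add (.mul (.sub (.var 2) (.var 1)) (.var 1)) (.sub (.var 3) (.var 1))))))

/-- Distances with paths of at most one edge. -/
def edgeDist : Expr :=
  .ite (eqq (.var 2) (.var 3)) (.lit 0) (.ite (.rd 0 (.var 2) (.var 3)) (.lit 1) .size)

/-- Allow paths through the vertex in variable `2`. -/
def relaxed : Expr :=
  .ite (.lt (.add (.rd 1 (.var 3) (.var 2)) (.rd 1 (.var 2) (.var 4))) (.rd 1 (.var 3) (.var 4)))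
    (.add (.rd 1 (.var 3) (.var 2)) (.rd 1 (.var 2) (.var 4))) (.rd 1 (.var 3) (.var 4))

/-- One round of the computation of distances. -/
def relaxRound : Cmd :=
  (Cmd.tab 16 3 4 relaxed).seq (Cmd.tab 1 3 4 (.rd 16 (.var 3) (.var 4)))

/-- Compute the adjacency matrix and the distances. -/
def distances : Cmd :=
  (Cmd.tab 0 2 3 adjExpr).seq ((Cmd.tab 1 2 3 edgeDist).seq (Cmd.loop 2 relaxRound))

theorem adjExpr_eval (h : Setup U n d C W) (hv : Params n d v) {i j : ℕ} (hi : i < C.N)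
    (hj : j < C.N) :
    adjExpr.eval C α (Function.update (Function.update v 2 i) 3 j) = adjN U i j := by
  have hs := h.size
  have hno : ∀ u w, ¬ (u < n ↔ w < n) → adjN U u w = 0 := fun u w h' => by
    unfold adjN
    rw [if_neg fun ha => h' (h.inst.side u w ha)]
  simp only [adjExpr, eval, Function.update_apply, ite_pos_iff]
  simp only [hv.n, Nat.reduceEqDiff, if_true, if_false, OfNat.one_ne_ofNat]
  by_cases h1 : i < n <;> by_cases h2 : j < n <;> simp only [h1, h2, if_true, if_false]
  · exact h.left i h1 j h2
  · exact (hno i j (by tauto)).symm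
  · exact (hno i j (by tauto)).symm
  · rw [h.right (i - n) (by omega) (j - n) (by omega)]
    congr 1 <;> omega

/-- The invariant of the computation of distances: paths through vertices below `k` are taken
into account. -/
structure DistInv (U : SimpleGraph ℕ) (N k : ℕ) (D : ℕ → ℕ → ℕ) : Prop where
  le : ∀ i < N, ∀ j < N, D i j ≤ N
  self : ∀ i < N, D i i = 0
  adj : ∀ i < N, ∀ j < N, U.Adj i j → D i j ≤ 1
  sound : ∀ i < N, ∀ j < N, capDist U N i j ≤ D i j
  tri : ∀ x < k, ∀ i < N, ∀ j < N, D i j ≤ D i x + D x j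

/-- One round of Floyd–Warshall, phrased by triangle inequalities through the vertices treated so
far. If both legs of a detour through x pass through k, the closed part between the two visits of k
can be dropped. -/
theorem DistInv.step {N k : ℕ} {D D' : ℕ → ℕ → ℕ} (hU : Below U N) (h : DistInv U N k D)
    (hk : k < N) (hD : ∀ i < N, ∀ j < N, D' i j = min (D i j) (D i k + D k j)) :
    DistInv U N (k + 1) D' where
  le i hi j hj := by rw [hD i hi j hj]; exact (min_le_left _ _).trans (h.le i hi j hj)
  self i hi := by rw [hD i hi i hi, h.self i hi]; simp
  adj i hi j hj ha := by rw [hD i hi j hj]; exact (min_le_left _ _).trans (h.adj i hi j hj ha)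
  sound i hi j hj := by
    rw [hD i hi j hj]
    refine le_min (h.sound i hi j hj) ((hU.capDist_triangle (x := k) hj).trans ?_)
    exact Nat.add_le_add (h.sound i hi k hk) (h.sound k hk j hj)
  tri x hx i hi j hj := by
    have hxN : x < N := by omega
    rw [hD i hi j hj, hD i hi x hxN, hD x hxN j hj]
    rcases (Nat.lt_succ_iff.mp hx).eq_or_lt with rfl | hlt
    · have := h.self x hk; omega
    · have h1 := h.tri x hlt i hi j hj
      have h2 := h.tri x hlt i hi k hk
      have h3 := h.tri x hlt k hk j hj
      omega

/-- Triangle inequalities through all vertices bound D by the length of any walk; the cap N deals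
with unreachable pairs. -/
theorem DistInv.eq_capDist {N : ℕ} {D : ℕ → ℕ → ℕ} (hU : Below U N) (h : DistInv U N N D) {i j : ℕ}
    (hi : i < N) (hj : j < N) : D i j = capDist U N i j := by
  refine le_antisymm ?_ (h.sound i hi j hj)
  by_cases hr : U.Reachable i j
  · have key : ∀ {a b : ℕ} (p : U.Walk a b), b < N → D a b ≤ p.length := by
      intro a b p hb
      induction p with
      | nil => rw [h.self _ hb]; simp
      | @cons a c b hac p ih =>
        have hc := hU _ _ hac.symm
        have ha := hU _ _ hac
        have h1 := h.tri c hc a ha b hb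
        have h2 := h.adj a ha c hc hac
        have h3 := ih hb
        simp only [SimpleGraph.Walk.length_cons]
        omega
    obtain ⟨p, hp⟩ := hr.exists_walk_length_eq_dist
    have := key p hj
    rw [capDist, if_pos hr]; omega
  · rw [capDist, if_neg hr]; exact h.le i hi j hj

/-- The new distances are written to the buffer 16 and copied back, because a table may not be read
by the expression that fills it. -/
theorem exists_distances : ∃ K, ∀ (U : SimpleGraph ℕ) (n d : ℕ) (C : Ctx) (W : ℕ) (v : Env)
    (α : Arr), Setup U n d C W → Params n d v → Tri C W distances v α (K * C.N ^ 3) (fun β =>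
      ∀ i < C.N, ∀ j < C.N, β 0 i j = adjN U i j ∧ β 1 i j = capDist U C.N i j) := by
  refine ⟨(adjExpr.cost 1 + 29) + ((edgeDist.cost 1 + 29) +
    (relaxed.cost 1 + (Expr.rd 16 (.var 3) (.var 4)).cost 1 + 66)), fun U n d C W v α h hv => ?_⟩
  have hN := h.one_le
  have hNB := h.size_le
  have hup : C.N ^ 2 ≤ C.N ^ 3 := Nat.pow_le_pow_right hN (by omega)
  refine Tri.seq (Tri.tab_frame h.valid hN (by decide) (by decide) (by decide) (by decide)
    (by decide) (fun i j => adjN U i j) (fun i hi j hj => adjExpr_eval h hv hi hj)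
    fun i _ j _ => (adjN_le U i j).trans (hN.trans hNB)) (fun β hβ => ?_)
    (T₂ := ((edgeDist.cost 1 + 29) +
    (relaxed.cost 1 + (Expr.rd 16 (.var 3) (.var 4)).cost 1 + 66)) * C.N ^ 3)
    (by rw [add_mul (adjExpr.cost 1 + 29)]; gcongr)
  refine Tri.seq (Tri.tab_frame h.valid hN (by decide) (by decide) (by decide) (by decide)
    (by decide) (fun i j => if i = j then 0 else if U.Adj i j then 1 else C.N) ?_ ?_)
    (fun γ hγ => ?_)
    (T₂ := (relaxed.cost 1 + (Expr.rd 16 (.var 3) (.var 4)).cost 1 + 66) * C.N ^ 3)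
    (by rw [add_mul (edgeDist.cost 1 + 29)]; gcongr)
  · intro i hi j hj
    simp only [edgeDist, eval, eval_eqq, Function.update_apply, ite_pos_iff]
    simp [hβ.2 i hi j hj, adjN_pos]
  · intro i hi j hj
    split_ifs <;> omega
  have hγ0 : ∀ i < C.N, ∀ j < C.N, γ 0 i j = adjN U i j := fun i hi j hj => by
    rw [hγ.1 0 (by decide)]; exact hβ.2 i hi j hj
  have hinit : DistInv U C.N 0 (γ 1) := by
    refine ⟨fun i hi j hj => ?_, fun i hi => ?_, fun i hi j hj ha => ?_, fun i hi j hj => ?_,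
      fun x hx => absurd hx (by omega)⟩
    · rw [hγ.2 i hi j hj]; split_ifs <;> omega
    · rw [hγ.2 i hi i hi]; simp
    · rw [hγ.2 i hi j hj]; split_ifs <;> omega
    · rw [hγ.2 i hi j hj]
      split_ifs with h1 h2
      · rw [h1, capDist_self]
      · exact (capDist_le_one h.two_le).mpr (Or.inr h2)
      · exact h.below.capDist_le hj
  refine Tri.mono (Tri.loop h.valid (by decide) (fun k β => (∀ i < C.N, ∀ j < C.N,
      β 0 i j = adjN U i j) ∧ DistInv U C.N k (β 1))
    (fun _ => (relaxed.cost 1 + 29) * C.N ^ 2 +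
      ((Expr.rd 16 (.var 3) (.var 4)).cost 1 + 29) * C.N ^ 2) ?_ ⟨hγ0, hinit⟩) ?_ ?_
  · rintro k hk δ ⟨hδ0, hδ⟩
    refine Tri.seq (Tri.tab_frame h.valid hN (by decide) (by decide) (by decide) (by decide)
      (by decide) (fun i j => min (δ 1 i j) (δ 1 i k + δ 1 k j)) ?_ ?_) (fun ε hε => ?_) le_rfl
    · intro i hi j hj
      simp only [relaxed, eval, Function.update_apply, ite_pos_iff]
      simp only [Nat.reduceEqDiff, if_true, if_false]
      split_ifs <;> omega
    · intro i hi j hj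
      exact (min_le_left _ _).trans ((hδ.le i hi j hj).trans hNB)
    · refine Tri.mono (Tri.tab_frame h.valid hN (by decide) (by decide) (by decide) (by decide)
        (by decide) (fun i j => min (δ 1 i j) (δ 1 i k + δ 1 k j)) ?_ ?_) le_rfl
        (fun ζ hζ => ⟨?_, hδ.step h.below hk fun i hi j hj => hζ.2 i hi j hj⟩)
      · intro i hi j hj
        simp [eval, hε.2 i hi j hj]
      · intro i hi j hj
        exact (min_le_left _ _).trans ((hδ.le i hi j hj).trans hNB)
      · intro i hi j hj
        rw [hζ.1 0 (by decide), hε.1 0 (by decide)]; exact hδ0 i hi j hj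
  · rw [Finset.sum_const, Finset.card_range, smul_eq_mul]
    generalize relaxed.cost 1 = c₁
    generalize (Expr.rd 16 (.var 3) (.var 4)).cost 1 = c₂
    have : C.N ≤ C.N ^ 3 := Nat.le_self_pow (by omega) _
    calc _ = (c₁ + c₂ + 58) * C.N ^ 3 + 4 * C.N + 4 := by ring
      _ ≤ _ := by nlinarith
  · rintro β ⟨h0, h1⟩ i hi j hj
    exact ⟨h0 i hi j hj, h1.eq_capDist h.below hi hj⟩

end

end StarIso

namespace StarIso

open WordRAM Classical Expr

noncomputable section

/-! ### Cliques from a simplicial elimination -/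

variable {U : SimpleGraph ℕ} {n d : ℕ} {C : Ctx} {W : ℕ} {v : Env} {α : Arr} {N : ℕ}

/-- The vertices that have not been eliminated. -/
def remaining (N : ℕ) (rem : ℕ → ℕ) : Finset ℕ := (Finset.range N).filter fun u => rem u = 1

/-- The invariant of the elimination, after `t` rounds. -/
structure ElimInv (U : SimpleGraph ℕ) (N t : ℕ) (rem : ℕ → ℕ) (cn cl : ℕ → ℕ → ℕ) : Prop where
  rem_le : ∀ u < N, rem u ≤ 1
  card : (remaining N rem).card + t = N
  count : ∀ i < N, ∀ j < N, cn i j = ((remaining N rem).filter fun z =>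
    capDist U N z i ≤ 1 ∧ capDist U N z j ≤ 1).card
  self : ∀ v < N, rem v = 0 → cl v v = 1
  cl_le : ∀ v < N, rem v = 0 → ∀ w < N, cl v w ≤ 1
  clique : ∀ v < N, rem v = 0 → ∀ w < N, ∀ w' < N, cl v w = 1 → cl v w' = 1 →
    capDist U N w w' ≤ 1
  cover : ∀ M : Set ℕ, (∀ u ∈ M, u < N) → (∀ u ∈ M, ∀ w ∈ M, capDist U N u w ≤ 1) →
    (∃ u ∈ M, rem u = 0) → ∃ v ∈ M, rem v = 0 ∧ ∀ u ∈ M, cl v u = 1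

theorem mem_remaining {rem : ℕ → ℕ} {u : ℕ} : u ∈ remaining N rem ↔ u < N ∧ rem u = 1 := by
  simp [remaining]

/-- For closed neighbourhoods among the remaining vertices, u is simplicial when every neighbour w
contains the whole neighbourhood of u, that is, when u and w have as many common neighbours as u has
with itself. With the counts stored, the test of u takes linear time. -/
theorem simplicial_iff {t : ℕ} {rem : ℕ → ℕ} {cn cl : ℕ → ℕ → ℕ} (h : ElimInv U N t rem cn cl)
    {u : ℕ} (hu : u < N) :
    (∀ w ∈ remaining N rem, capDist U N u w ≤ 1 → ¬ cn u w < cn u u) ↔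
      ∀ w ∈ remaining N rem, ∀ z ∈ remaining N rem, capDist U N u w ≤ 1 → capDist U N u z ≤ 1 →
        capDist U N z w ≤ 1 := by
  refine forall₂_congr fun w hw => ?_
  rw [forall_comm]
  rw [← forall_comm (α := capDist U N u w ≤ 1)]
  have key : capDist U N u w ≤ 1 → (¬ cn u w < cn u u ↔
      ∀ z ∈ remaining N rem, capDist U N u z ≤ 1 → capDist U N z w ≤ 1) := by
    intro _
    rw [h.count u hu w (mem_remaining.mp hw).1, h.count u hu u hu, not_lt]
    constructor
    · intro hle z hz hzu
      rw [capDist_comm] at hzu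
      have := Finset.eq_of_subset_of_card_le (s := (remaining N rem).filter fun z =>
        capDist U N z u ≤ 1 ∧ capDist U N z w ≤ 1) (t := (remaining N rem).filter fun z =>
        capDist U N z u ≤ 1 ∧ capDist U N z u ≤ 1)
        (fun x hx => by
          rw [Finset.mem_filter] at hx ⊢; exact ⟨hx.1, hx.2.1, hx.2.1⟩) hle
      have hz' : z ∈ (remaining N rem).filter fun z => capDist U N z u ≤ 1 ∧ capDist U N z u ≤ 1 :=
        Finset.mem_filter.mpr ⟨hz, hzu, hzu⟩
      rw [← this, Finset.mem_filter] at hz'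
      exact hz'.2.2
    · intro hz
      refine Finset.card_le_card fun z hz' => ?_
      rw [Finset.mem_filter] at hz' ⊢
      exact ⟨hz'.1, hz'.2.1, hz z hz'.1 (by rw [capDist_comm]; exact hz'.2.1)⟩
  constructor
  · intro h1 z hz h2 h3
    exact (key h2).mp (h1 h2) z hz h3
  · intro h1 h2
    exact (key h2).mpr fun z hz h3 => h1 z hz h2 h3

/-- The clique recorded for p is its closed neighbourhood among the remaining vertices. A clique M
is covered by the clique of the first of its members to be eliminated, since all the others were
still present then. -/
theorem ElimInv.step {t p : ℕ} {rem rem' : ℕ → ℕ} {cn cl cn' cl' : ℕ → ℕ → ℕ}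
    (h : ElimInv U N t rem cn cl) (hp : p < N) (hrp : rem p = 1)
    (hs : ∀ w ∈ remaining N rem, ∀ z ∈ remaining N rem, capDist U N p w ≤ 1 →
      capDist U N p z ≤ 1 → capDist U N z w ≤ 1)
    (hrem : ∀ u < N, rem' u = if u = p then 0 else rem u)
    (hcn : ∀ i < N, ∀ j < N, cn' i j =
      cn i j - if capDist U N p i ≤ 1 ∧ capDist U N p j ≤ 1 then 1 else 0)
    (hcl : ∀ u < N, ∀ w < N, cl' u w =
      if u = p then (if rem w = 1 ∧ capDist U N p w ≤ 1 then 1 else 0) else cl u w) :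
    ElimInv U N (t + 1) rem' cn' cl' := by
  have hpm : p ∈ remaining N rem := mem_remaining.mpr ⟨hp, hrp⟩
  have herase : remaining N rem' = (remaining N rem).erase p := by
    ext u
    rw [Finset.mem_erase, mem_remaining, mem_remaining]
    constructor
    · rintro ⟨h1, h2⟩
      rw [hrem u h1] at h2
      split_ifs at h2 with h3
      exact ⟨h3, h1, h2⟩
    · rintro ⟨h1, h2, h3⟩
      exact ⟨h2, by rw [hrem u h2, if_neg h1, h3]⟩
  have h0 : ∀ u < N, rem' u = 0 → u ≠ p → rem u = 0 := fun u hu hu0 hne => by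
    rwa [hrem u hu, if_neg hne] at hu0
  refine ⟨fun u hu => ?_, ?_, fun i hi j hj => ?_, fun u hu hu0 => ?_, fun u hu hu0 w hw => ?_,
    fun u hu hu0 w hw w' hw' h1 h2 => ?_, fun M hM hM' hne => ?_⟩
  · rw [hrem u hu]; have := h.rem_le u hu; split_ifs <;> omega
  · have := h.card
    have h2 := Finset.card_erase_add_one hpm
    rw [herase]; omega
  · rw [hcn i hi j hj, h.count i hi j hj, herase, Finset.filter_erase]
    split_ifs with hc
    · rw [Finset.card_erase_of_mem (Finset.mem_filter.mpr ⟨hpm, hc⟩)]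
    · have hnot : p ∉ (remaining N rem).filter fun z =>
          capDist U N z i ≤ 1 ∧ capDist U N z j ≤ 1 := fun hm => hc (Finset.mem_filter.mp hm).2
      rw [Finset.erase_eq_of_notMem hnot, Nat.sub_zero]
  · rw [hcl u hu u hu]
    split_ifs with h1 h2
    · rfl
    · exact absurd ⟨h1 ▸ hrp, by rw [h1, capDist_self]; omega⟩ h2
    · exact h.self u hu (h0 u hu hu0 h1)
  · rw [hcl u hu w hw]
    split_ifs with h1
    · exact le_rfl
    · omega
    · exact h.cl_le u hu (h0 u hu hu0 h1) w hw
  · rw [hcl u hu w hw] at h1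
    rw [hcl u hu w' hw'] at h2
    by_cases hup : u = p
    · rw [if_pos hup] at h1 h2
      split_ifs at h1 h2 with h3 h4
      exact hs w' (mem_remaining.mpr ⟨hw', h4.1⟩) w (mem_remaining.mpr ⟨hw, h3.1⟩) h4.2 h3.2
    · rw [if_neg hup] at h1 h2
      exact h.clique u hu (h0 u hu hu0 hup) w hw w' hw' h1 h2
  · by_cases hex : ∃ u ∈ M, rem u = 0
    · obtain ⟨x, hx, hx0, hcov⟩ := h.cover M hM hM' hex
      have hne : x ≠ p := by rintro rfl; omega
      refine ⟨x, hx, by rw [hrem x (hM x hx), if_neg hne, hx0], fun u hu => ?_⟩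
      rw [hcl x (hM x hx) u (hM u hu), if_neg hne]; exact hcov u hu
    · have hall : ∀ u ∈ M, rem u = 1 := fun u hu => by
        have := h.rem_le u (hM u hu)
        have : rem u ≠ 0 := fun h => hex ⟨u, hu, h⟩
        omega
      obtain ⟨u, hu, hu0⟩ := hne
      have hup : u = p := by
        by_contra hne
        rw [hrem u (hM u hu), if_neg hne, hall u hu] at hu0
        omega
      subst hup
      refine ⟨u, hu, hu0, fun w hw => ?_⟩
      rw [hcl u hp w (hM w hw), if_pos rfl, if_pos ⟨hall w hw, hM' u hu w hw⟩]

/-- A family of cliques that contains all maximal cliques. -/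
structure CliqueFamily (U : SimpleGraph ℕ) (N : ℕ) (K : ℕ → Set ℕ) : Prop where
  lt : ∀ v < N, ∀ w ∈ K v, w < N
  self : ∀ v < N, v ∈ K v
  clique : ∀ v < N, ∀ w ∈ K v, ∀ w' ∈ K v, w ≠ w' → U.Adj w w'
  cover : ∀ M : Set ℕ, (∀ u ∈ M, u < N) → (∀ u ∈ M, ∀ w ∈ M, u ≠ w → U.Adj u w) → M.Nonempty →
    ∃ v ∈ M, M ⊆ K v

theorem ElimInv.cliqueFamily {rem : ℕ → ℕ} {cn cl : ℕ → ℕ → ℕ} (hN : 2 ≤ N)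
    (h : ElimInv U N N rem cn cl) :
    CliqueFamily U N (fun v => {w | w < N ∧ cl v w = 1}) ∧
      ∀ v < N, ∀ w < N, cl v w = if w < N ∧ cl v w = 1 then 1 else 0 := by
  have h0 : ∀ v < N, rem v = 0 := fun v hv => by
    have h1 : remaining N rem = ∅ := by
      rw [← Finset.card_eq_zero]; have := h.card; omega
    have h2 : v ∉ remaining N rem := by simp [h1]
    have := h.rem_le v hv
    rw [mem_remaining] at h2
    have : rem v ≠ 1 := fun h => h2 ⟨hv, h⟩
    omega
  refine ⟨⟨fun v hv w hw => hw.1, fun v hv => ⟨hv, h.self v hv (h0 v hv)⟩,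
    fun v hv w hw w' hw' hne => ?_, fun M hM hM' hne => ?_⟩, fun v hv w hw => ?_⟩
  · exact ((capDist_le_one hN).mp
      (h.clique v hv (h0 v hv) w hw.1 w' hw'.1 hw.2 hw'.2)).resolve_left hne
  · obtain ⟨u, hu⟩ := hne
    obtain ⟨v, hv, -, hc⟩ := h.cover M hM (fun u hu w hw => (capDist_le_one hN).mpr (by
      by_cases e : u = w
      · exact Or.inl e
      · exact Or.inr (hM' u hu w hw e))) ⟨u, hu, h0 u (hM u hu)⟩
    exact ⟨v, hv, fun u hu => ⟨hM u hu, hc u hu⟩⟩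
  · have := h.cl_le v hv (h0 v hv) w hw
    simp only [hw, true_and]
    split_ifs <;> omega

/-! #### The program -/

theorem indicator_le (p : Prop) [Decidable p] : (if p then 1 else 0) ≤ 1 := by
  split_ifs <;> omega

/-- The number of remaining common neighbours, where vertices are their own neighbours. -/
def commonExpr : Expr :=
  .sum 4 (conj (le (.rd 1 (.var 4) (.var 2)) (.lit 1)) (le (.rd 1 (.var 4) (.var 3)) (.lit 1)))

/-- The number of remaining neighbours of the vertex in variable `3` that witness that it is not
simplicial. -/
def violations : Expr :=
  .sum 4 (conj (.rd 17 (.lit 0) (.var 4)) (conj (le (.rd 1 (.var 3) (.var 4)) (.lit 1))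
    (.lt (.rd 18 (.var 3) (.var 4)) (.rd 18 (.var 3) (.var 3)))))

/-- The first simplicial vertex. -/
def pickExpr : Expr :=
  .mn 3 (.ite (conj (.rd 17 (.lit 0) (.var 3)) (neg (.rd 20 (.lit 0) (.var 3)))) (.var 3) .size)

/-- The vertex to be eliminated. -/
def picked : Expr := .rd 21 (.lit 0) (.lit 0)

/-- Membership in the clique of the eliminated vertex. -/
def cliqueExpr : Expr :=
  conj (.rd 17 (.lit 0) (.var 3)) (le (.rd 1 picked (.var 3)) (.lit 1))

/-- The number of common neighbours after the elimination. -/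
def commonUpdate : Expr :=
  .sub (.rd 18 (.var 3) (.var 4))
    (conj (le (.rd 1 picked (.var 3)) (.lit 1)) (le (.rd 1 picked (.var 4)) (.lit 1)))

/-- One round of the elimination. -/
def elimRound : Cmd :=
  (Cmd.gtab 20 3 (.lit 1) violations).seq <| (Cmd.st 21 (.lit 0) (.lit 0) pickExpr).seq <|
  (Cmd.loop 3 (Cmd.st 2 picked (.var 3) cliqueExpr)).seq <|
  (Cmd.tab 19 3 4 commonUpdate).seq <|
  (Cmd.tab 18 3 4 (.rd 19 (.var 3) (.var 4))).seq (Cmd.st 17 (.lit 0) picked (.lit 0))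

/-- Eliminate all vertices. -/
def elimination : Cmd :=
  (Cmd.gtab 17 2 (.lit 1) (.lit 1)).seq <| (Cmd.tab 18 2 3 commonExpr).seq (Cmd.loop 2 elimRound)

/-- What the elimination maintains in memory. -/
structure ElimMem (U : SimpleGraph ℕ) (N t : ℕ) (β : Arr) : Prop where
  adj : ∀ i < N, ∀ j < N, β 0 i j = adjN U i j
  dist : ∀ i < N, ∀ j < N, β 1 i j = capDist U N i j
  inv : ElimInv U N t (β 17 0) (β 18) (β 2)

theorem violations_eval {t : ℕ} {β : Arr} (hm : ElimMem U C.N t β) {u : ℕ}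
    (hu : u < C.N) : violations.eval C β (Function.update v 3 u) = 0 ↔
      ∀ w ∈ remaining C.N (β 17 0), ∀ z ∈ remaining C.N (β 17 0), capDist U C.N u w ≤ 1 →
        capDist U C.N u z ≤ 1 → capDist U C.N z w ≤ 1 := by
  rw [← simplicial_iff hm.inv hu]
  simp only [violations, eval, eval_conj, eval_leq, Function.update_apply, ite_pos_iff]
  simp only [Nat.reduceEqDiff, if_true, if_false]
  rw [Finset.sum_eq_zero_iff]
  refine forall_congr' fun w => ?_
  rw [Finset.mem_range, mem_remaining, and_imp]
  refine forall_congr' fun hw => ?_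
  have h1 := hm.inv.rem_le w hw
  rw [hm.dist u hu w hw]
  have h2 : 0 < β 17 0 w ↔ β 17 0 w = 1 := by omega
  simp only [h2]
  by_cases ha : β 17 0 w = 1 <;> by_cases hb : capDist U C.N u w ≤ 1 <;> simp [ha, hb]

theorem pickExpr_eval (h : Setup U n d C W) {t : ℕ} {β : Arr} (hm : ElimMem U C.N t β)
    (ht : t < C.N) (hs : ∀ u < C.N, β 20 0 u = 0 ↔ ∀ w ∈ remaining C.N (β 17 0),
      ∀ z ∈ remaining C.N (β 17 0), capDist U C.N u w ≤ 1 → capDist U C.N u z ≤ 1 →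
        capDist U C.N z w ≤ 1) :
    ∃ p < C.N, pickExpr.eval C β v = p ∧ β 17 0 p = 1 ∧ ∀ w ∈ remaining C.N (β 17 0),
      ∀ z ∈ remaining C.N (β 17 0), capDist U C.N p w ≤ 1 → capDist U C.N p z ≤ 1 →
        capDist U C.N z w ≤ 1 := by
  have hne : (remaining C.N (β 17 0)).Nonempty := by
    rw [← Finset.card_pos]; have := hm.inv.card; omega
  obtain ⟨x, hx, hsx⟩ := h.inst.simplicial (↑(remaining C.N (β 17 0)))
    (fun u hu => h.size ▸ (mem_remaining.mp hu).1) hne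
  have hx' := mem_remaining.mp hx
  have hx0 : β 20 0 x = 0 := by
    rw [hs x hx'.1]
    intro w hw z hz h1 h2
    rw [capDist_le_one h.two_le] at h1 h2 ⊢
    by_cases hzw : z = w
    · exact Or.inl hzw
    rcases h1 with rfl | h1
    · exact Or.inr (h2.resolve_left fun e => hzw e.symm).symm
    · rcases h2 with rfl | h2
      · exact Or.inr h1
      · exact Or.inr (hsx z hz w hw h2 h1 hzw)
  have heval : pickExpr.eval C β v = minTo C.N (fun u =>
      if 0 < β 17 0 u ∧ β 20 0 u = 0 then u else C.N) C.N := by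
    simp only [pickExpr, eval, eval_conj, eval_neg, Function.update_apply, ite_pos_iff]
    refine minTo_congr fun u hu => ?_
    simp only [if_true]
    by_cases h1 : β 20 0 u = 0 <;> simp [h1, Nat.pos_iff_ne_zero]
  have hle := minTo_le (M := C.N) (f := fun u =>
      if 0 < β 17 0 u ∧ β 20 0 u = 0 then u else C.N) hx'.1
  rw [← heval, if_pos ⟨by omega, hx0⟩] at hle
  rcases minTo_eq_top_or C.N (fun u =>
      if 0 < β 17 0 u ∧ β 20 0 u = 0 then u else C.N) C.N with h1 | ⟨p, hp, h1⟩
  · omega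
  · rw [← heval] at h1
    split_ifs at h1 with h2
    · have := hm.inv.rem_le p hp
      exact ⟨p, hp, h1, by omega, (hs p hp).mp h2.2⟩
    · omega

/-- A round is quadratic because the counts of common neighbours are corrected by at most one per
pair instead of being recomputed. -/
theorem exists_elimRound : ∃ K, ∀ (U : SimpleGraph ℕ) (n d : ℕ) (C : Ctx) (W : ℕ) (v : Env)
    (β : Arr) (t : ℕ), Setup U n d C W → ElimMem U C.N t β → t < C.N →
      Tri C W elimRound v β (K * C.N ^ 2) (ElimMem U C.N (t + 1)) := by
  refine ⟨2 * ((Expr.lit 1).cost 1 + violations.cost 1 + 24) + (pickExpr.cost 1 + 13) +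
    (picked.cost 1 + 1 + cliqueExpr.cost 1 + 11 + 8) + (commonUpdate.cost 1 + 29) +
    ((Expr.rd 19 (.var 3) (.var 4)).cost 1 + 29) + (picked.cost 1 + 13),
    fun U n d C W v β t h hm ht => ?_⟩
  have hN := h.one_le
  have hNB := h.size_le
  have hNQ := h.valid.NQ
  have hN2 : C.N ≤ C.N ^ 2 := Nat.le_self_pow (by omega) _
  refine Tri.mono (T₁ := ((Expr.lit 1).cost 1 + violations.cost 1 + 24) * ((C.N + 1) * C.N) +
    ((pickExpr.cost 1 + 13) * C.N + ((picked.cost 1 + 1 + cliqueExpr.cost 1 + 11 + 8) * C.N +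
    ((commonUpdate.cost 1 + 29) * C.N ^ 2 +
    (((Expr.rd 19 (.var 3) (.var 4)).cost 1 + 29) * C.N ^ 2 + (picked.cost 1 + 13) * C.N)))))
    (Q := ElimMem U C.N (t + 1)) ?_ ?_ fun _ h => h
  rotate_left
  · generalize (Expr.lit 1).cost 1 + violations.cost 1 + 24 = c₁
    generalize pickExpr.cost 1 + 13 = c₂
    generalize picked.cost 1 + 1 + cliqueExpr.cost 1 + 11 + 8 = c₃
    generalize commonUpdate.cost 1 + 29 = c₄
    generalize (Expr.rd 19 (.var 3) (.var 4)).cost 1 + 29 = c₅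
    generalize picked.cost 1 + 13 = c₆
    calc _ = c₁ * C.N ^ 2 + c₁ * C.N + c₂ * C.N + c₃ * C.N + c₄ * C.N ^ 2 + c₅ * C.N ^ 2 +
          c₆ * C.N := by ring
      _ ≤ c₁ * C.N ^ 2 + c₁ * C.N ^ 2 + c₂ * C.N ^ 2 + c₃ * C.N ^ 2 + c₄ * C.N ^ 2 +
          c₅ * C.N ^ 2 + c₆ * C.N ^ 2 := by gcongr
      _ = _ := by ring
  refine Tri.seq (Tri.mono (Tri.gtab_frame h.valid hN (by decide) (by decide) (by decide) rfl rfl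
    rfl (by decide) (fun _ => True) (fun j hj => by simp [eval])
    (fun u => violations.eval C β (Function.update v 3 u)) (fun _ _ _ => rfl) ?_) ?_ fun _ h => h)
    (fun β₁ h₁ => ?_) le_rfl
  · intro u hu _
    simp only [violations, eval, eval_conj]
    exact (Finset.sum_le_card_nsmul _ _ 1 fun w _ => indicator_le _).trans (by simpa using hNB)
  · simp
  have hm₁ : ElimMem U C.N t β₁ := by
    refine ⟨?_, ?_, ?_⟩
    · rw [h₁.1 0 (by decide)]; exact hm.adj
    · rw [h₁.1 1 (by decide)]; exact hm.dist
    · rw [h₁.1 17 (by decide), h₁.1 18 (by decide), h₁.1 2 (by decide)]; exact hm.inv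
  obtain ⟨p, hp, hpe, hp1, hps⟩ := pickExpr_eval (v := v) h hm₁ ht (fun u hu => by
    rw [h₁.2 u hu, if_pos trivial, h₁.1 17 (by decide)]; exact violations_eval hm hu)
  refine Tri.seq (Tri.scalar h.valid hN (by decide) (by decide) (by decide) (by decide) p hpe
    (by omega)) (fun β₂ h₂ => ?_) le_rfl
  have hm₂ : ElimMem U C.N t β₂ := by
    refine ⟨?_, ?_, ?_⟩
    · rw [h₂.1 0 (by decide)]; exact hm₁.adj
    · rw [h₂.1 1 (by decide)]; exact hm₁.dist
    · rw [h₂.1 17 (by decide), h₂.1 18 (by decide), h₂.1 2 (by decide)]; exact hm₁.inv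
  have h17 : β₂ 17 = β₁ 17 := h₂.1 17 (by decide)
  rw [← h17] at hp1 hps
  refine Tri.seq (Tri.mono (Tri.loop h.valid (by decide) (fun k γ => Frame [2] β₂ γ ∧
      ∀ u < C.N, ∀ w < C.N, γ 2 u w = if u = p ∧ w < k then
        (if β₂ 17 0 w = 1 ∧ capDist U C.N p w ≤ 1 then 1 else 0) else β₂ 2 u w)
    (fun _ => picked.cost C.N + 1 + cliqueExpr.cost C.N + 11) ?_
    ⟨Frame.refl _ _, fun u _ w _ => by simp⟩) ?_ fun _ h => h) (fun β₃ h₃ => ?_) le_rfl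
  · rintro k hk γ ⟨hγ, hγ2⟩
    have hpk : picked.eval C γ (Function.update v 3 k) = p := by
      simp only [picked, eval]; rw [hγ 21 (by decide)]; exact h₂.2
    refine Tri.st h.valid (by decide) (by decide) (by decide) (by decide) (by rw [hpk]; omega)
      (by simp only [eval, Function.update_self]; omega) ?_
    rw [hpk]
    have hce : cliqueExpr.eval C γ (Function.update v 3 k) =
        if β₂ 17 0 k = 1 ∧ capDist U C.N p k ≤ 1 then 1 else 0 := by
      simp only [cliqueExpr, eval_conj, eval_leq, eval, hpk, Function.update_self, ite_pos_iff]
      rw [hγ 17 (by decide), hγ 1 (by decide), hm₂.dist p hp k hk]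
      have := hm₂.inv.rem_le k hk
      have e : 0 < β₂ 17 0 k ↔ β₂ 17 0 k = 1 := by omega
      simp only [e]
    refine ⟨hγ.trans (Frame.set _ (by simp) _ _ _), fun u hu w hw => ?_⟩
    simp only [eval, Function.update_self, Arr.set, true_and, hce]
    by_cases e : u = p ∧ w = k
    · have hlt : u = p ∧ w < k + 1 := ⟨e.1, by omega⟩
      rw [if_pos e, if_pos hlt, min_eq_left ((indicator_le _).trans (hN.trans hNB)), e.2]
    · rw [if_neg e, hγ2 u hu w hw]
      congr 1
      simp only [eq_iff_iff]
      constructor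
      · rintro ⟨h1, h2⟩; exact ⟨h1, by omega⟩
      · rintro ⟨h1, h2⟩; exact ⟨h1, by have : w ≠ k := fun hw => e ⟨h1, hw⟩; omega⟩
  · rw [Finset.sum_const, Finset.card_range, smul_eq_mul]
    have e1 := cost_le_const hN (e := picked) (by decide)
    have e2 := cost_le_const hN (e := cliqueExpr) (by decide)
    calc C.N * (picked.cost C.N + 1 + cliqueExpr.cost C.N + 11 + 4) + 4
        ≤ C.N * (picked.cost 1 + 1 + cliqueExpr.cost 1 + 11 + 4) + 4 * C.N := by gcongr; omega
      _ = _ := by ring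
  have hpk₃ : ∀ w, picked.eval C β₃ w = p := fun w => by
    simp only [picked, eval]; rw [h₃.1 21 (by decide)]; exact h₂.2
  have hd₃ : ∀ i < C.N, ∀ j < C.N, β₃ 1 i j = capDist U C.N i j := by
    rw [h₃.1 1 (by decide)]; exact hm₂.dist
  have hB₂ : ∀ i < C.N, ∀ j < C.N, β₂ 18 i j ≤ C.B := fun i hi j hj => by
    rw [hm₂.inv.count i hi j hj]
    refine (Finset.card_filter_le _ _).trans ?_
    have := hm₂.inv.card
    omega
  refine Tri.seq (Tri.tab_frame h.valid hN (by decide) (by decide) (by decide) rfl rfl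
    (fun i j => β₂ 18 i j - if capDist U C.N p i ≤ 1 ∧ capDist U C.N p j ≤ 1 then 1 else 0) ?_ ?_)
    (fun β₄ h₄ => ?_) le_rfl
  · intro i hi j hj
    simp only [commonUpdate, eval, eval_conj, eval_leq, hpk₃, Function.update_apply, ite_pos_iff]
    simp only [Nat.reduceEqDiff, if_true, if_false]
    rw [hd₃ p hp i hi, hd₃ p hp j hj, h₃.1 18 (by decide)]
  · intro i hi j hj
    exact (Nat.sub_le _ _).trans (hB₂ i hi j hj)
  refine Tri.seq (Tri.tab_frame h.valid hN (by decide) (by decide) (by decide) rfl rfl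
    (fun i j => β₂ 18 i j - if capDist U C.N p i ≤ 1 ∧ capDist U C.N p j ≤ 1 then 1 else 0) ?_ ?_)
    (fun β₅ h₅ => ?_) le_rfl
  · intro i hi j hj
    simp [eval, h₄.2 i hi j hj]
  · intro i hi j hj
    exact (Nat.sub_le _ _).trans (hB₂ i hi j hj)
  have hpk₅ : ∀ w, picked.eval C β₅ w = p := fun w => by
    simp only [picked, eval]
    rw [h₅.1 21 (by decide), h₄.1 21 (by decide), h₃.1 21 (by decide)]; exact h₂.2
  refine Tri.mono (Tri.st (Q := ElimMem U C.N (t + 1)) h.valid (by decide) (by decide) (by decide)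
    (by decide)
    (by simp only [eval]; omega) (by rw [hpk₅]; omega) ?_) ?_ fun _ h => h
  · rw [hpk₅]
    simp only [eval, Nat.zero_min]
    refine ⟨?_, ?_, ?_⟩
    · rw [Arr.set_of_ne _ _ _ _ (by decide), h₅.1 0 (by decide), h₄.1 0 (by decide),
        h₃.1 0 (by decide)]
      exact hm₂.adj
    · rw [Arr.set_of_ne _ _ _ _ (by decide), h₅.1 1 (by decide), h₄.1 1 (by decide)]
      exact hd₃
    · refine hm₂.inv.step hp hp1 hps (fun u hu => ?_) (fun i hi j hj => ?_) (fun u hu w hw => ?_)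
      · simp only [Arr.set, true_and]
        rw [h₅.1 17 (by decide), h₄.1 17 (by decide), h₃.1 17 (by decide)]
      · rw [Arr.set_of_ne _ _ _ _ (by decide), h₅.2 i hi j hj]
      · rw [Arr.set_of_ne _ _ _ _ (by decide), h₅.1 2 (by decide), h₄.1 2 (by decide),
          h₃.2 u hu w hw]
        simp only [hw, and_true]
  · have e1 := cost_le_const hN (e := picked) (by decide)
    simp only [cost]
    nlinarith

theorem exists_elimination : ∃ K, ∀ (U : SimpleGraph ℕ) (n d : ℕ) (C : Ctx) (W : ℕ) (v : Env)
    (α : Arr), Setup U n d C W →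
      (∀ i < C.N, ∀ j < C.N, α 0 i j = adjN U i j ∧ α 1 i j = capDist U C.N i j) →
      Tri C W elimination v α (K * C.N ^ 3) (fun β => ∃ F : ℕ → Set ℕ, CliqueFamily U C.N F ∧
        ∀ i < C.N, ∀ j < C.N, β 0 i j = adjN U i j ∧ β 1 i j = capDist U C.N i j ∧
          β 2 i j = if j ∈ F i then 1 else 0) := by
  obtain ⟨K, hK⟩ := exists_elimRound
  refine ⟨((Expr.lit 1).cost 1 + (Expr.lit 1).cost 1 + 24) + (commonExpr.cost 1 + 29) + (K + 8),
    fun U n d C W v α h hα => ?_⟩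
  have hN := h.one_le
  have hNB := h.size_le
  have hN3 : C.N ≤ C.N ^ 3 := Nat.le_self_pow (by omega) _
  refine Tri.mono (T₁ := ((Expr.lit 1).cost 1 + (Expr.lit 1).cost 1 + 24) * C.N +
    ((commonExpr.cost 1 + 29) * C.N ^ 3 + (K + 8) * C.N ^ 3)) ?_ ?_ fun _ h => h
  rotate_left
  · generalize (Expr.lit 1).cost 1 + (Expr.lit 1).cost 1 + 24 = c₁
    generalize commonExpr.cost 1 + 29 = c₂
    have := Nat.mul_le_mul_left c₁ hN3
    calc c₁ * C.N + (c₂ * C.N ^ 3 + (K + 8) * C.N ^ 3)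
        ≤ c₁ * C.N ^ 3 + (c₂ * C.N ^ 3 + (K + 8) * C.N ^ 3) := by gcongr
      _ = _ := by ring
  refine Tri.seq (Tri.row_frame h.valid hN (by decide) (by decide) (by decide) rfl rfl rfl rfl
    (fun _ => True) (fun j hj => by simp [eval]) (fun _ => 1) (fun _ _ _ => rfl)
    (fun _ _ _ => by omega)) (fun β₁ h₁ => ?_) le_rfl
  refine Tri.seq (Tri.mono (Tri.tab (Q := fun β => Frame [18] β₁ β ∧ ∀ i < C.N, ∀ j < C.N,
    β 18 i j = ((Finset.range C.N).filter fun z =>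
      capDist U C.N z i ≤ 1 ∧ capDist U C.N z j ≤ 1).card) h.valid (by decide) (by decide)
    (by decide) rfl ?_) (tab_time hN (cost_le_linear hN (by decide))) fun _ h => h)
    (fun β₂ h₂ => ?_) le_rfl
  · refine ⟨Frame.update _ (by simp) _, fun i hi j hj => ?_⟩
    simp only [Function.update_self, hi, hj, and_self, if_true]
    have : commonExpr.eval C β₁ (Function.update (Function.update v 2 i) 3 j) =
        ((Finset.range C.N).filter fun z =>
          capDist U C.N z i ≤ 1 ∧ capDist U C.N z j ≤ 1).card := by
      simp only [commonExpr, eval, eval_conj, eval_leq, Function.update_apply, ite_pos_iff]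
      simp only [Nat.reduceEqDiff, if_true, if_false]
      rw [Finset.card_filter]
      refine Finset.sum_congr rfl fun z hz => ?_
      rw [Finset.mem_range] at hz
      rw [h₁.1 1 (by decide), (hα z hz i hi).2, (hα z hz j hj).2]
    rw [this, min_eq_left]
    exact ((Finset.card_filter_le _ _).trans (by simp)).trans hNB
  have h17 : ∀ u < C.N, β₂ 17 0 u = 1 := fun u hu => by
    rw [h₂.1 17 (by decide), h₁.2 u hu, if_pos trivial]
  have hrem : remaining C.N (β₂ 17 0) = Finset.range C.N :=
    Finset.filter_true_of_mem fun u hu => h17 u (Finset.mem_range.mp hu)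
  have hinit : ElimMem U C.N 0 β₂ := by
    refine ⟨fun i hi j hj => ?_, fun i hi j hj => ?_, ?_, ?_, ?_, ?_, ?_, ?_, ?_⟩
    · rw [h₂.1 0 (by decide), h₁.1 0 (by decide)]; exact (hα i hi j hj).1
    · rw [h₂.1 1 (by decide), h₁.1 1 (by decide)]; exact (hα i hi j hj).2
    · intro u hu; rw [h17 u hu]
    · rw [hrem]; simp
    · rw [hrem]; exact h₂.2
    · intro u hu h0; rw [h17 u hu] at h0; omega
    · intro u hu h0; rw [h17 u hu] at h0; omega
    · intro u hu h0; rw [h17 u hu] at h0; omega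
    · rintro M hM - ⟨u, hu, h0⟩; rw [h17 u (hM u hu)] at h0; omega
  refine Tri.mono (Tri.loop h.valid (by decide) (fun t β => ElimMem U C.N t β)
    (fun _ => K * C.N ^ 2) (fun t ht β hβ => hK U n d C W _ β t h hβ ht) hinit) ?_ ?_
  · rw [Finset.sum_const, Finset.card_range, smul_eq_mul]
    calc C.N * (K * C.N ^ 2 + 4) + 4 = K * C.N ^ 3 + 4 * C.N + 4 := by ring
      _ ≤ (K + 8) * C.N ^ 3 := by nlinarith
  · intro β hβ
    obtain ⟨h1, h2⟩ := hβ.inv.cliqueFamily h.two_le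
    refine ⟨_, h1, fun i hi j hj => ⟨hβ.adj i hi j hj, hβ.dist i hi j hj, ?_⟩⟩
    rw [h2 i hi j hj]
    by_cases hc : j < C.N ∧ β 2 i j = 1
    · rw [if_pos hc]; exact (if_pos hc).symm
    · rw [if_neg hc]; exact (if_neg hc).symm

end

end StarIso

namespace StarIso

open WordRAM Classical Expr

noncomputable section

/-! ### Tables for all anchors -/

section

variable (U : SimpleGraph ℕ) (N : ℕ) (C : Set ℕ)

/-- The first vertex with the same ray and key. -/
def aRep (u : ℕ) : ℕ :=
  minTo N (fun w => if aLab U N C w = aLab U N C u ∧ aKey U N C w = aKey U N C u then w else N) N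

/-- The vertex `u` does not violate the conditions for a good anchor. -/
def GoodAt (u : ℕ) : Prop :=
  (u ∉ C → ∃ c < N, c ∈ C ∧ 1 < capDist U N c u) ∧
  (aLab U N C u < N → (∀ z < N, (nearZ U N C z u ↔ nearZ U N C z (aLab U N C u))) ∧
    ∀ y < N, (capDist U N u y ≤ 1 ↔ capDist U N (aRep U N C u) y ≤ 1))

variable {U N C}

theorem aRep_spec {u : ℕ} (hu : u < N) : aRep U N C u < N ∧
    aLab U N C (aRep U N C u) = aLab U N C u ∧ aKey U N C (aRep U N C u) = aKey U N C u := by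
  have hle : aRep U N C u ≤ u := by
    have := minTo_le (M := N) (f := fun w => if aLab U N C w = aLab U N C u ∧
      aKey U N C w = aKey U N C u then w else N) hu
    simpa [aRep] using this
  rcases minTo_eq_top_or N (fun w => if aLab U N C w = aLab U N C u ∧
      aKey U N C w = aKey U N C u then w else N) N with h | ⟨w, hw, h⟩
  · unfold aRep at hle; omega
  · split_ifs at h with h1
    · rw [aRep, h]; exact ⟨hw, h1⟩
    · unfold aRep at hle; omega

/-- Comparing all pairs of tied vertices would take cubic time per anchor. Comparing each vertex
with the first one of its class takes quadratic time, so all N anchors are tested in cubic time. -/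
theorem good_iff {d : ℕ} : Good U N C d ↔ (∀ u < N, GoodAt U N C u) ∧ aR U N C ≤ d := by
  constructor
  · intro h
    refine ⟨fun u hu => ⟨fun huC => ?_, fun hl => ⟨h.near u hu hl, ?_⟩⟩, h.rays⟩
    · by_contra hcon
      exact huC (h.maximal u hu fun c hc hcC => by
        by_contra hlt
        exact hcon ⟨c, hc, hcC, by omega⟩)
    · obtain ⟨h1, h2, h3⟩ := aRep_spec (U := U) (C := C) hu
      exact h.ties u hu _ h1 hl h2.symm h3.symm
  · rintro ⟨h, hr⟩
    refine ⟨fun u hu hc => ?_, fun u hu hl => ((h u hu).2 hl).1,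
      fun u hu w hw hl e1 e2 y hy => ?_, hr⟩
    · by_contra huC
      obtain ⟨c, h1, h2, h3⟩ := (h u hu).1 huC
      have := hc c h1 h2
      omega
    · have e : aRep U N C u = aRep U N C w := by unfold aRep; rw [e1, e2]
      rw [((h u hu).2 hl).2 y hy, ((h w hw).2 (e1 ▸ hl)).2 y hy, e]

end

/-- The contents of the tables, for the family `K` of anchors. -/
def spec (U : SimpleGraph ℕ) (N d : ℕ) (K : ℕ → Set ℕ) : Arr
  | 0, i, j => adjN U i j
  | 1, i, j => capDist U N i j
  | 2, a, u => if u ∈ K a then 1 else 0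
  | 3, a, u => aDist U N (K a) u
  | 4, a, u => aLab U N (K a) u
  | 5, a, u => aKey U N (K a) u
  | 6, a, z => if z ∈ aRoots U N (K a) then 1 else 0
  | 7, a, u => aIdx U N (K a) u
  | 8, a, u => aPos U N (K a) u
  | 9, a, u => aRep U N (K a) u
  | 10, a, _ => aR U N (K a)
  | 11, a, _ => (aX U N (K a)).card
  | 12, a, _ => (aC N (K a)).card
  | 13, a, u => if GoodAt U N (K a) u then 0 else 1
  | 14, a, _ => if Good U N (K a) d then 1 else 0
  | 15, a, _ => if Good U N (K a) d ∧ ∀ b < N, b < a → Good U N (K b) d → ¬ capDist U N b a < N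
      then 1 else 0
  | _, _, _ => 0

/-- The relation `nearZ` for the anchor in variable `2`. -/
def nearExpr (z u : Expr) : Expr :=
  conj (eqq (.rd 3 (.var 2) z) (.lit 1)) (le (.rd 1 z u) (.rd 3 (.var 2) u))

/-- The expressions by which the tables are computed. -/
def tableExpr : ℕ → Expr
  | 3 => .mn 4 (.ite (.rd 2 (.var 2) (.var 4)) (.rd 1 (.var 4) (.var 3)) .size)
  | 4 => .ite (conj (.rd 3 (.var 2) (.var 3)) (.lt (.rd 3 (.var 2) (.var 3)) .size))
      (.mn 4 (.ite (nearExpr (.var 4) (.var 3)) (.var 4) .size)) .size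
  | 5 => .add (.mul (.rd 3 (.var 2) (.var 3)) (.mul (.lit 2) (.add .size (.lit 1))))
      (.sub (.add (.add .size (.lit 1)) (.sum 4 (conj (.rd 0 (.var 4) (.var 3))
          (eqq (.rd 3 (.var 2) (.var 4)) (.add (.rd 3 (.var 2) (.var 3)) (.lit 1))))))
        (.sum 4 (conj (.rd 0 (.var 4) (.var 3))
          (eqq (.add (.rd 3 (.var 2) (.var 4)) (.lit 1)) (.rd 3 (.var 2) (.var 3))))))
  | 6 => .lt (.lit 0) (.sum 4 (eqq (.rd 4 (.var 2) (.var 4)) (.var 3)))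
  | 7 => .sum 4 (conj (.rd 6 (.var 2) (.var 4)) (.lt (.var 4) (.rd 4 (.var 2) (.var 3))))
  | 8 => .sum 4 (conj (eqq (.rd 4 (.var 2) (.var 4)) (.rd 4 (.var 2) (.var 3)))
      (disj (.lt (.rd 5 (.var 2) (.var 4)) (.rd 5 (.var 2) (.var 3)))
        (conj (eqq (.rd 5 (.var 2) (.var 4)) (.rd 5 (.var 2) (.var 3))) (.lt (.var 4) (.var 3)))))
  | 9 => .mn 4 (.ite (conj (eqq (.rd 4 (.var 2) (.var 4)) (.rd 4 (.var 2) (.var 3)))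
      (eqq (.rd 5 (.var 2) (.var 4)) (.rd 5 (.var 2) (.var 3)))) (.var 4) .size)
  | 10 => .sum 4 (.rd 6 (.var 2) (.var 4))
  | 11 => .sum 4 (.lt (.rd 4 (.var 2) (.var 4)) .size)
  | 12 => .sum 4 (.rd 2 (.var 2) (.var 4))
  | 13 => disj (conj (neg (.rd 2 (.var 2) (.var 3)))
        (neg (.sum 4 (conj (.rd 2 (.var 2) (.var 4)) (.lt (.lit 1) (.rd 1 (.var 4) (.var 3)))))))
      (conj (.lt (.rd 4 (.var 2) (.var 3)) .size)
        (disj (.sum 4 (differ (nearExpr (.var 4) (.var 3))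
            (nearExpr (.var 4) (.rd 4 (.var 2) (.var 3)))))
          (.sum 4 (differ (le (.rd 1 (.var 3) (.var 4)) (.lit 1))
            (le (.rd 1 (.rd 9 (.var 2) (.var 3)) (.var 4)) (.lit 1))))))
  | 14 => conj (neg (.sum 4 (.rd 13 (.var 2) (.var 4)))) (le (.rd 10 (.var 2) (.var 3)) (.var 0))
  | 15 => conj (.rd 14 (.var 2) (.var 3)) (neg (.sum 4 (conj (.lt (.var 4) (.var 2))
      (conj (.rd 14 (.var 4) (.var 3)) (.lt (.rd 1 (.var 4) (.var 2)) .size)))))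
  | _ => .lit 0

/-- Compute the tables from `3` on. -/
def tables : ℕ → Cmd
  | 0 => Cmd.skip
  | m + 1 => (tables m).seq (Cmd.tab (m + 3) 2 3 (tableExpr (m + 3)))

variable {U : SimpleGraph ℕ} {n d : ℕ} {C : Ctx} {W : ℕ} {v : Env} {α : Arr} {N : ℕ}
  {K : ℕ → Set ℕ}

theorem eval_sum_card {x : ℕ} {e : Expr} {p : ℕ → Prop} [DecidablePred p]
    (h : ∀ i < C.N, e.eval C α (Function.update v x i) = if p i then 1 else 0) :
    (Expr.sum x e).eval C α v = ((Finset.range C.N).filter p).card := by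
  rw [Finset.card_filter]
  exact Finset.sum_congr rfl fun i hi => h i (Finset.mem_range.mp hi)

theorem eval_sum_pos {x : ℕ} {e : Expr} {p : ℕ → Prop}
    (h : ∀ i < C.N, 0 < e.eval C α (Function.update v x i) ↔ p i) :
    0 < (Expr.sum x e).eval C α v ↔ ∃ i < C.N, p i := by
  rw [Nat.pos_iff_ne_zero, Ne, Expr.eval, Finset.sum_eq_zero_iff]
  push Not
  constructor
  · rintro ⟨i, hi, h1⟩
    rw [Finset.mem_range] at hi
    exact ⟨i, hi, (h i hi).mp (Nat.pos_of_ne_zero h1)⟩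
  · rintro ⟨i, hi, h1⟩
    exact ⟨i, Finset.mem_range.mpr hi, Nat.pos_iff_ne_zero.mp ((h i hi).mpr h1)⟩

theorem pos_ite_zero_iff (p : Prop) [Decidable p] : 0 < (if p then 0 else 1) ↔ ¬ p := by
  by_cases h : p <;> simp [h]

theorem CliqueFamily.anchor (hK : CliqueFamily U N K) (hU : Below U N) (hN : 2 ≤ N) {a : ℕ}
    (ha : a < N) : Anchor U N (K a) :=
  ⟨hU, hN, hK.lt a ha, hK.clique a ha, a, hK.self a ha⟩

/-- Each table depends only on tables with smaller numbers, so they can be computed in increasing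
order. -/
theorem tableExpr_eval (hv : Params n d v) {k : ℕ} (hk : 3 ≤ k) (hk' : k < 16) (hα : Pre C (spec U C.N d K) k α) {a u : ℕ} (ha : a < C.N)
    (hu : u < C.N) :
    (tableExpr k).eval C α (Function.update (Function.update v 2 a) 3 u) = spec U C.N d K k a u := by
  have hval : ∀ k' < k, ∀ i < C.N, ∀ j < C.N, α k' i j = spec U C.N d K k' i j := hα
  interval_cases k
  · simp only [tableExpr, eval, Function.update_apply, Nat.reduceEqDiff, if_true, if_false]
    refine minTo_congr fun c hc => ?_
    rw [hval 2 (by omega) a ha c hc, hval 1 (by omega) c hc u hu]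
    simp only [spec, ite_pos_iff]
  · have e3 : ∀ i < C.N, α 3 a i = aDist U C.N (K a) i := fun i hi => hval 3 (by omega) a ha i hi
    simp only [tableExpr, nearExpr, eval, eval_conj, eval_eqq, eval_leq, Function.update_apply,
      Nat.reduceEqDiff, if_true, if_false, ite_pos_iff]
    simp only [spec, aLab, e3 u hu]
    by_cases hc : inX U C.N (K a) u
    · rw [if_pos (show 0 < _ ∧ _ < _ from hc), if_pos hc]
      refine minTo_congr fun z hz => ?_
      rw [e3 z hz, hval 1 (by omega) z hz u hu]
      by_cases hn : nearZ U C.N (K a) z u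
      · rw [if_pos hn]; exact if_pos hn
      · rw [if_neg hn]; exact if_neg hn
    · rw [if_neg (show ¬ (0 < _ ∧ _ < _) from hc), if_neg hc]
  · have e3 : ∀ i < C.N, α 3 a i = aDist U C.N (K a) i := fun i hi => hval 3 (by omega) a ha i hi
    have e0 : ∀ i < C.N, 0 < α 0 i u ↔ U.Adj i u := fun i hi => by
      rw [hval 0 (by omega) i hi u hu]; exact adjN_pos
    simp only [tableExpr, eval, eval_conj, eval_eqq, Function.update_apply,
      Nat.reduceEqDiff, if_true, if_false, ite_pos_iff]
    simp only [spec, aKey, aUp, aDown, e3 u hu, Finset.card_filter]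
    congr 2
    · congr 1
      refine Finset.sum_congr rfl fun w hw => ?_
      rw [Finset.mem_range] at hw
      simp only [e3 w hw, e0 w hw]
    · refine Finset.sum_congr rfl fun w hw => ?_
      rw [Finset.mem_range] at hw
      simp only [e3 w hw, e0 w hw]
  · have e4 : ∀ i < C.N, α 4 a i = aLab U C.N (K a) i := fun i hi => hval 4 (by omega) a ha i hi
    simp only [tableExpr, eval.eq_7, eval.eq_2]
    rw [show spec U C.N d K 6 a u = if u ∈ aRoots U C.N (K a) then 1 else 0 from rfl]
    refine if_congr ?_ rfl rfl
    rw [eval_sum_pos (p := fun i => aLab U C.N (K a) i = u)]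
    · simp only [aRoots, Finset.mem_filter, Finset.mem_range, hu, true_and]
    · intro i hi
      simp only [eval, eval_eqq, Function.update_apply, Nat.reduceEqDiff, if_true, if_false,
        e4 i hi, ite_pos_iff]
  · rw [show spec U C.N d K 7 a u = aIdx U C.N (K a) u from rfl, aIdx, aRoots, Finset.filter_filter]
    refine eval_sum_card fun z hz => ?_
    simp only [eval, eval_conj, Function.update_apply, Nat.reduceEqDiff, if_true,
      if_false, ite_pos_iff]
    rw [hval 6 (by omega) a ha z hz, hval 4 (by omega) a ha u hu]
    simp only [spec, ite_pos_iff, aRoots, Finset.mem_filter, Finset.mem_range, hz, true_and]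
  · rw [show spec U C.N d K 8 a u = aPos U C.N (K a) u from rfl, aPos]
    refine eval_sum_card fun z hz => ?_
    simp only [eval, eval_conj, eval_disj, eval_eqq, Function.update_apply, Nat.reduceEqDiff,
      if_true, if_false, ite_pos_iff]
    rw [hval 4 (by omega) a ha z hz, hval 4 (by omega) a ha u hu, hval 5 (by omega) a ha z hz,
      hval 5 (by omega) a ha u hu]
    simp only [spec]
  · simp only [tableExpr, eval, eval_conj, eval_eqq, Function.update_apply,
      Nat.reduceEqDiff, if_true, if_false, ite_pos_iff]
    refine minTo_congr fun w hw => ?_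
    rw [hval 4 (by omega) a ha w hw, hval 4 (by omega) a ha u hu, hval 5 (by omega) a ha w hw,
      hval 5 (by omega) a ha u hu]
    simp only [spec]
  · rw [show spec U C.N d K 10 a u = aR U C.N (K a) from rfl, aR, aRoots]
    refine eval_sum_card fun z hz => ?_
    simp only [eval, Function.update_apply, Nat.reduceEqDiff, if_true, if_false]
    rw [hval 6 (by omega) a ha z hz]
    simp only [spec, aRoots, Finset.mem_filter, Finset.mem_range, hz, true_and]
  · rw [show spec U C.N d K 11 a u = (aX U C.N (K a)).card from rfl, aX]
    refine eval_sum_card fun z hz => ?_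
    simp only [eval, Function.update_apply, Nat.reduceEqDiff, if_true, if_false]
    rw [hval 4 (by omega) a ha z hz]
    simp only [spec]
  · rw [show spec U C.N d K 12 a u = (aC C.N (K a)).card from rfl, aC]
    refine eval_sum_card fun z hz => ?_
    simp only [eval, Function.update_apply, Nat.reduceEqDiff, if_true, if_false]
    rw [hval 2 (by omega) a ha z hz]
    simp only [spec]
  · have e2 : ∀ i < C.N, 0 < α 2 a i ↔ i ∈ K a := fun i hi => by
      rw [hval 2 (by omega) a ha i hi]; exact ite_pos_iff _
    have e3 : ∀ i < C.N, α 3 a i = aDist U C.N (K a) i := fun i hi => hval 3 (by omega) a ha i hi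
    have e4 : α 4 a u = aLab U C.N (K a) u := hval 4 (by omega) a ha u hu
    have e9 : α 9 a u = aRep U C.N (K a) u := hval 9 (by omega) a ha u hu
    have e1 : ∀ i < C.N, ∀ j < C.N, α 1 i j = capDist U C.N i j := fun i hi j hj =>
      hval 1 (by omega) i hi j hj
    have hmax := eval_sum_pos (C := C) (α := α) (x := 4)
      (e := conj (.rd 2 (.var 2) (.var 4)) (.lt (.lit 1) (.rd 1 (.var 4) (.var 3))))
      (v := Function.update (Function.update v 2 a) 3 u)
      (p := fun c => c ∈ K a ∧ 1 < capDist U C.N c u) (fun i hi => by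
        simp only [eval, eval_conj, Function.update_apply, Nat.reduceEqDiff, if_true, if_false,
          ite_pos_iff]
        rw [e2 i hi, e1 i hi u hu])
    -- The expression looks up entries at the label of u, which lies inside the tables only if the
    -- label is a vertex.
    have hnear (hl : aLab U C.N (K a) u < C.N) := eval_sum_pos (C := C) (α := α) (x := 4)
      (e := differ (nearExpr (.var 4) (.var 3)) (nearExpr (.var 4) (.rd 4 (.var 2) (.var 3))))
      (v := Function.update (Function.update v 2 a) 3 u)
      (p := fun z => ¬ (nearZ U C.N (K a) z u ↔ nearZ U C.N (K a) z (aLab U C.N (K a) u)))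
      (fun i hi => by
        simp only [eval, eval_conj, eval_differ, nearExpr, eval_eqq, eval_leq,
          Function.update_apply, Nat.reduceEqDiff, if_true, if_false, ite_pos_iff,
          pos_ite_zero_iff]
        rw [e4, e3 i hi, e3 u hu, e3 _ hl, e1 i hi u hu, e1 i hi _ hl]
        rfl)
    have hties := eval_sum_pos (C := C) (α := α) (x := 4)
      (e := differ (le (.rd 1 (.var 3) (.var 4)) (.lit 1))
        (le (.rd 1 (.rd 9 (.var 2) (.var 3)) (.var 4)) (.lit 1)))
      (v := Function.update (Function.update v 2 a) 3 u)
      (p := fun y => ¬ (capDist U C.N u y ≤ 1 ↔ capDist U C.N (aRep U C.N (K a) u) y ≤ 1))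
      (fun i hi => by
        simp only [eval, eval_differ, eval_leq,
          Function.update_apply, Nat.reduceEqDiff, if_true, if_false, ite_pos_iff,
          pos_ite_zero_iff]
        rw [e9, e1 u hu i hi, e1 _ (aRep_spec hu).1 i hi])
    have hlab : 0 < (Expr.lt (.rd 4 (.var 2) (.var 3)) .size).eval C α
        (Function.update (Function.update v 2 a) 3 u) ↔ aLab U C.N (K a) u < C.N := by
      simp only [eval, Function.update_apply, Nat.reduceEqDiff, if_true, if_false, ite_pos_iff, e4]
    have hcl : 0 < (Expr.rd 2 (.var 2) (.var 3)).eval C α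
        (Function.update (Function.update v 2 a) 3 u) ↔ u ∈ K a := by
      simp only [eval, Function.update_apply, Nat.reduceEqDiff, if_true, if_false, e2 u hu]
    rw [show spec U C.N d K 13 a u = if GoodAt U C.N (K a) u then 0 else 1 from rfl, tableExpr,
      eval_disj, eval_conj, eval_conj, eval_disj, eval_neg, eval_neg]
    simp only [ite_pos_iff, pos_ite_zero_iff, hlab, hcl, hmax, hties]
    by_cases hg : GoodAt U C.N (K a) u
    · rw [if_pos hg, if_neg]
      rintro (⟨h1, h2⟩ | ⟨h1, h2⟩)
      · exact h2 (hg.1 h1)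
      · obtain ⟨g1, g2⟩ := hg.2 h1
        rcases h2 with h2 | ⟨y, hy, h2⟩
        · obtain ⟨z, hz, h3⟩ := (hnear h1).mp h2
          exact h3 (g1 z hz)
        · exact h2 (g2 y hy)
    · rw [if_neg hg, if_pos]
      by_contra hcon
      rw [not_or] at hcon
      refine hg ⟨fun h1 => ?_, fun h1 => ⟨fun z hz => ?_, fun y hy => ?_⟩⟩
      · by_contra h2
        exact hcon.1 ⟨h1, h2⟩
      · by_contra h2
        exact hcon.2 ⟨h1, Or.inl ((hnear h1).mpr ⟨z, hz, h2⟩)⟩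
      · by_contra h2
        exact hcon.2 ⟨h1, Or.inr ⟨y, hy, h2⟩⟩
  · have e13 : ∀ i < C.N, 0 < α 13 a i ↔ ¬ GoodAt U C.N (K a) i := fun i hi => by
      rw [hval 13 (by omega) a ha i hi]; exact pos_ite_zero_iff _
    rw [show spec U C.N d K 14 a u = if Good U C.N (K a) d then 1 else 0 from rfl, tableExpr,
      eval_conj]
    refine if_congr ?_ rfl rfl
    rw [good_iff, eval_leq, eval_neg, ite_pos_iff]
    refine and_congr ?_ ?_
    · have := eval_sum_pos (C := C) (α := α) (x := 4) (e := .rd 13 (.var 2) (.var 4))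
        (v := Function.update (Function.update v 2 a) 3 u) (p := fun i => ¬ GoodAt U C.N (K a) i)
        (fun i hi => by
          simp only [eval, Function.update_apply, Nat.reduceEqDiff, if_true, if_false]
          exact e13 i hi)
      by_cases hc : 0 < eval C α (.sum 4 (.rd 13 (.var 2) (.var 4)))
          (Function.update (Function.update v 2 a) 3 u)
      · simp only [hc, if_true, lt_irrefl, false_iff]
        obtain ⟨i, hi, h1⟩ := this.mp hc
        exact fun h2 => h1 (h2 i hi)
      · simp only [hc, if_false, true_iff, zero_lt_one]
        intro i hi
        by_contra h1
        exact hc (this.mpr ⟨i, hi, h1⟩)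
    · simp only [eval, Function.update_apply, Nat.reduceEqDiff, if_true, if_false]
      rw [hval 10 (by omega) a ha u hu]
      simp only [spec]
      simp [hv.d]
  · have e14 : ∀ i < C.N, 0 < α 14 i u ↔ Good U C.N (K i) d := fun i hi => by
      rw [hval 14 (by omega) i hi u hu]; exact ite_pos_iff _
    rw [show spec U C.N d K 15 a u = if Good U C.N (K a) d ∧ ∀ b < C.N, b < a →
      Good U C.N (K b) d → ¬ capDist U C.N b a < C.N then 1 else 0 from rfl, tableExpr, eval_conj]
    refine if_congr (and_congr ?_ ?_) rfl rfl
    · simp only [eval, Function.update_apply, Nat.reduceEqDiff, if_true, if_false]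
      exact e14 a ha
    · have := eval_sum_pos (C := C) (α := α) (x := 4) (e := conj (.lt (.var 4) (.var 2))
          (conj (.rd 14 (.var 4) (.var 3)) (.lt (.rd 1 (.var 4) (.var 2)) .size)))
        (v := Function.update (Function.update v 2 a) 3 u)
        (p := fun b => b < a ∧ Good U C.N (K b) d ∧ capDist U C.N b a < C.N)
        (fun i hi => by
          simp only [eval, eval_conj, Function.update_apply, Nat.reduceEqDiff, if_true, if_false,
            ite_pos_iff]
          rw [e14 i hi, hval 1 (by omega) i hi a ha]
          simp only [spec])
      rw [eval_neg]
      split_ifs with hc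
      · simp only [lt_irrefl, false_iff]
        obtain ⟨b, hb, h1, h2, h3⟩ := this.mp hc
        exact fun h4 => h4 b hb h1 h2 h3
      · simp only [zero_lt_one, true_iff]
        intro b hb h1 h2 h3
        exact hc (this.mpr ⟨b, hb, h1, h2, h3⟩)

theorem spec_le (h : Setup U n d C W) (K : ℕ → Set ℕ) (k : ℕ) {a u : ℕ} (ha : a < C.N)
    (hu : u < C.N) : spec U C.N d K k a u ≤ C.B := by
  have hNB := h.size_le
  have hN := h.one_le
  have hc : ∀ (p : ℕ → Prop) [DecidablePred p], ((Finset.range C.N).filter p).card ≤ C.B := fun p _ =>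
    ((Finset.card_filter_le _ _).trans (by simp)).trans hNB
  have h1 : ∀ (p : Prop) [Decidable p], (if p then 1 else 0) ≤ C.B := fun p _ =>
    (indicator_le p).trans (hN.trans hNB)
  unfold spec
  split
  · exact (adjN_le U _ _).trans (hN.trans hNB)
  · exact (h.below.capDist_le hu).trans hNB
  · exact h1 _
  · exact (minTo_le_top _ _ _).trans hNB
  · unfold aLab
    split_ifs
    · exact (minTo_le_top _ _ _).trans hNB
    · exact hNB
  -- The key is the only entry of quadratic size, and the reason for the bound `le_bound`.
  · have h2 : aDist U C.N (K a) u ≤ C.N := minTo_le_top _ _ _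
    have h3 := aUp_le (U := U) (N := C.N) (C := K a) u
    have h4 := h.le_bound
    unfold aKey
    have h5 := Nat.mul_le_mul_right (2 * (C.N + 1)) h2
    have h6 : C.N + 1 + aUp U C.N (K a) u - aDown U C.N (K a) u ≤ C.N + 1 + C.N := by omega
    nlinarith
  · exact h1 _
  · exact (Finset.card_filter_le _ _).trans (hc _)
  · exact hc _
  · exact (minTo_le_top _ _ _).trans hNB
  · exact hc _
  · exact hc _
  · exact hc _
  · split_ifs <;> omega
  · exact h1 _
  · exact h1 _
  · omega

theorem exists_tables (m : ℕ) (hm : m ≤ 13) : ∃ T, ∀ (U : SimpleGraph ℕ) (n d : ℕ) (C : Ctx) (W : ℕ)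
    (v : Env) (α : Arr) (K : ℕ → Set ℕ), Setup U n d C W → Params n d v →
      Pre C (spec U C.N d K) 3 α →
      Tri C W (tables m) v α (T * C.N ^ 3) (Pre C (spec U C.N d K) (m + 3)) := by
  induction m with
  | zero =>
    refine ⟨1, fun U n d C W v α K h hv hα => Tri.mono (Tri.skip hα) ?_ fun _ h => h⟩
    have := Nat.one_le_pow 3 _ h.one_le
    omega
  | succ m ih =>
    obtain ⟨T, hT⟩ := ih (by omega)
    refine ⟨T + ((tableExpr (m + 3)).cost 1 + 29), fun U n d C W v α K h hv hα => ?_⟩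
    -- Exponents and depths are static data of the expressions and are checked by evaluation. The
    -- number 2000 has no significance beyond being large enough.
    have hpw : ∀ k < 16, (tableExpr k).pw ≤ 2000 ∧ (tableExpr k).reads k = false ∧
        (tableExpr k).dep ≤ 1 := by decide
    obtain ⟨h1, h2, h3⟩ := hpw (m + 3) (by omega)
    refine Tri.seq (hT U n d C W v α K h hv hα) (fun β hβ => ?_) (add_mul _ _ _).ge
    exact Tri.tab_pre h.valid h.one_le (by decide) h1 (by omega) h2 h3 hβ
      (fun i hi j hj => tableExpr_eval hv (by omega) (by omega) hβ hi hj)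
      fun i hi j hj => spec_le h K _ hi hj

end

end StarIso

/-! ### Loops whose body is charged only where its guard holds -/

namespace WordRAM

/-- A loop whose body is guarded. -/
theorem Tri.gloop {C : Ctx} {v : Env} {α : Arr} {W P x T : ℕ} {g : Expr} {c : Cmd}
    (hC : C.Valid W P) (hN : 1 ≤ C.N) (hP : 1 ≤ P) (hg : g.pw ≤ P) (hd : g.dep = 0)
    (I : ℕ → Arr → Prop) (p : ℕ → Prop) [DecidablePred p]
    (hp : ∀ i < C.N, ∀ β, I i β → (0 < g.eval C β (Function.update v x i) ↔ p i))
    (hstep : ∀ i < C.N, ∀ β, I i β → p i → Tri C W c (Function.update v x i) β T (I (i + 1)))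
    (hskip : ∀ i < C.N, ∀ β, I i β → ¬ p i → I (i + 1) β) (h0 : I 0 α) :
    Tri C W (Cmd.loop x (Cmd.ite g c Cmd.skip)) v α
      ((g.cost 1 + 11) * C.N + ((Finset.range C.N).filter p).card * T) (I C.N) := by
  refine Tri.mono (Tri.loop hC hP I
    (fun i => g.cost C.N + ((if p i then T else 0) + 1) + 2) (fun i hi β hβ => ?_) h0) ?_
    fun _ h => h
  · refine Tri.ite hC hg (fun h => ?_) (fun h => ?_)
    · rw [hp i hi β hβ] at h
      rw [if_pos h]
      exact Tri.mono (hstep i hi β hβ h) (by omega) fun _ h => h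
    · rw [hp i hi β hβ] at h
      rw [if_neg h]
      exact Tri.skip (hskip i hi β hβ h)
  · have h1 := Expr.cost_le_const hN hd
    have e : ∀ i, g.cost C.N + ((if p i then T else 0) + 1) + 2 + 4 =
        (g.cost C.N + 7) + (if p i then 1 else 0) * T := fun i => by
      split_ifs <;> ring
    simp only [e]
    rw [Finset.sum_add_distrib, ← Finset.sum_mul, ← Finset.card_filter, Finset.sum_const,
      Finset.card_range, smul_eq_mul]
    nlinarith

end WordRAM

namespace StarIso

open WordRAM Classical Expr

noncomputable section

/-! ### Testing one matching of rays -/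

section

variable {U : SimpleGraph ℕ} {n d : ℕ} {C : Ctx} {W : ℕ} {v : Env} {α : Arr} {K : ℕ → Set ℕ}
  {a b x : ℕ}

/-- The tables have been computed. -/
abbrev Tabs (U : SimpleGraph ℕ) (d : ℕ) (C : Ctx) (K : ℕ → Set ℕ) (α : Arr) : Prop :=
  Pre C (spec U C.N d K) 16 α

theorem Tabs.adj (h : Tabs U d C K α) (ha : a < C.N) (hx : x < C.N) : α 0 a x = adjN U a x :=
  h 0 (by omega) a ha x hx

theorem Tabs.dist (h : Tabs U d C K α) (ha : a < C.N) (hx : x < C.N) :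
    α 1 a x = capDist U C.N a x := h 1 (by omega) a ha x hx

theorem Tabs.clique (h : Tabs U d C K α) (ha : a < C.N) (hx : x < C.N) :
    0 < α 2 a x ↔ x ∈ K a := by
  rw [h 2 (by omega) a ha x hx]; exact ite_pos_iff _

theorem Tabs.lab (h : Tabs U d C K α) (ha : a < C.N) (hx : x < C.N) :
    α 4 a x = aLab U C.N (K a) x := h 4 (by omega) a ha x hx

theorem Tabs.idx (h : Tabs U d C K α) (ha : a < C.N) (hx : x < C.N) :
    α 7 a x = aIdx U C.N (K a) x := h 7 (by omega) a ha x hx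

theorem Tabs.pos (h : Tabs U d C K α) (ha : a < C.N) (hx : x < C.N) :
    α 8 a x = aPos U C.N (K a) x := h 8 (by omega) a ha x hx

theorem Tabs.rays (h : Tabs U d C K α) (ha : a < C.N) (hx : x < C.N) :
    α 10 a x = aR U C.N (K a) := h 10 (by omega) a ha x hx

theorem Tabs.cardX (h : Tabs U d C K α) (ha : a < C.N) (hx : x < C.N) :
    α 11 a x = (aX U C.N (K a)).card := h 11 (by omega) a ha x hx

theorem Tabs.cardC (h : Tabs U d C K α) (ha : a < C.N) (hx : x < C.N) :
    α 12 a x = (aC C.N (K a)).card := h 12 (by omega) a ha x hx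

theorem Tabs.des (h : Tabs U d C K α) (ha : a < C.N) (hx : x < C.N) :
    0 < α 15 a x ↔ Good U C.N (K a) d ∧
      ∀ b < C.N, b < a → Good U C.N (K b) d → ¬ capDist U C.N b a < C.N := by
  rw [h 15 (by omega) a ha x hx]; exact ite_pos_iff _

end

/-- The two anchors that are compared are given by the variables `2` and `3`. -/
structure Pair (U : SimpleGraph ℕ) (n d : ℕ) (C : Ctx) (W : ℕ) (a b : ℕ) (v : Env) : Prop where
  setup : Setup U n d C W
  va : v 2 = a
  vb : v 3 = b
  ha : a < C.N
  hb : b < C.N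

section

variable {U : SimpleGraph ℕ} {n d : ℕ} {C : Ctx} {W : ℕ} {v : Env} {α : Arr} {K : ℕ → Set ℕ}
  {a b x : ℕ}

theorem Pair.update (h : Pair U n d C W a b v) {x : ℕ} (hx : 4 ≤ x) (i : ℕ) :
    Pair U n d C W a b (Function.update v x i) :=
  ⟨h.setup, by rw [Function.update_of_ne (by omega)]; exact h.va,
    by rw [Function.update_of_ne (by omega)]; exact h.vb, h.ha, h.hb⟩

theorem aR_le_card (U : SimpleGraph ℕ) (N : ℕ) (C : Set ℕ) : aR U N C ≤ (aX U N C).card := by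
  refine (Finset.card_le_card (t := (aX U N C).image (aLab U N C)) fun z hz => ?_).trans
    Finset.card_image_le
  simp only [aRoots, Finset.mem_filter, Finset.mem_range] at hz
  obtain ⟨hz, u, hu, e⟩ := hz
  simp only [aX, Finset.mem_image, Finset.mem_filter, Finset.mem_range]
  exact ⟨u, ⟨hu, e ▸ hz⟩, e⟩

theorem aX_card_le (U : SimpleGraph ℕ) (N : ℕ) (C : Set ℕ) : (aX U N C).card ≤ N :=
  (Finset.card_filter_le _ _).trans (by simp)

/-- The values of the permutation serve as ray numbers stored in a table row, so the permutation
must not lead out of the range of the row. -/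
theorem permSeq_lt {dig : ℕ → ℕ} {r N : ℕ} (hr : r ≤ N) (h : ∀ i < r, dig i < N) {j : ℕ}
    (hj : j < N) : permSeq dig r j < N := by
  induction r generalizing j with
  | zero => exact hj
  | succ r ih =>
    refine ih (by omega) (fun i hi => h i (by omega)) ?_
    have := h r (by omega)
    rw [Equiv.swap_apply_def]
    split_ifs <;> omega

/-- Apply the transposition of the number in variable `5` and its digit. -/
def swapExpr : Expr :=
  .ite (eqq (.var 6) (.var 5)) (.rd 29 (.lit 0) (.rd 26 (.lit 0) (.var 5)))
    (.ite (eqq (.var 6) (.rd 26 (.lit 0) (.var 5))) (.rd 29 (.lit 0) (.var 5))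
      (.rd 29 (.lit 0) (.var 6)))

/-- Compute the permutation that belongs to the digits. -/
def buildPerm : Cmd :=
  (Cmd.gtab 29 5 (.lit 1) (.var 5)).seq <|
  Cmd.loop 5 (Cmd.ite (.lt (.var 5) (.rd 10 (.var 2) (.lit 0)))
    ((Cmd.gtab 30 6 (.lit 1) swapExpr).seq (Cmd.gtab 29 6 (.lit 1) (.rd 30 (.lit 0) (.var 6))))
    Cmd.skip)

/-- One transposition rewrites a row in linear time, and the number of transpositions is the number
of rays, at most the number of vertices on rays. The work is therefore charged to the component of
the anchor. -/
theorem exists_buildPerm : ∃ T, ∀ (U : SimpleGraph ℕ) (n d : ℕ) (C : Ctx) (W a b : ℕ)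
    (v : Env) (α : Arr) (K : ℕ → Set ℕ) (dig : ℕ → ℕ), Pair U n d C W a b v → Tabs U d C K α →
      (∀ i < C.N, α 26 0 i = dig i) → (∀ i, dig i ≤ i) →
      Tri C W buildPerm v α (T * (((aX U C.N (K a)).card + 1) * C.N)) (fun β =>
        Frame [29, 30] α β ∧ ∀ j < C.N, β 29 0 j = permSeq dig (aR U C.N (K a)) j) := by
  refine ⟨((Expr.lit 1).cost 1 + (Expr.var 5).cost 1 + 24) +
    ((Expr.lt (.var 5) (.rd 10 (.var 2) (.lit 0))).cost 1 + 11) +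
    ((Expr.lit 1).cost 1 + swapExpr.cost 1 + 24) +
    ((Expr.lit 1).cost 1 + (Expr.rd 30 (.lit 0) (.var 6)).cost 1 + 24),
    fun U n d C W a b v α K dig h hα hdig hle => ?_⟩
  have hN := h.setup.one_le
  have hNB := h.setup.size_le
  have hrX := aR_le_card U C.N (K a)
  have hXN := aX_card_le U C.N (K a)
  set r := aR U C.N (K a) with hr
  refine Tri.mono (T₁ := ((Expr.lit 1).cost 1 + (Expr.var 5).cost 1 + 24) * C.N +
    (((Expr.lt (.var 5) (.rd 10 (.var 2) (.lit 0))).cost 1 + 11) * C.N +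
      r * (((Expr.lit 1).cost 1 + swapExpr.cost 1 + 24) * C.N +
        ((Expr.lit 1).cost 1 + (Expr.rd 30 (.lit 0) (.var 6)).cost 1 + 24) * C.N))) ?_ ?_
    fun _ h => h
  rotate_left
  · generalize (Expr.lit 1).cost 1 + (Expr.var 5).cost 1 + 24 = c₁
    generalize (Expr.lt (.var 5) (.rd 10 (.var 2) (.lit 0))).cost 1 + 11 = c₂
    generalize (Expr.lit 1).cost 1 + swapExpr.cost 1 + 24 = c₃
    generalize (Expr.lit 1).cost 1 + (Expr.rd 30 (.lit 0) (.var 6)).cost 1 + 24 = c₄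
    have h1 : C.N ≤ ((aX U C.N (K a)).card + 1) * C.N := Nat.le_mul_of_pos_left _ (by omega)
    have h2 : r * C.N ≤ ((aX U C.N (K a)).card + 1) * C.N := Nat.mul_le_mul_right _ (by omega)
    calc _ = (c₁ + c₂) * C.N + (c₃ + c₄) * (r * C.N) := by ring
      _ ≤ (c₁ + c₂) * (((aX U C.N (K a)).card + 1) * C.N) +
          (c₃ + c₄) * (((aX U C.N (K a)).card + 1) * C.N) := by gcongr
      _ = _ := by ring
  refine Tri.seq (Tri.row_frame h.setup.valid hN (by decide) (by decide) (by decide) rfl rfl rfl rfl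
    (fun _ => True) (fun j _ => by simp [eval]) (fun j => j) (fun j _ _ => by simp [eval])
    (fun j hj _ => by omega)) (fun β₁ h₁ => ?_) le_rfl
  have hcard : ((Finset.range C.N).filter fun i => i < r).card = r := by
    rw [show ((Finset.range C.N).filter fun i => i < r) = Finset.range r from by
      ext i; simp only [Finset.mem_filter, Finset.mem_range]; omega, Finset.card_range]
  -- The loop runs over all N indices, but rounds from r on do nothing; hence `min i r` in the
  -- invariant.
  refine Tri.mono (Tri.gloop h.setup.valid hN (by decide) (by decide) rfl
    (fun i β => Frame [29, 30] α β ∧ ∀ j < C.N, β 29 0 j = permSeq dig (min i r) j)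
    (fun i => i < r) ?_ ?_ ?_ ?_) (T₁ := _ + ((Finset.range C.N).filter fun i => i < r).card * _) (by rw [hcard]) ?_
  · rintro i hi β ⟨hf, -⟩
    have : α 10 a 0 = r := hα.rays h.ha (by omega)
    simp only [eval, ite_pos_iff, (h.update (x := 5) (by omega) i).va, Function.update_self,
      hf 10 (by decide), this]
  · rintro i hi β ⟨hf, hP⟩ hir
    rw [min_eq_left hir.le] at hP
    have hd := hle i
    have hplt : ∀ j < C.N, permSeq dig i j < C.N := fun j hj =>
      permSeq_lt (by omega) (fun k hk => by have := hle k; omega) hj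
    have e26 : β 26 0 i = dig i := by rw [hf 26 (by decide)]; exact hdig i hi
    have hsw : ∀ j < C.N, Equiv.swap i (dig i) j < C.N := fun j hj => by
      rw [Equiv.swap_apply_def]; split_ifs <;> omega
    refine Tri.seq (Tri.row_frame h.setup.valid hN (by decide) (by decide) (by decide) rfl rfl rfl
      rfl (fun _ => True) (fun j _ => by simp [eval]) (fun j => permSeq dig (i + 1) j) ?_
      (fun j hj _ => ?_)) (fun β₂ h₂ => ?_) le_rfl
    · intro j hj _
      simp only [swapExpr, eval, eval_eqq, ite_pos_iff, Function.update_apply, Nat.reduceEqDiff,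
        if_true, if_false, e26]
      rw [permSeq, Equiv.Perm.mul_apply, Equiv.swap_apply_def]
      split_ifs
      · exact hP _ (by omega)
      · exact hP _ hi
      · exact hP _ hj
    · rw [permSeq, Equiv.Perm.mul_apply]
      exact (hplt _ (hsw j hj)).le.trans hNB
    · refine Tri.mono (Tri.row_frame h.setup.valid hN (by decide) (by decide) (by decide) rfl rfl
        rfl rfl (fun _ => True) (fun j _ => by simp [eval]) (fun j => permSeq dig (i + 1) j) ?_
        (fun j hj _ => ?_)) le_rfl (fun β₃ h₃ => ⟨?_, ?_⟩)
      · intro j hj _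
        simp only [eval, Function.update_apply, Nat.reduceEqDiff, if_true, if_false]
        rw [h₂.2 j hj, if_pos trivial]
      · rw [permSeq, Equiv.Perm.mul_apply]
        exact (hplt _ (hsw j hj)).le.trans hNB
      · exact (hf.trans (h₂.1.mono (by simp))).trans (h₃.1.mono (by simp))
      · intro j hj
        rw [h₃.2 j hj, if_pos trivial, min_eq_left (by omega)]
  · rintro i hi β ⟨hf, hP⟩ hir
    refine ⟨hf, fun j hj => ?_⟩
    rw [hP j hj, min_eq_right (by omega), min_eq_right (by omega)]
  · refine ⟨h₁.1.mono (by simp), fun j hj => ?_⟩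
    rw [h₁.2 j hj, if_pos trivial]
    simp [permSeq]
  · rintro β ⟨hf, hP⟩
    refine ⟨hf, fun j hj => ?_⟩
    rw [hP j hj, min_eq_right (by omega)]

/-- The vertex in variable `5` lies outside the first anchor, in its component. -/
def inRay : Expr := .lt (.rd 4 (.var 2) (.var 5)) .size

/-- The mate of the vertex in variable `5`. -/
def mateExpr : Expr :=
  .mn 6 (.ite (conj (.lt (.rd 4 (.var 3) (.var 6)) .size)
    (conj (eqq (.rd 7 (.var 3) (.var 6)) (.rd 29 (.lit 0) (.rd 7 (.var 2) (.var 5))))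
      (eqq (.rd 8 (.var 3) (.var 6)) (.rd 8 (.var 2) (.var 5))))) (.var 6) .size)

/-- Compute the mates. -/
def mates : Cmd := Cmd.gtab 31 5 inRay mateExpr

theorem inRay_eval (h : Pair U n d C W a b v) (hα : Tabs U d C K α) {x : ℕ} (hx : x < C.N) :
    0 < inRay.eval C α (Function.update v 5 x) ↔ aLab U C.N (K a) x < C.N := by
  simp only [inRay, eval, ite_pos_iff, (h.update (x := 5) (by omega) x).va, Function.update_self,
    hα.lab h.ha hx]

/-- The linear search for a mate is made only for vertices on rays, so the cost is again the size of
the component times N. -/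
theorem exists_mates : ∃ T, ∀ (U : SimpleGraph ℕ) (n d : ℕ) (C : Ctx) (W a b : ℕ)
    (v : Env) (α : Arr) (K : ℕ → Set ℕ) (σ : ℕ → ℕ), Pair U n d C W a b v → Tabs U d C K α →
      (∀ j < C.N, α 29 0 j = σ j) →
      Tri C W mates v α (T * (((aX U C.N (K a)).card + 1) * C.N)) (fun β =>
        Frame [31] α β ∧ ∀ x < C.N, aLab U C.N (K a) x < C.N →
          β 31 0 x = mate U C.N (K a) (K b) σ x) := by
  refine ⟨inRay.cost 1 + mateExpr.cost 1 + 24, fun U n d C W a b v α K σ h hα hσ => ?_⟩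
  have hN := h.setup.one_le
  have hNB := h.setup.size_le
  refine Tri.mono (Tri.gtab_frame h.setup.valid hN (by decide) (by decide) (by decide) rfl rfl rfl
    (by decide) (fun x => aLab U C.N (K a) x < C.N) (fun x hx => inRay_eval h hα hx)
    (fun x => mate U C.N (K a) (K b) σ x) ?_ ?_) le_rfl (fun β hβ => ⟨hβ.1, fun x hx hl => ?_⟩)
  · intro x hx hl
    have hlt := aIdx_lt hx hl
    have hrX := aR_le_card U C.N (K a)
    have hXN := aX_card_le U C.N (K a)
    have ha := h.va
    have hb := h.vb
    simp only [mateExpr, eval, eval_conj, eval_eqq, ite_pos_iff, Function.update_apply,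
      Nat.reduceEqDiff, if_true, if_false, ha, hb]
    refine minTo_congr fun y hy => ?_
    rw [hα.lab h.hb hy, hα.idx h.hb hy, hα.idx h.ha hx, hσ _ (by omega), hα.pos h.hb hy,
      hα.pos h.ha hx]
    by_cases hm : Matches U C.N (K a) (K b) σ x y
    · rw [if_pos hm]; exact if_pos hm
    · rw [if_neg hm]; exact if_neg hm
  · intro x hx _
    exact (minTo_le_top _ _ _).trans hNB
  · rw [hβ.2 x hx, if_pos hl]

end

end

end StarIso

/-! ### Checking adjacency of mates and colouring the anchors -/

namespace StarIso

open WordRAM Classical Expr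

noncomputable section

variable {U : SimpleGraph ℕ} {n d : ℕ} {C : Ctx} {W : ℕ} {v : Env} {α : Arr} {K : ℕ → Set ℕ}
  {a b x : ℕ} {σ : ℕ → ℕ}

/-- The number of edges at the vertex in variable `5` which the matching does not respect. -/
def mismatchExpr : Expr :=
  .ite (.lt (.rd 31 (.lit 0) (.var 5)) .size)
    (.sum 6 (conj (.lt (.rd 4 (.var 2) (.var 6)) .size)
      (neg (eqq (.rd 0 (.var 5) (.var 6))
        (.rd 0 (.rd 31 (.lit 0) (.var 5)) (.rd 31 (.lit 0) (.var 6)))))))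
    (.lit 1)

/-- The number of vertices at which the matching fails. -/
def mismatchTotal : Expr := .sum 5 (conj inRay (.rd 32 (.lit 0) (.var 5)))

/-- Test whether the matching respects adjacency. -/
def mismatches : Cmd :=
  (Cmd.gtab 32 5 inRay mismatchExpr).seq (Cmd.st 33 (.lit 0) (.lit 0) mismatchTotal)

theorem eval_sum_le {x : ℕ} {e : Expr} (h : ∀ i < C.N, e.eval C α (Function.update v x i) ≤ 1) :
    (Expr.sum x e).eval C α v ≤ C.N := by
  refine (Finset.sum_le_card_nsmul _ _ 1 fun i hi => h i (Finset.mem_range.mp hi)).trans ?_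
  simp

theorem eval_sum_eq_zero {x : ℕ} {e : Expr} {p : ℕ → Prop}
    (h : ∀ i < C.N, e.eval C α (Function.update v x i) = 0 ↔ p i) :
    (Expr.sum x e).eval C α v = 0 ↔ ∀ i < C.N, p i := by
  rw [Expr.eval, Finset.sum_eq_zero_iff]
  exact forall_congr' fun i => by
    rw [Finset.mem_range]; exact forall_congr' fun hi => h i hi

theorem ite_one_eq_zero_iff (p : Prop) [Decidable p] : (if p then 1 else 0) = 0 ↔ ¬ p := by
  by_cases h : p <;> simp [h]

/-- A vertex without a mate counts as one failure in itself, so the same total also detects missing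
mates. -/
theorem mismatchExpr_eval (h : Pair U n d C W a b v) (hα : Tabs U d C K α) {x : ℕ} (hx : x < C.N) :
    mismatchExpr.eval C α (Function.update v 5 x) = 0 ↔ α 31 0 x < C.N ∧ ∀ w < C.N,
      aLab U C.N (K a) w < C.N → adjN U x w = α 0 (α 31 0 x) (α 31 0 w) := by
  have hva := h.va
  have hval : ∀ i < C.N, (conj (.lt (.rd 4 (.var 2) (.var 6)) .size)
      (neg (eqq (.rd 0 (.var 5) (.var 6)) (.rd 0 (.rd 31 (.lit 0) (.var 5))
        (.rd 31 (.lit 0) (.var 6)))))).eval C α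
        (Function.update (Function.update v 5 x) 6 i) = 0 ↔
      (aLab U C.N (K a) i < C.N → adjN U x i = α 0 (α 31 0 x) (α 31 0 i)) := by
    intro i hi
    simp only [eval, eval_conj, eval_neg, eval_eqq, ite_pos_iff, pos_ite_zero_iff,
      Function.update_apply, Nat.reduceEqDiff, if_true, if_false, hva, ite_one_eq_zero_iff]
    rw [hα.lab h.ha hi, hα.adj hx hi]
    tauto
  have key := eval_sum_eq_zero hval
  have hlt : 0 < (Expr.lt (.rd 31 (.lit 0) (.var 5)) .size).eval C α (Function.update v 5 x) ↔
      α 31 0 x < C.N := by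
    simp only [eval, ite_pos_iff, Function.update_self]
  rw [mismatchExpr, Expr.eval]
  by_cases hc : α 31 0 x < C.N
  · rw [if_pos (hlt.mpr hc), key]; simp [hc]
  · rw [if_neg (mt hlt.mp hc)]; simp [hc, eval]

theorem exists_mismatches : ∃ T, ∀ (U : SimpleGraph ℕ) (n d : ℕ) (C : Ctx) (W a b : ℕ)
    (v : Env) (α : Arr) (K : ℕ → Set ℕ) (σ : ℕ → ℕ), Pair U n d C W a b v → Tabs U d C K α →
      (∀ x < C.N, aLab U C.N (K a) x < C.N → α 31 0 x = mate U C.N (K a) (K b) σ x) →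
      Tri C W mismatches v α (T * (((aX U C.N (K a)).card + 1) * C.N)) (fun β =>
        Frame [32, 33] α β ∧ (β 33 0 0 = 0 ↔
          (∀ x < C.N, aLab U C.N (K a) x < C.N → mate U C.N (K a) (K b) σ x < C.N) ∧
          ∀ x < C.N, ∀ w < C.N, aLab U C.N (K a) x < C.N → aLab U C.N (K a) w < C.N →
            adjN U x w = adjN U (mate U C.N (K a) (K b) σ x) (mate U C.N (K a) (K b) σ w))) := by
  refine ⟨inRay.cost 1 + mismatchExpr.cost 1 + 24 + (mismatchTotal.cost 1 + 13),
    fun U n d C W a b v α K σ h hα hm => ?_⟩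
  have hN := h.setup.one_le
  have hNB := h.setup.size_le
  have hva := h.va
  refine Tri.seq (T₂ := (mismatchTotal.cost 1 + 13) * C.N)
    (Tri.gtab_frame h.setup.valid hN (by decide) (by decide) (by decide) rfl rfl rfl
    (by decide) (fun x => aLab U C.N (K a) x < C.N) (fun x hx => inRay_eval h hα hx)
    (fun x => mismatchExpr.eval C α (Function.update v 5 x)) (fun _ _ _ => rfl) ?_)
    (fun β₁ h₁ => ?_) ?_
  · intro x hx _
    refine le_trans ?_ hNB
    rw [mismatchExpr, Expr.eval]
    split_ifs
    · refine eval_sum_le fun i _ => ?_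
      rw [eval_conj]; exact indicator_le _
    · exact hN
  · have hα₁ : Tabs U d C K β₁ := hα.frame h₁.1 (by decide)
    have hle : mismatchTotal.eval C β₁ v ≤ C.N := eval_sum_le fun i _ => by
      rw [eval_conj]; exact indicator_le _
    refine Tri.mono (Tri.scalar h.setup.valid hN (by decide) (by decide) (by decide) (by decide)
      (mismatchTotal.eval C β₁ v) rfl (hle.trans hNB)) le_rfl (fun β₂ h₂ => ⟨?_, ?_⟩)
    · exact (h₁.1.mono (by simp)).trans (h₂.1.mono (by simp))
    rw [h₂.2, mismatchTotal, eval_sum_eq_zero (p := fun x => aLab U C.N (K a) x < C.N →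
      α 31 0 x < C.N ∧ ∀ w < C.N, aLab U C.N (K a) w < C.N →
        adjN U x w = α 0 (α 31 0 x) (α 31 0 w))]
    · constructor
      · intro hall
        have hlt : ∀ x < C.N, aLab U C.N (K a) x < C.N → mate U C.N (K a) (K b) σ x < C.N :=
          fun x hx hl => hm x hx hl ▸ (hall x hx hl).1
        refine ⟨hlt, fun x hx w hw hlx hlw => ?_⟩
        rw [(hall x hx hlx).2 w hw hlw, hm x hx hlx, hm w hw hlw,
          hα.adj (hlt x hx hlx) (hlt w hw hlw)]
      · rintro ⟨hlt, hadj⟩ x hx hlx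
        refine ⟨hm x hx hlx ▸ hlt x hx hlx, fun w hw hlw => ?_⟩
        rw [hm x hx hlx, hm w hw hlw, hα.adj (hlt x hx hlx) (hlt w hw hlw)]
        exact hadj x hx w hw hlx hlw
    · intro x hx
      rw [eval_conj, ite_one_eq_zero_iff, inRay_eval h hα₁ hx]
      simp only [eval, Function.update_self]
      rw [h₁.2 x hx]
      by_cases hl : aLab U C.N (K a) x < C.N
      · rw [if_pos hl, ← mismatchExpr_eval h hα hx]
        simp [hl]
      · simp [hl]
  · have h1 : C.N ≤ ((aX U C.N (K a)).card + 1) * C.N := Nat.le_mul_of_pos_left _ (by omega)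
    rw [add_mul (inRay.cost 1 + mismatchExpr.cost 1 + 24)]
    exact Nat.add_le_add (le_of_eq rfl) (Nat.mul_le_mul_left _ h1)

/-! #### Colours -/

/-- Adjacency of the vertex in variable `6` to the pair of the vertex in variable `5`. -/
def bitExpr : Expr :=
  .add (.rd 0 (.var 6) (.var 5)) (.rd 0 (.var 6) (.rd 31 (.lit 0) (.var 5)))

/-- The colour of the vertex in variable `6`. -/
def colourExpr : Expr := .rd 34 (.lit 0) (.var 6)

/-- Refine the colours by adjacency to a pair. -/
def refineColours : Cmd :=
  (Cmd.loop 6 (Cmd.st 36 colourExpr bitExpr (.var 6))).seq <|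
  (Cmd.gtab 35 6 (.lit 1) (.rd 36 colourExpr bitExpr)).seq
    (Cmd.gtab 34 6 (.lit 1) (.rd 35 (.lit 0) (.var 6)))

/-- Compute the colours. -/
def colours : Cmd :=
  (Cmd.gtab 34 5 (.lit 1) (.lit 0)).seq (Cmd.loop 5 (Cmd.ite inRay refineColours Cmd.skip))

/-- The new colour of u is the last vertex with the same old colour and the same bit. It is found by
direct addressing: every vertex writes its number to the cell of array 36 given by colour and bit,
and then reads that cell. Colours remain below N, the time is linear, and stale entries are harmless
because every cell that is read has just been written. -/
theorem exists_refineColours : ∃ T, ∀ (U : SimpleGraph ℕ) (n d : ℕ) (C : Ctx) (W a b : ℕ)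
    (v : Env) (α : Arr) (K : ℕ → Set ℕ) (x y : ℕ), Pair U n d C W a b v → Tabs U d C K α →
      v 5 = x → x < C.N → α 31 0 x = y → y < C.N → (∀ u < C.N, α 34 0 u < C.N) →
      Tri C W refineColours v α (T * C.N) (fun β => Frame [34, 35, 36] α β ∧
        (∀ u < C.N, β 34 0 u < C.N) ∧ ∀ u < C.N, ∀ w < C.N, β 34 0 u = β 34 0 w ↔
          α 34 0 u = α 34 0 w ∧ adjN U u x + adjN U u y = adjN U w x + adjN U w y) := by
  refine ⟨(colourExpr.cost 1 + bitExpr.cost 1 + 20) +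
    (((Expr.lit 1).cost 1 + (Expr.rd 36 colourExpr bitExpr).cost 1 + 24) +
    ((Expr.lit 1).cost 1 + (Expr.rd 35 (.lit 0) (.var 6)).cost 1 + 24)),
    fun U n d C W a b v α K x y h hα hvx hx hy hyN hcol => ?_⟩
  have hN := h.setup.one_le
  have hNB := h.setup.size_le
  have hNQ := h.setup.valid.NQ
  set t : ℕ → ℕ := fun u => adjN U u x + adjN U u y with ht
  -- A bit is at most 2 and serves as a column index, which fits because N is at least 2 and Q
  -- exceeds N.
  have htQ : ∀ u, t u < C.Q := fun u => by
    have h1 := adjN_le U u x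
    have h2 := adjN_le U u y
    have h3 := h.setup.two_le
    simp only [ht]; omega
  have hbit : ∀ β : Arr, Frame [34, 35, 36] α β → ∀ u < C.N,
      bitExpr.eval C β (Function.update v 6 u) = t u := fun β hf u hu => by
    simp only [bitExpr, eval, Function.update_apply, Nat.reduceEqDiff, if_true, if_false, hvx]
    rw [hf 0 (by decide), hf 31 (by decide), hy, hα.adj hu hx, hα.adj hu hyN]
  have hce : ∀ (β : Arr) u, colourExpr.eval C β (Function.update v 6 u) = β 34 0 u := fun β u => by
    simp [colourExpr, eval]
  rw [add_mul]
  refine Tri.seq (Tri.mono (Tri.loop h.setup.valid (by decide) (fun k β => Frame [36] α β ∧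
      ∀ u < k, ∃ w < k, β 36 (α 34 0 u) (t u) = w ∧ α 34 0 w = α 34 0 u ∧ t w = t u)
    (fun _ => colourExpr.cost C.N + bitExpr.cost C.N + 1 + 11) ?_
    ⟨Frame.refl _ _, fun u hu => absurd hu (by omega)⟩) ?_ fun _ h => h) (fun β₁ h₁ => ?_) le_rfl
  · rintro k hk β ⟨hf, hI⟩
    have hf' := hf.mono (l' := [34, 35, 36]) (by simp)
    have e34 : β 34 = α 34 := hf 34 (by decide)
    refine Tri.st h.setup.valid (by decide) (by decide) (by decide) (by decide)
      (by rw [hce, e34]; have := hcol k hk; omega) (by rw [hbit β hf' k hk]; exact htQ k) ?_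
    rw [hce, e34, hbit β hf' k hk]
    simp only [eval, Function.update_self]
    rw [min_eq_left (by omega)]
    refine ⟨hf.trans (Frame.set _ (by simp) _ _ _), fun u hu => ?_⟩
    by_cases hs : α 34 0 u = α 34 0 k ∧ t u = t k
    · refine ⟨k, by omega, ?_, hs.1.symm, hs.2.symm⟩
      simp [Arr.set, hs]
    · have huk : u < k := by
        rcases (Nat.lt_succ_iff.mp hu).eq_or_lt with rfl | hlt
        · exact absurd ⟨rfl, rfl⟩ hs
        · exact hlt
      obtain ⟨w, hw, h1, h2, h3⟩ := hI u huk
      refine ⟨w, by omega, ?_, h2, h3⟩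
      simp only [Arr.set, true_and, hs, if_false]
      exact h1
  · rw [Finset.sum_const, Finset.card_range, smul_eq_mul]
    have e1 := cost_le_const hN (e := colourExpr) (by decide)
    have e2 := cost_le_const hN (e := bitExpr) (by decide)
    calc C.N * (colourExpr.cost C.N + bitExpr.cost C.N + 1 + 11 + 4) + 4
        ≤ C.N * (colourExpr.cost 1 + bitExpr.cost 1 + 1 + 11 + 4) + 4 * C.N := by gcongr; omega
      _ = _ := by ring
  have e34 : β₁ 34 = α 34 := h₁.1 34 (by decide)
  have hf₁ := h₁.1.mono (l' := [34, 35, 36]) (by simp)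
  rw [add_mul]
  refine Tri.seq (Tri.row_frame h.setup.valid hN (by decide) (by decide) (by decide) rfl rfl rfl
    rfl (fun _ => True) (fun j _ => by simp [eval]) (fun u => β₁ 36 (α 34 0 u) (t u)) ?_ ?_)
    (fun β₂ h₂ => ?_) le_rfl
  · intro u hu _
    rw [Expr.eval, hce, e34, hbit β₁ hf₁ u hu]
  · intro u hu _
    obtain ⟨w, hw, h1, -, -⟩ := h₁.2 u hu
    omega
  refine Tri.mono (Tri.row_frame h.setup.valid hN (by decide) (by decide) (by decide) rfl rfl rfl
    rfl (fun _ => True) (fun j _ => by simp [eval]) (fun u => β₁ 36 (α 34 0 u) (t u)) ?_ ?_) le_rfl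
    (fun β₃ h₃ => ⟨?_, ?_, ?_⟩)
  · intro u hu _
    simp only [eval, Function.update_self]
    rw [h₂.2 u hu, if_pos trivial]
  · intro u hu _
    obtain ⟨w, hw, h1, -, -⟩ := h₁.2 u hu
    omega
  · exact (hf₁.trans (h₂.1.mono (by simp))).trans (h₃.1.mono (by simp))
  · intro u hu
    obtain ⟨w, hw, h1, -, -⟩ := h₁.2 u hu
    rw [h₃.2 u hu, if_pos trivial]; omega
  · intro u hu w hw
    rw [h₃.2 u hu, h₃.2 w hw, if_pos trivial, if_pos trivial]
    constructor
    · intro e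
      obtain ⟨z, hz, h1, h2, h3⟩ := h₁.2 u hu
      obtain ⟨z', hz', h1', h2', h3'⟩ := h₁.2 w hw
      obtain rfl : z = z' := by omega
      exact ⟨h2.symm.trans h2', h3.symm.trans h3'⟩
    · rintro ⟨e1, e2⟩
      rw [e1, show t u = t w from e2]

/-- Whole adjacency vectors are replaced by single numbers: one linear refinement per vertex on a
ray separates exactly the vectors that differ up to that coordinate. Comparing colours then takes
constant time. -/
theorem exists_colours : ∃ T, ∀ (U : SimpleGraph ℕ) (n d : ℕ) (C : Ctx) (W a b : ℕ)
    (v : Env) (α : Arr) (K : ℕ → Set ℕ) (σ : ℕ → ℕ), Pair U n d C W a b v → Tabs U d C K α →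
      (∀ x < C.N, aLab U C.N (K a) x < C.N → α 31 0 x = mate U C.N (K a) (K b) σ x) →
      (∀ x < C.N, aLab U C.N (K a) x < C.N → mate U C.N (K a) (K b) σ x < C.N) →
      Tri C W colours v α (T * (((aX U C.N (K a)).card + 1) * C.N)) (fun β =>
        Frame [34, 35, 36] α β ∧ ∀ u < C.N, ∀ w < C.N, β 34 0 u = β 34 0 w ↔
          colour U C.N (K a) (K b) σ u = colour U C.N (K a) (K b) σ w) := by
  obtain ⟨T, hT⟩ := exists_refineColours
  refine ⟨((Expr.lit 1).cost 1 + (Expr.lit 0).cost 1 + 24) + ((inRay.cost 1 + 11) + T),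
    fun U n d C W a b v α K σ h hα hm hlt => ?_⟩
  have hN := h.setup.one_le
  have hNB := h.setup.size_le
  refine Tri.seq (T₂ := (inRay.cost 1 + 11) * C.N + (aX U C.N (K a)).card * (T * C.N))
    (Tri.row_frame h.setup.valid hN (by decide) (by decide) (by decide) rfl rfl rfl
    rfl (fun _ => True) (fun j _ => by simp [eval]) (fun _ => 0) (fun _ _ _ => rfl)
    (fun _ _ _ => by omega)) (fun β₁ h₁ => ?_) ?_
  rotate_left
  · generalize (Expr.lit 1).cost 1 + (Expr.lit 0).cost 1 + 24 = c₁
    generalize inRay.cost 1 + 11 = c₂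
    have h1 : C.N ≤ ((aX U C.N (K a)).card + 1) * C.N := Nat.le_mul_of_pos_left _ (by omega)
    calc _ = (c₁ + c₂) * C.N + T * ((aX U C.N (K a)).card * C.N) := by ring
      _ ≤ (c₁ + c₂) * (((aX U C.N (K a)).card + 1) * C.N) +
          T * (((aX U C.N (K a)).card + 1) * C.N) := by gcongr; omega
      _ = _ := by ring
  refine Tri.mono (Tri.gloop h.setup.valid hN (by decide) (by decide) rfl
    (fun i β => Frame [34, 35, 36] α β ∧ (∀ u < C.N, β 34 0 u < C.N) ∧
      ∀ u < C.N, ∀ w < C.N, β 34 0 u = β 34 0 w ↔ ∀ x < i,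
        colour U C.N (K a) (K b) σ u x = colour U C.N (K a) (K b) σ w x)
    (fun x => aLab U C.N (K a) x < C.N) ?_ ?_ ?_ ?_)
    (T₁ := _ + ((Finset.range C.N).filter fun x => aLab U C.N (K a) x < C.N).card * (T * C.N))
    le_rfl ?_
  · rintro i hi β ⟨hf, -, -⟩
    exact inRay_eval h (hα.frame hf (by decide)) hi
  · rintro i hi β ⟨hf, hlt', heq⟩ hl
    refine Tri.mono (hT U n d C W a b _ β K i (mate U C.N (K a) (K b) σ i) (h.update (by omega) i)
      (hα.frame hf (by decide)) (by simp) hi (by rw [hf 31 (by decide)]; exact hm i hi hl)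
      (hlt i hi hl) hlt') le_rfl (fun γ hγ => ⟨hf.trans hγ.1, hγ.2.1, fun u hu w hw => ?_⟩)
    rw [hγ.2.2 u hu w hw, heq u hu w hw]
    constructor
    · rintro ⟨h1, h2⟩ x hx
      rcases (Nat.lt_succ_iff.mp hx).eq_or_lt with rfl | hx
      · simp only [colour, hi, hl, and_self, if_true, bit]; exact h2
      · exact h1 x hx
    · intro h1
      refine ⟨fun x hx => h1 x (by omega), ?_⟩
      have := h1 i (by omega)
      simpa only [colour, hi, hl, and_self, if_true, bit] using this
  · rintro i hi β ⟨hf, hlt', heq⟩ hl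
    refine ⟨hf, hlt', fun u hu w hw => ?_⟩
    rw [heq u hu w hw]
    constructor
    · intro h1 x hx
      rcases (Nat.lt_succ_iff.mp hx).eq_or_lt with rfl | hx
      · simp [colour, hl]
      · exact h1 x hx
    · intro h1 x hx
      exact h1 x (by omega)
  · refine ⟨h₁.1.mono (by simp), fun u hu => ?_, fun u hu w hw => ?_⟩
    · rw [h₁.2 u hu, if_pos trivial]; omega
    · rw [h₁.2 u hu, h₁.2 w hw]; simp
  · rintro β ⟨hf, -, heq⟩
    refine ⟨hf, fun u hu w hw => ?_⟩
    rw [heq u hu w hw]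
    constructor
    · intro h1
      funext x
      by_cases hx : x < C.N
      · exact h1 x hx
      · simp [colour, hx]
    · intro h1 x _
      rw [h1]

end

end StarIso

/-! ### Comparing colour classes, testing one permutation, and stepping to the next -/

namespace StarIso

open WordRAM Classical Expr

noncomputable section

variable {U : SimpleGraph ℕ} {n d : ℕ} {C : Ctx} {W : ℕ} {v : Env} {α : Arr} {K : ℕ → Set ℕ}
  {a b x : ℕ} {σ : ℕ → ℕ}

theorem eval_lt_pos {a b : Expr} : 0 < (Expr.lt a b).eval C α v ↔ a.eval C α v < b.eval C α v :=
  ite_pos_iff _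

/-- The number of vertices of the anchor in variable `y` with the colour of the vertex in
variable `5`. -/
def colourCount (y : ℕ) : Expr :=
  .sum 6 (conj (.rd 2 (.var y) (.var 6)) (eqq (.rd 34 (.lit 0) (.var 6)) (.rd 34 (.lit 0) (.var 5))))

/-- The colour of the vertex in variable `5` does not occur equally often in both anchors. -/
def countExpr : Expr := neg (eqq (colourCount 2) (colourCount 3))

/-- Whether every colour occurs equally often. -/
def countTotal : Expr := neg (.sum 5 (conj (.rd 2 (.var 2) (.var 5)) (.rd 37 (.lit 0) (.var 5))))

/-- Compare the numbers of vertices of each colour. -/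
def counts : Cmd :=
  (Cmd.gtab 37 5 (.rd 2 (.var 2) (.var 5)) countExpr).seq
    (Cmd.st 38 (.lit 0) (.lit 0) countTotal)

/-- A measure for the size of the component of an anchor. -/
def leafSize (U : SimpleGraph ℕ) (N : ℕ) (C : Set ℕ) : ℕ :=
  (aX U N C).card + (aC N C).card + 1

theorem colourCount_eval (hα : Tabs U d C K α) {y c : ℕ} (hy : v y = c) (hy4 : y < 5)
    (hc : c < C.N) (hx : x < C.N)
    (hcol : ∀ u < C.N, ∀ w < C.N, α 34 0 u = α 34 0 w ↔
      colour U C.N (K a) (K b) σ u = colour U C.N (K a) (K b) σ w) :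
    (colourCount y).eval C α (Function.update v 5 x) = ((Finset.range C.N).filter fun w => w ∈ K c ∧
      colour U C.N (K a) (K b) σ w = colour U C.N (K a) (K b) σ x).card := by
  refine eval_sum_card fun w hw => ?_
  have h1 : y ≠ 6 := by omega
  have h2 : y ≠ 5 := by omega
  rw [eval_conj]
  simp only [eval, eval_eqq, ite_pos_iff, Function.update_apply,
    Nat.reduceEqDiff, if_true, if_false, h1, h2, hy]
  simp only [hα.clique hc hw, hcol w hw x hx]

/-- Only vertices of the first anchor trigger the linear counting. The converse comparison is not
needed, since the cardinalities of the anchors are compared beforehand. -/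
theorem exists_counts : ∃ T, ∀ (U : SimpleGraph ℕ) (n d : ℕ) (C : Ctx) (W a b : ℕ)
    (v : Env) (α : Arr) (K : ℕ → Set ℕ) (σ : ℕ → ℕ), Pair U n d C W a b v → Tabs U d C K α →
      (∀ u < C.N, ∀ w < C.N, α 34 0 u = α 34 0 w ↔
        colour U C.N (K a) (K b) σ u = colour U C.N (K a) (K b) σ w) →
      Tri C W counts v α (T * (((aC C.N (K a)).card + 1) * C.N)) (fun β =>
        Frame [37, 38] α β ∧ β 38 0 0 = if ∀ x < C.N, x ∈ K a →
          ((Finset.range C.N).filter fun w => w ∈ K a ∧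
            colour U C.N (K a) (K b) σ w = colour U C.N (K a) (K b) σ x).card =
          ((Finset.range C.N).filter fun w => w ∈ K b ∧
            colour U C.N (K a) (K b) σ w = colour U C.N (K a) (K b) σ x).card then 1 else 0) := by
  refine ⟨(Expr.rd 2 (.var 2) (.var 5)).cost 1 + countExpr.cost 1 + 24 + (countTotal.cost 1 + 13),
    fun U n d C W a b v α K σ h hα hcol => ?_⟩
  have hN := h.setup.one_le
  have hNB := h.setup.size_le
  have hva := h.va
  have hg : ∀ β : Arr, Tabs U d C K β → ∀ x < C.N,
      (0 < (Expr.rd 2 (.var 2) (.var 5)).eval C β (Function.update v 5 x) ↔ x ∈ K a) := by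
    intro β hβ x hx
    simp only [eval, Function.update_apply, Nat.reduceEqDiff, if_true, if_false, hva]
    exact hβ.clique h.ha hx
  set p : ℕ → Prop := fun x => ((Finset.range C.N).filter fun w => w ∈ K a ∧
      colour U C.N (K a) (K b) σ w = colour U C.N (K a) (K b) σ x).card =
    ((Finset.range C.N).filter fun w => w ∈ K b ∧
      colour U C.N (K a) (K b) σ w = colour U C.N (K a) (K b) σ x).card with hp
  refine Tri.seq (T₂ := (countTotal.cost 1 + 13) * C.N)
    (Tri.gtab_frame h.setup.valid hN (by decide) (by decide) (by decide) rfl rfl rfl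
    (by decide) (fun x => x ∈ K a) (fun x hx => hg α hα x hx)
    (fun x => if p x then 0 else 1) (fun x hx _ => ?_) ?_)
    (fun β₁ h₁ => ?_) ?_
  · rw [countExpr, eval_neg, eval_eqq, colourCount_eval hα h.va (by omega) h.ha hx hcol,
      colourCount_eval hα h.vb (by omega) h.hb hx hcol]
    simp only [ite_pos_iff, hp]
  · intro x hx _
    split_ifs <;> omega
  · have hα₁ : Tabs U d C K β₁ := hα.frame h₁.1 (by decide)
    have hsum := eval_sum_pos (C := C) (α := β₁) (v := v) (x := 5)
      (e := conj (.rd 2 (.var 2) (.var 5)) (.rd 37 (.lit 0) (.var 5)))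
      (p := fun x => x ∈ K a ∧ ¬ p x) (fun x hx => by
        rw [eval_conj, ite_pos_iff, hg β₁ hα₁ x hx]
        refine and_congr_right fun hxa => ?_
        simp only [eval, Function.update_self]
        rw [h₁.2 x hx, if_pos hxa, pos_ite_zero_iff])
    refine Tri.mono (Tri.scalar h.setup.valid hN (by decide) (by decide) (by decide) (by decide)
      (if ∀ x < C.N, x ∈ K a → p x then 1 else 0) ?_ ((indicator_le _).trans (hN.trans hNB))) le_rfl
      (fun β₂ h₂ => ⟨(h₁.1.mono (by simp)).trans (h₂.1.mono (by simp)), h₂.2⟩)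
    rw [countTotal, eval_neg]
    by_cases hall : ∀ x < C.N, x ∈ K a → p x
    · rw [if_pos hall, if_neg]
      intro hpos
      obtain ⟨x, hx, hxa, hnp⟩ := hsum.mp hpos
      exact hnp (hall x hx hxa)
    · rw [if_neg hall, if_pos]
      push Not at hall
      obtain ⟨x, hx, hxa, hnp⟩ := hall
      exact hsum.mpr ⟨x, hx, hxa, hnp⟩
  · have h1 : C.N ≤ ((aC C.N (K a)).card + 1) * C.N := Nat.le_mul_of_pos_left _ (by omega)
    rw [add_mul ((Expr.rd 2 (.var 2) (.var 5)).cost 1 + countExpr.cost 1 + 24)]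
    exact Nat.add_le_add (le_of_eq rfl) (Nat.mul_le_mul_left _ h1)

/-- Test whether the permutation of rays given by the digits extends to an isomorphism. -/
def leafTest : Cmd :=
  buildPerm.seq <| mates.seq <| mismatches.seq <|
  Cmd.ite (.rd 33 (.lit 0) (.lit 0)) (Cmd.st 38 (.lit 0) (.lit 0) (.lit 0)) (colours.seq counts)

/-- The arrays used to test a permutation. -/
abbrev leafArrays : List ℕ := [29, 30, 31, 32, 33, 34, 35, 36, 37, 38]

/-- The stages are charged either to the vertices on rays or to the vertices of the anchor, and
`leafSize` adds both; its final 1 covers overheads that are linear in N. -/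
theorem exists_leafTest : ∃ T, ∀ (U : SimpleGraph ℕ) (n d : ℕ) (C : Ctx) (W a b : ℕ)
    (v : Env) (α : Arr) (K : ℕ → Set ℕ) (dig : ℕ → ℕ), Pair U n d C W a b v → Tabs U d C K α →
      (∀ i < C.N, α 26 0 i = dig i) → (∀ i, dig i ≤ i) →
      Tri C W leafTest v α (T * (leafSize U C.N (K a) * C.N)) (fun β => Frame leafArrays α β ∧
        β 38 0 0 = if Leaf U C.N (K a) (K b) (permSeq dig (aR U C.N (K a))) then 1 else 0) := by
  obtain ⟨T₁, hT₁⟩ := exists_buildPerm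
  obtain ⟨T₂, hT₂⟩ := exists_mates
  obtain ⟨T₃, hT₃⟩ := exists_mismatches
  obtain ⟨T₄, hT₄⟩ := exists_colours
  obtain ⟨T₅, hT₅⟩ := exists_counts
  refine ⟨T₁ + (T₂ + (T₃ + ((Expr.rd 33 (.lit 0) (.lit 0)).cost 1 + (T₄ + T₅ + 14) + 2))),
    fun U n d C W a b v α K dig h hα hdig hle => ?_⟩
  have hN := h.setup.one_le
  have hNB := h.setup.size_le
  set m := leafSize U C.N (K a) with hm
  have hX : ((aX U C.N (K a)).card + 1) * C.N ≤ m * C.N :=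
    Nat.mul_le_mul_right _ (by rw [hm, leafSize]; omega)
  have hCm : ((aC C.N (K a)).card + 1) * C.N ≤ m * C.N :=
    Nat.mul_le_mul_right _ (by rw [hm, leafSize]; omega)
  have h1m : C.N ≤ m * C.N := Nat.le_mul_of_pos_left _ (by rw [hm, leafSize]; omega)
  set σ : ℕ → ℕ := ⇑(permSeq dig (aR U C.N (K a))) with hσ
  rw [add_mul]
  refine Tri.seq (Tri.mono (hT₁ U n d C W a b v α K dig h hα hdig hle)
    (Nat.mul_le_mul_left _ hX) fun _ h => h) (fun β₁ h₁ => ?_) le_rfl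
  have hα₁ : Tabs U d C K β₁ := hα.frame h₁.1 (by decide)
  rw [add_mul]
  refine Tri.seq (Tri.mono (hT₂ U n d C W a b v β₁ K σ h hα₁ h₁.2)
    (Nat.mul_le_mul_left _ hX) fun _ h => h) (fun β₂ h₂ => ?_) le_rfl
  have hα₂ : Tabs U d C K β₂ := hα₁.frame h₂.1 (by decide)
  rw [add_mul]
  refine Tri.seq (Tri.mono (hT₃ U n d C W a b v β₂ K σ h hα₂ h₂.2)
    (Nat.mul_le_mul_left _ hX) fun _ h => h) (fun β₃ h₃ => ?_) le_rfl
  have hα₃ : Tabs U d C K β₃ := hα₂.frame h₃.1 (by decide)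
  have hf : Frame leafArrays α β₃ :=
    ((h₁.1.mono (by decide)).trans (h₂.1.mono (by decide))).trans (h₃.1.mono (by decide))
  refine Tri.mono (Tri.ite (T := (T₄ + T₅ + 14) * (m * C.N)) h.setup.valid (by decide)
    (fun hbad => ?_) (fun hok => ?_)) ?_ fun _ h => h
  -- After a mismatch the answer is already negative, and the colours must be skipped because they
  -- presuppose that all mates exist.
  · simp only [eval] at hbad
    refine Tri.mono (Tri.scalar h.setup.valid hN (by decide) (by decide) (by decide) (by decide) 0
      rfl (by omega)) ?_ (fun β₄ h₄ => ⟨hf.trans (h₄.1.mono (by decide)), ?_⟩)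
    · exact Nat.mul_le_mul (by simp only [cost]; omega) h1m
    · rw [h₄.2, if_neg]
      intro hl
      have := h₃.2.mpr ⟨hl.lt, hl.adj⟩
      omega
  · simp only [eval, Nat.pos_iff_ne_zero, not_not] at hok
    obtain ⟨hlt, hadj⟩ := h₃.2.mp hok
    refine Tri.seq (T₁ := T₄ * (m * C.N)) (T₂ := T₅ * (m * C.N))
      (Tri.mono (hT₄ U n d C W a b v β₃ K σ h hα₃ ?_ hlt)
      (Nat.mul_le_mul_left _ hX) fun _ h => h) (fun β₄ h₄ => ?_)
      (by rw [← add_mul]; exact Nat.mul_le_mul_right _ (by omega))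
    · rw [h₃.1 31 (by decide)]; exact h₂.2
    · refine Tri.mono (hT₅ U n d C W a b v β₄ K σ h (hα₃.frame h₄.1 (by decide)) h₄.2)
        (Nat.mul_le_mul_left _ hCm) (fun β₅ h₅ => ⟨(hf.trans (h₄.1.mono (by decide))).trans
          (h₅.1.mono (by decide)), ?_⟩)
      rw [h₅.2]
      refine if_congr ⟨fun hc => ⟨hlt, hadj, hc⟩, fun hl => hl.count⟩ rfl rfl
  · have e1 := cost_le_const hN (e := Expr.rd 33 (.lit 0) (.lit 0)) (by decide)
    have : 1 ≤ m * C.N := hN.trans h1m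
    generalize T₄ + T₅ + 14 = c
    nlinarith

/-! ### Trying all permutations -/

/-- The first digit that can be increased. -/
def firstDigit : Expr :=
  .mn 5 (.ite (conj (.lt (.var 5) (.rd 10 (.var 2) (.lit 0)))
    (.lt (.rd 26 (.lit 0) (.var 5)) (.var 5))) (.var 5) .size)

/-- The digits of the next number. -/
def nextDigit : Expr :=
  .ite (.lt (.var 5) (.rd 28 (.lit 0) (.lit 0))) (.lit 0)
    (.ite (eqq (.var 5) (.rd 28 (.lit 0) (.lit 0))) (.add (.rd 26 (.lit 0) (.var 5)) (.lit 1))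
      (.rd 26 (.lit 0) (.var 5)))

/-- Go to the next permutation, or finish after the last one. -/
def advance : Cmd :=
  (Cmd.st 28 (.lit 0) (.lit 0) firstDigit).seq <|
  Cmd.ite (.lt (.rd 28 (.lit 0) (.lit 0)) .size)
    ((Cmd.gtab 27 5 (.lit 1) nextDigit).seq (Cmd.gtab 26 5 (.lit 1) (.rd 27 (.lit 0) (.var 5))))
    (Cmd.st 25 (.lit 0) (.lit 0) (.lit 1))

/-- The digits of `k` as they are stored for `r` rays. -/
def storedDigit (r k i : ℕ) : ℕ := if i < r then digit k i else 0

theorem storedDigit_le (r k i : ℕ) : storedDigit r k i ≤ i := by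
  unfold storedDigit
  split_ifs
  · exact digit_le k i
  · omega

theorem permSeq_storedDigit (r k : ℕ) : permSeq (storedDigit r k) r = permSeq (digit k) r :=
  permSeq_congr fun i hi => by simp [storedDigit, hi]

/-- Counting in the factorial number system: the first digit below its maximum is raised and the
digits before it are reset. If there is no such digit among the first r, the counter has run through
all r! values. Digits from r on are stored as zero. -/
theorem exists_advance : ∃ T, ∀ (U : SimpleGraph ℕ) (n d : ℕ) (C : Ctx) (W a b : ℕ)
    (v : Env) (α : Arr) (K : ℕ → Set ℕ) (k : ℕ), Pair U n d C W a b v → Tabs U d C K α →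
      k < (aR U C.N (K a)).factorial →
      (∀ i < C.N, α 26 0 i = storedDigit (aR U C.N (K a)) k i) → α 25 0 0 = 0 →
      Tri C W advance v α (T * C.N) (fun β => Frame [25, 26, 27, 28] α β ∧
        ((β 25 0 0 = 0 ∧ k + 1 < (aR U C.N (K a)).factorial ∧
            ∀ i < C.N, β 26 0 i = storedDigit (aR U C.N (K a)) (k + 1) i) ∨
          β 25 0 0 = 1 ∧ k + 1 = (aR U C.N (K a)).factorial)) := by
  refine ⟨(firstDigit.cost 1 + 13) + ((Expr.lt (.rd 28 (.lit 0) (.lit 0)) .size).cost 1 +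
    (((Expr.lit 1).cost 1 + nextDigit.cost 1 + 24) +
      ((Expr.lit 1).cost 1 + (Expr.rd 27 (.lit 0) (.var 5)).cost 1 + 24)) + 2),
    fun U n d C W a b v α K k h hα hk hdig hdone => ?_⟩
  have hN := h.setup.one_le
  have hNB := h.setup.size_le
  have hva := h.va
  have hrX := aR_le_card U C.N (K a)
  have hXN := aX_card_le U C.N (K a)
  have e10 : α 10 a 0 = aR U C.N (K a) := hα.rays h.ha (by omega)
  set r := aR U C.N (K a) with hr
  have heval : firstDigit.eval C α v = minTo C.N (fun i =>
      if i < r ∧ digit k i < i then i else C.N) C.N := by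
    simp only [firstDigit, eval, eval_conj, ite_pos_iff, Function.update_apply, Nat.reduceEqDiff,
      if_true, if_false, hva, e10]
    refine minTo_congr fun i hi => ?_
    rw [hdig i hi]
    by_cases hir : i < r <;> simp [storedDigit, hir]
  rw [add_mul]
  refine Tri.seq (Tri.scalar h.setup.valid hN (by decide) (by decide) (by decide) (by decide) _
    heval ((minTo_le_top _ _ _).trans hNB)) (fun β₁ h₁ => ?_) le_rfl
  have e26 : ∀ i < C.N, β₁ 26 0 i = storedDigit r k i := by rw [h₁.1 26 (by decide)]; exact hdig
  have e25 : β₁ 25 0 0 = 0 := by rw [h₁.1 25 (by decide)]; exact hdone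
  refine Tri.mono (Tri.ite (T := (((Expr.lit 1).cost 1 + nextDigit.cost 1 + 24) +
      ((Expr.lit 1).cost 1 + (Expr.rd 27 (.lit 0) (.var 5)).cost 1 + 24)) * C.N) h.setup.valid
    (by decide) (fun hlt => ?_) (fun hge => ?_)) ?_ fun _ h => h
  · rw [eval_lt_pos] at hlt
    simp only [eval] at hlt
    rw [h₁.2] at hlt
    rcases minTo_eq_top_or C.N (fun i => if i < r ∧ digit k i < i then i else C.N) C.N with
      htop | ⟨q, hq, hmin⟩
    · omega
    have hqe : (q < r ∧ digit k q < q) ∧ β₁ 28 0 0 = q := by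
      rw [h₁.2]
      split_ifs at hmin with hc
      · exact ⟨hc, hmin⟩
      · omega
    obtain ⟨⟨hqr, hqd⟩, hqe⟩ := hqe
    have hfull : ∀ j < q, digit k j = j := fun j hj => by
      by_contra hne
      have h1 : digit k j < j := lt_of_le_of_ne (digit_le k j) hne
      have h2 := minTo_le (M := C.N) (f := fun i => if i < r ∧ digit k i < i then i else C.N)
        (show j < C.N by omega)
      rw [if_pos ⟨by omega, h1⟩, ← h₁.2] at h2
      omega
    have hnext : ∀ i < C.N, nextDigit.eval C β₁ (Function.update v 5 i) =
        storedDigit r (k + 1) i := by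
      intro i hi
      simp only [nextDigit, eval, eval_eqq, ite_pos_iff, Function.update_self, hqe, e26 i hi]
      by_cases h1 : i < q
      · rw [if_pos h1, storedDigit, if_pos (by omega),
          digit_succ_of_full fun j hj => hfull j (by omega), hfull i h1]
        simp
      · rw [if_neg h1]
        by_cases h2 : i = q
        · subst h2
          rw [if_pos rfl, storedDigit, storedDigit, if_pos hqr, if_pos hqr,
            digit_succ_of_full hfull, if_pos hqd]
        · rw [if_neg h2, storedDigit, storedDigit]
          rw [digit_succ_of_lt (show q < i by omega) hqd]
    have hnB : ∀ i < C.N, storedDigit r (k + 1) i ≤ C.B := fun i hi =>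
      (storedDigit_le _ _ _).trans (by omega)
    rw [add_mul ((Expr.lit 1).cost 1 + nextDigit.cost 1 + 24)]
    refine Tri.seq (Tri.row_frame h.setup.valid hN (by decide) (by decide) (by decide) rfl rfl rfl
      rfl (fun _ => True) (fun j _ => by simp [eval]) (fun i => storedDigit r (k + 1) i)
      (fun i hi _ => hnext i hi) (fun i hi _ => hnB i hi)) (fun β₂ h₂ => ?_) le_rfl
    refine Tri.mono (Tri.row_frame h.setup.valid hN (by decide) (by decide) (by decide) rfl rfl rfl
      rfl (fun _ => True) (fun j _ => by simp [eval]) (fun i => storedDigit r (k + 1) i)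
      (fun i hi _ => ?_) (fun i hi _ => hnB i hi)) le_rfl (fun β₃ h₃ => ⟨?_, Or.inl ⟨?_, ?_, ?_⟩⟩)
    · simp only [eval, Function.update_self]
      rw [h₂.2 i hi, if_pos trivial]
    · exact ((h₁.1.mono (by decide)).trans (h₂.1.mono (by decide))).trans (h₃.1.mono (by decide))
    · rw [h₃.1 25 (by decide), h₂.1 25 (by decide)]; exact e25
    · refine lt_of_le_of_ne hk fun e => ?_
      exact not_dvd_of_digit_lt hqr hqd (by rw [e])
    · intro i hi
      rw [h₃.2 i hi, if_pos trivial]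
  · rw [eval_lt_pos] at hge
    simp only [eval] at hge
    refine Tri.mono (Tri.scalar h.setup.valid hN (by decide) (by decide) (by decide) (by decide) 1
      rfl (by omega)) ?_ (fun β₂ h₂ => ⟨(h₁.1.mono (by decide)).trans (h₂.1.mono (by decide)),
        Or.inr ⟨h₂.2, ?_⟩⟩)
    · exact Nat.mul_le_mul_right _ (by simp only [cost]; omega)
    · refine eq_factorial_of_full hk fun i hi => ?_
      by_contra hne
      have h1 : digit k i < i := lt_of_le_of_ne (digit_le k i) hne
      have h2 := minTo_le (M := C.N) (f := fun i => if i < r ∧ digit k i < i then i else C.N)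
        (show i < C.N by omega)
      rw [if_pos ⟨hi, h1⟩, ← h₁.2] at h2
      omega
  · have e1 := cost_le_const hN (e := Expr.lt (.rd 28 (.lit 0) (.lit 0)) .size) (by decide)
    generalize ((Expr.lit 1).cost 1 + nextDigit.cost 1 + 24) +
      ((Expr.lit 1).cost 1 + (Expr.rd 27 (.lit 0) (.var 5)).cost 1 + 24) = c
    nlinarith

end

end StarIso

/-! ### The loop over all permutations of rays for two given anchors -/

namespace StarIso

open WordRAM Classical Expr

noncomputable section

variable {U : SimpleGraph ℕ} {n d : ℕ} {C : Ctx} {W : ℕ} {v : Env} {α : Arr} {K : ℕ → Set ℕ}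
  {a b x : ℕ}

/-- Record that the components of the anchors are isomorphic. -/
def success : Cmd :=
  (Cmd.st 24 (.lit 0) (.lit 0) (.lit 1)).seq <| (Cmd.st 25 (.lit 0) (.lit 0) (.lit 1)).seq
    (Cmd.gtab 23 5 (.lt (.rd 1 (.var 3) (.var 5)) .size) (.lit 1))

/-- Test one permutation. -/
def attemptStep : Cmd := leafTest.seq (Cmd.ite (.rd 38 (.lit 0) (.lit 0)) success advance)

/-- Try all permutations of the rays. -/
def attempt : Cmd :=
  (Cmd.gtab 26 5 (.lit 1) (.lit 0)).seq <| (Cmd.st 25 (.lit 0) (.lit 0) (.lit 0)).seq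
    (Cmd.whl (neg (.rd 25 (.lit 0) (.lit 0))) attemptStep)

/-- The arrays that change while two anchors are compared. -/
abbrev attemptArrays : List ℕ := [23, 24, 25, 26, 27, 28, 29, 30, 31, 32, 33, 34, 35, 36, 37, 38]

/-- An isomorphism has been found, and recorded. -/
def Success (U : SimpleGraph ℕ) (N : ℕ) (K : ℕ → Set ℕ) (a b : ℕ) (α β : Arr) : Prop :=
  (∃ σ : Equiv.Perm ℕ, Leaf U N (K a) (K b) σ) ∧ β 24 0 0 = 1 ∧
    ∀ x < N, β 23 0 x = if capDist U N b x < N then 1 else α 23 0 x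

/-- There is no isomorphism. -/
def Failure (U : SimpleGraph ℕ) (N : ℕ) (K : ℕ → Set ℕ) (a b : ℕ) (α β : Arr) : Prop :=
  (∀ σ : Equiv.Perm ℕ, (∀ i, aR U N (K a) ≤ i → σ i = i) → ¬ Leaf U N (K a) (K b) σ) ∧
    β 24 = α 24 ∧ β 23 = α 23

/-- The state after `k` permutations. -/
def AttemptInv (U : SimpleGraph ℕ) (C : Ctx) (K : ℕ → Set ℕ) (a b : ℕ) (α : Arr) (k : ℕ)
    (β : Arr) : Prop :=
  Frame attemptArrays α β ∧
  ((β 25 0 0 = 0 ∧ k < (aR U C.N (K a)).factorial ∧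
      (∀ i < C.N, β 26 0 i = storedDigit (aR U C.N (K a)) k i) ∧
      (∀ j < k, ¬ Leaf U C.N (K a) (K b) (permSeq (digit j) (aR U C.N (K a)))) ∧
      β 24 = α 24 ∧ β 23 = α 23) ∨
    (β 25 0 0 = 1 ∧ (Success U C.N K a b α β ∨ Failure U C.N K a b α β)))

theorem exists_success : ∃ T, ∀ (U : SimpleGraph ℕ) (n d : ℕ) (C : Ctx) (W a b : ℕ)
    (v : Env) (α : Arr) (K : ℕ → Set ℕ), Pair U n d C W a b v → Tabs U d C K α →
      Tri C W success v α (T * C.N) (fun β => Frame [23, 24, 25] α β ∧ β 24 0 0 = 1 ∧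
        β 25 0 0 = 1 ∧ ∀ x < C.N, β 23 0 x = if capDist U C.N b x < C.N then 1 else α 23 0 x) := by
  refine ⟨((Expr.lit 1).cost 1 + 13) + (((Expr.lit 1).cost 1 + 13) +
    ((Expr.lt (.rd 1 (.var 3) (.var 5)) .size).cost 1 + (Expr.lit 1).cost 1 + 24)),
    fun U n d C W a b v α K h hα => ?_⟩
  have hN := h.setup.one_le
  have hNB := h.setup.size_le
  have hvb := h.vb
  rw [add_mul ((Expr.lit 1).cost 1 + 13)]
  refine Tri.seq (Tri.scalar h.setup.valid hN (by decide) (by decide) (by decide) (by decide) 1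
    rfl (by omega)) (fun β₁ h₁ => ?_) le_rfl
  rw [add_mul ((Expr.lit 1).cost 1 + 13)]
  refine Tri.seq (Tri.scalar h.setup.valid hN (by decide) (by decide) (by decide) (by decide) 1
    rfl (by omega)) (fun β₂ h₂ => ?_) le_rfl
  have hα₂ : Tabs U d C K β₂ := (hα.frame h₁.1 (by decide)).frame h₂.1 (by decide)
  refine Tri.mono (Tri.row_frame h.setup.valid hN (by decide) (by decide) (by decide) rfl rfl rfl
    rfl (fun x => capDist U C.N b x < C.N) (fun x hx => ?_) (fun _ => 1) (fun _ _ _ => rfl)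
    (fun _ _ _ => by omega)) le_rfl (fun β₃ h₃ => ⟨?_, ?_, ?_, ?_⟩)
  · rw [eval_lt_pos]
    simp only [eval, Function.update_apply, Nat.reduceEqDiff, if_true, if_false, hvb]
    rw [hα₂.dist h.hb hx]
  · exact ((h₁.1.mono (by decide)).trans (h₂.1.mono (by decide))).trans (h₃.1.mono (by decide))
  · rw [h₃.1 24 (by decide), h₂.1 24 (by decide)]; exact h₁.2
  · rw [h₃.1 25 (by decide)]; exact h₂.2
  · intro x hx
    rw [h₃.2 x hx, h₂.1 23 (by decide), h₁.1 23 (by decide)]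

theorem exists_attemptStep : ∃ T, ∀ (U : SimpleGraph ℕ) (n d : ℕ) (C : Ctx) (W a b : ℕ)
    (v : Env) (α β : Arr) (K : ℕ → Set ℕ) (k : ℕ), Pair U n d C W a b v → Tabs U d C K α →
      AttemptInv U C K a b α k β → β 25 0 0 = 0 →
      Tri C W attemptStep v β (T * (leafSize U C.N (K a) * C.N))
        (AttemptInv U C K a b α (k + 1)) := by
  obtain ⟨T₁, hT₁⟩ := exists_leafTest
  obtain ⟨T₂, hT₂⟩ := exists_success
  obtain ⟨T₃, hT₃⟩ := exists_advance
  refine ⟨T₁ + ((Expr.rd 38 (.lit 0) (.lit 0)).cost 1 + (T₂ + T₃) + 2),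
    fun U n d C W a b v α β K k h hα hI hrun => ?_⟩
  have hN := h.setup.one_le
  obtain ⟨hf, ⟨-, hk, hdig, hno, h24, h23⟩ | ⟨hdone, -⟩⟩ := hI
  swap
  · omega
  have hβ : Tabs U d C K β := hα.frame hf (by decide)
  have h1m : C.N ≤ leafSize U C.N (K a) * C.N :=
    Nat.le_mul_of_pos_left _ (by rw [leafSize]; omega)
  set r := aR U C.N (K a) with hr
  rw [add_mul]
  refine Tri.seq (hT₁ U n d C W a b v β K (storedDigit r k) h hβ hdig (storedDigit_le r k))
    (fun β₁ h₁ => ?_) le_rfl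
  have hβ₁ : Tabs U d C K β₁ := hβ.frame h₁.1 (by decide)
  have hf₁ : Frame attemptArrays α β₁ := hf.trans (h₁.1.mono (by decide))
  have e23 : β₁ 23 = α 23 := (h₁.1 23 (by decide)).trans h23
  have e24 : β₁ 24 = α 24 := (h₁.1 24 (by decide)).trans h24
  refine Tri.mono (Tri.ite (T := (T₂ + T₃) * C.N) h.setup.valid
    (by decide) (fun hok => ?_) (fun hbad => ?_)) ?_ fun _ h => h
  · simp only [eval] at hok
    rw [h₁.2, ite_pos_iff] at hok
    refine Tri.mono (hT₂ U n d C W a b v β₁ K h hβ₁) (Nat.mul_le_mul_right _ (by omega))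
      (fun β₂ h₂ => ⟨hf₁.trans (h₂.1.mono (by decide)),
        Or.inr ⟨h₂.2.2.1, Or.inl ⟨⟨_, hok⟩, h₂.2.1, fun x hx => ?_⟩⟩⟩)
    rw [h₂.2.2.2 x hx, e23]
  · simp only [eval] at hbad
    rw [h₁.2, ite_pos_iff, permSeq_storedDigit] at hbad
    have hno' : ∀ j < k + 1, ¬ Leaf U C.N (K a) (K b) (permSeq (digit j) r) := fun j hj => by
      rcases (Nat.lt_succ_iff.mp hj).eq_or_lt with rfl | hj
      · exact hbad
      · exact hno j hj
    refine Tri.mono (hT₃ U n d C W a b v β₁ K k h hβ₁ hk ?_ ?_)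
      (Nat.mul_le_mul_right _ (by omega)) (fun β₂ h₂ => ⟨hf₁.trans (h₂.1.mono (by decide)), ?_⟩)
    · rw [h₁.1 26 (by decide)]; exact hdig
    · rw [h₁.1 25 (by decide)]; exact hrun
    have g23 : β₂ 23 = α 23 := (h₂.1 23 (by decide)).trans e23
    have g24 : β₂ 24 = α 24 := (h₂.1 24 (by decide)).trans e24
    rcases h₂.2 with ⟨h3, h4, h5⟩ | ⟨h3, h4⟩
    · exact Or.inl ⟨h3, h4, h5, hno', g24, g23⟩
    -- Failure is claimed for all permutations supported on the first r numbers. Each of them is a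
    -- product of transpositions with bounded digits, and these are the factorial digits of some
    -- number below r!, which has been tried.
    · refine Or.inr ⟨h3, Or.inr ⟨fun σ hσ hl => ?_, g24, g23⟩⟩
      obtain ⟨dig, hd1, rfl⟩ := exists_permSeq r σ hσ
      obtain ⟨j, hj, hd2⟩ := exists_digit dig hd1 r
      refine hno' j (by rw [h4]; exact hj) ?_
      rw [permSeq_congr hd2]; exact hl
  · have e1 := cost_le_const hN (e := Expr.rd 38 (.lit 0) (.lit 0)) (by decide)
    generalize leafSize U C.N (K a) * C.N = M at *
    have := Nat.mul_le_mul_left (T₂ + T₃) h1m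
    have : 1 ≤ M := hN.trans h1m
    generalize (Expr.rd 38 (.lit 0) (.lit 0)).cost 1 = c at *
    nlinarith

theorem exists_attempt : ∃ T, ∀ (U : SimpleGraph ℕ) (n d : ℕ) (C : Ctx) (W a b : ℕ)
    (v : Env) (α : Arr) (K : ℕ → Set ℕ), Pair U n d C W a b v → Tabs U d C K α →
      Tri C W attempt v α (T * ((aR U C.N (K a)).factorial * (leafSize U C.N (K a) * C.N)))
        (fun β => Frame attemptArrays α β ∧
          (Success U C.N K a b α β ∨ Failure U C.N K a b α β)) := by
  obtain ⟨T, hT⟩ := exists_attemptStep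
  refine ⟨((Expr.lit 1).cost 1 + (Expr.lit 0).cost 1 + 24) + (((Expr.lit 0).cost 1 + 13) +
    2 * (T + (neg (.rd 25 (.lit 0) (.lit 0))).cost 1 + 2)),
    fun U n d C W a b v α K h hα => ?_⟩
  have hN := h.setup.one_le
  have hNB := h.setup.size_le
  have h1m : C.N ≤ leafSize U C.N (K a) * C.N :=
    Nat.le_mul_of_pos_left _ (by rw [leafSize]; omega)
  set r := aR U C.N (K a) with hr
  have hr1 : 1 ≤ r.factorial := Nat.factorial_pos r
  have h2m : C.N ≤ r.factorial * (leafSize U C.N (K a) * C.N) :=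
    h1m.trans (Nat.le_mul_of_pos_left _ hr1)
  rw [add_mul ((Expr.lit 1).cost 1 + (Expr.lit 0).cost 1 + 24)]
  refine Tri.seq (Tri.mono (Tri.row_frame h.setup.valid hN (by decide) (by decide) (by decide) rfl
    rfl rfl rfl (fun _ => True) (fun j _ => by simp [eval]) (fun _ => 0) (fun _ _ _ => rfl)
    (fun _ _ _ => by omega)) (Nat.mul_le_mul_left _ h2m) fun _ h => h) (fun β₁ h₁ => ?_) le_rfl
  rw [add_mul ((Expr.lit 0).cost 1 + 13)]
  refine Tri.seq (Tri.mono (Tri.scalar h.setup.valid hN (by decide) (by decide) (by decide)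
    (by decide) 0 rfl (by omega)) (Nat.mul_le_mul_left _ h2m) fun _ h => h) (fun β₂ h₂ => ?_) le_rfl
  have hf₂ : Frame attemptArrays α β₂ := (h₁.1.mono (by decide)).trans (h₂.1.mono (by decide))
  have hcond : ∀ β : Arr, 0 < (neg (.rd 25 (.lit 0) (.lit 0))).eval C β v ↔ β 25 0 0 = 0 :=
    fun β => by
      rw [eval_neg, pos_ite_zero_iff]; simp only [eval]; omega
  refine Tri.mono (Tri.whl h.setup.valid (by decide) (AttemptInv U C K a b α)
    (T * (leafSize U C.N (K a) * C.N)) r.factorial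
    (fun k _ β hβ hrun => hT U n d C W a b v α β K k h hα hβ ((hcond β).mp hrun))
    (fun β hβ hrun => ?_) ⟨hf₂, Or.inl ⟨h₂.2, hr1, ?_, fun j hj => absurd hj (by omega), ?_, ?_⟩⟩)
    ?_ ?_
  · rw [hcond] at hrun
    rcases hβ.2 with ⟨-, hlt, -⟩ | ⟨h1, -⟩
    · exact absurd hlt (lt_irrefl _)
    · omega
  · intro i hi
    rw [h₂.1 26 (by decide), h₁.2 i hi, if_pos trivial, storedDigit, digit_zero]
    simp
  · rw [h₂.1 24 (by decide), h₁.1 24 (by decide)]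
  · rw [h₂.1 23 (by decide), h₁.1 23 (by decide)]
  · have e1 := cost_le_const hN (e := neg (.rd 25 (.lit 0) (.lit 0))) (by decide)
    have h1 : 1 ≤ leafSize U C.N (K a) * C.N := hN.trans h1m
    generalize leafSize U C.N (K a) * C.N = M at *
    generalize (neg (.rd 25 (.lit 0) (.lit 0))).cost 1 = c at *
    calc (r.factorial + 1) * (T * M + (neg (.rd 25 (.lit 0) (.lit 0))).cost C.N + 2)
        ≤ (2 * r.factorial) * (T * M + c * M + 2 * M) := by
          gcongr
          · omega
          · exact e1.trans (Nat.le_mul_of_pos_right _ h1)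
          · omega
      _ = _ := by ring
  · rintro β ⟨k, hk, ⟨hf, ⟨hrun, -⟩ | ⟨-, hres⟩⟩, hnot⟩
    · exact absurd ((hcond β).mpr hrun) hnot
    · exact ⟨hf, hres⟩

end

end StarIso

namespace StarIso

open WordRAM Classical Expr

noncomputable section

/-! ### Searching for an isomorphic component -/

variable {U : SimpleGraph ℕ} {n d : ℕ} {C : Ctx} {W : ℕ} {v : Env} {α : Arr} {K : ℕ → Set ℕ}
  {a b x N : ℕ}

/-- The anchor in variable `3` belongs to an unused component of the second graph and has the same
parameters as the anchor in variable `2`. -/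
def candidate : Expr :=
  conj (neg (.rd 24 (.lit 0) (.lit 0))) <| conj (neg (.lt (.var 3) (.var 1))) <|
  conj (neg (.rd 23 (.lit 0) (.var 3))) <|
  conj (eqq (.rd 10 (.var 2) (.lit 0)) (.rd 10 (.var 3) (.lit 0))) <|
  conj (eqq (.rd 11 (.var 2) (.lit 0)) (.rd 11 (.var 3) (.lit 0)))
    (eqq (.rd 12 (.var 2) (.lit 0)) (.rd 12 (.var 3) (.lit 0)))

/-- Search for an unused component isomorphic to that of the anchor in variable `2`. -/
def search : Cmd :=
  (Cmd.st 24 (.lit 0) (.lit 0) (.lit 0)).seq <|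
  (Cmd.loop 3 (Cmd.ite candidate attempt Cmd.skip)).seq <|
  Cmd.ite (.rd 24 (.lit 0) (.lit 0)) Cmd.skip (Cmd.st 22 (.lit 0) (.lit 0) (.lit 0))

/-- The arrays that change during the search. -/
abbrev searchArrays : List ℕ := 22 :: attemptArrays

/-- The parameters of two anchors agree. -/
def Similar (U : SimpleGraph ℕ) (N : ℕ) (C D : Set ℕ) : Prop :=
  aR U N C = aR U N D ∧ (aX U N C).card = (aX U N D).card ∧ (aC N C).card = (aC N D).card

/-- The search has found the component of `b`. -/
def Found (U : SimpleGraph ℕ) (N n : ℕ) (K : ℕ → Set ℕ) (a b : ℕ) (α β : Arr) : Prop :=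
  n ≤ b ∧ b < N ∧ α 23 0 b = 0 ∧ Similar U N (K a) (K b) ∧
    (∃ σ : Equiv.Perm ℕ, Leaf U N (K a) (K b) σ) ∧
    ∀ x < N, β 23 0 x = if capDist U N b x < N then 1 else α 23 0 x

/-- No unused anchor below `k` is suitable. -/
def NoneBelow (U : SimpleGraph ℕ) (N n : ℕ) (K : ℕ → Set ℕ) (a k : ℕ) (α : Arr) : Prop :=
  ∀ b < k, n ≤ b → α 23 0 b = 0 → Similar U N (K a) (K b) →
    ∀ σ : Equiv.Perm ℕ, (∀ i, aR U N (K a) ≤ i → σ i = i) → ¬ Leaf U N (K a) (K b) σ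

theorem candidate_eval (h : Setup U n d C W) (hv : Params n d v) (hα : Tabs U d C K α)
    (hva : v 2 = a) (ha : a < C.N) (hb : b < C.N) :
    0 < candidate.eval C α (Function.update v 3 b) ↔
      α 24 0 0 = 0 ∧ n ≤ b ∧ α 23 0 b = 0 ∧ Similar U C.N (K a) (K b) := by
  have hn := hv.n
  have h0 : 0 < C.N := h.one_le
  simp only [candidate, eval, eval_conj, eval_neg, eval_eqq, ite_pos_iff, pos_ite_zero_iff,
    Function.update_apply, Nat.reduceEqDiff, if_true, if_false, hva, hn, not_lt,
    Nat.le_zero, OfNat.one_ne_ofNat]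
  rw [hα.rays ha h0, hα.rays hb h0, hα.cardX ha h0, hα.cardX hb h0, hα.cardC ha h0,
    hα.cardC hb h0]
  refine and_congr ?_ Iff.rfl
  by_cases h : 0 < α 24 0 0 <;> simp [h] <;> omega

/-- Only the anchor a is assumed good, which bounds its number of rays by d; a candidate b merely
has to agree with a in its parameters. At most N candidates, with at most d! permutations each, give
the factor N² together with the linear cost per vertex of the component. Once the flag in array 24
is set, the guard fails for all later candidates. -/
theorem exists_search : ∃ T, ∀ (U : SimpleGraph ℕ) (n d : ℕ) (C : Ctx) (W a : ℕ)
    (v : Env) (α : Arr) (K : ℕ → Set ℕ), Setup U n d C W → Params n d v → Tabs U d C K α →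
      v 2 = a → a < C.N → aR U C.N (K a) ≤ d →
      Tri C W search v α (T * (d.factorial * (leafSize U C.N (K a) * C.N ^ 2)))
        (fun β => Frame searchArrays α β ∧
          ((β 22 = α 22 ∧ ∃ b, Found U C.N n K a b α β) ∨
            (β 22 0 0 = 0 ∧ β 23 = α 23 ∧ NoneBelow U C.N n K a C.N α))) := by
  obtain ⟨T, hT⟩ := exists_attempt
  refine ⟨((Expr.lit 0).cost 1 + 13) + ((candidate.cost 1 + T + 11) +
    ((Expr.rd 24 (.lit 0) (.lit 0)).cost 1 + 17)),
    fun U n d C W a v α K h hv hα hva ha hr => ?_⟩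
  have hN := h.one_le
  have hNB := h.size_le
  set M := d.factorial * (leafSize U C.N (K a) * C.N ^ 2) with hM
  have hd1 : 1 ≤ d.factorial := Nat.factorial_pos d
  have hl1 : 1 ≤ leafSize U C.N (K a) := by rw [leafSize]; omega
  have hNM2 : C.N * C.N ≤ M := by
    rw [hM, pow_two]
    exact (Nat.le_mul_of_pos_left _ hl1).trans (Nat.le_mul_of_pos_left _ hd1)
  have hNM : C.N ≤ M := le_trans (by nlinarith) hNM2
  have hM1 : 1 ≤ M := hN.trans hNM
  rw [add_mul]
  refine Tri.seq (Tri.mono (Tri.scalar h.valid hN (by decide) (by decide) (by decide)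
    (by decide) 0 rfl (by omega)) (Nat.mul_le_mul_left _ hNM) fun _ h => h) (fun β₁ h₁ => ?_) le_rfl
  have hα₁ : Tabs U d C K β₁ := hα.frame h₁.1 (by decide)
  have e23 : β₁ 23 = α 23 := h₁.1 23 (by decide)
  rw [add_mul]
  refine Tri.seq (R := fun β => Frame attemptArrays β₁ β ∧
      ((β 24 0 0 = 1 ∧ ∃ b, Found U C.N n K a b β₁ β) ∨
        (β 24 0 0 = 0 ∧ β 23 = β₁ 23 ∧ NoneBelow U C.N n K a C.N β₁)))
    (Tri.mono (Tri.loop h.valid (by decide) (fun k β => Frame attemptArrays β₁ β ∧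
      ((β 24 0 0 = 1 ∧ ∃ b, Found U C.N n K a b β₁ β) ∨
        (β 24 0 0 = 0 ∧ β 23 = β₁ 23 ∧ NoneBelow U C.N n K a k β₁)))
    (fun _ => candidate.cost C.N + (T * ((aR U C.N (K a)).factorial *
      (leafSize U C.N (K a) * C.N)) + 1) + 2) ?_
    ⟨Frame.refl _ _, Or.inr ⟨h₁.2, rfl, fun b hb => absurd hb (by omega)⟩⟩) ?_ fun _ h => h)
    (fun β₂ h₂ => ?_) le_rfl
  · rintro k hk β ⟨hf, hI⟩
    have hβ : Tabs U d C K β := hα₁.frame hf (by decide)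
    refine Tri.ite h.valid (by decide) (fun hc => ?_) (fun hc => ?_)
    · rw [candidate_eval h hv hβ hva ha hk] at hc
      obtain ⟨c1, c2, c3, c4⟩ := hc
      rcases hI with ⟨h1, -⟩ | ⟨-, h23, hno⟩
      · omega
      refine Tri.mono (hT U n d C W a k _ β K ⟨h, ?_, by simp, ha, hk⟩ hβ) (by omega)
        (fun γ hγ => ⟨hf.trans hγ.1, ?_⟩)
      · rw [Function.update_of_ne (by decide)]; exact hva
      rw [h23] at c3
      rcases hγ.2 with ⟨g1, g2, g3⟩ | ⟨g1, g2, g3⟩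
      · exact Or.inl ⟨g2, k, c2, hk, c3, c4, g1, fun x hx => by rw [g3 x hx, h23]⟩
      · refine Or.inr ⟨by rw [g2]; exact c1, g3.trans h23, fun b hb => ?_⟩
        rcases (Nat.lt_succ_iff.mp hb).eq_or_lt with rfl | hb
        · exact fun _ _ _ => g1
        · exact hno b hb
    · rw [candidate_eval h hv hβ hva ha hk] at hc
      refine Tri.mono (Tri.skip ⟨hf, ?_⟩) (by omega) fun _ h => h
      rcases hI with hI | ⟨h0, h23, hno⟩
      · exact Or.inl hI
      · refine Or.inr ⟨h0, h23, fun b hb c2 c3 c4 => ?_⟩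
        rcases (Nat.lt_succ_iff.mp hb).eq_or_lt with rfl | hb
        · exact absurd ⟨h0, c2, h23 ▸ c3, c4⟩ hc
        · exact hno b hb c2 c3 c4
  · rw [Finset.sum_const, Finset.card_range, smul_eq_mul]
    have e1 := cost_le_const hN (e := candidate) (by decide)
    have e2 : C.N * ((aR U C.N (K a)).factorial * (leafSize U C.N (K a) * C.N)) ≤ M := by
      calc _ = (aR U C.N (K a)).factorial * (leafSize U C.N (K a) * C.N ^ 2) := by ring
        _ ≤ M := Nat.mul_le_mul_right _ (Nat.factorial_le hr)
    generalize (aR U C.N (K a)).factorial * (leafSize U C.N (K a) * C.N) = R at *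
    calc C.N * (candidate.cost C.N + (T * R + 1) + 2 + 4) + 4
        ≤ C.N * (candidate.cost 1 + (T * R + 1) + 2 + 4) + 4 := by gcongr
      _ = (candidate.cost 1 + 7) * C.N + T * (C.N * R) + 4 := by ring
      _ ≤ (candidate.cost 1 + 7) * M + T * M + 4 * M := by gcongr; omega
      _ = _ := by ring
  · have hf₂ : Frame searchArrays α β₂ :=
      (h₁.1.mono (by decide)).trans (h₂.1.mono (by decide))
    have e22 : β₂ 22 = α 22 := (h₂.1 22 (by decide)).trans (h₁.1 22 (by decide))
    refine Tri.mono (Tri.ite (T := 15 * C.N) h.valid (by decide) (fun hc => ?_) (fun hc => ?_)) ?_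
      fun _ h => h
    · simp only [eval] at hc
      rcases h₂.2 with ⟨-, b, f1, f2, f3, f4, f5, f6⟩ | ⟨h0, -⟩
      · refine Tri.mono (Tri.skip ⟨hf₂, Or.inl ⟨e22, b, f1, f2, e23 ▸ f3, f4, f5, ?_⟩⟩) (by omega)
          fun _ h => h
        intro x hx
        rw [f6 x hx, e23]
      · omega
    · simp only [eval] at hc
      rcases h₂.2 with ⟨h0, -⟩ | ⟨-, h23, hno⟩
      · omega
      · refine Tri.mono (Tri.scalar h.valid hN (by decide) (by decide) (by decide)
          (by decide) 0 rfl (by omega)) (Nat.mul_le_mul_right _ (by simp only [cost]; omega))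
          (fun γ hγ => ⟨hf₂.trans (hγ.1.mono (by decide)), Or.inr ⟨hγ.2, ?_, ?_⟩⟩)
        · rw [hγ.1 23 (by decide), h23, e23]
        · intro b hb c2 c3
          exact hno b hb c2 (by rw [e23]; exact c3)
    · have e1 := cost_le_const hN (e := Expr.rd 24 (.lit 0) (.lit 0)) (by decide)
      generalize (Expr.rd 24 (.lit 0) (.lit 0)).cost 1 = c at *
      nlinarith

end

end StarIso

namespace StarIso

open WordRAM Classical Expr

noncomputable section

/-! ### Matching all components -/

section

variable {U : SimpleGraph ℕ} {n d N : ℕ} {α β : Arr} {K : ℕ → Set ℕ} {a b i : ℕ} {f : ℕ → ℕ}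

/-- The clique of `a` is good, and no earlier clique of the same component is. -/
def Chosen (U : SimpleGraph ℕ) (N d : ℕ) (K : ℕ → Set ℕ) (a : ℕ) : Prop :=
  Good U N (K a) d ∧ ∀ b < N, b < a → Good U N (K b) d → ¬ U.Reachable b a

/-- The vertices of the first graph outside the components of the chosen vertices below `i`. -/
def leftRest (U : SimpleGraph ℕ) (N n d : ℕ) (K : ℕ → Set ℕ) (i : ℕ) : Set ℕ :=
  {u | u < n ∧ ∀ a < i, a < n ∧ Chosen U N d K a → ¬ U.Reachable a u}

/-- The vertices of the second graph that are not marked as used. -/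
def rightRest (N n : ℕ) (α : Arr) : Set ℕ := {u | n ≤ u ∧ u < N ∧ α 23 0 u = 0}

theorem Instance.reachable_lt_iff (h : Instance U n d) {u w : ℕ} (hr : U.Reachable u w) :
    u < n ↔ w < n := by
  rw [SimpleGraph.reachable_iff_reflTransGen] at hr
  induction hr with
  | refl => exact Iff.rfl
  | tail _ hadj ih => exact ih.trans (h.side _ _ hadj)

theorem closedSet_leftRest (h : Instance U n d) : ClosedSet U (leftRest U N n d K i) :=
  fun u hu w hadj => ⟨(h.side u w hadj).mp hu.1, fun a ha hc hr =>
    hu.2 a ha hc (hr.trans hadj.symm.reachable)⟩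

theorem leftRest_succ (hc : a < n ∧ Chosen U N d K a) :
    leftRest U N n d K (a + 1) = leftRest U N n d K a \ {u | U.Reachable a u} := by
  ext u
  simp only [leftRest, Set.mem_ofPred_eq, Set.mem_sdiff, Nat.lt_succ_iff_lt_or_eq, and_assoc]
  refine and_congr_right fun _ => ⟨fun h => ⟨fun b hb => h b (Or.inl hb), h a (Or.inr rfl) hc⟩, ?_⟩
  rintro ⟨h1, h2⟩ b (hb | rfl)
  · exact h1 b hb
  · exact fun _ => h2

theorem leftRest_succ_of_not (hc : ¬ (a < n ∧ Chosen U N d K a)) :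
    leftRest U N n d K (a + 1) = leftRest U N n d K a := by
  ext u
  simp only [leftRest, Set.mem_ofPred_eq, Nat.lt_succ_iff_lt_or_eq]
  refine and_congr_right fun _ => ⟨fun h b hb => h b (Or.inl hb), ?_⟩
  rintro h1 b (hb | rfl)
  · exact h1 b hb
  · exact fun h => absurd h hc

theorem leftRest_zero : leftRest U N n d K 0 = {u | u < n} := by simp [leftRest]

theorem Chosen.mem_leftRest (hnN : n ≤ N) (hc : Chosen U N d K a) (ha : a < n) :
    a ∈ leftRest U N n d K a :=
  ⟨ha, fun b hb hb' => hc.2 b (by omega) hb hb'.2.1⟩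

/-- The component of any vertex contains a good maximal clique, which occurs in the family because a
family clique containing it must equal it. The least good index in the component is then a chosen
one. -/
theorem leftRest_eq_empty (h : Instance U n d) (hK : CliqueFamily U (n + n) K) :
    leftRest U (n + n) n d K (n + n) = ∅ := by
  rw [Set.eq_empty_iff_forall_notMem]
  rintro u ⟨hu, hno⟩
  obtain ⟨C, hC, hg, hmax, hr⟩ := h.anchor u (by omega)
  obtain ⟨v, hv, hCv⟩ := hK.cover C hC.lt hC.clique hC.nonempty
  have hvN := hC.lt v hv
  have hKv : K v = C := Set.Subset.antisymm (fun w hw => hmax w fun c hc hne =>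
    hK.clique v hvN c (hCv hc) w hw hne) hCv
  have hex : ∃ v, v < n + n ∧ Good U (n + n) (K v) d ∧ U.Reachable u v :=
    ⟨v, hvN, hKv ▸ hg, hr v hv⟩
  obtain ⟨h1, h2, h3⟩ := Nat.find_spec hex
  refine hno _ h1 ⟨(h.reachable_lt_iff h3).mp hu, h2, fun b hb hlt hgb hrb => ?_⟩ h3.symm
  exact Nat.find_min hex hlt ⟨hb, hgb, h3.trans hrb.symm⟩

theorem CliqueFamily.subset_reachable (hK : CliqueFamily U N K) (ha : a < N) :
    ∀ u ∈ K a, U.Reachable a u := fun u hu => by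
  by_cases e : a = u
  · rw [e]
  · exact (hK.clique a ha a (hK.self a ha) u hu e).reachable

theorem disjoint_rest : Disjoint (leftRest U N n d K i) (rightRest N n α) :=
  Set.disjoint_left.mpr fun _ h1 h2 => absurd h1.1 (not_lt.mpr h2.1)

/-- If the search fails then the remaining graphs are not isomorphic. -/
theorem NoneBelow.not_isoOn (h : Instance U n d) (hn : 1 ≤ n) (hK : CliqueFamily U (n + n) K)
    (hc : Chosen U (n + n) d K a) (ha : a < n) (hR : ClosedSet U (rightRest (n + n) n α))
    (hno : NoneBelow U (n + n) n K a (n + n) α) :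
    ¬ ∃ f, IsoOn U f (leftRest U (n + n) n d K a) (rightRest (n + n) n α) := by
  rintro ⟨f, hf⟩
  have haN : a < n + n := by omega
  have hL : ClosedSet U (leftRest U (n + n) n d K a) := closedSet_leftRest h
  have hKS : K a ⊆ leftRest U (n + n) n d K a := fun u hu =>
    hL.mem_of_reachable (hc.mem_leftRest (by omega) ha) (hK.subset_reachable haN u hu)
  -- The image of the anchor under an isomorphism is a clique, so it lies in a listed clique.
  -- Pulling the latter back and using the maximality of the good anchor shows that the two are
  -- equal. Thus the image is itself an anchor that the search has tried.
  obtain ⟨b, hb, hsub⟩ := hK.cover (Set.image f (K a))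
    (by rintro _ ⟨u, hu, rfl⟩; exact (hf.bij.mapsTo (hKS hu)).2.1)
    (by
      rintro _ ⟨u, hu, rfl⟩ _ ⟨w, hw, rfl⟩ hne
      exact (hf.adj u (hKS hu) w (hKS hw)).mpr
        (hK.clique a haN u hu w hw fun e => hne (congrArg f e)))
    ⟨_, a, hK.self a haN, rfl⟩
  obtain ⟨c₀, hc₀, rfl⟩ := hb
  have hbR := hf.bij.mapsTo (hKS hc₀)
  have himg : Set.image f (K a) = K (f c₀) := by
    refine Set.Subset.antisymm hsub fun w hw => ?_
    have hwR := hR.mem_of_reachable hbR (hK.subset_reachable hbR.2.1 w hw)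
    obtain ⟨u, hu, rfl⟩ := hf.bij.surjOn hwR
    refine ⟨u, hc.1.maximal u (by have := hu.1; omega) fun c hcN hcK => ?_, rfl⟩
    rw [capDist_le_one (by omega)]
    by_cases e : c = u
    · exact Or.inl e
    · refine Or.inr ((hf.adj c (hKS hcK) u hu).mp (hK.clique _ hbR.2.1 _ (hsub ⟨c, hcK, rfl⟩) _ hw ?_))
      exact fun e' => e (hf.bij.injOn (hKS hcK) hu e')
  obtain ⟨h1, h2, h3, σ, hσ, hl⟩ := AnchorIso.leaf (d := d) ⟨hK.anchor h.below (by omega) haN,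
    hK.anchor h.below (by omega) hbR.2.1, hf, hL, hR, fun u hu => by have := hu.1; omega,
    fun u hu => hu.2.1, hKS, himg⟩ disjoint_rest hc.1
  exact hno _ hbR.2.1 hbR.1 hbR.2.2 ⟨h1, h2, h3⟩ σ hσ hl

theorem Found.exists_isoOn (h : Instance U n d) (hn : 1 ≤ n) (hK : CliqueFamily U (n + n) K)
    (ha : a < n) (hf : Found U (n + n) n K a b α β) :
    ∃ f, IsoOn U f {u | U.Reachable a u} {u | U.Reachable b u} := by
  obtain ⟨h1, h2, -, hs, ⟨σ, hl⟩, -⟩ := hf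
  have haN : a < n + n := by omega
  refine hl.exists_isoOn σ.injective (hK.anchor h.below (by omega) haN)
    (hK.anchor h.below (by omega) h2) (hK.self a haN) (hK.self b h2) ?_ hs.2.1 hs.2.2
  refine Set.disjoint_left.mpr fun u hu hu' => ?_
  have := h.reachable_lt_iff hu
  have := h.reachable_lt_iff hu'
  omega

theorem Found.rightRest_eq (h : Instance U n d) (hf : Found U (n + n) n K a b α β) :
    rightRest (n + n) n β = rightRest (n + n) n α \ {u | U.Reachable b u} := by
  ext u
  simp only [rightRest, Set.mem_ofPred_eq, Set.mem_sdiff, and_assoc]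
  refine and_congr_right fun _ => and_congr_right fun hu => ?_
  rw [hf.2.2.2.2.2 u hu]
  by_cases hr : U.Reachable b u
  · simp [(h.below.capDist_lt hu).mpr hr, hr]
  · simp [mt (h.below.capDist_lt hu).mp hr, hr]

theorem IsoOn.ncard_eq {S S' : Set ℕ} (h : IsoOn U f S S') : S.ncard = S'.ncard := by
  rw [← h.bij.image_eq, h.bij.injOn.ncard_image]

/-- The state of the comparison after treating the vertices below `i`. -/
structure Compared (U : SimpleGraph ℕ) (n d : ℕ) (K : ℕ → Set ℕ) (i : ℕ) (α : Arr) : Prop where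
  closed : ClosedSet U (rightRest (n + n) n α)
  card : (leftRest U (n + n) n d K i).ncard = (rightRest (n + n) n α).ncard
  iff : (∃ f, IsoOn U f {u | u < n} {u | n ≤ u ∧ u < n + n}) ↔
    ∃ f, IsoOn U f (leftRest U (n + n) n d K i) (rightRest (n + n) n α)

theorem compared_zero (h : Instance U n d) (hα : ∀ u < n + n, α 23 0 u = 0) :
    Compared U n d K 0 α := by
  have e : rightRest (n + n) n α = {u | n ≤ u ∧ u < n + n} := by
    ext u
    simp only [rightRest, Set.mem_ofPred_eq]
    exact and_congr_right fun _ => ⟨fun hu => hu.1, fun hu => ⟨hu, hα u hu⟩⟩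
  refine ⟨?_, ?_, by rw [e, leftRest_zero]⟩
  · rw [e]
    intro u hu w hadj
    have h1 := h.side u w hadj
    have h2 := hu.1
    exact ⟨by omega, h.below w u hadj.symm⟩
  · have e1 : {u : ℕ | u < n} = ((Finset.range n : Finset ℕ) : Set ℕ) := by ext; simp
    have e2 : {u : ℕ | n ≤ u ∧ u < n + n} = ((Finset.Ico n (n + n) : Finset ℕ) : Set ℕ) := by
      ext; simp
    rw [e, leftRest_zero, e1, e2, Set.ncard_coe_finset, Set.ncard_coe_finset]
    simp

theorem Compared.found (hI : Compared U n d K a α) (h : Instance U n d) (hn : 1 ≤ n)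
    (hK : CliqueFamily U (n + n) K) (hc : Chosen U (n + n) d K a) (ha : a < n)
    (hf : Found U (n + n) n K a b α β) : Compared U n d K (a + 1) β := by
  have hL : ClosedSet U (leftRest U (n + n) n d K a) := closedSet_leftRest h
  have haS := hc.mem_leftRest (n := n) (by omega) ha
  have hbS : b ∈ rightRest (n + n) n α := ⟨hf.1, hf.2.1, hf.2.2.1⟩
  have hiso := hf.exists_isoOn h hn hK ha
  obtain ⟨g, hg⟩ := hiso
  have e1 := leftRest_succ ⟨ha, hc⟩
  have e2 := hf.rightRest_eq h
  refine ⟨?_, ?_, ?_⟩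
  · rw [e2]
    exact fun u hu w hadj => ⟨hI.closed u hu.1 w hadj, fun hr => hu.2 (hr.trans hadj.symm.reachable)⟩
  · have c1 := Set.ncard_sdiff_add_ncard_of_subset (s := {u | U.Reachable a u})
      (t := leftRest U (n + n) n d K a) (fun u hu => hL.mem_of_reachable haS hu)
      ((Set.finite_lt_nat n).subset fun u hu => hu.1)
    have c2 := Set.ncard_sdiff_add_ncard_of_subset (s := {u | U.Reachable b u})
      (t := rightRest (n + n) n α) (fun u hu => hI.closed.mem_of_reachable hbS hu)
      ((Set.finite_lt_nat (n + n)).subset fun u hu => hu.2.1)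
    have c3 := hI.card
    have c4 := hg.ncard_eq
    rw [e1, e2]
    omega
  · rw [hI.iff, e1, e2]
    exact exists_isoOn_diff_iff hL hI.closed haS hbS ⟨g, hg⟩

/-- This is where cardinalities are needed: when nothing is left of the first graph, equal sizes
ensure that nothing is left of the second. -/
theorem Compared.isoOn (hI : Compared U n d K (n + n) α) (h : Instance U n d)
    (hK : CliqueFamily U (n + n) K) :
    ∃ f, IsoOn U f {u | u < n} {u | n ≤ u ∧ u < n + n} := by
  have hc := hI.card
  rw [leftRest_eq_empty h hK, Set.ncard_empty] at hc
  have e : rightRest (n + n) n α = ∅ :=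
    (Set.ncard_eq_zero ((Set.finite_lt_nat (n + n)).subset fun u hu => hu.2.1)).mp hc.symm
  rw [hI.iff, leftRest_eq_empty h hK, e]
  exact ⟨id, Set.bijOn_empty _, fun u hu => absurd hu (Set.notMem_empty u)⟩

/-- The anchor and the vertices on its rays are disjoint parts of one component; the factor 2
absorbs the final 1 of `leafSize`. -/
theorem leafSize_le (hK : CliqueFamily U N K) (hU : Below U N) (hN : 2 ≤ N) (ha : a < N) :
    leafSize U N (K a) ≤ 2 * ((Finset.range N).filter fun u => U.Reachable a u).card := by
  have hA := hK.anchor hU hN ha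
  have hd : Disjoint (aX U N (K a)) (aC N (K a)) := by
    rw [Finset.disjoint_left]
    intro u hu hu'
    simp only [aX, aC, Finset.mem_filter, Finset.mem_range] at hu hu'
    exact hA.notMem_of_aLab_lt hu.1 hu.2 hu'.2
  have hsub : aX U N (K a) ∪ aC N (K a) ⊆ (Finset.range N).filter fun u => U.Reachable a u := by
    intro u hu
    simp only [aX, aC, Finset.mem_union, Finset.mem_filter, Finset.mem_range] at hu ⊢
    rcases hu with ⟨hu, hl⟩ | ⟨hu, hl⟩
    · exact ⟨hu, (hA.aDist_lt_iff (hK.self a ha) hu).mp ((hA.aLab_lt hu).mp hl).2⟩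
    · exact ⟨hu, hK.subset_reachable ha u hl⟩
  have h1 := Finset.card_le_card hsub
  rw [Finset.card_union_of_disjoint hd] at h1
  have h2 : 0 < ((Finset.range N).filter fun u => U.Reachable a u).card :=
    Finset.card_pos.mpr ⟨a, by simp [ha]⟩
  rw [leafSize]
  omega

/-- The chosen anchors lie in different components. -/
theorem sum_leafSize_le (hK : CliqueFamily U N K) (hU : Below U N) (hN : 2 ≤ N) (n : ℕ) :
    ∑ a ∈ (Finset.range N).filter (fun a => a < n ∧ Chosen U N d K a), leafSize U N (K a) ≤
      2 * N := by
  set F := (Finset.range N).filter (fun a => a < n ∧ Chosen U N d K a) with hF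
  have hmem : ∀ a ∈ F, a < N ∧ Chosen U N d K a := fun a ha => by
    simp only [hF, Finset.mem_filter, Finset.mem_range] at ha
    exact ⟨ha.1, ha.2.2⟩
  calc ∑ a ∈ F, leafSize U N (K a)
      ≤ ∑ a ∈ F, 2 * ((Finset.range N).filter fun u => U.Reachable a u).card :=
        Finset.sum_le_sum fun a ha => leafSize_le hK hU hN (hmem a ha).1
    _ = 2 * (F.biUnion fun a => (Finset.range N).filter fun u => U.Reachable a u).card := by
        rw [← Finset.mul_sum, Finset.card_biUnion]
        intro a ha b hb hne
        rw [Function.onFun, Finset.disjoint_left]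
        intro u hu hu'
        simp only [Finset.mem_filter] at hu hu'
        rcases lt_or_gt_of_ne hne with hlt | hlt
        · exact (hmem b hb).2.2 a (hmem a ha).1 hlt (hmem a ha).2.1 (hu.2.trans hu'.2.symm)
        · exact (hmem a ha).2.2 b (hmem b hb).1 hlt (hmem b hb).2.1 (hu'.2.trans hu.2.symm)
    _ ≤ 2 * N := by
        refine Nat.mul_le_mul_left _ ((Finset.card_le_card (t := Finset.range N) ?_).trans (by simp))
        exact Finset.biUnion_subset.mpr fun a _ => Finset.filter_subset _ _

end

end

end StarIso

namespace StarIso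

open WordRAM Classical Expr

noncomputable section

/-- The vertex in variable `2` belongs to the first graph and its clique has been chosen. -/
def chosenExpr : Expr := conj (.lt (.var 2) (.var 1)) (.rd 15 (.var 2) (.lit 0))

/-- Match the components of the first graph with components of the second graph. -/
def compareAll : Cmd :=
  (Cmd.st 22 (.lit 0) (.lit 0) (.lit 1)).seq <|
  (Cmd.gtab 23 5 (.lit 1) (.lit 0)).seq <|
  Cmd.loop 2 (Cmd.ite chosenExpr search Cmd.skip)

theorem chosenExpr_eval {U : SimpleGraph ℕ} {n d : ℕ} {C : Ctx} {W : ℕ} {v : Env} {α : Arr}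
    {K : ℕ → Set ℕ} {a : ℕ} (h : Setup U n d C W) (hv : Params n d v) (hα : Tabs U d C K α)
    (ha : a < C.N) :
    0 < chosenExpr.eval C α (Function.update v 2 a) ↔ a < n ∧ Chosen U C.N d K a := by
  have hn := hv.n
  rw [chosenExpr, eval_conj, ite_pos_iff]
  simp only [eval, ite_pos_iff, Function.update_apply, if_true, if_false, hn, OfNat.one_ne_ofNat]
  refine and_congr_right fun _ => ?_
  rw [hα.des ha h.one_le, Chosen]
  simp only [h.below.capDist_lt ha]

/-- The cost of the searches is d! N² times the sum of the leaf sizes of the chosen anchors, and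
these lie in different components. Summation replaces a further factor N² by 2N. -/
theorem exists_compareAll : ∃ T, ∀ (U : SimpleGraph ℕ) (n d : ℕ) (C : Ctx) (W : ℕ)
    (v : Env) (α : Arr) (K : ℕ → Set ℕ), Setup U n d C W → Params n d v → Tabs U d C K α →
      CliqueFamily U C.N K →
      Tri C W compareAll v α (T * (d.factorial * C.N ^ 3)) (fun β => β 22 0 0 =
        if ∃ f, IsoOn U f {u | u < n} {u | n ≤ u ∧ u < n + n} then 1 else 0) := by
  obtain ⟨T, hT⟩ := exists_search
  refine ⟨((Expr.lit 1).cost 1 + 13) + (((Expr.lit 1).cost 1 + (Expr.lit 0).cost 1 + 24) +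
    (chosenExpr.cost 1 + 2 * T + 11)), fun U n d C W v α K h hv hα hK => ?_⟩
  have hN := h.one_le
  have hNB := h.size_le
  have hs := h.size
  have hinst := h.inst
  have hn := h.pos
  have hsum := sum_leafSize_le (d := d) hK h.below h.two_le n
  have hd1 : 1 ≤ d.factorial := Nat.factorial_pos d
  set M := d.factorial * C.N ^ 3 with hM
  have hNM : C.N ≤ M := (Nat.le_self_pow (by omega) _).trans (Nat.le_mul_of_pos_left _ hd1)
  rw [add_mul]
  refine Tri.seq (Tri.mono (Tri.scalar h.valid hN (by decide) (by decide) (by decide)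
    (by decide) 1 rfl (by omega)) (Nat.mul_le_mul_left _ hNM) fun _ h => h) (fun β₁ h₁ => ?_) le_rfl
  rw [add_mul]
  refine Tri.seq (Tri.mono (Tri.row_frame h.valid hN (by decide) (by decide) (by decide)
    (by decide) (by decide) (by decide) (by decide) (fun _ => True) (fun j _ => by simp [eval])
    (fun _ => 0) (fun j _ _ => rfl) (fun _ _ _ => by omega))
    (Nat.mul_le_mul_left _ hNM) fun _ h => h) (fun β₂ h₂ => ?_) le_rfl
  have hα₂ : Tabs U d C K β₂ := (hα.frame h₁.1 (by decide)).frame h₂.1 (by decide)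
  rw [hs] at hK
  -- After a failure the loop keeps running, but a search either leaves the flag in array 22 alone
  -- or clears it. The negative answer persists, and the rest of the state no longer matters.
  refine Tri.mono (Tri.loop h.valid (by decide) (fun i β => Frame searchArrays β₂ β ∧
      ((β 22 0 0 = 1 ∧ Compared U n d K i β) ∨
        (β 22 0 0 = 0 ∧ ¬ ∃ f, IsoOn U f {u | u < n} {u | n ≤ u ∧ u < n + n})))
    (fun i => chosenExpr.cost C.N + ((if i < n ∧ Chosen U C.N d K i then
      T * (d.factorial * (leafSize U C.N (K i) * C.N ^ 2)) else 0) + 1) + 2) ?_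
    ⟨Frame.refl _ _, Or.inl ⟨?_, compared_zero hinst fun u hu => ?_⟩⟩) ?_ ?_
  · rintro i hi β ⟨hf, hI⟩
    have hβ : Tabs U d C K β := hα₂.frame hf (by decide)
    refine Tri.ite h.valid (by decide) (fun hc => ?_) (fun hc => ?_)
    · rw [chosenExpr_eval h hv hβ hi] at hc
      rw [if_pos hc]
      refine Tri.mono (hT U n d C W i _ β K h (hv.update le_rfl i) hβ (by simp) hi hc.2.1.rays)
        (by omega) (fun γ hγ => ⟨hf.trans hγ.1, ?_⟩)
      rw [hs] at hc hγ
      rcases hI with ⟨h1, hI⟩ | ⟨h0, hno⟩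
      · rcases hγ.2 with ⟨e, b, hb⟩ | ⟨e, -, hb⟩
        · exact Or.inl ⟨by rw [e]; exact h1, hI.found hinst hn hK hc.2 hc.1 hb⟩
        · refine Or.inr ⟨e, ?_⟩
          rw [hI.iff]
          exact hb.not_isoOn hinst hn hK hc.2 hc.1 hI.closed
      · rcases hγ.2 with ⟨e, -⟩ | ⟨e, -⟩
        · exact Or.inr ⟨by rw [e]; exact h0, hno⟩
        · exact Or.inr ⟨e, hno⟩
    · rw [chosenExpr_eval h hv hβ hi] at hc
      rw [if_neg hc]
      refine Tri.mono (Tri.skip ⟨hf, ?_⟩) (by omega) fun _ h => h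
      rw [hs] at hc
      have e := leftRest_succ_of_not hc
      rcases hI with ⟨h1, hI⟩ | hI
      · exact Or.inl ⟨h1, hI.closed, e ▸ hI.card, by rw [hI.iff, e]⟩
      · exact Or.inr hI
  · rw [h₂.1 22 (by decide)]; exact h₁.2
  · rw [h₂.2 u (by omega), if_pos trivial]
  · have h1 := Expr.cost_le_const hN (e := chosenExpr) (by decide)
    have e : ∀ i, chosenExpr.cost C.N + ((if i < n ∧ Chosen U C.N d K i then
        T * (d.factorial * (leafSize U C.N (K i) * C.N ^ 2)) else 0) + 1) + 2 + 4 =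
        (chosenExpr.cost C.N + 7) + (T * (d.factorial * C.N ^ 2)) *
          (if i < n ∧ Chosen U C.N d K i then leafSize U C.N (K i) else 0) := fun i => by
      split_ifs <;> ring
    simp only [e]
    rw [Finset.sum_add_distrib, ← Finset.mul_sum, ← Finset.sum_filter, Finset.sum_const,
      Finset.card_range, smul_eq_mul]
    calc _ ≤ C.N * (chosenExpr.cost 1 + 7) + T * (d.factorial * C.N ^ 2) * (2 * C.N) + 4 := by
          gcongr
      _ = (chosenExpr.cost 1 + 7) * C.N + 2 * T * M + 4 := by rw [hM]; ring
      _ ≤ (chosenExpr.cost 1 + 7) * M + 2 * T * M + 4 * M := by gcongr; omega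
      _ = _ := by ring
  · rintro β ⟨-, ⟨h1, hI⟩ | ⟨h0, hno⟩⟩
    · rw [hs] at hI
      rw [h1, if_pos (hI.isoOn hinst hK)]
    · rw [h0, if_neg hno]

end

end StarIso

namespace StarIso

open WordRAM Classical Expr

noncomputable section

/-! ### The program -/

/-- The isomorphism test, after setting up the parameters. -/
def isoTest : Cmd := distances.seq (elimination.seq ((tables 13).seq compareAll))

theorem exists_isoTest : ∃ T, ∀ (U : SimpleGraph ℕ) (n d : ℕ) (C : Ctx) (W : ℕ)
    (v : Env) (α : Arr), Setup U n d C W → Params n d v →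
      Tri C W isoTest v α (T * (d.factorial * C.N ^ 3)) (fun β => β 22 0 0 =
        if ∃ f, IsoOn U f {u | u < n} {u | n ≤ u ∧ u < n + n} then 1 else 0) := by
  obtain ⟨T₁, h₁⟩ := exists_distances
  obtain ⟨T₂, h₂⟩ := exists_elimination
  obtain ⟨T₃, h₃⟩ := exists_tables 13 le_rfl
  obtain ⟨T₄, h₄⟩ := exists_compareAll
  refine ⟨T₁ + (T₂ + (T₃ + T₄)), fun U n d C W v α h hv => ?_⟩
  have hM : C.N ^ 3 ≤ d.factorial * C.N ^ 3 := Nat.le_mul_of_pos_left _ (Nat.factorial_pos d)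
  rw [add_mul, add_mul, add_mul]
  refine Tri.seq (Tri.mono (h₁ U n d C W v α h hv) (Nat.mul_le_mul_left _ hM) fun _ h => h)
    (fun β₁ hβ₁ => ?_) le_rfl
  refine Tri.seq (Tri.mono (h₂ U n d C W v β₁ h hβ₁) (Nat.mul_le_mul_left _ hM) fun _ h => h) ?_ le_rfl
  rintro β₂ ⟨K, hK, hβ₂⟩
  have hpre : Pre C (spec U C.N d K) 3 β₂ := by
    intro k hk i hi j hj
    obtain ⟨e0, e1, e2⟩ := hβ₂ i hi j hj
    interval_cases k
    · exact e0
    · exact e1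
    · exact e2
  refine Tri.seq (Tri.mono (h₃ U n d C W v β₂ K h hv hpre) (Nat.mul_le_mul_left _ hM) fun _ h => h)
    (fun β₃ hβ₃ => ?_) le_rfl
  exact h₄ U n d C W v β₃ K h hv hβ₃ hK

/-- Compute the parameters. -/
def setupProgram : Program :=
  .seq (.copy 3 1) <| .seq (.add 2 1 1) <| .seq (.const 4 2) <| .seq (.add 5 2 4) <|
  .seq (.add 7 5 0) <| .seq (.mul 8 7 7) (.mul 8 8 7)

/-- Read the result. -/
def readProgram : Program :=
  .seq (.const 4 23) <| .seq (.mul 4 4 5) <| .seq (.mul 4 4 5) (.load 0 4)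

/-- The decision procedure. -/
def isoProgram : Program :=
  .ifLt 4 1 (.seq setupProgram (.seq (isoTest 0) readProgram)) (.const 0 1)

theorem mul_add_inj {n i j i' j' : ℕ} (hj : j < n) (hj' : j' < n) (h : i * n + j = i' * n + j') :
    i = i' ∧ j = j' := by
  obtain rfl : i = i' := by
    rcases lt_trichotomy i i' with hlt | rfl | hlt
    · have := Nat.mul_le_mul_right n (Nat.succ_le_of_lt hlt)
      rw [Nat.succ_mul] at this
      omega
    · rfl
    · have := Nat.mul_le_mul_right n (Nat.succ_le_of_lt hlt)
      rw [Nat.succ_mul] at this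
      omega
  exact ⟨rfl, by omega⟩

theorem mul_add_lt {n i j : ℕ} (hi : i < n) (hj : j < n) : i * n + j < n * n := by
  have := Nat.mul_le_mul_right n (Nat.succ_le_of_lt hi)
  rw [Nat.succ_mul] at this
  omega

section

variable {n : ℕ} (d : ℕ) (G H : SimpleGraph (Fin n))

theorem input_mem_left {i j : ℕ} (hi : i < n) (hj : j < n) :
    (input d G H).mem (i * n + j) = adjN (glue G H) i j := by
  have hlt := mul_add_lt hi hj
  simp only [input, adjN, glue_adj_left hi hj]
  rw [if_neg (c := ∃ i' j' : Fin n, H.Adj i' j' ∧ _) (by rintro ⟨i', j', -, e⟩; omega)]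
  refine if_congr ⟨?_, fun h => ⟨_, _, h, rfl⟩⟩ rfl rfl
  rintro ⟨i', j', h, e⟩
  obtain ⟨rfl, rfl⟩ := mul_add_inj hj j'.2 e
  exact h

theorem input_mem_right {i j : ℕ} (hi : i < n) (hj : j < n) :
    (input d G H).mem (n * n + (i * n + j)) = adjN (glue G H) (n + i) (n + j) := by
  simp only [input, adjN, glue_adj_right hi hj]
  rw [if_neg (c := ∃ i' j' : Fin n, G.Adj i' j' ∧ _)
    (by rintro ⟨i', j', -, e⟩; have := mul_add_lt i'.2 j'.2; omega)]
  refine if_congr ⟨?_, fun h => ⟨_, _, h, rfl⟩⟩ rfl rfl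
  rintro ⟨i', j', h, e⟩
  obtain ⟨rfl, rfl⟩ := mul_add_inj hj j'.2 (by omega : i * n + j = i' * n + j')
  exact h

theorem input_mem_le (e : ℕ) : (input d G H).mem e ≤ 1 := by
  simp only [input]; split_ifs <;> omega

theorem input_mem_eq_zero {e : ℕ} (he : n * n + n * n ≤ e) : (input d G H).mem e = 0 := by
  simp only [input]
  rw [if_neg, if_neg]
  · rintro ⟨i, j, -, rfl⟩
    have := mul_add_lt i.2 j.2
    omega
  · rintro ⟨i, j, -, rfl⟩
    have := mul_add_lt i.2 j.2
    omega

/-- The parameters of the run. -/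
def inputCtx : Ctx where
  N := n + n
  Q := n + n + 2
  B := (n + n + 2 + d) * (n + n + 2 + d) * (n + n + 2 + d)
  inp := (input d G H).mem

variable {d G H}

theorem inputCtx_Q_add_le : n + n + 2 + d ≤ (n + n + 2 + d) * (n + n + 2 + d) ∧
    (n + n + 2 + d) * (n + n + 2 + d) ≤ (inputCtx d G H).B :=
  ⟨Nat.le_mul_of_pos_right _ (by omega), Nat.le_mul_of_pos_right _ (by omega)⟩

theorem inputCtx_setup (hG : IsProperStarGraph d G) (hH : IsProperStarGraph d H) (hn : 0 < n)
    {W : ℕ} (hW : (inputCtx d G H).B ^ 2000 < W) :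
    Setup (glue G H) n d (inputCtx d G H) W := by
  obtain ⟨h1, h2⟩ := inputCtx_Q_add_le (d := d) (G := G) (H := H)
  refine ⟨⟨?_, ?_, ?_, ?_, ?_, hW⟩, glue_instance hG hH, rfl, hn, ?_, ?_, ?_⟩
  · change n + n < n + n + 2; omega
  · change n + n + 2 ≤ _; omega
  · omega
  · intro e
    exact (input_mem_le d G H e).trans (by omega)
  · intro e he
    refine input_mem_eq_zero d G H (le_trans ?_ he)
    simp only [inputCtx]
    nlinarith
  · calc (n + n + 2) ^ 3 = (n + n + 2) * (n + n + 2) * (n + n + 2) := by ring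
      _ ≤ (n + n + 2 + d) * (n + n + 2 + d) * (n + n + 2 + d) :=
        Nat.mul_le_mul (Nat.mul_le_mul (by omega) (by omega)) (by omega)
  · exact fun i hi j hj => input_mem_left d G H hi hj
  · exact fun i hi j hj => input_mem_right d G H hi hj

/-- The initial values of the variables. -/
def inputEnv (n d : ℕ) : Env := fun k => if k = 0 then d else if k = 1 then n else 0

/-- The layout of the input fits the language: d is already in the register of variable 0 and n is
copied to that of variable 1. The registers 4 and 7 used on the way are temporaries. All arrays
start as zero because Q² exceeds the length 2n² of the input. -/
theorem setupProgram_go {W : ℕ} (hW : (inputCtx d G H).B < W) :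
    Go W setupProgram (input d G H) 7
      (Rel (inputCtx d G H) (inputEnv n d) fun _ _ _ => 0) := by
  obtain ⟨h1, h2⟩ := inputCtx_Q_add_le (d := d) (G := G) (H := H)
  have hr : ∀ r, (input d G H).reg r = if r = 0 then d else if r = 1 then n else 0 := fun r => rfl
  have hm : (input d G H).mem = (inputCtx d G H).inp := rfl
  generalize input d G H = I at hr hm
  refine Go.seq_copy (Go.seq_add ?_ (Go.seq_const ?_ (Go.seq_add ?_ (Go.seq_add ?_
      (Go.seq_mul ?_ (Go.mul ?_ ?_))))))
  · simp only [State.reg_setReg, hr, Nat.reduceEqDiff, if_true, if_false, one_ne_zero]; omega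
  · omega
  · simp [hr]; omega
  · simp [hr]; omega
  · simp [hr]; omega
  · simp [hr]; exact hW
  · refine ⟨fun k => ?_, ?_, ?_, ?_, fun k i j hi hj => ?_, fun e _ => congrFun hm e, fun k => ?_,
      fun _ _ _ => Nat.zero_le _, fun _ _ _ _ => rfl⟩
    · simp only [State.reg_setReg, hr, inputEnv, show 3 * k ≠ 8 by omega, show 3 * k ≠ 7 by omega,
        show 3 * k ≠ 5 by omega, show 3 * k ≠ 4 by omega, show 3 * k ≠ 2 by omega,
        show 3 * k ≠ 1 by omega, show 3 * k = 3 ↔ k = 1 by omega, show 3 * k = 0 ↔ k = 0 by omega,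
        if_false, if_true, one_ne_zero]
      split_ifs <;> omega
    · simp [hr, inputCtx]
    · simp [hr, inputCtx]
    · simp [hr, inputCtx]
    · simp only [State.mem_setReg, hm]
      refine input_mem_eq_zero d G H ?_
      simp only [inputCtx]
      nlinarith [Nat.zero_le (k * (n + n + 2) * (n + n + 2))]
    · simp only [inputEnv]
      split_ifs <;> omega

/-- The cell (0, 0) of array 22 has the address (22 + 1) Q², whence the constant 23. -/
theorem readProgram_go {C : Ctx} {v : Env} {α : Arr} {W : ℕ} {s : State} (hC : C.Valid W 2000)
    (hs : Rel C v α s) : Go W readProgram s 4 (fun s' => s'.reg 0 = α 22 0 0) := by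
  have hQ : 0 < C.Q := (Nat.zero_le _).trans_lt hC.NQ
  have h5 := hs.rQ
  have h2 := hC.two
  have hW : C.B ^ 5 * C.B * C.B < W := by
    rw [← pow_succ, ← pow_succ]
    exact (Nat.pow_le_pow_right (by omega) (by omega)).trans_lt hC.word
  have h32 : 32 ≤ C.B ^ 5 := Nat.pow_le_pow_left h2 5
  have e1 : 23 ≤ 23 * C.Q := Nat.le_mul_of_pos_right _ hQ
  have e2 : 23 * C.Q ≤ 23 * C.Q * C.Q := Nat.le_mul_of_pos_right _ hQ
  have e3 : 23 * C.Q * C.Q ≤ C.B ^ 5 * C.B * C.B :=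
    Nat.mul_le_mul (Nat.mul_le_mul (by omega) hC.QB) hC.QB
  refine Go.seq_const (by omega) (Go.seq_mul ?_ (Go.seq_mul ?_ (Go.load ?_)))
  · simp [h5]; omega
  · simp [h5]; omega
  · have h22 := hs.arr 22 0 0 hQ hQ
    simp only [zero_mul, zero_add, Nat.reduceAdd] at h22
    simpa [h5] using h22

/-- Since 2n + 2 + d ≤ (n + d + 2)², the bound B is at most the sixth power of n + d + 2, and its
2000th power at most the 12000th. -/
theorem inputCtx_B_pow_lt (d : ℕ) (G H : SimpleGraph (Fin n)) {c : ℕ} (hc : 12000 < c) :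
    (inputCtx d G H).B ^ 2000 < (n + d + 2) ^ c := by
  have h2 : n + n + 2 + d ≤ (n + d + 2) ^ 2 := by nlinarith
  have h6 : (inputCtx d G H).B ≤ (n + d + 2) ^ 6 := by
    calc (n + n + 2 + d) * (n + n + 2 + d) * (n + n + 2 + d)
        ≤ (n + d + 2) ^ 2 * (n + d + 2) ^ 2 * (n + d + 2) ^ 2 := by gcongr
      _ = _ := by rw [← pow_add, ← pow_add]
  calc (inputCtx d G H).B ^ 2000 ≤ ((n + d + 2) ^ 6) ^ 2000 := Nat.pow_le_pow_left h6 _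
    _ = (n + d + 2) ^ 12000 := (pow_mul _ 6 2000).symm
    _ < _ := Nat.pow_lt_pow_right (by omega) hc

end

theorem exists_decidesIso : ∃ c, ∀ (d n : ℕ) (G H : SimpleGraph (Fin n)),
    IsProperStarGraph d G → IsProperStarGraph d H →
      DecidesIso isoProgram ((n + d + 2) ^ c) (c * (d.factorial * n ^ 3 + 1)) d G H := by
  obtain ⟨T, hT⟩ := exists_isoTest
  -- The constant must serve both as exponent of the word size, hence more than 12000, and as time
  -- factor, where (2n)³ = 8n³ produces 8T; the surplus covers setup and reading.
  refine ⟨8 * T + 12100, fun d n G H hG hH => ?_⟩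
  have hBW := inputCtx_B_pow_lt d G H (c := 8 * T + 12100) (by omega)
  generalize (n + d + 2) ^ (8 * T + 12100) = W at hBW
  suffices hgo : Go W isoProgram (input d G H) ((8 * T + 12100) * (d.factorial * n ^ 3 + 1))
      (fun s => s.reg 0 = if Nonempty (G ≃g H) then 1 else 0) by
    obtain ⟨t, s, h1, h2, h3⟩ := hgo
    exact ⟨t, s, h1, h2, fun h => by rw [h3, if_pos h], fun h => by rw [h3, if_neg h]⟩
  have hr : ∀ r, (input d G H).reg r = if r = 0 then d else if r = 1 then n else 0 := fun r => rfl
  have hle : (inputCtx d G H).B ≤ (inputCtx d G H).B ^ 2000 := Nat.le_self_pow (by omega) _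
  have h2B : 2 ≤ (inputCtx d G H).B := by
    have := inputCtx_Q_add_le (d := d) (G := G) (H := H); omega
  -- The first test of the program compares register 4, which is initially zero, with n. For n = 0
  -- the answer is yes without further work.
  rcases Nat.eq_zero_or_pos n with hn | hn
  · refine Go.mono (T := 1 + 1) (Go.ifLt (fun h => ?_) fun _ => Go.const (by omega) ?_)
      (by nlinarith [Nat.zero_le (d.factorial * n ^ 3)]) fun _ h => h
    · simp [hr, hn] at h
    · subst hn
      rw [if_pos ⟨⟨Equiv.refl _, fun {a} => a.elim0⟩⟩]
      simp
  have hS := inputCtx_setup hG hH hn hBW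
  have htest := hT (glue G H) n d _ W (inputEnv n d) (fun _ _ _ => 0) hS ⟨rfl, rfl⟩
  refine Go.mono (T := 7 + (T * (d.factorial * (n + n) ^ 3) + 4) + 1)
    (Go.ifLt (fun _ => ?_) fun h => ?_) ?_ fun _ h => h
  · refine (setupProgram_go (by omega)).bind (fun s hs => (htest 0 s hs).bind ?_ le_rfl) le_rfl
    rintro s' ⟨β, hs', hβ, -⟩
    refine (readProgram_go hS.valid hs').mono le_rfl fun s'' h => ?_
    rw [h, hβ, ← nonempty_iso_iff]
  · simp [hr] at h
    omega
  · have : d.factorial * (n + n) ^ 3 = 8 * (d.factorial * n ^ 3) := by ring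
    have e : (8 * T + 12100) * (d.factorial * n ^ 3 + 1) =
        T * (8 * (d.factorial * n ^ 3)) + 8 * T + 12100 * (d.factorial * n ^ 3) + 12100 := by ring
    rw [this, e]
    omega

end

end StarIso

theorem mainTheorem7 :
    (∀ (V : Type*) [Finite V] (G : SimpleGraph V) (d : ℕ) (ℓ : Fin d → ℕ)
      (R : V → (subdividedStar d ℓ).Subgraph),
      IsProperRepresentation G (subdividedStar d ℓ) R →
        (attachedComponents G (centralClique R)).encard ≤ d) ∧
    (∃ (p : WordRAM.Program) (c : ℕ), ∀ (d n : ℕ) (G H : SimpleGraph (Fin n)),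
      IsProperStarGraph d G → IsProperStarGraph d H →
        WordRAM.DecidesIso p ((n + d + 2) ^ c) (c * (d.factorial * n ^ 3 + 1)) d G H) := by
  constructor
  · intro V _ G d ℓ R hR
    obtain ⟨ray, lo, hi, reach, M⟩ := hR.exists_model
    exact M.encard_attachedComponents_le
  · obtain ⟨c, hc⟩ := StarIso.exists_decidesIso
    exact ⟨StarIso.isoProgram, c, hc⟩
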